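/- **Conventions.** A Morse gauge is a map $M:\mathbb R_{\ge 1}\times\mathbb R_{\ge 0}\to\mathbb R_{\ge 0}$ that is increasing and continuous in the second argument; $\mathcal M$ is the set of Morse gauges with the pointwise order. A function $f:\mathcal M\to\mathcal M$ is called increasing if it is monotone and $f(M)\ge M$ for all $M$. All quasi-geodesics are continuous. A quasi-geodesic $\gamma$ in a geodesic metric space is $M$-Morse if every $(\lambda,\epsilon)$-quasi-geodesic segment with endpoints on $\gamma$ lies in the closed $M(\lambda,\epsilon)$-neighbourhood of $\gamma$, and Morse if it is $M$-Morse for some $M$. The Morse boundary $\partial_*X$ is the set of Morse geodesic rays modulo bounded Hausdorff distance; for a Morse quasi-geodesic ray $\gamma$, $[\gamma]\in\partial_*X$ is the class of the geodesic rays at bounded Hausdorff distance from $\gamma$. An element of $\partial_*X$ is $M$-Morse if it is represented by an $M$-Morse geodesic ray starting at the base point of $X$. **Morseless stars.** Let $\mathcal G$ be a graph of groups over a finite connected graph $\Gamma$ with vertex set $\{0,\dots,n\}$ all of whose edges are incident to $0$, with finitely generated vertex groups $G_v$, finitely generated edge groups $\tilde H_\alpha=\tilde H_{\bar\alpha}$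 and injections $f_\alpha:\tilde H_\alpha\to G_{\alpha^+}$, $H_\alpha=f_\alpha(\tilde H_\alpha)$. It is a *Morseless star* if every $H_\alpha$ is undistorted in $\pi_1(\mathcal G)$, has infinite index in $G_{\alpha^+}$, and is relatively wide in $G_{\alpha^+}$, i.e. in no asymptotic cone of $G_{\alpha^+}$ two points of the limit of $H_\alpha$ are separated by a cut point. Fix a spanning tree of $\Gamma$ and finite symmetric generating sets $\tilde S_\alpha=\tilde S_{\bar\alpha}$ of $\tilde H_\alpha$ and $S_v$ of $G_v$ with $f_\alpha(\tilde S_\alpha)\subset S_{\alpha^+}$. Then $\pi_1(\mathcal G)$ is generated by the $G_v$ and elements $t_\alpha$ with $t_{\bar\alpha}=t_\alpha^{-1}$, $t_\alpha=1$ for $\alpha$ in the spanning tree, and $f_{\bar\alpha}(h)=t_\alpha f_\alpha(h)t_\alpha^{-1}$. The Bass–Serre space $X$ is the graph (edges of length $1$) with vertices $(g,v)$, $g\in\pi_1(\mathcal G)$, $v\in\{0,\dots,n\}$, in which $(g,v)$ is joined to $(gs,v)$ for $s\in S_v$ and $(g,\alpha^-)$ to $(gt_\alpha,\alpha^+)$;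 its base point is $1=(1,0)$. Let $T$ be the Bass–Serre tree, whose vertices are the cosets $gG_v$, and $\pi:X\to T$ the projection $(g,v)\mapsto gG_v$. **Combinatorial rays.** An edge $\alpha$ of $T$ is outgoing if $\alpha^+$ is further from $G_0$ than $\alpha^-$. For every outgoing $\alpha$ fix a vertex $\alpha^*$ of $\pi^{-1}(\alpha)^+$ (the set of the targets of the edges of $X$ over $\alpha$) closest to $1$; put $G_0^*=1$ and $v^*=\alpha^*$ if $v=\alpha^+\ne G_0$ with $\alpha$ outgoing. An outgoing edge $\alpha$ with $\alpha^-=v$ is $M$-Morse if there is an $M$-Morse geodesic in $X$ from $v^*$ to $\alpha^*$. A combinatorial ray $r$ is either an infinite geodesic edge path $(\alpha_1,\alpha_2,\dots)$ in $T$ starting at $G_0$, or $(\alpha_1,\dots,\alpha_k;z)$, $k\ge 0$, where $(\alpha_1,\dots,\alpha_k)$ is a geodesic edge path in $T$ starting at $G_0$ with end vertex $\omega$ a coset of $G_j$, and $z\in\partial_*G_j$ (the Morse boundary of the Cayley graph of $G_j$ with respect to $S_j$). A geodesic ray of $X$ realises $z$ if it starts at $(1,j)$ and has bounded Hausdorff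 distance from the image under $g\mapsto(g,j)$ of the rays representing $z$. The ray $r$ is $M$-Morse if all its edges are $M$-Morse and, in the second case, $z$ has an $M$-Morse realisation in $X$; it is Morse if it is $M$-Morse for some $M$. Let $\delta_*X$ be the set of Morse combinatorial rays. Fix geodesics $[x,y]$ between the vertices of $X$ and realisations $\xi_z$ of the tails $z$. The realisation $\bar r$ is the concatenation $[1,\alpha_1^*]\circ[\alpha_1^*,\alpha_2^*]\circ\cdots$, followed in the second case by $g\cdot\xi_z$, where $\omega^*=(g,j)$. The star $\mathcal G$ is *Morse-preserving* if there is an increasing $f_4:\mathcal M\to\mathcal M$ such that $\bar r$ is $f_4(M)$-Morse for every $M$-Morse combinatorial ray $r$. **Proposition.** Let $\mathcal G$ be a Morse-preserving Morseless star. Then for every $r\in\delta_*X$ the realisation $\bar r$ is a Morse quasi-geodesic ray, and the map $\Phi:\delta_*X\to\partial_*X$, $\Phi(r)=[\bar r]$, is a well-defined bijection. Moreover, there is an increasing function $f_5:\mathcal M\to\mathcal M$ such that for every Morse gauge $M$: if $r\in\delta_*X$ is $M$-Morse, then $\Phi(r)$ is $f_5(M)$-Morse; and if $z\in\partial_*X$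 is $M$-Morse, then $\Phi^{-1}(z)$ is $f_5(M)$-Morse. -/

import Mathlib

open Set Filter Topology
open scoped NNReal ENNReal

noncomputable section

/-! ### Geometric realisation of a connected graph -/

/-- A point of the geometric realisation of a simple graph, in barycentric coordinates: a convex
combination of the endpoints of an edge, or a vertex. -/
@[ext]
structure GeomReal {V : Type*} (G : SimpleGraph V) where
  coord : V →₀ ℝ
  carried : ∃ u v : V, ∃ t : ℝ, (u = v ∨ G.Adj u v) ∧ 0 ≤ t ∧ t ≤ 1 ∧
    coord = Finsupp.single u (1 - t) + Finsupp.single v t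

namespace GeomReal

variable {V : Type*} {G : SimpleGraph V}

/-- The point of the realisation given by a vertex. -/
def vertex (G : SimpleGraph V) (v : V) : GeomReal G where
  coord := Finsupp.single v 1
  carried := ⟨v, v, 0, Or.inl rfl, le_rfl, zero_le_one, by simp⟩

/-- The simplicial map induced by a map on vertices which sends edges to edges or vertices. -/
def map {W : Type*} {G' : SimpleGraph W} (φ : V → W)
    (hφ : ∀ u v, G.Adj u v → φ u = φ v ∨ G'.Adj (φ u) (φ v)) (x : GeomReal G) : GeomReal G' where
  coord := Finsupp.mapDomain φ x.coord
  carried := by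
    obtain ⟨u, v, t, huv, h0, h1, h⟩ := x.carried
    refine ⟨φ u, φ v, t, ?_, h0, h1, ?_⟩
    · rcases huv with rfl | huv
      · exact Or.inl rfl
      · exact hφ u v huv
    · rw [h, Finsupp.mapDomain_add, Finsupp.mapDomain_single, Finsupp.mapDomain_single]

/-- Both points lie on the closed edge `ab` (which is a single vertex if `a = b`). -/
def OnEdge (x y : GeomReal G) (a b : V) : Prop :=
  (a = b ∨ G.Adj a b) ∧ (x.coord.support : Set V) ⊆ {a, b} ∧ (y.coord.support : Set V) ⊆ {a, b}

/-- Lengths of the candidates for a shortest path from `x` to `y` when all edges have length `1`: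
leave `x` along its edge to an endpoint `u`, follow a shortest edge path from `u` to an endpoint
`v` of the edge of `y`, and go to `y`; or move inside one edge containing both points. -/
def pathLengths (x y : GeomReal G) : Set ℝ :=
  {r | ∃ u ∈ x.coord.support, ∃ v ∈ y.coord.support,
      r = (1 - x.coord u) + G.dist u v + (1 - y.coord v)} ∪
  {r | ∃ a b, OnEdge x y a b ∧ r = |x.coord a - y.coord a|}

theorem coord_nonneg (x : GeomReal G) (u : V) : 0 ≤ x.coord u := by
  classical
  obtain ⟨a, b, t, -, h0, h1, h⟩ := x.carried
  rw [h]
  simp only [Finsupp.add_apply, Finsupp.single_apply]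
  split_ifs <;> linarith

theorem coord_le_one (x : GeomReal G) (u : V) : x.coord u ≤ 1 := by
  classical
  obtain ⟨a, b, t, -, h0, h1, h⟩ := x.carried
  rw [h]
  simp only [Finsupp.add_apply, Finsupp.single_apply]
  split_ifs <;> linarith

theorem coord_add (x : GeomReal G) {a b : V} (hab : a ≠ b)
    (h : (x.coord.support : Set V) ⊆ {a, b}) : x.coord a + x.coord b = 1 := by
  classical
  have hsum : x.coord.sum (fun _ r => r) = 1 := by
    obtain ⟨u, v, t, -, h0, h1, hx⟩ := x.carried
    rw [hx, Finsupp.sum_add_index' (by simp) (by simp), Finsupp.sum_single_index rfl,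
      Finsupp.sum_single_index rfl]
    ring
  have hs : x.coord.support ⊆ ({a, b} : Finset V) := by
    intro w hw
    have := h (Finset.mem_coe.2 hw)
    simpa using this
  rw [Finsupp.sum_of_support_subset _ hs _ (by simp), Finset.sum_pair hab] at hsum
  exact hsum

theorem coord_self (x : GeomReal G) {a : V} (h : (x.coord.support : Set V) ⊆ {a}) :
    x.coord a = 1 := by
  classical
  have hsum : x.coord.sum (fun _ r => r) = 1 := by
    obtain ⟨u, v, t, -, h0, h1, hx⟩ := x.carried
    rw [hx, Finsupp.sum_add_index' (by simp) (by simp), Finsupp.sum_single_index rfl,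
      Finsupp.sum_single_index rfl]
    ring
  have hs : x.coord.support ⊆ ({a} : Finset V) := by
    intro w hw
    have := h (Finset.mem_coe.2 hw)
    simpa using this
  rwa [Finsupp.sum_of_support_subset _ hs _ (by simp), Finset.sum_singleton] at hsum

theorem coord_eq_zero (x : GeomReal G) {a b u : V}
    (h : (x.coord.support : Set V) ⊆ {a, b}) (ha : u ≠ a) (hb : u ≠ b) : x.coord u = 0 := by
  by_contra hu
  have := h (Finset.mem_coe.2 (Finsupp.mem_support_iff.2 hu))
  simp [ha, hb] at this

theorem exists_edge (x : GeomReal G) :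
    ∃ a b, (a = b ∨ G.Adj a b) ∧ (x.coord.support : Set V) ⊆ {a, b} := by
  classical
  obtain ⟨u, v, t, huv, -, -, h⟩ := x.carried
  refine ⟨u, v, huv, ?_⟩
  intro w hw
  by_contra hne
  simp only [mem_insert_iff, mem_singleton_iff, not_or] at hne
  rw [Finset.mem_coe, Finsupp.mem_support_iff, h] at hw
  exact hw (by simp [Ne.symm hne.1, Ne.symm hne.2])

theorem support_nonempty (x : GeomReal G) : x.coord.support.Nonempty := by
  obtain ⟨a, b, hab, h⟩ := x.exists_edge
  by_contra hne
  rw [Finset.not_nonempty_iff_eq_empty, Finsupp.support_eq_empty] at hne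
  rcases eq_or_ne a b with rfl | hne'
  · have := x.coord_self (a := a) (by simpa using h)
    simp [hne] at this
  · have := x.coord_add hne' h
    simp [hne] at this

theorem dist_support_le (x : GeomReal G) {v v' : V} (hv : v ∈ x.coord.support)
    (hv' : v' ∈ x.coord.support) :
    (G.dist v v' : ℝ) ≤ (1 - x.coord v) + (1 - x.coord v') := by
  rcases eq_or_ne v v' with rfl | hne
  · simp only [SimpleGraph.dist_self, Nat.cast_zero]
    linarith [x.coord_le_one v]
  obtain ⟨a, b, hab, h⟩ := x.exists_edge
  have h1 := h (Finset.mem_coe.2 hv)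
  have h2 := h (Finset.mem_coe.2 hv')
  simp only [mem_insert_iff, mem_singleton_iff] at h1 h2
  have hadj : G.Adj v v' ∧ x.coord v + x.coord v' = 1 := by
    rcases hab with rfl | hab
    · exfalso; rcases h1 with rfl | rfl <;> rcases h2 with rfl | rfl <;> exact hne rfl
    · have hsum := x.coord_add hab.ne h
      rcases h1 with rfl | rfl <;> rcases h2 with rfl | rfl
      · exact absurd rfl hne
      · exact ⟨hab, hsum⟩
      · exact ⟨hab.symm, by linarith⟩
      · exact absurd rfl hne
  rw [SimpleGraph.dist_eq_one_iff_adj.2 hadj.1, Nat.cast_one]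
  linarith [hadj.2]

/-- Moving to an endpoint `c` of an edge carrying `x` costs `1 - x.coord c`. -/
theorem exists_support_le (x : GeomReal G) {a b c : V} (hab : a = b ∨ G.Adj a b)
    (h : (x.coord.support : Set V) ⊆ {a, b}) (hc : c = a ∨ c = b) :
    ∃ u ∈ x.coord.support, (1 - x.coord u) + (G.dist u c : ℝ) ≤ 1 - x.coord c := by
  by_cases hcs : c ∈ x.coord.support
  · exact ⟨c, hcs, by simp⟩
  · obtain ⟨u, hu⟩ := x.support_nonempty
    have hc0 : x.coord c = 0 := by simpa using hcs
    have hxu := h (Finset.mem_coe.2 hu)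
    simp only [mem_insert_iff, mem_singleton_iff] at hxu
    have huc : u ≠ c := fun e => hcs (e ▸ hu)
    refine ⟨u, hu, ?_⟩
    rcases hab with rfl | hab
    · exfalso; apply huc; rcases hxu with rfl | rfl <;> rcases hc with rfl | rfl <;> rfl
    · have hsum := x.coord_add hab.ne h
      have hadj : G.Adj u c ∧ x.coord u + x.coord c = 1 := by
        rcases hxu with rfl | rfl <;> rcases hc with rfl | rfl
        · exact absurd rfl huc
        · exact ⟨hab, hsum⟩
        · exact ⟨hab.symm, by linarith⟩
        · exact absurd rfl huc
      rw [SimpleGraph.dist_eq_one_iff_adj.2 hadj.1, Nat.cast_one]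
      linarith [hadj.2]

theorem pathLengths_comm (x y : GeomReal G) : pathLengths x y = pathLengths y x := by
  have key : ∀ x y : GeomReal G, pathLengths x y ⊆ pathLengths y x := by
    rintro x y r (⟨u, hu, v, hv, rfl⟩ | ⟨a, b, ⟨hab, hx, hy⟩, rfl⟩)
    · exact Or.inl ⟨v, hv, u, hu, by rw [SimpleGraph.dist_comm]; ring⟩
    · exact Or.inr ⟨a, b, ⟨hab, hy, hx⟩, abs_sub_comm _ _⟩
  exact (key x y).antisymm (key y x)

theorem pathLengths_nonneg (x y : GeomReal G) {r : ℝ} (hr : r ∈ pathLengths x y) : 0 ≤ r := by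
  rcases hr with ⟨u, hu, v, hv, rfl⟩ | ⟨a, b, -, rfl⟩
  · have := x.coord_le_one u
    have := y.coord_le_one v
    have : (0 : ℝ) ≤ G.dist u v := Nat.cast_nonneg _
    linarith
  · exact abs_nonneg _

theorem pathLengths_nonempty (x y : GeomReal G) : (pathLengths x y).Nonempty := by
  obtain ⟨u, hu⟩ := x.support_nonempty
  obtain ⟨v, hv⟩ := y.support_nonempty
  exact ⟨_, Or.inl ⟨u, hu, v, hv, rfl⟩⟩

theorem pathLengths_bddBelow (x y : GeomReal G) : BddBelow (pathLengths x y) :=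
  ⟨0, fun _ hr => pathLengths_nonneg x y hr⟩

theorem pathLengths_finite (x y : GeomReal G) : (pathLengths x y).Finite := by
  classical
  apply Set.Finite.union
  · refine ((x.coord.support ×ˢ y.coord.support).image
      (fun p => (1 - x.coord p.1) + (G.dist p.1 p.2 : ℝ) + (1 - y.coord p.2))).finite_toSet.subset ?_
    rintro r ⟨u, hu, v, hv, rfl⟩
    simp only [Finset.coe_image, Set.mem_image, Finset.mem_coe, Finset.mem_product]
    exact ⟨(u, v), ⟨hu, hv⟩, rfl⟩
  · refine (((x.coord.support ∪ y.coord.support).image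
      (fun a => |x.coord a - y.coord a|)).finite_toSet.union (Set.finite_singleton 0)).subset ?_
    rintro r ⟨a, b, -, rfl⟩
    by_cases ha : a ∈ x.coord.support ∪ y.coord.support
    · left
      simp only [Finset.coe_image, Set.mem_image, Finset.mem_coe]
      exact ⟨a, ha, rfl⟩
    · right
      simp only [Finset.mem_union, Finsupp.mem_support_iff, not_or, not_not] at ha
      simp [ha.1, ha.2]

theorem local_global (hG : G.Connected) {x y : GeomReal G} {a b v w : V} (h : OnEdge x y a b)
    (hv : v ∈ y.coord.support) :
    ∃ u ∈ x.coord.support, (1 - x.coord u) + (G.dist u w : ℝ) ≤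
      |x.coord a - y.coord a| + ((1 - y.coord v) + G.dist v w) := by
  obtain ⟨hab, hx, hy⟩ := h
  have hv' := hy (Finset.mem_coe.2 hv)
  simp only [mem_insert_iff, mem_singleton_iff] at hv'
  obtain ⟨u, hu, hle⟩ := x.exists_support_le hab hx hv'
  refine ⟨u, hu, ?_⟩
  have htri : (G.dist u w : ℝ) ≤ G.dist u v + G.dist v w := by
    exact_mod_cast hG.dist_triangle (u := u) (v := v) (w := w)
  have habs : |x.coord v - y.coord v| = |x.coord a - y.coord a| := by
    rcases hv' with rfl | rfl
    · rfl
    · rcases hab with rfl | hab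
      · rfl
      · have h1 := x.coord_add hab.ne hx
        have h2 := y.coord_add hab.ne hy
        rw [abs_sub_comm]
        congr 1
        linarith
  have := neg_abs_le (x.coord v - y.coord v)
  linarith

theorem pathLengths_triangle (hG : G.Connected) (x y z : GeomReal G) {r s : ℝ}
    (hr : r ∈ pathLengths x y) (hs : s ∈ pathLengths y z) :
    ∃ q ∈ pathLengths x z, q ≤ r + s := by
  rcases hr with ⟨u, hu, v, hv, rfl⟩ | ⟨a, b, h, rfl⟩
  · rcases hs with ⟨v', hv', w, hw, rfl⟩ | ⟨a, b, h, rfl⟩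
    · refine ⟨_, Or.inl ⟨u, hu, w, hw, rfl⟩, ?_⟩
      have h1 : (G.dist u w : ℝ) ≤ G.dist u v + (G.dist v v' + G.dist v' w) := by
        have e1 := hG.dist_triangle (u := u) (v := v) (w := w)
        have e2 := hG.dist_triangle (u := v) (v := v') (w := w)
        exact_mod_cast e1.trans (Nat.add_le_add_left e2 _)
      have h2 := y.dist_support_le hv hv'
      linarith
    · obtain ⟨w, hw, hle⟩ := local_global hG (x := z) (y := y) (w := u)
        ⟨h.1, h.2.2, h.2.1⟩ hv
      refine ⟨_, Or.inl ⟨u, hu, w, hw, rfl⟩, ?_⟩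
      rw [SimpleGraph.dist_comm (u := w), SimpleGraph.dist_comm (u := v),
        abs_sub_comm] at hle
      linarith
  · rcases hs with ⟨v, hv, w, hw, rfl⟩ | ⟨a', b', h', rfl⟩
    · obtain ⟨u, hu, hle⟩ := local_global hG (w := w) h hv
      exact ⟨_, Or.inl ⟨u, hu, w, hw, rfl⟩, by linarith⟩
    · by_cases hsub : (z.coord.support : Set V) ⊆ {a, b}
      · refine ⟨_, Or.inr ⟨a, b, ⟨h.1, h.2.1, hsub⟩, rfl⟩, ?_⟩
        have habs : |y.coord a - z.coord a| = |y.coord a' - z.coord a'| := by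
          rcases h.1 with rfl | hab
          · have e1 := y.coord_self (a := a) (by simpa using h.2.2)
            have e2 := z.coord_self (a := a) (by simpa using hsub)
            have e3 : ∀ c, y.coord c = z.coord c := by
              intro c
              rcases eq_or_ne c a with rfl | hc
              · rw [e1, e2]
              · rw [y.coord_eq_zero h.2.2 hc hc, z.coord_eq_zero hsub hc hc]
            simp [e3]
          · have e1 := y.coord_add hab.ne h.2.2
            have e2 := z.coord_add hab.ne hsub
            rcases eq_or_ne a' a with rfl | ha
            · rfl
            · rcases eq_or_ne a' b with rfl | hb
              · rw [abs_sub_comm]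
                congr 1
                linarith
              · have f1 := y.coord_eq_zero h.2.2 ha hb
                have f2 := z.coord_eq_zero hsub ha hb
                have g1 : y.coord b' = 1 := y.coord_self (by
                  intro c hc
                  rcases h'.2.1 hc with rfl | hc'
                  · exact absurd f1 (Finsupp.mem_support_iff.1 hc)
                  · exact hc')
                have g2 : z.coord b' = 1 := z.coord_self (by
                  intro c hc
                  rcases h'.2.2 hc with rfl | hc'
                  · exact absurd f2 (Finsupp.mem_support_iff.1 hc)
                  · exact hc')
                have hb' : b' = a ∨ b' = b := by
                  have := h.2.2 (Finset.mem_coe.2 (Finsupp.mem_support_iff.2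
                    (show y.coord b' ≠ 0 by rw [g1]; exact one_ne_zero)))
                  simpa using this
                rcases hb' with rfl | rfl
                · simp [f1, f2, g1, g2]
                · have : y.coord a = z.coord a := by linarith
                  simp [f1, f2, this]
        rw [← habs]
        exact abs_sub_le _ _ _
      · obtain ⟨w, hw, hwab⟩ := Set.not_subset.1 hsub
        simp only [mem_insert_iff, mem_singleton_iff, not_or] at hwab
        have hw' := h'.2.2 hw
        simp only [mem_insert_iff, mem_singleton_iff] at hw'
        have hyw : y.coord w = 0 := y.coord_eq_zero h.2.2 hwab.1 hwab.2
        obtain ⟨c, hc⟩ := y.support_nonempty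
        have hcw : c ≠ w := by
          rintro rfl
          exact (Finsupp.mem_support_iff.1 hc) hyw
        have hc' := h'.2.1 (Finset.mem_coe.2 hc)
        simp only [mem_insert_iff, mem_singleton_iff] at hc'
        obtain ⟨w', hw₁, hle⟩ := z.exists_support_le h'.1 h'.2.2 hc'
        obtain ⟨u, hu, hle'⟩ := local_global hG (w := w') h hc
        refine ⟨_, Or.inl ⟨u, hu, w', hw₁, rfl⟩, ?_⟩
        have hcy : y.coord c = 1 := y.coord_self (by
          intro d hd
          have hd' := h'.2.1 hd
          simp only [mem_insert_iff, mem_singleton_iff] at hd'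
          have hdw : d ≠ w := by
            rintro rfl
            exact (Finsupp.mem_support_iff.1 (Finset.mem_coe.1 hd)) hyw
          simp only [mem_singleton_iff]
          rcases hw' with rfl | rfl <;> rcases hd' with rfl | rfl <;> rcases hc' with rfl | rfl <;>
            first | rfl | exact absurd rfl hdw | exact absurd rfl hcw)
        have habs : |y.coord a' - z.coord a'| = |y.coord c - z.coord c| := by
          rcases hc' with rfl | rfl
          · rfl
          · rcases h'.1 with rfl | hab
            · rfl
            · have h1 := y.coord_add hab.ne h'.2.1
              have h2 := z.coord_add hab.ne h'.2.2
              rw [abs_sub_comm]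
              congr 1
              linarith
        rw [habs]
        have := le_abs_self (y.coord c - z.coord c)
        rw [SimpleGraph.dist_comm (u := w')] at hle
        linarith

/-- The path metric on the geometric realisation of a connected graph, with edges of length `1`. -/
instance [hG : Fact G.Connected] : MetricSpace (GeomReal G) where
  dist x y := sInf (pathLengths x y)
  dist_self x := by
    obtain ⟨a, b, hab, h⟩ := x.exists_edge
    refine le_antisymm ?_ (le_csInf (pathLengths_nonempty x x) fun _ => pathLengths_nonneg x x)
    exact csInf_le (pathLengths_bddBelow x x) (Or.inr ⟨a, b, ⟨hab, h, h⟩, by simp⟩)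
  dist_comm x y := by rw [pathLengths_comm]
  dist_triangle x y z := by
    have h1 := (pathLengths_nonempty x y).csInf_mem (pathLengths_finite x y)
    have h2 := (pathLengths_nonempty y z).csInf_mem (pathLengths_finite y z)
    obtain ⟨q, hq, hle⟩ := pathLengths_triangle hG.out x y z h1 h2
    exact (csInf_le (pathLengths_bddBelow x z) hq).trans hle
  eq_of_dist_eq_zero := by
    intro x y h0
    have hm := (pathLengths_nonempty x y).csInf_mem (pathLengths_finite x y)
    rw [show sInf (pathLengths x y) = 0 from h0] at hm
    rcases hm with ⟨u, hu, v, hv, h⟩ | ⟨a, b, ⟨hab, hx, hy⟩, h⟩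
    · have e1 := x.coord_le_one u
      have e2 := y.coord_le_one v
      have e3 : (0 : ℝ) ≤ G.dist u v := Nat.cast_nonneg _
      have e4 : (G.dist u v : ℝ) = 0 := by linarith
      have huv : u = v := by
        have : G.dist u v = 0 := by exact_mod_cast e4
        exact hG.out.dist_eq_zero_iff.1 this
      subst huv
      have f1 : x.coord u = 1 := by linarith
      have f2 : y.coord u = 1 := by linarith
      have key : ∀ z : GeomReal G, z.coord u = 1 → ∀ w, w ≠ u → z.coord w = 0 := by
        intro z hz w hw
        by_contra hne
        have hws : w ∈ z.coord.support := Finsupp.mem_support_iff.2 hne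
        have hus : u ∈ z.coord.support := Finsupp.mem_support_iff.2 (by rw [hz]; exact one_ne_zero)
        have hd := z.dist_support_le hws hus
        have hpos : 0 < G.dist w u := hG.out.pos_dist_of_ne hw
        have : (1 : ℝ) ≤ G.dist w u := by exact_mod_cast hpos
        have := (z.coord_nonneg w).lt_of_ne (Ne.symm hne)
        linarith
      ext w
      rcases eq_or_ne w u with rfl | hw
      · rw [f1, f2]
      · rw [key x f1 w hw, key y f2 w hw]
    · have hxy : x.coord a = y.coord a := by
        have := abs_eq_zero.1 h.symm
        linarith
      ext w
      rcases eq_or_ne w a with rfl | ha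
      · exact hxy
      · rcases eq_or_ne w b with rfl | hb
        · rcases hab with rfl | hab
          · exact hxy
          · have h1 := x.coord_add hab.ne hx
            have h2 := y.coord_add hab.ne hy
            linarith
        · rw [x.coord_eq_zero hx ha hb, y.coord_eq_zero hy ha hb]

theorem dist_vertex [hG : Fact G.Connected] (u v : V) :
    dist (vertex G u) (vertex G v) = G.dist u v := by
  classical
  change sInf (pathLengths (vertex G u) (vertex G v)) = G.dist u v
  have hsupp : ∀ w, (vertex G w).coord.support = {w} := fun w =>
    by simp [vertex, Finsupp.support_single]
  have hc : ∀ w, (vertex G w).coord w = 1 := fun w => by simp [vertex]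
  apply le_antisymm
  · refine csInf_le (pathLengths_bddBelow _ _) (Or.inl ⟨u, by simp [hsupp], v, by simp [hsupp], ?_⟩)
    simp [hc]
  · refine le_csInf (pathLengths_nonempty _ _) ?_
    rintro r (⟨u', hu, v', hv, rfl⟩ | ⟨a, b, ⟨hab, hx, hy⟩, rfl⟩)
    · rw [hsupp, Finset.mem_singleton] at hu hv
      subst hu hv
      simp [hc]
    · rcases eq_or_ne u v with rfl | hne
      · simp
      · simp only [hsupp, Finset.coe_singleton, Set.singleton_subset_iff, mem_insert_iff,
          mem_singleton_iff] at hx hy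
        have hadj : G.Adj u v ∧ (u = a ∨ v = a) := by
          rcases hab with rfl | hab
          · exfalso; rcases hx with rfl | rfl <;> rcases hy with rfl | rfl <;> exact hne rfl
          · rcases hx with rfl | rfl <;> rcases hy with rfl | rfl
            · exact absurd rfl hne
            · exact ⟨hab, Or.inl rfl⟩
            · exact ⟨hab.symm, Or.inr rfl⟩
            · exact absurd rfl hne
        rw [SimpleGraph.dist_eq_one_iff_adj.2 hadj.1]
        rcases hadj.2 with rfl | rfl
        · simp [vertex, Ne.symm hne]
        · simp [vertex, hne]

end GeomReal

/-! ### Quasi-geodesics, Morse gauges and the Morse boundary -/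

/-- A Morse gauge: an increasing map `ℝ_{≥ 1} × ℝ_{≥ 0} → ℝ_{≥ 0}`, continuous in the second
argument. -/
@[ext]
structure MorseGauge where
  toFun : Set.Ici (1 : ℝ) → ℝ≥0 → ℝ≥0
  mono : ∀ {l l' : Set.Ici (1 : ℝ)} {e e' : ℝ≥0}, l ≤ l' → e ≤ e' → toFun l e ≤ toFun l' e'
  cont : ∀ l, Continuous (toFun l)

/-- Morse gauges are ordered pointwise. -/
instance : PartialOrder MorseGauge :=
  PartialOrder.lift MorseGauge.toFun fun _ _ h => MorseGauge.ext h

/-- Increasing functions on the set of Morse gauges, which by convention satisfy `M ≤ f M`. -/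
def IsIncreasing (f : MorseGauge → MorseGauge) : Prop := Monotone f ∧ ∀ M, M ≤ f M

section Morse

variable {X : Type*} [MetricSpace X]

/-- `γ` restricted to `I` is a continuous `(l, e)`-quasi-geodesic. -/
def IsQuasiGeodesicOn (l e : ℝ) (γ : ℝ → X) (I : Set ℝ) : Prop :=
  ContinuousOn γ I ∧ ∀ s ∈ I, ∀ t ∈ I,
    l⁻¹ * |s - t| - e ≤ dist (γ s) (γ t) ∧ dist (γ s) (γ t) ≤ l * |s - t| + e

/-- `γ` restricted to `[0, dist x y]` is a geodesic segment from `x` to `y`. -/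
def IsGeodesicSegment (γ : ℝ → X) (x y : X) : Prop :=
  γ 0 = x ∧ γ (dist x y) = y ∧
    ∀ s ∈ Icc 0 (dist x y), ∀ t ∈ Icc 0 (dist x y), dist (γ s) (γ t) = |s - t|

/-- `γ` restricted to `[0, ∞)` is a geodesic ray. -/
def IsGeodesicRay (γ : ℝ → X) : Prop :=
  ∀ s ∈ Ici (0 : ℝ), ∀ t ∈ Ici (0 : ℝ), dist (γ s) (γ t) = |s - t|

/-- The condition for a (quasi-)geodesic with image `A` to be `M`-Morse: continuous
`(l, e)`-quasi-geodesic segments with endpoints on `A` stay in the closed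
`M(l, e)`-neighbourhood of `A`. -/
def IsMorseSet (M : MorseGauge) (A : Set X) : Prop :=
  ∀ (l : Set.Ici (1 : ℝ)) (e : ℝ≥0) (T : ℝ) (η : ℝ → X), 0 ≤ T →
    IsQuasiGeodesicOn (l : ℝ) (e : ℝ) η (Icc 0 T) → η 0 ∈ A → η T ∈ A →
    η '' Icc 0 T ⊆ Metric.cthickening (M.toFun l e : ℝ) A

/-- The image of a ray. -/
def rayImage (γ : ℝ → X) : Set X := γ '' Ici 0

/-- The image of a segment from `x` to `y`. -/
def segImage (γ : ℝ → X) (x y : X) : Set X := γ '' Icc 0 (dist x y)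

/-- The two sets have bounded Hausdorff distance. -/
def FiniteHausdorff (A B : Set X) : Prop := Metric.hausdorffEDist A B ≠ ∞

variable (X) in
/-- Morse geodesic rays. -/
def MorseRay : Type _ :=
  {γ : ℝ → X // IsGeodesicRay γ ∧ ∃ M : MorseGauge, IsMorseSet M (rayImage γ)}

variable (X) in
/-- Two Morse geodesic rays are equivalent if they have bounded Hausdorff distance. -/
instance morseRaySetoid : Setoid (MorseRay X) where
  r γ γ' := FiniteHausdorff (rayImage γ.1) (rayImage γ'.1)
  iseqv := by
    refine ⟨fun γ => ?_, fun {γ γ'} h => ?_, fun {γ γ' γ''} h h' => ?_⟩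
    · simp [FiniteHausdorff, Metric.hausdorffEDist_self]
    · rwa [FiniteHausdorff, Metric.hausdorffEDist_comm]
    · exact ne_top_of_le_ne_top (ENNReal.add_ne_top.2 ⟨h, h'⟩) Metric.hausdorffEDist_triangle

variable (X) in
/-- The Morse boundary of `X`, as a set. -/
def MorseBoundary : Type _ := Quotient (morseRaySetoid X)

/-- The Morse direction `z` has an `M`-Morse realisation starting at `a`. -/
def MorseBoundary.IsMorse (a : X) (M : MorseGauge) (z : MorseBoundary X) : Prop :=
  ∃ γ : MorseRay X, γ.1 0 = a ∧ (Quotient.mk _ γ : MorseBoundary X) = z ∧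
    IsMorseSet M (rayImage γ.1)

/-- `γ` is a Morse quasi-geodesic ray and its class `[γ]` is the Morse direction `z`: the geodesic
rays representing `z` have bounded Hausdorff distance from `γ`. -/
def IsClassOf (γ : ℝ → X) (z : MorseBoundary X) : Prop :=
  (∃ C : ℝ, 1 ≤ C ∧ IsQuasiGeodesicOn C C γ (Ici 0)) ∧
  (∃ M : MorseGauge, IsMorseSet M (rayImage γ)) ∧
  ∃ ρ : MorseRay X, (Quotient.mk _ ρ : MorseBoundary X) = z ∧
    FiniteHausdorff (rayImage γ) (rayImage ρ.1)

/-- The concatenation `γ₀ ∘ γ₁ ∘ ⋯` of paths: for `i < k` the path `γᵢ` is used on `[0, len i]`,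
and `γₖ`, if `k` is finite, is used on `[0, ∞)`. -/
def concatPaths (k : ℕ∞) (len : ℕ → ℝ) (γ : ℕ → ℝ → X) (t : ℝ) : X :=
  let i := sInf {i : ℕ | (i : ℕ∞) = k ∨ t < ∑ m ∈ Finset.range (i + 1), len m}
  γ i (t - ∑ m ∈ Finset.range i, len m)

end Morse

/-! ### Asymptotic cones -/

/-- A non-principal ultrafilter on `ℕ` and a sequence of scaling factors tending to infinity. -/
structure ConeData where
  ω : Ultrafilter ℕ
  nonprincipal : (ω : Filter ℕ) ≤ cofinite
  scale : ℕ → ℝ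
  scale_pos : ∀ n, 0 < scale n
  scale_tendsto : Tendsto scale atTop atTop

/-- Sequences whose distance from the base point `b` grows at most linearly in the scale. -/
structure ConeSeq {Y : Type*} [MetricSpace Y] (D : ConeData) (b : Y) where
  seq : ℕ → Y
  bdd : ∃ C : ℝ, ∀ n, dist (seq n) b ≤ C * D.scale n

namespace ConeSeq

variable {Y : Type*} [MetricSpace Y] {D : ConeData} {b : Y}

theorem tendsto_dist (x y : ConeSeq D b) :
    Tendsto (fun n => dist (x.seq n) (y.seq n) / D.scale n) D.ω
      (𝓝 (limUnder (D.ω : Filter ℕ) fun n => dist (x.seq n) (y.seq n) / D.scale n)) := by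
  apply tendsto_nhds_limUnder
  obtain ⟨C, hC⟩ := x.bdd
  obtain ⟨C', hC'⟩ := y.bdd
  have hmem : ∀ n, dist (x.seq n) (y.seq n) / D.scale n ∈ Icc (0 : ℝ) (C + C') := by
    intro n
    refine ⟨div_nonneg dist_nonneg (D.scale_pos n).le, ?_⟩
    rw [div_le_iff₀ (D.scale_pos n)]
    have := dist_triangle_right (x.seq n) (y.seq n) b
    linarith [hC n, hC' n]
  obtain ⟨r, -, hr⟩ := (isCompact_Icc (a := (0 : ℝ)) (b := C + C')).ultrafilter_le_nhds
    (D.ω.map fun n => dist (x.seq n) (y.seq n) / D.scale n)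
    (le_principal_iff.2 (Ultrafilter.mem_map.2 (Filter.univ_mem' hmem)))
  exact ⟨r, hr⟩

/-- The limit of the rescaled distances along the ultrafilter. -/
instance : PseudoMetricSpace (ConeSeq D b) where
  dist x y := limUnder (D.ω : Filter ℕ) fun n => dist (x.seq n) (y.seq n) / D.scale n
  dist_self x := tendsto_nhds_unique (tendsto_dist x x) (by simp)
  dist_comm x y := by simp only [dist_comm]
  dist_triangle x y z := by
    refine le_of_tendsto_of_tendsto (tendsto_dist x z)
      ((tendsto_dist x y).add (tendsto_dist y z)) (Eventually.of_forall fun n => ?_)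
    simp only
    rw [← add_div]
    exact div_le_div_of_nonneg_right (dist_triangle _ _ _) (D.scale_pos n).le

end ConeSeq

/-- The asymptotic cone of `Y` with base point `b`. -/
abbrev AsymptoticCone {Y : Type*} [MetricSpace Y] (D : ConeData) (b : Y) : Type _ :=
  SeparationQuotient (ConeSeq D b)

/-! ### Notions from geometric group theory -/

theorem mulCayley_connected {Γ : Type*} [Group Γ] {S : Set Γ} (hS : Subgroup.closure S = ⊤) :
    (SimpleGraph.mulCayley S).Connected := by
  have hadj : ∀ g : Γ, ∀ s ∈ S, (SimpleGraph.mulCayley S).Reachable g (g * s) := by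
    intro g s hs
    rcases eq_or_ne g (g * s) with h | h
    · rw [← h]
    · exact (SimpleGraph.Adj.reachable (by
        rw [SimpleGraph.mulCayley_adj']
        exact ⟨h, s, hs, Or.inl rfl⟩))
  have key : ∀ x : Γ, ∀ g : Γ, (SimpleGraph.mulCayley S).Reachable g (g * x) := by
    intro x
    have hx : x ∈ Subgroup.closure S := by rw [hS]; trivial
    induction hx using Subgroup.closure_induction with
    | mem s hs => exact fun g => hadj g s hs
    | one => intro g; simp
    | mul x y _ _ hx hy =>
      intro g
      rw [← mul_assoc]
      exact (hx g).trans (hy _)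
    | inv x _ hx =>
      intro g
      simpa using (hx (g * x⁻¹)).symm
  have : Nonempty Γ := ⟨1⟩
  exact ⟨fun g h => by simpa using key (g⁻¹ * h) g⟩

/-- A homomorphism `φ : H → Γ` of finitely generated groups is undistorted if it is a
quasi-isometric embedding for word metrics given by finite generating sets (the other inequality of
a quasi-isometric embedding always holds). -/
def IsUndistorted {H Γ : Type*} [Group H] [Group Γ] (φ : H →* Γ) : Prop :=
  ∃ (A : Set H) (B : Set Γ), A.Finite ∧ B.Finite ∧
    Subgroup.closure A = ⊤ ∧ Subgroup.closure B = ⊤ ∧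
    ∃ C : ℝ, ∀ h : H, ((SimpleGraph.mulCayley A).dist 1 h : ℝ) ≤
      C * (SimpleGraph.mulCayley B).dist 1 (φ h) + C

/-- `H` is relatively wide in the group `Γ` generated by `S`: in no asymptotic cone of (the Cayley
graph of) `Γ`, two points of the limit of `H` are separated by a cut point of the cone. -/
def IsRelativelyWide {Γ : Type*} [Group Γ] (S : Set Γ) [Fact (SimpleGraph.mulCayley S).Connected]
    (H : Subgroup Γ) : Prop :=
  ∀ (D : ConeData)
    (x y : ConeSeq D (GeomReal.vertex (SimpleGraph.mulCayley S) 1)),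
    (∀ n, ∃ h ∈ H, x.seq n = GeomReal.vertex _ h) →
    (∀ n, ∃ h ∈ H, y.seq n = GeomReal.vertex _ h) →
    ∀ p : AsymptoticCone D (GeomReal.vertex (SimpleGraph.mulCayley S) 1),
      p ≠ SeparationQuotient.mk x → p ≠ SeparationQuotient.mk y →
      JoinedIn {p}ᶜ (SeparationQuotient.mk x) (SeparationQuotient.mk y)

/-! ### Graphs of groups, Bass–Serre space and Bass–Serre tree -/

/-- A graph of finitely generated groups over a finite connected graph with vertex set
`{0, …, n}`, together with a spanning tree and generating sets.

`E` is the set of geometric edges. The oriented edges are the pairs `(e, b) : E × Bool`, the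
reverse of `(e, b)` is `(e, !b)`, and the target of `(e, b)` is `vtx e b`. Thus the edge group
`H e` is the same for an oriented edge and its reverse, by construction. -/
structure GraphOfGroups (n : ℕ) (E : Type*) [Finite E] where
  vtx : E → Bool → Fin (n + 1)
  G : Fin (n + 1) → Type*
  [grpG : ∀ v, Group (G v)]
  H : E → Type*
  [grpH : ∀ e, Group (H e)]
  f : ∀ e b, H e →* G (vtx e b)
  f_inj : ∀ e b, Function.Injective (f e b)
  /-- A spanning tree: `n` edges which connect all `n + 1` vertices. -/
  tree : Finset E
  tree_card : tree.card = n
  tree_connected : ∀ v w, Relation.ReflTransGen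
    (fun a c => ∃ e ∈ tree, ∃ b, vtx e (!b) = a ∧ vtx e b = c) v w
  /-- Finite symmetric generating sets of the edge groups and of the vertex groups. -/
  SH : ∀ e, Set (H e)
  SH_finite : ∀ e, (SH e).Finite
  SH_symm : ∀ e, ∀ s ∈ SH e, s⁻¹ ∈ SH e
  SH_gen : ∀ e, Subgroup.closure (SH e) = ⊤
  SG : ∀ v, Set (G v)
  SG_finite : ∀ v, (SG v).Finite
  SG_symm : ∀ v, ∀ s ∈ SG v, s⁻¹ ∈ SG v
  SG_gen : ∀ v, Subgroup.closure (SG v) = ⊤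
  f_SH : ∀ e b, ∀ s ∈ SH e, f e b s ∈ SG (vtx e b)

attribute [instance] GraphOfGroups.grpG GraphOfGroups.grpH

namespace GraphOfGroups

variable {n : ℕ} {E : Type*} [Finite E] (𝒢 : GraphOfGroups n E)

/-- Target of an oriented edge. -/
def tgt (α : E × Bool) : Fin (n + 1) := 𝒢.vtx α.1 α.2

/-- Source of an oriented edge. -/
def src (α : E × Bool) : Fin (n + 1) := 𝒢.vtx α.1 (!α.2)

/-- The free product of the vertex groups and the infinite cyclic groups `⟨t_α⟩`. -/
abbrev FG : Type _ := Monoid.Coprod (Monoid.CoprodI 𝒢.G) (FreeGroup (E × Bool))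

/-- An element of a vertex group as an element of the free product. -/
def vertexInFG (v : Fin (n + 1)) : 𝒢.G v →* 𝒢.FG :=
  Monoid.Coprod.inl.comp Monoid.CoprodI.of

/-- The generator `t_α` of the free product. -/
def tInFG (α : E × Bool) : 𝒢.FG := Monoid.Coprod.inr (FreeGroup.of α)

/-- The relations of the fundamental group: `t_ᾱ = t_α⁻¹`, `t_α = 1` for edges of the spanning
tree, and `f_ᾱ(h) = t_α f_α(h) t_α⁻¹`. -/
def relators : Set 𝒢.FG :=
  {x | ∃ α : E × Bool, x = 𝒢.tInFG (α.1, !α.2) * 𝒢.tInFG α} ∪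
  {x | ∃ α : E × Bool, α.1 ∈ 𝒢.tree ∧ x = 𝒢.tInFG α} ∪
  {x | ∃ (α : E × Bool) (h : 𝒢.H α.1),
    x = (𝒢.vertexInFG _ (𝒢.f α.1 (!α.2) h))⁻¹ *
      (𝒢.tInFG α * 𝒢.vertexInFG _ (𝒢.f α.1 α.2 h) * (𝒢.tInFG α)⁻¹)}

/-- The fundamental group of the graph of groups. -/
abbrev FundGroup : Type _ := 𝒢.FG ⧸ Subgroup.normalClosure 𝒢.relators

/-- The canonical map from a vertex group to the fundamental group. -/
def ι (v : Fin (n + 1)) : 𝒢.G v →* 𝒢.FundGroup :=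
  (QuotientGroup.mk' _).comp (𝒢.vertexInFG v)

/-- The element `t_α` of the fundamental group. -/
def t (α : E × Bool) : 𝒢.FundGroup := QuotientGroup.mk' _ (𝒢.tInFG α)

theorem t_tree {α : E × Bool} (h : α.1 ∈ 𝒢.tree) : 𝒢.t α = 1 :=
  (QuotientGroup.eq_one_iff _).2 (Subgroup.subset_normalClosure (Or.inl (Or.inr ⟨α, h, rfl⟩)))

theorem t_conj (α : E × Bool) (h : 𝒢.H α.1) :
    𝒢.ι _ (𝒢.f α.1 (!α.2) h) = 𝒢.t α * 𝒢.ι _ (𝒢.f α.1 α.2 h) * (𝒢.t α)⁻¹ := by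
  have h1 : QuotientGroup.mk' (Subgroup.normalClosure 𝒢.relators)
      ((𝒢.vertexInFG _ (𝒢.f α.1 (!α.2) h))⁻¹ *
        (𝒢.tInFG α * 𝒢.vertexInFG _ (𝒢.f α.1 α.2 h) * (𝒢.tInFG α)⁻¹)) = 1 :=
    (QuotientGroup.eq_one_iff _).2 (Subgroup.subset_normalClosure (Or.inr ⟨α, h, rfl⟩))
  simp only [map_mul, map_inv] at h1
  exact inv_mul_eq_one.1 h1

/-- The Cayley graph of a vertex group. -/
abbrev cay (v : Fin (n + 1)) : SimpleGraph (𝒢.G v) := SimpleGraph.mulCayley (𝒢.SG v)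

instance (v : Fin (n + 1)) : Fact (𝒢.cay v).Connected := ⟨mulCayley_connected (𝒢.SG_gen v)⟩

/-- Vertices `(g, v)` of the Bass–Serre space. -/
abbrev XVert : Type _ := 𝒢.FundGroup × Fin (n + 1)

/-- The Bass–Serre space as a graph: `(g, v)` is joined to `(g s, v)` for `s ∈ S_v`, and `(g, α⁻)`
is joined to `(g t_α, α⁺)`. -/
def xGraph : SimpleGraph 𝒢.XVert :=
  SimpleGraph.fromRel fun x y =>
    (∃ s ∈ 𝒢.SG x.2, y = (x.1 * 𝒢.ι x.2 s, x.2)) ∨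
    ∃ α : E × Bool, x.2 = 𝒢.src α ∧ y = (x.1 * 𝒢.t α, 𝒢.tgt α)

theorem xGraph_connected : 𝒢.xGraph.Connected := by
  have hrel : ∀ x y : 𝒢.XVert, ((∃ s ∈ 𝒢.SG x.2, y = (x.1 * 𝒢.ι x.2 s, x.2)) ∨
      ∃ α : E × Bool, x.2 = 𝒢.src α ∧ y = (x.1 * 𝒢.t α, 𝒢.tgt α)) → 𝒢.xGraph.Reachable x y := by
    intro x y h
    rcases eq_or_ne x y with rfl | hne
    · exact SimpleGraph.Reachable.refl _
    · exact SimpleGraph.Adj.reachable (by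
        rw [xGraph, SimpleGraph.fromRel_adj]
        exact ⟨hne, Or.inl h⟩)
  have hvert : ∀ v (x : 𝒢.G v) (g : 𝒢.FundGroup),
      𝒢.xGraph.Reachable (g, v) (g * 𝒢.ι v x, v) := by
    intro v x
    have hx : x ∈ Subgroup.closure (𝒢.SG v) := by rw [𝒢.SG_gen]; trivial
    induction hx using Subgroup.closure_induction with
    | mem s hs => exact fun g => hrel _ _ (Or.inl ⟨s, hs, rfl⟩)
    | one => intro g; simp
    | mul x y _ _ hx hy =>
      intro g
      rw [map_mul, ← mul_assoc]
      exact (hx g).trans (hy _)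
    | inv x _ hx =>
      intro g
      simpa using (hx (g * (𝒢.ι v x)⁻¹)).symm
  have htree : ∀ v w (g : 𝒢.FundGroup), 𝒢.xGraph.Reachable (g, v) (g, w) := by
    intro v w g
    induction 𝒢.tree_connected v w with
    | refl => exact SimpleGraph.Reachable.refl _
    | tail _ h ih =>
      obtain ⟨e, he, b, rfl, rfl⟩ := h
      refine ih.trans (hrel _ _ (Or.inr ⟨(e, b), rfl, ?_⟩))
      rw [𝒢.t_tree (α := (e, b)) he, mul_one]
      rfl
  let N : Subgroup 𝒢.FundGroup :=
    { carrier := {h | ∀ g v w, 𝒢.xGraph.Reachable (g, v) (g * h, w)}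
      one_mem' := fun g v w => by simpa using htree v w g
      mul_mem' := fun {a b} ha hb g v w => by
        rw [← mul_assoc]
        exact (ha g v v).trans (hb _ v w)
      inv_mem' := fun {a} ha g v w => by
        have := (ha (g * a⁻¹) w v).symm
        simpa using this }
  have hN : ∀ x : 𝒢.FG, QuotientGroup.mk' (Subgroup.normalClosure 𝒢.relators) x ∈ N := by
    intro x
    induction x using Monoid.Coprod.induction_on with
    | inl m =>
      induction m using Monoid.CoprodI.induction_on with
      | one => simp
      | of v y => exact fun g v' w => ((htree v' v g).trans (hvert v y g)).trans (htree v w _)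
      | mul a b ha hb => simpa only [map_mul] using N.mul_mem ha hb
    | inr m =>
      induction m using FreeGroup.induction_on with
      | C1 => simp
      | of α =>
        exact fun g v w => ((htree v _ g).trans
          (hrel (g, 𝒢.src α) _ (Or.inr ⟨α, rfl, rfl⟩))).trans (htree _ w _)
      | inv_of α h => simpa only [map_inv] using N.inv_mem h
      | mul a b ha hb => simpa only [map_mul] using N.mul_mem ha hb
    | mul a b ha hb => simpa only [map_mul] using N.mul_mem ha hb
  have : Nonempty 𝒢.XVert := ⟨(1, 0)⟩
  refine ⟨fun x y => ?_⟩
  obtain ⟨z, hz⟩ := QuotientGroup.mk'_surjective (Subgroup.normalClosure 𝒢.relators)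
    (x.1⁻¹ * y.1)
  have h := hN z
  rw [hz] at h
  simpa using h x.1 x.2 y.2

instance : Fact 𝒢.xGraph.Connected := ⟨𝒢.xGraph_connected⟩

/-- The Bass–Serre space. -/
abbrev X : Type _ := GeomReal 𝒢.xGraph

/-- A vertex of the Bass–Serre space as a point. -/
abbrev pt (x : 𝒢.XVert) : 𝒢.X := GeomReal.vertex 𝒢.xGraph x

/-- The base point `(1, 0)` of the Bass–Serre space. -/
def one : 𝒢.XVert := (1, 0)

/-- The action of the fundamental group on the Bass–Serre space. -/
def translate (g : 𝒢.FundGroup) : 𝒢.X → 𝒢.X :=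
  GeomReal.map (fun x : 𝒢.XVert => (g * x.1, x.2)) (by
    intro x y h
    right
    rw [xGraph, SimpleGraph.fromRel_adj] at h ⊢
    obtain ⟨hne, h⟩ := h
    refine ⟨fun e => hne ?_, h.imp ?_ ?_⟩
    · simp only [Prod.mk.injEq, mul_right_inj] at e
      exact Prod.ext e.1 e.2
    all_goals
      rintro (⟨s, hs, rfl⟩ | ⟨α, hα, rfl⟩)
      · exact Or.inl ⟨s, hs, by simp [mul_assoc]⟩
      · exact Or.inr ⟨α, hα, by simp [mul_assoc]⟩)

/-- The canonical inclusion of the Cayley graph of a vertex group, induced by `g ↦ (g, v)`. -/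
def inclusion (v : Fin (n + 1)) : GeomReal (𝒢.cay v) → 𝒢.X :=
  GeomReal.map (fun g => (𝒢.ι v g, v)) (by
    intro x y h
    rcases eq_or_ne (𝒢.ι v x) (𝒢.ι v y) with heq | hne
    · left; rw [heq]
    · right
      rw [SimpleGraph.mulCayley_adj'] at h
      rw [xGraph, SimpleGraph.fromRel_adj]
      refine ⟨fun e => hne (Prod.ext_iff.1 e).1, ?_⟩
      obtain ⟨-, s, hs, rfl | rfl⟩ := h
      · exact Or.inl (Or.inl ⟨s, hs, by simp⟩)
      · exact Or.inr (Or.inl ⟨s, hs, by simp⟩))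

/-- The image of a vertex group in the fundamental group. -/
def vertexSubgroup (v : Fin (n + 1)) : Subgroup 𝒢.FundGroup := (𝒢.ι v).range

/-- The map from the edge group of an oriented edge `α` to the fundamental group, through the
vertex group of `α⁺`. -/
def edgeHom (α : E × Bool) : 𝒢.H α.1 →* 𝒢.FundGroup := (𝒢.ι _).comp (𝒢.f α.1 α.2)

/-- The image of the edge group of `α` in the fundamental group. -/
def edgeSubgroup (α : E × Bool) : Subgroup 𝒢.FundGroup := (𝒢.edgeHom α).range

/-- Vertices `g G_v` of the Bass–Serre tree. -/
abbrev TVert : Type _ := Σ v : Fin (n + 1), 𝒢.FundGroup ⧸ 𝒢.vertexSubgroup v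

/-- Oriented edges of the Bass–Serre tree: cosets `g H_α`. -/
abbrev TEdge : Type _ := Σ α : E × Bool, 𝒢.FundGroup ⧸ 𝒢.edgeSubgroup α

/-- The target of the edge `g H_α` is `g G_{α⁺}`. -/
def tTgt (ε : 𝒢.TEdge) : 𝒢.TVert :=
  ⟨𝒢.tgt ε.1, Quotient.map' (s₁ := QuotientGroup.leftRel (𝒢.edgeSubgroup ε.1))
    (s₂ := QuotientGroup.leftRel (𝒢.vertexSubgroup (𝒢.tgt ε.1))) id (by
      intro a b h
      rw [QuotientGroup.leftRel_apply] at h ⊢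
      obtain ⟨x, hx⟩ := h
      exact ⟨𝒢.f ε.1.1 ε.1.2 x, hx⟩) ε.2⟩

/-- The source of the edge `g H_α` is `g t_α⁻¹ G_{α⁻}`. -/
def tSrc (ε : 𝒢.TEdge) : 𝒢.TVert :=
  ⟨𝒢.src ε.1, Quotient.map' (s₁ := QuotientGroup.leftRel (𝒢.edgeSubgroup ε.1))
    (s₂ := QuotientGroup.leftRel (𝒢.vertexSubgroup (𝒢.src ε.1)))
    (fun g => g * (𝒢.t ε.1)⁻¹) (by
      intro a b h
      rw [QuotientGroup.leftRel_apply] at h ⊢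
      obtain ⟨x, hx⟩ := h
      refine ⟨𝒢.f ε.1.1 (!ε.1.2) x, ?_⟩
      have h1 := 𝒢.t_conj ε.1 x
      have h2 : 𝒢.ι _ (𝒢.f ε.1.1 ε.1.2 x) = a⁻¹ * b := hx
      rw [h2] at h1
      refine Eq.trans h1 ?_
      group) ε.2⟩

/-- The Bass–Serre tree. -/
def bsTree : SimpleGraph 𝒢.TVert :=
  SimpleGraph.fromRel fun a b => ∃ ε : 𝒢.TEdge, 𝒢.tSrc ε = a ∧ 𝒢.tTgt ε = b

/-- The vertex `G_0` of the Bass–Serre tree. -/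
def root : 𝒢.TVert := ⟨0, ((1 : 𝒢.FundGroup) : 𝒢.FundGroup ⧸ 𝒢.vertexSubgroup 0)⟩

/-- An edge of the Bass–Serre tree is outgoing if its target is further from `G_0` than its
source. -/
def Outgoing (ε : 𝒢.TEdge) : Prop :=
  𝒢.bsTree.dist 𝒢.root (𝒢.tSrc ε) < 𝒢.bsTree.dist 𝒢.root (𝒢.tTgt ε)

/-- For an edge `ε = g H_α`, the vertices `(x, α⁺)`, `x ∈ g H_α`, of the Bass–Serre space: these
are the targets of the edges which project to `ε`. -/
def edgeFibre (ε : 𝒢.TEdge) : Set 𝒢.XVert :=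
  {x | x.2 = 𝒢.tgt ε.1 ∧ (x.1 : 𝒢.FundGroup ⧸ 𝒢.edgeSubgroup ε.1) = ε.2}

/-- Morseless stars: every edge is incident to the vertex `0`, and the edge groups are undistorted
in the fundamental group, and relatively wide and of infinite index in the vertex groups. -/
structure IsMorselessStar : Prop where
  star : ∀ e, 𝒢.vtx e true = 0 ∨ 𝒢.vtx e false = 0
  undistorted : ∀ α : E × Bool, IsUndistorted (𝒢.edgeHom α)
  wide : ∀ e b, IsRelativelyWide (𝒢.SG (𝒢.vtx e b)) (𝒢.f e b).range
  infinite_index : ∀ e b, (𝒢.f e b).range.index = 0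

/-! ### Combinatorial rays -/

/-- The vertices of a finite edge path starting at `G_0`. -/
def pathVertex {k : ℕ} (p : Fin k → 𝒢.TEdge) : Fin (k + 1) → 𝒢.TVert :=
  Fin.cons 𝒢.root fun i => 𝒢.tTgt (p i)

/-- `p` is a finite geodesic edge path in the Bass–Serre tree starting at `G_0`. -/
def IsGeodesicPath {k : ℕ} (p : Fin k → 𝒢.TEdge) : Prop :=
  (∀ i : Fin k, 𝒢.tSrc (p i) = 𝒢.pathVertex p i.castSucc) ∧
  ∀ i j : Fin (k + 1), i ≤ j →
    𝒢.bsTree.dist (𝒢.pathVertex p i) (𝒢.pathVertex p j) = (j : ℕ) - (i : ℕ)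

/-- The vertices of an infinite edge path starting at `G_0`. -/
def pathVertexInf (p : ℕ → 𝒢.TEdge) : ℕ → 𝒢.TVert
  | 0 => 𝒢.root
  | i + 1 => 𝒢.tTgt (p i)

/-- `p` is an infinite geodesic edge path in the Bass–Serre tree starting at `G_0`. -/
def IsGeodesicPathInf (p : ℕ → 𝒢.TEdge) : Prop :=
  (∀ i, 𝒢.tSrc (p i) = 𝒢.pathVertexInf p i) ∧
  ∀ i j, i ≤ j → 𝒢.bsTree.dist (𝒢.pathVertexInf p i) (𝒢.pathVertexInf p j) = j - i

/-- The end vertex of a finite edge path starting at `G_0`. -/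
def endVertex {k : ℕ} (p : Fin k → 𝒢.TEdge) : 𝒢.TVert := 𝒢.pathVertex p (Fin.last k)

/-- Combinatorial rays, of finite type (with a tail in the Morse boundary of the vertex group of
the end vertex) or of infinite type. -/
inductive CombRay
  | finite (k : ℕ) (p : Fin k → 𝒢.TEdge) (hp : 𝒢.IsGeodesicPath p)
      (z : MorseBoundary (GeomReal (𝒢.cay (𝒢.endVertex p).1))) : CombRay
  | infinite (p : ℕ → 𝒢.TEdge) (hp : 𝒢.IsGeodesicPathInf p) : CombRay

/-- The geodesic ray `ξ` of the Bass–Serre space realises the Morse direction `z` of the vertex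
group `G_j`, viewed as a direction of the Bass–Serre space, and starts at `(1, j)`. -/
def RealisesTail (j : Fin (n + 1)) (z : MorseBoundary (GeomReal (𝒢.cay j))) (ξ : ℝ → 𝒢.X) :
    Prop :=
  ξ 0 = 𝒢.pt (1, j) ∧ IsGeodesicRay ξ ∧
  ∃ ρ : MorseRay (GeomReal (𝒢.cay j)), (Quotient.mk _ ρ : MorseBoundary (GeomReal (𝒢.cay j))) = z ∧
    FiniteHausdorff (𝒢.inclusion j '' rayImage ρ.1) (rayImage ξ)

/-- The choices which enter the definition of the realisation of a combinatorial ray: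
the base points `α^*` of the outgoing edges of the tree, geodesics `[x, y]` between the vertices of
the Bass–Serre space, and realisations of the Morse directions of the vertex groups (wherever a
realisation exists). -/
structure Choices where
  edgeBase : 𝒢.TEdge → 𝒢.XVert
  edgeBase_mem : ∀ ε, 𝒢.Outgoing ε → edgeBase ε ∈ 𝒢.edgeFibre ε
  edgeBase_min : ∀ ε, 𝒢.Outgoing ε → ∀ x ∈ 𝒢.edgeFibre ε,
    dist (𝒢.pt 𝒢.one) (𝒢.pt (edgeBase ε)) ≤ dist (𝒢.pt 𝒢.one) (𝒢.pt x)
  seg : 𝒢.XVert → 𝒢.XVert → ℝ → 𝒢.X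
  seg_geodesic : ∀ x y, IsGeodesicSegment (seg x y) (𝒢.pt x) (𝒢.pt y)
  tail : ∀ j, MorseBoundary (GeomReal (𝒢.cay j)) → ℝ → 𝒢.X
  tail_realises : ∀ j z, (∃ ξ, 𝒢.RealisesTail j z ξ) → 𝒢.RealisesTail j z (tail j z)

namespace Choices

variable {𝒢} (c : 𝒢.Choices)

open Classical in
/-- The base point `v^*`: it is `1 = (1, 0)` for `v = G_0`, and `α^*` for the outgoing edge `α`
with target `v` otherwise. -/
def vertBase (v : 𝒢.TVert) : 𝒢.XVert :=
  if h : v ≠ 𝒢.root ∧ ∃ ε, 𝒢.Outgoing ε ∧ 𝒢.tTgt ε = v then c.edgeBase h.2.choose else 𝒢.one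

/-- The edge `ε` is `M`-Morse: for `v` its source, there is an `M`-Morse geodesic from `v^*` to
`ε^*`. -/
def IsMorseEdge (M : MorseGauge) (ε : 𝒢.TEdge) : Prop :=
  ∃ γ : ℝ → 𝒢.X, IsGeodesicSegment γ (𝒢.pt (c.vertBase (𝒢.tSrc ε))) (𝒢.pt (c.edgeBase ε)) ∧
    IsMorseSet M (segImage γ (𝒢.pt (c.vertBase (𝒢.tSrc ε))) (𝒢.pt (c.edgeBase ε)))

/-- The combinatorial ray is `M`-Morse: its edges are `M`-Morse, and so is its tail (that is, the
tail has an `M`-Morse realisation in the Bass–Serre space) if it is of finite type. -/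
def IsMorseRay (M : MorseGauge) : 𝒢.CombRay → Prop
  | .finite _ p _ z => (∀ i, c.IsMorseEdge M (p i)) ∧
      ∃ ξ, 𝒢.RealisesTail _ z ξ ∧ IsMorseSet M (rayImage ξ)
  | .infinite p _ => ∀ i, c.IsMorseEdge M (p i)

/-- The combinatorial Morse boundary: the set of Morse combinatorial rays. -/
def CombBoundary : Type _ := {r : 𝒢.CombRay // ∃ M, c.IsMorseRay M r}

/-- The points `1, α₁^*, α₂^*, …` along a combinatorial ray (with the value `1` beyond its
end, which is not used). -/
def corner : 𝒢.CombRay → ℕ → 𝒢.XVert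
  | _, 0 => 𝒢.one
  | .finite k p _ _, i + 1 => if h : i < k then c.edgeBase (p ⟨i, h⟩) else 𝒢.one
  | .infinite p _, i + 1 => c.edgeBase (p i)

/-- The pieces `γᵢ` of the realisation of a combinatorial ray: the geodesics between consecutive
corners, and finally, for a ray of finite type with end vertex `w`, the translate `w^* · ξ` of the
realisation `ξ` of the tail. -/
def piece : 𝒢.CombRay → ℕ → ℝ → 𝒢.X
  | .finite k p hp z, i =>
      if i < k then c.seg (c.corner (.finite k p hp z) i) (c.corner (.finite k p hp z) (i + 1))
      else fun s => 𝒢.translate (c.vertBase (𝒢.endVertex p)).1 (c.tail _ z s)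
  | .infinite p hp, i => c.seg (c.corner (.infinite p hp) i) (c.corner (.infinite p hp) (i + 1))

/-- The length of a combinatorial ray. -/
def length : 𝒢.CombRay → ℕ∞
  | .finite k _ _ _ => k
  | .infinite _ _ => ⊤

/-- The realisation of a combinatorial ray, the concatenation of its pieces. -/
def realisation (r : 𝒢.CombRay) : ℝ → 𝒢.X :=
  concatPaths (length r)
    (fun i => dist (𝒢.pt (c.corner r i)) (𝒢.pt (c.corner r (i + 1)))) (c.piece r)

/-- The graph of groups is Morse preserving. -/
def MorsePreserving : Prop :=
  ∃ f₄ : MorseGauge → MorseGauge, IsIncreasing f₄ ∧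
    ∀ (M : MorseGauge) (r : 𝒢.CombRay), c.IsMorseRay M r →
      IsMorseSet (f₄ M) (rayImage (c.realisation r))

end Choices

end GraphOfGroups

end

/-! Everything rests on one consequence of relative wideness: for every gauge `M`, the `M`-Morse
geodesics of the Bass–Serre space with both endpoints in one edge fibre have bounded length
(`exists_bound_fibre`). Otherwise, rescale by their lengths. Edge groups are undistorted, so a
quasi-geodesic along the fibre joins the endpoints and, by the Morse property, passes near the
midpoint of the geodesic. In an asymptotic cone of the vertex group the endpoints and the midpoint
thus become points of the limit of the edge group. The midpoint separates the endpoints, because a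
path around it would yield, at some scale, a quasi-geodesic which avoids the middle of a Morse
geodesic (`not_joinedIn_of_isMorseSet`). Consequently the times at which a Morse geodesic is near a
given fibre lie in an interval of bounded length (`exists_bound_near_fibre`).

The second ingredient is that every edge separates the Bass–Serre tree (`not_beyond_src`), so that a
path which changes sides passes near the fibre of the edge (`exists_near_fibre`). Instead of normal
forms, explicit actions of the fundamental group are used: one counts signed crossings of an edge
(`exists_crossing`), another shows that vertex groups embed (`ι_injective`). Separation also shows
that vertex groups are undistorted (`exists_vertex_undistorted`).

`Φ` is well defined. The realisation of a Morse combinatorial ray is Morse by hypothesis; it has to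
be shown that it is a quasi-geodesic. Its pieces are uniformly Morse geodesics, so by the fibre
bound they make only short excursions beyond the edges at their ends (`exists_bound_excursion`). If
two different pieces come close to each other, they do so near the adjacent corners, and the number
of pieces in between is bounded because the corners project to a geodesic of the tree. Hence
realisations are uniformly proper (`exists_proper`). A `1`-Lipschitz, proper path with quasi-convex
image is a quasi-geodesic (`exists_isQuasiGeodesicOn_of_proper`), and a Morse quasi-geodesic ray in
a proper space is near a geodesic ray (`exists_geodesicRay`).

`Φ` is injective. If two combinatorial rays part at some edge, a common Morse geodesic ray would be
near both sides of this edge at arbitrarily late times, which the fibre bound forbids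
(`not_frequently_both`). If all edges agree, the tails agree because vertex groups are undistorted
(`eq_of_finiteHausdorff`).

`Φ` is surjective. A Morse geodesic ray `ρ` from the base point selects the outgoing edges `α`
beyond which it is found at arbitrarily late times. It passes near each `α^*`: a geodesic from `1`
to `α^*`, followed by a quasi-geodesic along the fibre, is a quasi-geodesic since `α^*` is a nearest
point (`exists_bound_edgeBase`). So the segments between consecutive base points follow `ρ` and are
uniformly Morse. If the selection stops at a vertex, `ρ` stays near the corresponding coset
(`exists_bound_stays`) and determines a Morse direction of the vertex group (`exists_realisesTail`).

All constants depend on the gauge only; choosing them monotonically (`exists_monotone_bound`) gives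
the increasing function `f₅`. -/

open Set Filter Topology
open scoped NNReal ENNReal

/-! ### Coarse geometry of geodesic metric spaces -/

section CoarseGeometry

variable {X : Type*} [MetricSpace X]

/-- `x` is at distance at most `K` from some point of `A`. -/
def Near (K : ℝ) (A : Set X) (x : X) : Prop := ∃ a ∈ A, dist x a ≤ K

/-- `γ` is an isometric embedding on `J`. -/
def GeodOn (γ : ℝ → X) (J : Set ℝ) : Prop := ∀ s ∈ J, ∀ t ∈ J, dist (γ s) (γ t) = |s - t|

variable (X) in
/-- Any two points are joined by a geodesic. -/
class GeodesicSpace : Prop where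
  exists_geodesic : ∀ x y : X, ∃ γ, IsGeodesicSegment γ x y

theorem Near.mono {K K' : ℝ} {A B : Set X} {x : X} (h : Near K A x) (hK : K ≤ K') (hAB : A ⊆ B) :
    Near K' B x := by
  obtain ⟨a, ha, hd⟩ := h
  exact ⟨a, hAB ha, hd.trans hK⟩

theorem Near.trans_dist {K D : ℝ} {A : Set X} {x y : X} (h : Near K A y) (hd : dist x y ≤ D) :
    Near (D + K) A x := by
  obtain ⟨a, ha, hd'⟩ := h
  exact ⟨a, ha, (dist_triangle x y a).trans (by linarith)⟩

theorem Near.trans {K D : ℝ} {A B : Set X} {x : X} (h : Near K A x) (hB : ∀ a ∈ A, Near D B a) :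
    Near (K + D) B x := by
  obtain ⟨a, ha, hd⟩ := h
  exact (hB a ha).trans_dist hd

theorem near_self {A : Set X} {x : X} (h : x ∈ A) : Near 0 A x := ⟨x, h, by simp⟩

theorem IsGeodesicSegment.geodOn {γ : ℝ → X} {x y : X} (h : IsGeodesicSegment γ x y) :
    GeodOn γ (Icc 0 (dist x y)) := h.2.2

theorem GeodOn.mono {γ : ℝ → X} {J J' : Set ℝ} (h : GeodOn γ J) (hJ : J' ⊆ J) : GeodOn γ J' :=
  fun s hs t ht => h s (hJ hs) t (hJ ht)

theorem GeodOn.continuousOn {γ : ℝ → X} {J : Set ℝ} (h : GeodOn γ J) : ContinuousOn γ J := by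
  rw [Metric.continuousOn_iff]
  intro b hb ε hε
  exact ⟨ε, hε, fun a ha hab => by rw [h a ha b hb]; exact hab⟩

theorem GeodOn.isQuasiGeodesicOn {γ : ℝ → X} {J : Set ℝ} (h : GeodOn γ J) :
    IsQuasiGeodesicOn 1 0 γ J :=
  ⟨h.continuousOn, fun s hs t ht => by rw [h s hs t ht]; simp⟩

theorem IsQuasiGeodesicOn.mono {l e : ℝ} {γ : ℝ → X} {J J' : Set ℝ}
    (h : IsQuasiGeodesicOn l e γ J) (hJ : J' ⊆ J) : IsQuasiGeodesicOn l e γ J' :=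
  ⟨h.1.mono hJ, fun s hs t ht => h.2 s (hJ hs) t (hJ ht)⟩

theorem IsQuasiGeodesicOn.weaken {l e l' e' : ℝ} {γ : ℝ → X} {J : Set ℝ}
    (h : IsQuasiGeodesicOn l e γ J) (hl : 1 ≤ l) (hl' : l ≤ l') (he : e ≤ e') :
    IsQuasiGeodesicOn l' e' γ J := by
  refine ⟨h.1, fun s hs t ht => ?_⟩
  obtain ⟨h1, h2⟩ := h.2 s hs t ht
  have h3 : l'⁻¹ ≤ l⁻¹ := inv_anti₀ (by linarith) hl'
  have h4 := mul_le_mul_of_nonneg_right h3 (abs_nonneg (s - t))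
  have h5 := mul_le_mul_of_nonneg_right hl' (abs_nonneg (s - t))
  constructor <;> linarith

/-- The upper bound on the parameter given by a quasi-geodesic. -/
theorem IsQuasiGeodesicOn.abs_sub_le {l e : ℝ} {γ : ℝ → X} {J : Set ℝ}
    (h : IsQuasiGeodesicOn l e γ J) (hl : 1 ≤ l) {s t : ℝ} (hs : s ∈ J) (ht : t ∈ J) :
    |s - t| ≤ l * (dist (γ s) (γ t) + e) := by
  have h1 := (h.2 s hs t ht).1
  have h2 : l⁻¹ * |s - t| ≤ dist (γ s) (γ t) + e := by linarith
  rwa [inv_mul_le_iff₀ (by linarith)] at h2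

theorem IsQuasiGeodesicOn.reverse {l e T : ℝ} {η : ℝ → X}
    (h : IsQuasiGeodesicOn l e η (Icc 0 T)) :
    IsQuasiGeodesicOn l e (fun t => η (T - t)) (Icc 0 T) := by
  have hm : ∀ t ∈ Icc (0 : ℝ) T, T - t ∈ Icc (0 : ℝ) T := fun t ht =>
    ⟨by linarith [ht.2], by linarith [ht.1]⟩
  refine ⟨h.1.comp (by fun_prop) hm, fun s hs t ht => ?_⟩
  have := h.2 _ (hm s hs) _ (hm t ht)
  rwa [show T - s - (T - t) = -(s - t) by ring, abs_neg] at this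

theorem IsGeodesicSegment.reverse {γ : ℝ → X} {x y : X} (h : IsGeodesicSegment γ x y) :
    IsGeodesicSegment (fun t => γ (dist x y - t)) y x := by
  have hm : ∀ t ∈ Icc (0 : ℝ) (dist y x), dist x y - t ∈ Icc (0 : ℝ) (dist x y) := by
    rw [dist_comm y x]
    exact fun t ht => ⟨by linarith [ht.2], by linarith [ht.1]⟩
  refine ⟨by simpa using h.2.1, by simpa [dist_comm y x] using h.1, fun s hs t ht => ?_⟩
  rw [h.2.2 _ (hm s hs) _ (hm t ht), show dist x y - s - (dist x y - t) = -(s - t) by ring, abs_neg]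

theorem IsGeodesicSegment.segImage_reverse {γ : ℝ → X} {x y : X} :
    segImage (fun t => γ (dist x y - t)) y x = segImage γ x y := by
  unfold segImage
  ext p
  constructor
  · rintro ⟨t, ht, rfl⟩
    rw [dist_comm y x] at ht
    exact ⟨_, ⟨by linarith [ht.2], by linarith [ht.1]⟩, rfl⟩
  · rintro ⟨t, ht, rfl⟩
    refine ⟨dist x y - t, ?_, by simp⟩
    rw [dist_comm y x]
    exact ⟨by linarith [ht.2], by linarith [ht.1]⟩

/-- Follow `γ` on `[0, L]` and then `η`. -/
noncomputable def joinPath {X : Type*} (γ : ℝ → X) (L : ℝ) (η : ℝ → X) (t : ℝ) : X :=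
  if t ≤ L then γ t else η (t - L)

theorem joinPath_of_le {X : Type*} {γ η : ℝ → X} {L t : ℝ} (h : t ≤ L) : joinPath γ L η t = γ t := if_pos h

theorem joinPath_of_ge {X : Type*} {γ η : ℝ → X} {L t : ℝ} (hγ : γ L = η 0) (h : L ≤ t) :
    joinPath γ L η t = η (t - L) := by
  rcases h.eq_or_lt with rfl | h
  · rw [joinPath_of_le le_rfl, hγ, sub_self]
  · exact if_neg (not_le.2 h)

theorem continuousOn_joinPath {γ η : ℝ → X} {L T : ℝ} (hL : 0 ≤ L) (hT : 0 ≤ T)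
    (h1 : ContinuousOn γ (Icc 0 L)) (h2 : ContinuousOn η (Icc 0 T)) (hγ : γ L = η 0) :
    ContinuousOn (joinPath γ L η) (Icc 0 (L + T)) := by
  rw [← Icc_union_Icc_eq_Icc hL (by linarith : L ≤ L + T)]
  refine ContinuousOn.union_of_isClosed ?_ ?_ isClosed_Icc isClosed_Icc
  · exact h1.congr fun t ht => joinPath_of_le ht.2
  · refine ContinuousOn.congr (f := fun t => η (t - L)) ?_ fun t ht => joinPath_of_ge hγ ht.1
    exact h2.comp (by fun_prop) fun t ht => ⟨by linarith [ht.1], by linarith [ht.2]⟩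

/-- The concatenation of two quasi-geodesics is a quasi-geodesic as soon as the estimates hold
for pairs of points on different parts. -/
theorem isQuasiGeodesicOn_joinPath {γ η : ℝ → X} {L T l e : ℝ} (hL : 0 ≤ L) (hT : 0 ≤ T)
    (h1 : IsQuasiGeodesicOn l e γ (Icc 0 L)) (h2 : IsQuasiGeodesicOn l e η (Icc 0 T))
    (hγ : γ L = η 0)
    (h : ∀ s ∈ Icc 0 L, ∀ t ∈ Icc 0 T, l⁻¹ * ((L - s) + t) - e ≤ dist (γ s) (η t) ∧
      dist (γ s) (η t) ≤ l * ((L - s) + t) + e) :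
    IsQuasiGeodesicOn l e (joinPath γ L η) (Icc 0 (L + T)) := by
  refine ⟨continuousOn_joinPath hL hT h1.1 h2.1 hγ, ?_⟩
  have key : ∀ s ∈ Icc 0 (L + T), ∀ t ∈ Icc 0 (L + T), s ≤ t →
      l⁻¹ * |s - t| - e ≤ dist (joinPath γ L η s) (joinPath γ L η t) ∧
      dist (joinPath γ L η s) (joinPath γ L η t) ≤ l * |s - t| + e := by
    intro s hs t ht hst
    rcases le_total t L with htL | htL
    · rw [joinPath_of_le (hst.trans htL), joinPath_of_le htL]
      exact h1.2 s ⟨hs.1, hst.trans htL⟩ t ⟨ht.1, htL⟩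
    · rcases le_total s L with hsL | hsL
      · rw [joinPath_of_le hsL, joinPath_of_ge hγ htL,
          show |s - t| = (L - s) + (t - L) by rw [abs_of_nonpos (by linarith)]; ring]
        exact h s ⟨hs.1, hsL⟩ (t - L) ⟨by linarith, by linarith [ht.2]⟩
      · rw [joinPath_of_ge hγ hsL, joinPath_of_ge hγ htL,
          show s - t = (s - L) - (t - L) by ring]
        exact h2.2 _ ⟨by linarith, by linarith [hs.2]⟩ _ ⟨by linarith, by linarith [ht.2]⟩
  intro s hs t ht
  rcases le_total s t with hst | hst
  · exact key s hs t ht hst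
  · rw [dist_comm, abs_sub_comm]
    exact key t ht s hs hst

/-- Adding a geodesic of length at most `K` at the start of a quasi-geodesic. -/
theorem IsQuasiGeodesicOn.join_short {γ η : ℝ → X} {L T l e K : ℝ} (hl : 1 ≤ l) (he : 0 ≤ e)
    (hL : 0 ≤ L) (hLK : L ≤ K) (hT : 0 ≤ T) (h1 : GeodOn γ (Icc 0 L))
    (h2 : IsQuasiGeodesicOn l e η (Icc 0 T)) (hγ : γ L = η 0) :
    IsQuasiGeodesicOn l (e + 2 * K) (joinPath γ L η) (Icc 0 (L + T)) := by
  refine isQuasiGeodesicOn_joinPath hL hT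
    (h1.isQuasiGeodesicOn.weaken le_rfl hl (by linarith)) (h2.weaken hl le_rfl (by linarith)) hγ
    fun s hs t ht => ?_
  have hd : dist (γ s) (η 0) = L - s := by
    rw [← hγ, h1 s hs L ⟨hL, le_rfl⟩, abs_of_nonpos (by linarith [hs.2])]; ring
  obtain ⟨h3, h4⟩ := h2.2 0 ⟨le_rfl, hT⟩ t ht
  rw [show |0 - t| = t by rw [zero_sub, abs_neg, abs_of_nonneg ht.1]] at h3 h4
  have h5 := dist_triangle (γ s) (η 0) (η t)
  have h6 := dist_triangle_left (η 0) (η t) (γ s)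
  have hinv : l⁻¹ ≤ 1 := inv_le_one_of_one_le₀ hl
  have h7 : l⁻¹ * (L - s) ≤ 1 * (L - s) := mul_le_mul_of_nonneg_right hinv (by linarith [hs.2])
  have h8 : 1 * (L - s) ≤ l * (L - s) := mul_le_mul_of_nonneg_right hl (by linarith [hs.2])
  have := hs.1
  constructor
  · rw [mul_add]; linarith
  · rw [mul_add]; linarith

/-- Adding a geodesic which ends at an approximately nearest point. -/
theorem IsQuasiGeodesicOn.join_nearest {γ η : ℝ → X} {L T l e κ : ℝ} (hl : 1 ≤ l) (he : 0 ≤ e)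
    (hκ : 0 ≤ κ) (hL : 0 ≤ L) (hT : 0 ≤ T) (h1 : GeodOn γ (Icc 0 L))
    (h2 : IsQuasiGeodesicOn l e η (Icc 0 T)) (hγ : γ L = η 0)
    (hnear : ∀ t ∈ Icc 0 T, dist (γ 0) (γ L) ≤ dist (γ 0) (η t) + κ) :
    IsQuasiGeodesicOn (2 * l + 1) (e + κ) (joinPath γ L η) (Icc 0 (L + T)) := by
  refine isQuasiGeodesicOn_joinPath hL hT
    (h1.isQuasiGeodesicOn.weaken le_rfl (by linarith) (by linarith))
    (h2.weaken hl (by linarith) (by linarith)) hγ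
    fun s hs t ht => ?_
  have hd : dist (γ s) (η 0) = L - s := by
    rw [← hγ, h1 s hs L ⟨hL, le_rfl⟩, abs_of_nonpos (by linarith [hs.2])]; ring
  have hd0 : dist (γ 0) (γ s) = s := by
    rw [h1 0 ⟨le_rfl, hL⟩ s hs, zero_sub, abs_neg, abs_of_nonneg hs.1]
  have hdL : dist (γ 0) (γ L) = L := by
    rw [h1 0 ⟨le_rfl, hL⟩ L ⟨hL, le_rfl⟩, zero_sub, abs_neg, abs_of_nonneg hL]
  -- With `d = dist (γ s) (η t)`, near-minimality gives `L - s ≤ d + κ`, hence `dist (η 0) (η t) ≤ 2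
  -- * d + κ` and `t ≤ l * (2 * d + κ + e)`. The two bounds add up to the factor `2 * l + 1`.
  have hn := hnear t ht
  have h3 := h2.abs_sub_le hl (s := 0) ⟨le_rfl, hT⟩ ht
  have h4 := (h2.2 0 ⟨le_rfl, hT⟩ t ht).2
  rw [show |0 - t| = t by rw [zero_sub, abs_neg, abs_of_nonneg ht.1]] at h3 h4
  have h5 := dist_triangle (γ s) (η 0) (η t)
  have h6 := dist_triangle_left (η 0) (η t) (γ s)
  have h7 := dist_triangle (γ 0) (γ s) (η t)
  have hs2 := hs.2
  have ht1 := ht.1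
  constructor
  · have h8 : l * (dist (η 0) (η t) + e) ≤ l * (2 * dist (γ s) (η t) + κ + e) :=
      mul_le_mul_of_nonneg_left (by linarith) (by linarith)
    have h9 : (2 * l + 1)⁻¹ * (L - s + t) ≤ dist (γ s) (η t) + (e + κ) := by
      rw [inv_mul_le_iff₀ (by linarith)]
      nlinarith [mul_nonneg (by linarith : (0 : ℝ) ≤ l) hκ, mul_nonneg (by linarith : (0 : ℝ) ≤ l) he]
    linarith
  · have h10 : l * t ≤ (2 * l + 1) * t := mul_le_mul_of_nonneg_right (by linarith) ht1
    have h11 : 1 * (L - s) ≤ (2 * l + 1) * (L - s) :=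
      mul_le_mul_of_nonneg_right (by linarith) (by linarith)
    rw [mul_add]; linarith

/-- A path which starts near `P`, ends near `Q` and stays near `P ∪ Q` has a point near both. -/
theorem exists_near_both {η : ℝ → X} {a b m : ℝ} (hab : a ≤ b) (hη : ContinuousOn η (Icc a b))
    {P Q : Set X} (ha : Near m P (η a)) (hb : Near m Q (η b))
    (h : ∀ t ∈ Icc a b, Near m P (η t) ∨ Near m Q (η t)) :
    ∃ t ∈ Icc a b, Near (m + 1) P (η t) ∧ Near (m + 1) Q (η t) := by
  have hP : P.Nonempty := by obtain ⟨x, hx, -⟩ := ha; exact ⟨x, hx⟩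
  have hQ : Q.Nonempty := by obtain ⟨x, hx, -⟩ := hb; exact ⟨x, hx⟩
  -- Distance functions turn the two alternatives into closed conditions on the interval, to which
  -- connectedness applies. The additional `1` pays for an infimum that need not be attained.
  have key : ∀ (S : Set X) t, Near m S (η t) → Metric.infDist (η t) S ≤ m := by
    rintro S t ⟨x, hx, hd⟩
    exact (Metric.infDist_le_dist_of_mem hx).trans hd
  have key' : ∀ (S : Set X), S.Nonempty → ∀ t, Metric.infDist (η t) S ≤ m →
      Near (m + 1) S (η t) := by
    intro S hS t ht
    obtain ⟨x, hx, hd⟩ := (Metric.infDist_lt_iff hS).1 (lt_of_le_of_lt ht (lt_add_one m))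
    exact ⟨x, hx, hd.le⟩
  have hc : ∀ S : Set X, ContinuousOn (fun t => Metric.infDist (η t) S) (Icc a b) := fun S =>
    (Metric.continuous_infDist_pt S).comp_continuousOn hη
  have hcl : ∀ S : Set X, ∃ F, IsClosed F ∧
      Icc a b ∩ (fun t => Metric.infDist (η t) S) ⁻¹' Iic m = Icc a b ∩ F := by
    intro S
    obtain ⟨F, hF, hF'⟩ := continuousOn_iff_isClosed.1 (hc S) (Iic m) isClosed_Iic
    exact ⟨F, hF, by rw [inter_comm, hF', inter_comm]⟩
  obtain ⟨F, hF, hF'⟩ := hcl P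
  obtain ⟨F', hF1, hF1'⟩ := hcl Q
  have h1 : ∀ t ∈ Icc a b, (Metric.infDist (η t) P ≤ m ↔ t ∈ F) := by
    intro t ht
    have := Set.ext_iff.1 hF' t
    simpa [ht.1, ht.2] using this
  have h2 : ∀ t ∈ Icc a b, (Metric.infDist (η t) Q ≤ m ↔ t ∈ F') := by
    intro t ht
    have := Set.ext_iff.1 hF1' t
    simpa [ht.1, ht.2] using this
  have ham : a ∈ Icc a b := ⟨le_rfl, hab⟩
  have hbm : b ∈ Icc a b := ⟨hab, le_rfl⟩
  obtain ⟨t, ht, htF, htF'⟩ := isPreconnected_closed_iff.1 isPreconnected_Icc F F' hF hF1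
    (fun t ht => (h t ht).imp (fun h => (h1 t ht).1 (key P t h))
      (fun h => (h2 t ht).1 (key Q t h)))
    ⟨a, ham, (h1 a ham).1 (key P a ha)⟩ ⟨b, hbm, (h2 b hbm).1 (key Q b hb)⟩
  exact ⟨t, ht, key' P hP t ((h1 t ht).2 htF), key' Q hQ t ((h2 t ht).2 htF')⟩

/-- A path between the two sides of a point `ρ s` of a geodesic, in a neighbourhood of the
geodesic, passes near `ρ s`. -/
theorem exists_near_of_crosses {η ρ : ℝ → X} {a b m s : ℝ} {J : Set ℝ} (hρ : GeodOn ρ J)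
    (hs : s ∈ J) (hab : a ≤ b)
    (hη : ContinuousOn η (Icc a b)) (ha : Near m (ρ '' (J ∩ Iic s)) (η a))
    (hb : Near m (ρ '' (J ∩ Ici s)) (η b)) (h : ∀ t ∈ Icc a b, Near m (ρ '' J) (η t)) :
    ∃ t ∈ Icc a b, dist (η t) (ρ s) ≤ 3 * m + 3 := by
  obtain ⟨t, ht, ⟨-, ⟨r, hr, rfl⟩, h1⟩, ⟨-, ⟨r', hr', rfl⟩, h2⟩⟩ :=
    exists_near_both hab hη ha hb (fun t ht => by
      obtain ⟨-, ⟨r, hr, rfl⟩, hd⟩ := h t ht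
      rcases le_total r s with hrs | hrs
      · exact Or.inl ⟨_, ⟨r, ⟨hr, hrs⟩, rfl⟩, hd⟩
      · exact Or.inr ⟨_, ⟨r, ⟨hr, hrs⟩, rfl⟩, hd⟩)
  -- Both `ρ r` and `ρ r'` are within `m + 1` of `η t` and `r ≤ s ≤ r'`, so `s - r ≤ 2 * m + 2`.
  refine ⟨t, ht, ?_⟩
  have h3 := dist_triangle_left (ρ r) (ρ r') (η t)
  rw [hρ r hr.1 r' hr'.1, abs_of_nonpos (by linarith [mem_Iic.1 hr.2, mem_Ici.1 hr'.2])] at h3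
  have h4 := dist_triangle (η t) (ρ r) (ρ s)
  rw [hρ r hr.1 s hs, abs_of_nonpos (by linarith [mem_Iic.1 hr.2])] at h4
  linarith [mem_Iic.1 hr.2, mem_Ici.1 hr'.2]

/-- An unbounded path from a point near the start of a geodesic ray in a neighbourhood of the ray
passes near every point of the ray. -/
theorem near_of_unbounded {η ρ : ℝ → X} {K : ℝ} (hρ : GeodOn ρ (Ici 0))
    (hη : ContinuousOn η (Ici 0)) (h0 : dist (η 0) (ρ 0) ≤ K)
    (hunb : ∀ R, ∃ t ∈ Ici (0 : ℝ), R ≤ dist (η t) (ρ 0))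
    (h : ∀ t ∈ Ici (0 : ℝ), Near K (ρ '' Ici 0) (η t)) :
    ∀ s ∈ Ici (0 : ℝ), Near (3 * K + 3) (η '' Ici 0) (ρ s) := by
  intro s hs
  have hs0 : (0 : ℝ) ≤ s := hs
  obtain ⟨b, hb, hbd⟩ := hunb (s + K + 1)
  obtain ⟨-, ⟨r, hr, rfl⟩, hd⟩ := h b hb
  have hr0 : (0 : ℝ) ≤ r := hr
  have hsr : s ≤ r := by
    have h1 := dist_triangle (η b) (ρ r) (ρ 0)
    rw [hρ r hr 0 (by simp), sub_zero, abs_of_nonneg hr0] at h1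
    linarith
  obtain ⟨t, ht, htd⟩ := exists_near_of_crosses hρ hs hb (hη.mono fun t ht => ht.1)
    ⟨_, ⟨0, ⟨by simp, hs0⟩, rfl⟩, h0⟩ ⟨_, ⟨r, ⟨hr, hsr⟩, rfl⟩, hd⟩ fun t ht => h t ht.1
  exact ⟨_, ⟨t, ht.1, rfl⟩, by rwa [dist_comm]⟩

end CoarseGeometry

/-! ### Morse gauges and Morse sets -/

namespace MorseGauge

/-- The value of a Morse gauge plus one, for real parameters. -/
noncomputable def bd (M : MorseGauge) (l e : ℝ) : ℝ :=
  M.toFun ⟨max 1 l, mem_Ici.2 (le_max_left _ _)⟩ e.toNNReal + 1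

theorem bd_pos (M : MorseGauge) (l e : ℝ) : 0 < M.bd l e := by
  unfold bd
  positivity

/-- The gauge of a set at Hausdorff distance at most `K` from an `M`-Morse set. -/
def shift (M : MorseGauge) (K : ℝ≥0) : MorseGauge where
  -- `4 * K` comes from extending a quasi-geodesic at both ends by geodesics of length at most `K`,
  -- `1` from replacing an infimum by a point, and the last `K` from the way back to the new set.
  toFun l e := M.toFun l (e + 4 * K) + 1 + K
  mono hl he := by
    gcongr
    exact M.mono hl (by gcongr)
  cont l := by
    have := M.cont l
    fun_prop

theorem shift_mono {M M' : MorseGauge} {K K' : ℝ≥0} (hM : M ≤ M') (hK : K ≤ K') :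
    M.shift K ≤ M'.shift K' := by
  intro l e
  change M.toFun l (e + 4 * K) + 1 + K ≤ M'.toFun l (e + 4 * K') + 1 + K'
  have h1 : M.toFun l (e + 4 * K) ≤ M'.toFun l (e + 4 * K) := hM l _
  have h2 : M'.toFun l (e + 4 * K) ≤ M'.toFun l (e + 4 * K') := M'.mono le_rfl (by gcongr)
  exact add_le_add (add_le_add (h1.trans h2) le_rfl) hK

/-- The gauge of a subsegment bounded at one side of an `M`-Morse geodesic. -/
def half (M : MorseGauge) : MorseGauge where
  -- With `m = M.toFun l e + 1`, the bound of `exists_near_of_crosses` is `3 * m + 3 = 3 * M.toFun l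
  -- e + 6`; it enters once directly and once doubled.
  toFun l e := l.1.toNNReal * (l.1.toNNReal * (6 * M.toFun l e + 12 + e)) + e +
    (3 * M.toFun l e + 6)
  mono {l l' e e'} hl he := by
    have h1 : l.1.toNNReal ≤ l'.1.toNNReal := Real.toNNReal_le_toNNReal hl
    have h2 := M.mono hl he
    gcongr
  cont l := by
    have := M.cont l
    fun_prop

theorem half_mono {M M' : MorseGauge} (hM : M ≤ M') : M.half ≤ M'.half := by
  intro l e
  have h1 : M.toFun l e ≤ M'.toFun l e := hM l e
  change l.1.toNNReal * (l.1.toNNReal * (6 * M.toFun l e + 12 + e)) + e + (3 * M.toFun l e + 6) ≤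
    l.1.toNNReal * (l.1.toNNReal * (6 * M'.toFun l e + 12 + e)) + e + (3 * M'.toFun l e + 6)
  gcongr

/-- The sum of two Morse gauges. -/
def add (M M' : MorseGauge) : MorseGauge where
  toFun l e := M.toFun l e + M'.toFun l e
  mono hl he := add_le_add (M.mono hl he) (M'.mono hl he)
  cont l := (M.cont l).add (M'.cont l)

theorem le_add_left (M M' : MorseGauge) : M ≤ M.add M' := fun _ _ => le_self_add

theorem le_add_right (M M' : MorseGauge) : M' ≤ M.add M' := fun _ _ => le_add_self

theorem add_mono {M M' N N' : MorseGauge} (h : M ≤ M') (h' : N ≤ N') : M.add N ≤ M'.add N' :=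
  fun l e => add_le_add (h l e) (h' l e)

/-- Change of the quasi-geodesic constants in a Morse gauge. -/
def comp (M : MorseGauge) (C : ℝ≥0) : MorseGauge where
  toFun l e := C * M.toFun ⟨max 1 (C * l), mem_Ici.2 (le_max_left _ _)⟩ (e + 1) + C * 2
  mono {l l' e e'} hl he := by
    gcongr
    refine M.mono ?_ (by gcongr)
    exact max_le_max le_rfl (mul_le_mul_of_nonneg_left (show (l : ℝ) ≤ l' from hl) C.2)
  cont l := by
    have := M.cont ⟨max 1 (C * l), mem_Ici.2 (le_max_left _ _)⟩
    fun_prop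

end MorseGauge

section MorseSets

variable {X : Type*} [MetricSpace X]

theorem IsMorseSet.mono {M M' : MorseGauge} {A : Set X} (h : IsMorseSet M A) (hM : M ≤ M') :
    IsMorseSet M' A := fun l e T η hT hη h0 h1 =>
  (h l e T η hT hη h0 h1).trans (Metric.cthickening_mono (by exact_mod_cast hM l e) A)

theorem isMorseSet_of_near {M : MorseGauge} {A : Set X}
    (h : ∀ (l : Set.Ici (1 : ℝ)) (e : ℝ≥0) (T : ℝ) (η : ℝ → X), 0 ≤ T →
      IsQuasiGeodesicOn (l : ℝ) (e : ℝ) η (Icc 0 T) → η 0 ∈ A → η T ∈ A →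
      ∀ t ∈ Icc 0 T, Near (M.toFun l e : ℝ) A (η t)) : IsMorseSet M A := by
  rintro l e T η hT hη h0 h1 _ ⟨t, ht, rfl⟩
  obtain ⟨a, ha, hd⟩ := h l e T η hT hη h0 h1 t ht
  exact Metric.mem_cthickening_of_dist_le _ a _ A ha hd

/-- A closed neighbourhood is defined by an infimum of distances; enlarging the radius by one yields
an actual point of `A`. -/
theorem IsMorseSet.near_val {M : MorseGauge} {A : Set X} (h : IsMorseSet M A)
    {l : Set.Ici (1 : ℝ)} {e : ℝ≥0} {T : ℝ} {η : ℝ → X} (hT : 0 ≤ T)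
    (hη : IsQuasiGeodesicOn (l : ℝ) (e : ℝ) η (Icc 0 T)) (h0 : η 0 ∈ A) (h1 : η T ∈ A) {t : ℝ}
    (ht : t ∈ Icc 0 T) : Near (M.toFun l e + 1 : ℝ) A (η t) := by
  have h2 := Metric.cthickening_subset_thickening' (by positivity)
    (lt_add_one (M.toFun l e : ℝ)) A (h l e T η hT hη h0 h1 ⟨t, ht, rfl⟩)
  obtain ⟨z, hz, hd⟩ := Metric.mem_thickening_iff.1 h2
  exact ⟨z, hz, hd.le⟩

theorem IsMorseSet.near {M : MorseGauge} {A : Set X} (h : IsMorseSet M A) {l e T : ℝ} (hl : 1 ≤ l)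
    (he : 0 ≤ e) {η : ℝ → X} (hT : 0 ≤ T) (hη : IsQuasiGeodesicOn l e η (Icc 0 T)) (h0 : η 0 ∈ A)
    (h1 : η T ∈ A) {t : ℝ} (ht : t ∈ Icc 0 T) : Near (M.bd l e) A (η t) := by
  refine h.near_val (l := ⟨max 1 l, mem_Ici.2 (le_max_left _ _)⟩) (e := e.toNNReal) hT ?_ h0 h1 ht
  simpa [max_eq_right hl, Real.coe_toNNReal e he] using hη

/-- Extending a quasi-geodesic by short geodesics at both ends. -/
theorem exists_extension [GeodesicSpace X] {l e K T : ℝ} (hl : 1 ≤ l) (he : 0 ≤ e)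
    (hT : 0 ≤ T) {η : ℝ → X} (hη : IsQuasiGeodesicOn l e η (Icc 0 T)) {x y : X}
    (hx : dist x (η 0) ≤ K) (hy : dist (η T) y ≤ K) :
    ∃ T' η', 0 ≤ T' ∧ IsQuasiGeodesicOn l (e + 4 * K) η' (Icc 0 T') ∧ η' 0 = x ∧ η' T' = y ∧
      η '' Icc 0 T ⊆ η' '' Icc 0 T' := by
  obtain ⟨γ, hγ⟩ := GeodesicSpace.exists_geodesic x (η 0)
  obtain ⟨σ, hσ⟩ := GeodesicSpace.exists_geodesic y (η T)
  have hK : 0 ≤ K := dist_nonneg.trans hx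
  rw [dist_comm] at hy
  -- One geodesic is added at the start, the path is reversed, the other geodesic is added, and the
  -- path is reversed again; each addition costs `2 * K`.
  have h1 := hη.join_short hl he dist_nonneg hx hT hγ.geodOn hγ.2.1
  have hL : 0 ≤ dist x (η 0) + T := by positivity
  have hend : joinPath γ (dist x (η 0)) η (dist x (η 0) + T) = η T := by
    rw [joinPath_of_ge hγ.2.1 (by linarith)]
    congr 1; ring
  have h2 := h1.reverse.join_short hl (by linarith) dist_nonneg hy hL hσ.geodOn
    (by rw [hσ.2.1, sub_zero, hend])
  have h3 := h2.reverse
  have hL' : 0 ≤ dist y (η T) + (dist x (η 0) + T) := by positivity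
  refine ⟨_, _, hL', by convert h3 using 1; ring, ?_, ?_, ?_⟩
  · simp only [sub_zero]
    rw [joinPath_of_ge (by rw [hσ.2.1, sub_zero, hend]) (by linarith)]
    rw [show dist x (η 0) + T - (dist y (η T) + (dist x (η 0) + T) - dist y (η T)) = 0 by ring,
      joinPath_of_le dist_nonneg, hγ.1]
  · simp only [sub_self]
    rw [joinPath_of_le dist_nonneg, hσ.1]
  · rintro _ ⟨t, ht, rfl⟩
    have hd : 0 ≤ dist x (η 0) := dist_nonneg
    have hd' : 0 ≤ dist y (η T) := dist_nonneg
    refine ⟨dist x (η 0) + t, ⟨by linarith [ht.1], by linarith [ht.2]⟩, ?_⟩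
    simp only
    rw [joinPath_of_ge (by rw [hσ.2.1, sub_zero, hend]) (by linarith [ht.2])]
    rw [joinPath_of_ge hγ.2.1 (by linarith [ht.1])]
    congr 1; ring

/-- Sets at finite Hausdorff distance from Morse sets are Morse. -/
theorem IsMorseSet.transfer [GeodesicSpace X] {M : MorseGauge} {A B : Set X}
    (h : IsMorseSet M A) {K : ℝ≥0} (hB : ∀ b ∈ B, Near K A b) (hA : ∀ a ∈ A, Near K B a) :
    IsMorseSet (M.shift K) B := by
  refine isMorseSet_of_near fun l e T η hT hη h0 h1 t ht => ?_
  obtain ⟨x, hx, hx'⟩ := hB _ h0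
  obtain ⟨y, hy, hy'⟩ := hB _ h1
  obtain ⟨T', η', hT', hη', h0', h1', hsub⟩ := exists_extension l.2 e.2 hT hη
    (by rwa [dist_comm] at hx') hy'
  obtain ⟨t', ht', htt⟩ := hsub ⟨t, ht, rfl⟩
  rw [← htt]
  have h2 : IsQuasiGeodesicOn (l : ℝ) ((e + 4 * K : ℝ≥0) : ℝ) η' (Icc 0 T') := by
    simpa using hη'
  have h3 := h.near_val hT' h2 (h0'.symm ▸ hx) (h1'.symm ▸ hy) ht'
  refine (h3.trans hA).mono (le_of_eq ?_) subset_rfl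
  simp [MorseGauge.shift]

/-- A quasi-geodesic with endpoints on the part after `s` may stray to a point `η u` near the part
before `s`. It then passes near `ρ s` at a time `u₁ ≤ u` and at a time `u₂ ≥ u`. As `η u₁` and `η
u₂` are close, so are the times, and `η u` is near `ρ s`. -/
theorem IsMorseSet.of_ge {M : MorseGauge} {ρ : ℝ → X} {J : Set ℝ} (hρ : GeodOn ρ J)
    (h : IsMorseSet M (ρ '' J)) {s : ℝ} (hs : s ∈ J) : IsMorseSet M.half (ρ '' (J ∩ Ici s)) := by
  refine isMorseSet_of_near fun l e T η hT hη h0 h1 u hu => ?_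
  have hsub : ρ '' (J ∩ Ici s) ⊆ ρ '' J := image_mono inter_subset_left
  set m : ℝ := M.toFun l e + 1 with hm
  have hm0 : 0 ≤ m := by positivity
  have hl : (1 : ℝ) ≤ l := l.2
  have hnear : ∀ t ∈ Icc 0 T, Near m (ρ '' J) (η t) := fun t ht =>
    h.near_val hT hη (hsub h0) (hsub h1) ht
  have hval : (M.half.toFun l e : ℝ) = l * (l * (2 * (3 * m + 3) + e)) + e + (3 * m + 3) := by
    have : (l : ℝ).toNNReal = (l : ℝ) := Real.coe_toNNReal _ (by linarith)
    simp only [MorseGauge.half, NNReal.coe_add, NNReal.coe_mul, this, hm]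
    push_cast
    ring
  obtain ⟨-, ⟨r, hr, rfl⟩, hd⟩ := hnear u hu
  rcases le_total s r with hsr | hrs
  · refine ⟨_, ⟨r, ⟨hr, hsr⟩, rfl⟩, hd.trans ?_⟩
    rw [hval]
    have : (0 : ℝ) ≤ e := e.2
    have : (0 : ℝ) ≤ l * (l * (2 * (3 * m + 3) + e)) := by positivity
    linarith
  obtain ⟨u₁, hu₁, hd₁⟩ : ∃ t ∈ Icc 0 u, dist (η t) (ρ s) ≤ 3 * m + 3 := by
    have hrev : ContinuousOn (fun t => η (u - t)) (Icc 0 u) :=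
      hη.1.comp (by fun_prop) fun t ht => ⟨by linarith [ht.2], by linarith [ht.1, hu.2]⟩
    obtain ⟨t, ht, htd⟩ := exists_near_of_crosses (m := m) hρ hs hu.1 hrev
      (show Near m _ (η (u - 0)) from ⟨ρ r, ⟨r, ⟨hr, hrs⟩, rfl⟩, by simpa using hd⟩)
      ((near_self (by simpa using h0)).mono hm0 subset_rfl)
      fun t ht => hnear _ ⟨by linarith [ht.2], by linarith [ht.1, hu.2]⟩
    exact ⟨u - t, ⟨by linarith [ht.2], by linarith [ht.1]⟩, htd⟩
  obtain ⟨u₂, hu₂, hd₂⟩ : ∃ t ∈ Icc u T, dist (η t) (ρ s) ≤ 3 * m + 3 :=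
    exists_near_of_crosses (m := m) hρ hs hu.2 (hη.1.mono fun t ht => ⟨hu.1.trans ht.1, ht.2⟩)
      ⟨_, ⟨r, ⟨hr, hrs⟩, rfl⟩, hd⟩ ((near_self h1).mono hm0 subset_rfl)
      fun t ht => hnear _ ⟨hu.1.trans ht.1, ht.2⟩
  refine ⟨ρ s, ⟨s, ⟨hs, self_mem_Ici⟩, rfl⟩, ?_⟩
  have hm1 : u₁ ∈ Icc 0 T := ⟨hu₁.1, hu₁.2.trans hu.2⟩
  have hm2 : u₂ ∈ Icc 0 T := ⟨hu.1.trans hu₂.1, hu₂.2⟩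
  have h3 := hη.abs_sub_le hl hm1 hm2
  have h4 := dist_triangle_right (η u₁) (η u₂) (ρ s)
  have h5 := (hη.2 u hu u₁ hm1).2
  have h6 : |u - u₁| ≤ |u₁ - u₂| := by
    rw [abs_of_nonneg (by linarith [hu₁.2]), abs_of_nonpos (by linarith [hu₁.2, hu₂.1])]
    linarith [hu₂.1]
  have h7 := dist_triangle (η u) (η u₁) (ρ s)
  have h8 : (l : ℝ) * (dist (η u₁) (η u₂) + e) ≤ l * (2 * (3 * m + 3) + e) :=
    mul_le_mul_of_nonneg_left (by linarith) (by linarith)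
  have h9 : (l : ℝ) * |u - u₁| ≤ l * (l * (2 * (3 * m + 3) + e)) :=
    mul_le_mul_of_nonneg_left (by linarith) (by linarith)
  rw [hval]
  linarith

theorem IsMorseSet.of_le {M : MorseGauge} {ρ : ℝ → X} {J : Set ℝ} (hρ : GeodOn ρ J)
    (h : IsMorseSet M (ρ '' J)) {s : ℝ} (hs : s ∈ J) : IsMorseSet M.half (ρ '' (J ∩ Iic s)) := by
  have himg : ∀ K : Set ℝ, (fun t => ρ (-t)) '' ((fun t => -t) '' K) = ρ '' K := by
    intro K
    rw [image_image]
    simp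
  have hg : GeodOn (fun t => ρ (-t)) ((fun t => -t) '' J) := by
    rintro _ ⟨a, ha, rfl⟩ _ ⟨b, hb, rfl⟩
    simp only [neg_neg]
    rw [hρ a ha b hb, ← abs_neg]
    congr 1; ring
  have := IsMorseSet.of_ge hg (by rwa [himg]) (s := -s) ⟨s, hs, rfl⟩
  rwa [show (fun t : ℝ => -t) '' J ∩ Ici (-s) = (fun t => -t) '' (J ∩ Iic s) by
    ext t
    constructor
    · rintro ⟨⟨a, ha, rfl⟩, h2⟩
      exact ⟨a, ⟨ha, by simpa using h2⟩, rfl⟩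
    · rintro ⟨a, ⟨ha, h2⟩, rfl⟩
      exact ⟨⟨a, ha, rfl⟩, by simpa using h2⟩, himg] at this

/-- A subsegment of a Morse geodesic is Morse. -/
theorem IsMorseSet.of_Icc {M : MorseGauge} {ρ : ℝ → X} {J : Set ℝ} [hJ : J.OrdConnected]
    (hρ : GeodOn ρ J) (h : IsMorseSet M (ρ '' J)) {s t : ℝ} (hs : s ∈ J) (ht : t ∈ J)
    (hst : s ≤ t) : IsMorseSet M.half.half (ρ '' Icc s t) := by
  have h1 := IsMorseSet.of_le (hρ.mono inter_subset_left) (IsMorseSet.of_ge hρ h hs)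
    (s := t) ⟨ht, hst⟩
  rwa [show J ∩ Ici s ∩ Iic t = Icc s t by
    ext r
    constructor
    · rintro ⟨⟨-, h2⟩, h3⟩
      exact ⟨h2, h3⟩
    · exact fun h2 => ⟨⟨hJ.out hs ht h2, h2.1⟩, h2.2⟩] at h1

/-- A geodesic with endpoints near a Morse geodesic is close to the subsegment between these. -/
theorem near_of_endpoints_near [GeodesicSpace X] (M : MorseGauge) (K : ℝ) :
    ∃ K' : ℝ≥0, ∀ {ρ : ℝ → X} {J : Set ℝ} [J.OrdConnected], GeodOn ρ J → IsMorseSet M (ρ '' J) →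
      ∀ {x y : X} {σ : ℝ → X} {s t : ℝ}, IsGeodesicSegment σ x y → s ∈ J → t ∈ J →
      s ≤ t → dist x (ρ s) ≤ K → dist y (ρ t) ≤ K →
      (∀ p ∈ segImage σ x y, Near K' (ρ '' Icc s t) p) ∧
      ∀ p ∈ ρ '' Icc s t, Near K' (segImage σ x y) p := by
  set m := M.bd 1 (4 * K) with hm
  have hmpos : 0 < m := M.bd_pos _ _
  refine ⟨(5 * m + 5 * |K| + 5 * |K|).toNNReal, fun {ρ J} hJ hρ hM {x y σ s t} hσ hs ht hst hx hy => ?_⟩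
  have hK : 0 ≤ K := dist_nonneg.trans hx
  rw [Real.coe_toNNReal _ (by positivity), abs_of_nonneg hK]
  have hxy := dist_triangle4 x (ρ s) (ρ t) y
  have hxy' := dist_triangle4 (ρ s) x y (ρ t)
  rw [hρ s hs t ht, abs_of_nonpos (by linarith), dist_comm (ρ t) y] at hxy
  rw [hρ s hs t ht, abs_of_nonpos (by linarith), dist_comm (ρ s) x] at hxy'
  have hnear : ∀ u ∈ Icc 0 (dist x y), ∃ r ∈ Icc s t, dist (σ u) (ρ r) ≤ 2 * m + 3 * K := by
    intro u hu
    obtain ⟨T', η', hT', hη', h0', h1', hsub⟩ := exists_extension (x := ρ s) (y := ρ t) (K := K)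
      le_rfl le_rfl dist_nonneg
      hσ.geodOn.isQuasiGeodesicOn (by rwa [hσ.1, dist_comm]) (by rwa [hσ.2.1])
    obtain ⟨u', hu', huu⟩ := hsub ⟨u, hu, rfl⟩
    rw [zero_add] at hη'
    obtain ⟨-, ⟨r, hr, rfl⟩, hd⟩ := hM.near le_rfl (by linarith) hT' hη' ⟨s, hs, h0'.symm⟩
      ⟨t, ht, h1'.symm⟩ hu'
    rw [huu] at hd
    have e1 : dist (σ u) x = u := by
      rw [← hσ.1, hσ.geodOn u hu 0 ⟨le_rfl, dist_nonneg⟩, sub_zero, abs_of_nonneg hu.1]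
    have e2 : dist (σ u) y = dist x y - u := by
      conv_lhs => rw [← hσ.2.1]
      rw [hσ.geodOn u hu _ ⟨dist_nonneg, le_rfl⟩, abs_of_nonpos (by linarith [hu.2])]; ring
    have d1 := dist_triangle4 (ρ r) (σ u) x (ρ s)
    have d2 := dist_triangle4 (ρ r) (σ u) y (ρ t)
    rw [dist_comm (ρ r) (σ u), hρ r hr s hs] at d1
    rw [dist_comm (ρ r) (σ u), hρ r hr t ht] at d2
    -- If `r` lies outside `[s, t]`, the sum of the two triangle inequalities bounds the overshoot
    -- by `m + 2 * K`, and the endpoint `ρ s` or `ρ t` serves instead.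
    rcases lt_or_ge r s with hrs | hrs
    · rw [abs_of_nonpos (by linarith)] at d1 d2
      refine ⟨s, ⟨le_rfl, hst⟩, ?_⟩
      have := dist_triangle (σ u) (ρ r) (ρ s)
      rw [hρ r hr s hs, abs_of_nonpos (by linarith)] at this
      linarith
    rcases lt_or_ge t r with htr | htr
    · rw [abs_of_nonneg (by linarith)] at d1 d2
      refine ⟨t, ⟨hst, le_rfl⟩, ?_⟩
      have := dist_triangle (σ u) (ρ r) (ρ t)
      rw [hρ r hr t ht, abs_of_nonneg (by linarith)] at this
      linarith
    · exact ⟨r, ⟨hrs, htr⟩, by linarith⟩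
  constructor
  · rintro _ ⟨u, hu, rfl⟩
    obtain ⟨r, hr, hd⟩ := hnear u hu
    exact ⟨_, ⟨r, hr, rfl⟩, by linarith⟩
  · rintro _ ⟨r, hr, rfl⟩
    have hrJ : r ∈ J := hJ.out hs ht hr
    -- The two geodesics match by arc length up to a bounded error: `ρ r` is compared with `σ (r -
    -- s)`, or with `y` if `σ` is too short.
    rcases le_total (r - s) (dist x y) with hle | hle
    · have hu : r - s ∈ Icc 0 (dist x y) := ⟨by linarith [hr.1], hle⟩
      refine ⟨_, ⟨r - s, hu, rfl⟩, ?_⟩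
      obtain ⟨r', hr', hd⟩ := hnear _ hu
      have hrJ' : r' ∈ J := hJ.out hs ht hr'
      have e1 : dist (σ (r - s)) x = r - s := by
        rw [← hσ.1, hσ.geodOn _ hu 0 ⟨le_rfl, dist_nonneg⟩, sub_zero, abs_of_nonneg hu.1]
      have d1 := dist_triangle4 (ρ r') (σ (r - s)) x (ρ s)
      have d2 := dist_triangle4 x (ρ s) (ρ r') (σ (r - s))
      rw [hρ r' hrJ' s hs, dist_comm (ρ r'), e1, abs_of_nonneg (by linarith [hr'.1])] at d1
      rw [hρ s hs r' hrJ', dist_comm x (σ _), dist_comm (ρ r') (σ (r - s)), e1, abs_of_nonpos (by linarith [hr'.1])] at d2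
      have d3 : |r - r'| ≤ 2 * m + 4 * K := abs_le.2 ⟨by linarith, by linarith⟩
      have d4 := dist_triangle (ρ r) (ρ r') (σ (r - s))
      rw [hρ r hrJ r' hrJ', dist_comm (ρ r') (σ _)] at d4
      linarith
    · refine ⟨y, ⟨dist x y, ⟨dist_nonneg, le_rfl⟩, hσ.2.1⟩, ?_⟩
      have d1 := dist_triangle (ρ r) (ρ t) y
      rw [hρ r hrJ t ht, abs_of_nonpos (by linarith [hr.2]), dist_comm (ρ t)] at d1
      linarith [hr.2]

end MorseSets

/-! ### Limit rays, Morse rays, and criteria for quasi-geodesics -/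

section Rays

variable {X : Type*} [MetricSpace X]

/-- Longer and longer geodesics from a point of a proper space subconverge to a ray. -/
theorem exists_ray_limit [ProperSpace X] {a : X} {γ : ℕ → ℝ → X} {L : ℕ → ℝ}
    (hL : Tendsto L atTop atTop) (h0 : ∀ n, γ n 0 = a) (hγ : ∀ n, GeodOn (γ n) (Icc 0 (L n))) :
    ∃ ρ : ℝ → X, ρ 0 = a ∧ IsGeodesicRay ρ ∧ ∀ (K : ℝ) (A : Set X),
      (∀ n, ∀ t ∈ Icc 0 (L n), Near K A (γ n t)) → ∀ t ∈ Ici (0 : ℝ), Near (K + 1) A (ρ t) := by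
  -- Pointwise limits along an ultrafilter exist because closed balls are compact, so no diagonal
  -- subsequence is needed.
  let ω : Ultrafilter ℕ := hyperfilter ℕ
  have hω : (ω : Filter ℕ) ≤ atTop := Nat.hyperfilter_le_atTop
  have hev : ∀ t : ℝ, ∀ᶠ n in (ω : Filter ℕ), t ≤ L n := fun t =>
    hω (hL.eventually_ge_atTop t)
  have hlim : ∀ t ∈ Ici (0 : ℝ), ∃ x, Tendsto (fun n => γ n t) ω (𝓝 x) := by
    intro t ht
    obtain ⟨x, -, hx⟩ := (isCompact_closedBall a t).ultrafilter_le_nhds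
      (ω.map fun n => γ n t) (le_principal_iff.2 (Ultrafilter.mem_map.2 (by
        filter_upwards [hev t] with n hn
        rw [mem_preimage, Metric.mem_closedBall, ← h0 n, hγ n t ⟨ht, hn⟩ 0 ⟨le_rfl, le_trans ht hn⟩,
          sub_zero, abs_of_nonneg ht])))
    exact ⟨x, hx⟩
  have : Nonempty X := ⟨a⟩
  choose! ρ hρ using hlim
  refine ⟨ρ, ?_, ?_, ?_⟩
  · refine tendsto_nhds_unique (hρ 0 self_mem_Ici) ?_
    simp only [h0]
    exact tendsto_const_nhds
  · intro s hs t ht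
    refine tendsto_nhds_unique ((hρ s hs).dist (hρ t ht)) (tendsto_const_nhds.congr' ?_)
    filter_upwards [hev s, hev t] with n hn hn'
    rw [hγ n s ⟨hs, hn⟩ t ⟨ht, hn'⟩]
  · intro K A hA t ht
    obtain ⟨n, hn, hn'⟩ := ((hev t).and ((Metric.tendsto_nhds.1 (hρ t ht)) 1 one_pos)).exists
    rw [dist_comm] at hn'
    refine ((hA n t ⟨ht, hn⟩).trans_dist hn'.le).mono ?_ subset_rfl
    linarith

/-- A Morse quasi-geodesic ray is close to a geodesic ray. -/
theorem exists_geodesicRay [ProperSpace X] [GeodesicSpace X] (M : MorseGauge) (C K : ℝ)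
    (hC : 1 ≤ C) : ∃ K' : ℝ≥0, ∀ {q : ℝ → X}, IsQuasiGeodesicOn C C q (Ici 0) →
      IsMorseSet M (rayImage q) → ∀ a, dist a (q 0) ≤ K → ∃ ρ : ℝ → X, ρ 0 = a ∧
      IsGeodesicRay ρ ∧ (∀ p ∈ rayImage ρ, Near K' (rayImage q) p) ∧
      ∀ p ∈ rayImage q, Near K' (rayImage ρ) p := by
  set m := M.bd 1 (4 * K) + 1 + |K| with hm
  have hm0 : 0 < M.bd 1 (4 * K) := M.bd_pos _ _
  refine ⟨(C * (C * (2 * m + 2 + C)) + C + m + 1).toNNReal, fun {q} hq hM a ha => ?_⟩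
  have hK : 0 ≤ K := dist_nonneg.trans ha
  have hmpos : 0 < m := by positivity
  rw [Real.coe_toNNReal _ (by positivity)]
  rw [abs_of_nonneg hK] at hm
  choose γ hγ using fun n : ℕ => GeodesicSpace.exists_geodesic a (q n)
  have hq0 : ∀ n : ℕ, C⁻¹ * n - C - K ≤ dist a (q n) := by
    intro n
    have h1 := (hq.2 n (mem_Ici.2 n.cast_nonneg) 0 self_mem_Ici).1
    rw [sub_zero, abs_of_nonneg n.cast_nonneg] at h1
    have := dist_triangle_left (q n) (q 0) a
    linarith
  have hL : Tendsto (fun n : ℕ => dist a (q n)) atTop atTop := by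
    refine tendsto_atTop_mono hq0 ?_
    have : Tendsto (fun n : ℕ => C⁻¹ * (n : ℝ)) atTop atTop :=
      tendsto_natCast_atTop_atTop.const_mul_atTop (by positivity)
    simpa [sub_eq_add_neg, add_assoc] using tendsto_atTop_add_const_right _ (-C + -K) this
  -- The geodesics from `a` to `q n`, extended to start at `q 0`, have endpoints on the Morse set;
  -- they and their limit therefore stay near the image of `q`.
  obtain ⟨ρ, hρ0, hρ, hlim⟩ := exists_ray_limit hL (fun n => (hγ n).1) (fun n => (hγ n).geodOn)
  have hρq : ∀ t ∈ Ici (0 : ℝ), Near m (rayImage q) (ρ t) := by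
    have := hlim (M.bd 1 (4 * K)) (rayImage q) fun n t ht => by
      obtain ⟨T', η', hT', hη', h0', h1', hsub⟩ := exists_extension (x := q 0) (y := q n) (K := K)
        le_rfl le_rfl dist_nonneg (hγ n).geodOn.isQuasiGeodesicOn
        (by rwa [(hγ n).1, dist_comm]) (by rw [(hγ n).2.1, dist_self]; exact hK)
      obtain ⟨u', hu', huu⟩ := hsub ⟨t, ht, rfl⟩
      rw [zero_add] at hη'
      rw [← huu]
      exact hM.near le_rfl (by linarith) hT' hη' ⟨0, self_mem_Ici, h0'.symm⟩
        ⟨n, mem_Ici.2 n.cast_nonneg, h1'.symm⟩ hu'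
    exact fun t ht => (this t ht).mono (by linarith) subset_rfl
  refine ⟨ρ, hρ0, hρ, ?_, ?_⟩
  · rintro _ ⟨t, ht, rfl⟩
    refine (hρq t ht).mono ?_ subset_rfl
    have : 0 ≤ C * (C * (2 * m + 2 + C)) := by positivity
    linarith
  · rintro _ ⟨u, hu, rfl⟩
    have hu0 : (0 : ℝ) ≤ u := hu
    -- At this time the ray is too far from its start to be near `q '' Icc 0 u`. On the way some `ρ
    -- t` is near both `q v₁` and `q v₂` with `v₁ ≤ u ≤ v₂`; then `v₂ - v₁` is bounded and `q u` is
    -- near `ρ t`.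
    have hb0 : 0 ≤ m + (C * u + C) + K + 1 := by positivity
    obtain ⟨t, ht, ⟨-, ⟨v₁, hv₁, rfl⟩, hd₁⟩, ⟨-, ⟨v₂, hv₂, rfl⟩, hd₂⟩⟩ :=
      exists_near_both (η := ρ) (P := q '' Icc 0 u) (Q := q '' Ici u) (m := m) hb0
        (GeodOn.continuousOn (GeodOn.mono hρ fun t ht => ht.1))
        ⟨q 0, ⟨0, ⟨le_rfl, hu0⟩, rfl⟩, by rw [hρ0]; linarith⟩ (by
          obtain ⟨-, ⟨v, hv, rfl⟩, hd⟩ := hρq _ hb0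
          have hv0 : (0 : ℝ) ≤ v := hv
          refine ⟨_, ⟨v, ?_, rfl⟩, hd⟩
          by_contra hvu
          rw [mem_Ici, not_le] at hvu
          have h1 := dist_triangle4 (ρ 0) (q 0) (q v) (ρ (m + (C * u + C) + K + 1))
          have h2 := (hq.2 0 self_mem_Ici v hv).2
          rw [zero_sub, abs_neg, abs_of_nonneg hv0] at h2
          rw [hρ 0 self_mem_Ici _ hb0, hρ0, zero_sub, abs_neg, abs_of_nonneg hb0,
            dist_comm (q v)] at h1
          have h3 : C * v ≤ C * u := mul_le_mul_of_nonneg_left hvu.le (by linarith)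
          linarith) (by
          intro t ht
          obtain ⟨-, ⟨v, hv, rfl⟩, hd⟩ := hρq t ht.1
          rcases le_total v u with hvu | hvu
          · exact Or.inl ⟨_, ⟨v, ⟨hv, hvu⟩, rfl⟩, hd⟩
          · exact Or.inr ⟨_, ⟨v, hvu, rfl⟩, hd⟩)
    refine ⟨ρ t, ⟨t, ht.1, rfl⟩, ?_⟩
    have hv₂' : v₂ ∈ Ici (0 : ℝ) := hu0.trans hv₂
    have h1 := hq.abs_sub_le hC hv₁.1 hv₂'
    have h2 := dist_triangle_left (q v₁) (q v₂) (ρ t)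
    have h3 := (hq.2 u hu v₁ hv₁.1).2
    have h4 : |u - v₁| ≤ |v₁ - v₂| := by
      rw [abs_of_nonneg (by linarith [hv₁.2]), abs_of_nonpos (by linarith [hv₁.2, mem_Ici.1 hv₂])]
      linarith [mem_Ici.1 hv₂]
    have h5 := dist_triangle_right (q u) (ρ t) (q v₁)
    have h6 : C * (dist (q v₁) (q v₂) + C) ≤ C * (2 * m + 2 + C) :=
      mul_le_mul_of_nonneg_left (by linarith) (by linarith)
    have h7 : C * |u - v₁| ≤ C * (C * (2 * m + 2 + C)) :=
      mul_le_mul_of_nonneg_left (by linarith) (by linarith)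
    linarith

theorem FiniteHausdorff.exists_near {A B : Set X} (h : FiniteHausdorff A B) :
    ∃ R : ℝ≥0, (∀ a ∈ A, Near R B a) ∧ ∀ b ∈ B, Near R A b := by
  have hlt : Metric.hausdorffEDist A B < Metric.hausdorffEDist A B + 1 :=
    ENNReal.lt_add_right h one_ne_zero
  have key : ∀ {A B : Set X} (r : ℝ≥0), Metric.hausdorffEDist A B < r →
      ∀ a ∈ A, Near r B a := by
    intro A B r hr a ha
    obtain ⟨b, hb, hd⟩ := Metric.exists_edist_lt_of_hausdorffEDist_lt ha hr
    exact ⟨b, hb, by rw [dist_nndist]; rw [edist_nndist] at hd; exact_mod_cast hd.le⟩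
  obtain ⟨r, hr⟩ : ∃ r : ℝ≥0, Metric.hausdorffEDist A B + 1 = r :=
    ⟨_, (ENNReal.coe_toNNReal (ENNReal.add_ne_top.2 ⟨h, ENNReal.one_ne_top⟩)).symm⟩
  rw [hr] at hlt
  exact ⟨r, key r hlt, key r (by rwa [Metric.hausdorffEDist_comm])⟩

theorem finiteHausdorff_of_near {A B : Set X} {R : ℝ} (h : ∀ a ∈ A, Near R B a)
    (h' : ∀ b ∈ B, Near R A b) : FiniteHausdorff A B := by
  have key : ∀ {x : X} {S : Set X}, Near R S x → ∃ y ∈ S, edist x y ≤ ENNReal.ofReal R := by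
    rintro x S ⟨y, hy, hd⟩
    exact ⟨y, hy, by rw [edist_dist]; exact ENNReal.ofReal_le_ofReal hd⟩
  exact ne_top_of_le_ne_top (ENNReal.ofReal_ne_top (r := R))
    (Metric.hausdorffEDist_le_of_mem_edist (fun a ha => key (h a ha)) fun b hb => key (h' b hb))

theorem FiniteHausdorff.symm {A B : Set X} (h : FiniteHausdorff A B) : FiniteHausdorff B A := by
  rwa [FiniteHausdorff, Metric.hausdorffEDist_comm]

theorem FiniteHausdorff.trans {A B C : Set X} (h : FiniteHausdorff A B)
    (h' : FiniteHausdorff B C) : FiniteHausdorff A C :=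
  ne_top_of_le_ne_top (ENNReal.add_ne_top.2 ⟨h, h'⟩) Metric.hausdorffEDist_triangle

/-- Asymptotic geodesic rays with the same start are uniformly close if one of them is Morse. -/
theorem dist_le_of_finiteHausdorff [GeodesicSpace X] {M : MorseGauge} {ξ ξ' : ℝ → X}
    (hξ : IsGeodesicRay ξ) (hξ' : IsGeodesicRay ξ') (h0 : ξ 0 = ξ' 0)
    (hM : IsMorseSet M (rayImage ξ')) (h : FiniteHausdorff (rayImage ξ) (rayImage ξ')) {t : ℝ}
    (ht : 0 ≤ t) : dist (ξ t) (ξ' t) ≤ 2 * M.bd 3 0 := by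
  obtain ⟨R, -, hR⟩ := h.exists_near
  have hR0 : (0 : ℝ) ≤ R := R.2
  have hs0 : 0 ≤ t + R + 1 := by positivity
  -- The non-uniform `R` enters only through the choice of this far point. A geodesic from `y` to a
  -- nearest point `ξ w` of an initial segment of `ξ`, followed by `ξ` backwards, is a `(3,
  -- 0)`-quasi-geodesic between points of `ξ'` which passes through `ξ t`.
  set y := ξ' (t + R + 1) with hy
  obtain ⟨-, ⟨r, hr, rfl⟩, hd⟩ := hR y ⟨_, hs0, rfl⟩
  have hr0 : (0 : ℝ) ≤ r := hr
  have hcont : ContinuousOn (fun s => dist y (ξ s)) (Icc 0 r) :=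
    (continuous_const.dist continuous_id).comp_continuousOn (GeodOn.continuousOn (GeodOn.mono hξ fun t ht => ht.1))
  obtain ⟨w, hw, hmin⟩ := isCompact_Icc.exists_isMinOn ⟨0, le_rfl, hr0⟩ hcont
  have hyw : dist y (ξ w) ≤ R := (hmin (show r ∈ Icc 0 r from ⟨hr0, le_rfl⟩)).trans hd
  have hw0 := hw.1
  have htw : t ≤ w := by
    have h1 := dist_triangle y (ξ w) (ξ 0)
    rw [hy, h0, hξ' _ hs0 0 self_mem_Ici, ← h0, hξ w hw.1 0 self_mem_Ici, sub_zero, sub_zero,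
      abs_of_nonneg hs0, abs_of_nonneg hw.1] at h1
    linarith
  obtain ⟨γ, hγ⟩ := GeodesicSpace.exists_geodesic y (ξ w)
  have hq : IsQuasiGeodesicOn 1 0 (fun s => ξ (w - s)) (Icc 0 w) :=
    IsQuasiGeodesicOn.reverse (GeodOn.isQuasiGeodesicOn (GeodOn.mono hξ fun t ht => ht.1))
  have hglue : γ (dist y (ξ w)) = ξ (w - 0) := by rw [hγ.2.1, sub_zero]
  have hj := hq.join_nearest le_rfl le_rfl le_rfl dist_nonneg hw.1 hγ.geodOn hglue (by
    intro s hs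
    rw [hγ.1, hγ.2.1, add_zero]
    exact hmin (show w - s ∈ Icc 0 r from ⟨by linarith [hs.2], by linarith [hs.1, hw.2]⟩))
  have hN := hM.near (l := 3) (e := 0) (T := dist y (ξ w) + w) (by norm_num) le_rfl (by positivity) (by
    convert hj using 1 <;> norm_num) (by
      rw [joinPath_of_le dist_nonneg, hγ.1]; exact ⟨_, hs0, rfl⟩) (by
      rw [joinPath_of_ge hglue (by linarith), add_sub_cancel_left, sub_self, h0]
      exact ⟨0, self_mem_Ici, rfl⟩) (t := dist y (ξ w) + (w - t))
      ⟨add_nonneg dist_nonneg (by linarith), by linarith⟩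
  rw [joinPath_of_ge hglue (by linarith), add_sub_cancel_left, sub_sub_cancel] at hN
  obtain ⟨-, ⟨v, hv, rfl⟩, hvd⟩ := hN
  have hv0 : (0 : ℝ) ≤ v := hv
  have d1 := dist_triangle (ξ t) (ξ' v) (ξ' 0)
  have d2 := dist_triangle_left (ξ' v) (ξ 0) (ξ t)
  rw [← h0, hξ t ht 0 self_mem_Ici, h0, hξ' v hv 0 self_mem_Ici, sub_zero, sub_zero,
    abs_of_nonneg ht, abs_of_nonneg hv0] at d1
  rw [hξ t ht 0 self_mem_Ici, h0, hξ' v hv 0 self_mem_Ici, sub_zero, sub_zero,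
    abs_of_nonneg ht, abs_of_nonneg hv0] at d2
  have d3 := dist_triangle (ξ t) (ξ' v) (ξ' t)
  rw [hξ' v hv t ht] at d3
  have d4 : |v - t| ≤ M.bd 3 0 := abs_le.2 ⟨by linarith, by linarith⟩
  linarith

/-- A polygonal chain with `k` sides can be shortened to a quasi-geodesic whose constants depend
only on `k`. -/
theorem exists_quasiGeodesic_of_chain [GeodesicSpace X] (k : ℕ) : ∃ Λ : ℝ, 1 ≤ Λ ∧
    ∀ (q : ℕ → X) (δ : ℝ), 0 ≤ δ → (∀ i < k, dist (q i) (q (i + 1)) ≤ δ) →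
      ∃ T η, 0 ≤ T ∧ IsQuasiGeodesicOn Λ 0 η (Icc 0 T) ∧ η 0 = q 0 ∧ η T = q k ∧
        ∀ t ∈ Icc 0 T, ∃ i ≤ k, dist (η t) (q i) ≤ δ := by
  induction k with
  | zero =>
    refine ⟨1, le_rfl, fun q δ hδ _ => ⟨0, fun _ => q 0, le_rfl, ⟨continuousOn_const, ?_⟩, rfl, rfl,
      fun t _ => ⟨0, le_rfl, by simpa using hδ⟩⟩⟩
    intro s hs t ht
    have h1 : s = 0 := le_antisymm hs.2 hs.1
    have h2 : t = 0 := le_antisymm ht.2 ht.1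
    simp [h1, h2]
  | succ k ih =>
    obtain ⟨Λ, hΛ, ih⟩ := ih
    refine ⟨2 * Λ + 1, by linarith, fun q δ hδ hq => ?_⟩
    obtain ⟨T, η, hT, hη, h0, h1, hnear⟩ := ih q δ hδ fun i hi => hq i (by omega)
    have hcont : ContinuousOn (fun s => dist (q (k + 1)) (η s)) (Icc 0 T) :=
      (continuous_const.dist continuous_id).comp_continuousOn hη.1
    -- The path so far is cut at a point nearest to the new vertex and continued by a geodesic. By
    -- `join_nearest` this replaces `Λ` by `2 * Λ + 1`, whatever `δ` is.
    obtain ⟨w, hw, hmin⟩ := isCompact_Icc.exists_isMinOn ⟨0, le_rfl, hT⟩ hcont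
    have hw0 := hw.1
    have hd : dist (q (k + 1)) (η w) ≤ δ := by
      refine (hmin (show T ∈ Icc 0 T from ⟨hT, le_rfl⟩)).trans ?_
      change dist (q (k + 1)) (η T) ≤ δ
      rw [h1, dist_comm]
      exact hq k (by omega)
    obtain ⟨γ, hγ⟩ := GeodesicSpace.exists_geodesic (q (k + 1)) (η w)
    have hqg : IsQuasiGeodesicOn Λ 0 (fun s => η (w - s)) (Icc 0 w) :=
      (hη.mono fun t ht => ⟨ht.1, ht.2.trans hw.2⟩).reverse
    have hglue : γ (dist (q (k + 1)) (η w)) = η (w - 0) := by rw [hγ.2.1, sub_zero]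
    have hj := hqg.join_nearest hΛ le_rfl le_rfl dist_nonneg hw.1 hγ.geodOn hglue (by
      intro s hs
      rw [hγ.1, hγ.2.1, add_zero]
      exact hmin (show w - s ∈ Icc 0 T from ⟨by linarith [hs.2], by linarith [hs.1, hw.2]⟩))
    have hpos : 0 ≤ dist (q (k + 1)) (η w) + w := by positivity
    refine ⟨_, _, hpos, by simpa using hj.reverse, ?_, ?_, ?_⟩
    · simp only [sub_zero]
      rw [joinPath_of_ge hglue (by linarith), add_sub_cancel_left, sub_self, h0]
    · simp only [sub_self]
      rw [joinPath_of_le dist_nonneg, hγ.1]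
    · intro t ht
      rcases le_total (dist (q (k + 1)) (η w) + w - t) (dist (q (k + 1)) (η w)) with h | h
      · refine ⟨k + 1, le_rfl, ?_⟩
        rw [joinPath_of_le h]
        have := hγ.geodOn _ ⟨by linarith [ht.2], h⟩ 0 ⟨le_rfl, dist_nonneg⟩
        rw [hγ.1, sub_zero, abs_of_nonneg (by linarith [ht.2])] at this
        linarith
      · rw [joinPath_of_ge hglue h]
        obtain ⟨i, hi, hid⟩ := hnear (w - (dist (q (k + 1)) (η w) + w - t - dist (q (k + 1)) (η w)))
          ⟨by linarith [ht.1], by linarith [hw.2]⟩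
        exact ⟨i, by omega, hid⟩

/-- A uniformly proper `1`-Lipschitz path with quasi-convex image is a quasi-geodesic. -/
theorem exists_isQuasiGeodesicOn_of_proper [GeodesicSpace X] (K : ℝ) (hK : 0 ≤ K) (R : ℝ → ℝ) :
    ∃ C : ℝ, 1 ≤ C ∧ ∀ q : ℝ → X,
      (∀ s ∈ Ici (0 : ℝ), ∀ t ∈ Ici (0 : ℝ), dist (q s) (q t) ≤ |s - t|) →
      (∀ D, ∀ s ∈ Ici (0 : ℝ), ∀ t ∈ Ici (0 : ℝ), dist (q s) (q t) ≤ D → |s - t| ≤ R D) →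
      (∀ s ∈ Ici (0 : ℝ), ∀ t ∈ Ici (0 : ℝ), ∀ σ, IsGeodesicSegment σ (q s) (q t) →
        ∀ p ∈ segImage σ (q s) (q t), Near K (rayImage q) p) →
      IsQuasiGeodesicOn C C q (Ici 0) := by
  -- Between the times `a` and `b` the path stays within `K₁` of a geodesic `σ` from `q a` to `q b`:
  -- for `τ` in between, a point of `σ` is near `q v₁` and `q v₂` with `v₁ ≤ τ ≤ v₂`, and properness
  -- bounds `v₂ - v₁`. The spacing `h` exceeds the time between points of the path at distance at
  -- most `2 * K₁ + 2`.
  set K₁ := R (2 * K + 2) + K + 1 with hK₁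
  set h := |R (2 * K₁ + 2)| + 1 with hh
  have hh1 : 1 ≤ h := by have := abs_nonneg (R (2 * K₁ + 2)); linarith
  refine ⟨h, hh1, fun q hlip hprop hconv => ⟨?_, ?_⟩⟩
  · rw [Metric.continuousOn_iff]
    exact fun b hb ε hε => ⟨ε, hε, fun a ha hab => (hlip a ha b hb).trans_lt hab⟩
  have key : ∀ a ∈ Ici (0 : ℝ), ∀ b ∈ Ici (0 : ℝ), a ≤ b →
      b - a ≤ h * (dist (q a) (q b) + 1) := by
    intro a ha b hb hab
    have ha0 : (0 : ℝ) ≤ a := ha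
    obtain ⟨σ, hσ⟩ := GeodesicSpace.exists_geodesic (q a) (q b)
    have hclose : ∀ τ ∈ Icc a b, ∃ v ∈ Icc 0 (dist (q a) (q b)), dist (q τ) (σ v) ≤ K₁ := by
      intro τ hτ
      have hτ0 : (0 : ℝ) ≤ τ := ha0.trans hτ.1
      obtain ⟨v, hv, ⟨-, ⟨v₁, hv₁, rfl⟩, hd₁⟩, ⟨-, ⟨v₂, hv₂, rfl⟩, hd₂⟩⟩ :=
        exists_near_both (η := σ) (P := q '' Icc 0 τ) (Q := q '' Ici τ) (m := K)
          dist_nonneg hσ.geodOn.continuousOn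
          ⟨q a, ⟨a, ⟨ha0, hτ.1⟩, rfl⟩, by rw [hσ.1, dist_self]; exact hK⟩
          ⟨q b, ⟨b, hτ.2, rfl⟩, by rw [hσ.2.1, dist_self]; exact hK⟩ (by
          intro t ht
          obtain ⟨-, ⟨v, hv, rfl⟩, hd⟩ := hconv a ha b hb σ hσ _ ⟨t, ht, rfl⟩
          rcases le_total v τ with hvu | hvu
          · exact Or.inl ⟨_, ⟨v, ⟨hv, hvu⟩, rfl⟩, hd⟩
          · exact Or.inr ⟨_, ⟨v, hvu, rfl⟩, hd⟩)
      refine ⟨v, hv, ?_⟩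
      have hv₂' : v₂ ∈ Ici (0 : ℝ) := hτ0.trans hv₂
      have h1 := hprop (2 * K + 2) v₁ hv₁.1 v₂ hv₂'
        ((dist_triangle_left (q v₁) (q v₂) (σ v)).trans (by linarith))
      have h2 := hlip τ hτ0 v₁ hv₁.1
      have h4 : |τ - v₁| ≤ |v₁ - v₂| := by
        rw [abs_of_nonneg (by linarith [hv₁.2]), abs_of_nonpos (by linarith [hv₁.2, mem_Ici.1 hv₂])]
        linarith [mem_Ici.1 hv₂]
      have h5 := dist_triangle_right (q τ) (σ v) (q v₁)
      linarith
    -- Pigeonhole: if there were more times with spacing `h` in `[a, b]` than unit intervals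
    -- covering `σ`, two of them would have points of `σ` in the same unit interval and contradict
    -- the choice of `h`.
    have hN : ⌊(b - a) / h⌋₊ ≤ ⌊dist (q a) (q b)⌋₊ := by
      by_contra hlt
      rw [not_le] at hlt
      have hτ : ∀ i ∈ Finset.range (⌊(b - a) / h⌋₊ + 1), a + i * h ∈ Icc a b := by
        intro i hi
        rw [Finset.mem_range, Nat.lt_succ_iff] at hi
        have h1 : (i : ℝ) ≤ (b - a) / h :=
          (Nat.cast_le.2 hi).trans (Nat.floor_le (div_nonneg (by linarith) (by linarith)))
        rw [le_div_iff₀ (by linarith)] at h1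
        exact ⟨by have : 0 ≤ (i : ℝ) * h := by positivity
                  linarith, by linarith⟩
      choose! v hv hvd using hclose
      obtain ⟨i, hi, j, hj, hij, heq⟩ := Finset.exists_ne_map_eq_of_card_lt_of_maps_to
        (s := Finset.range (⌊(b - a) / h⌋₊ + 1)) (t := Finset.range (⌊dist (q a) (q b)⌋₊ + 1))
        (by simpa using hlt) (f := fun i : ℕ => ⌊v (a + i * h)⌋₊) (by
          intro i hi
          simp only [Finset.coe_range, mem_Iio, Nat.lt_succ_iff]
          exact Nat.floor_le_floor (hv _ (hτ i hi)).2)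
      have hvi := hv _ (hτ i hi)
      have hvj := hv _ (hτ j hj)
      have h1 : |v (a + i * h) - v (a + j * h)| ≤ 1 := by
        have e1 := Nat.floor_le hvi.1
        have e2 := Nat.lt_floor_add_one (v (a + i * h))
        have e3 := Nat.floor_le hvj.1
        have e4 := Nat.lt_floor_add_one (v (a + j * h))
        rw [← heq] at e3 e4
        rw [abs_le]
        constructor <;> linarith
      have h2 := dist_triangle4 (q (a + i * h)) (σ (v (a + i * h))) (σ (v (a + j * h)))
        (q (a + j * h))
      rw [hσ.geodOn _ hvi _ hvj, dist_comm (σ (v (a + j * h)))] at h2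
      have h3 := hprop (2 * K₁ + 2) (a + i * h) (ha0.trans (hτ i hi).1) (a + j * h)
        (ha0.trans (hτ j hj).1) (by linarith [hvd _ (hτ i hi), hvd _ (hτ j hj)])
      have h4 : (1 : ℝ) ≤ |(i : ℝ) - j| := by
        have : (1 : ℤ) ≤ |(i : ℤ) - j| := Int.one_le_abs (by omega)
        exact_mod_cast this
      rw [show a + i * h - (a + j * h) = ((i : ℝ) - j) * h by ring, abs_mul,
        abs_of_pos (by linarith : 0 < h)] at h3
      have h5 := le_abs_self (R (2 * K₁ + 2))
      nlinarith
    have h1 := Nat.lt_floor_add_one ((b - a) / h)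
    have h2 : (⌊(b - a) / h⌋₊ : ℝ) ≤ dist (q a) (q b) :=
      (Nat.cast_le.2 hN).trans (Nat.floor_le dist_nonneg)
    have h3 : (b - a) / h ≤ dist (q a) (q b) + 1 := by linarith
    rwa [div_le_iff₀' (by linarith)] at h3
  intro s hs t ht
  constructor
  · have h1 : |s - t| ≤ h * (dist (q s) (q t) + 1) := by
      rcases le_total s t with hst | hst
      · rw [abs_sub_comm, abs_of_nonneg (by linarith)]
        exact key s hs t ht hst
      · rw [abs_of_nonneg (by linarith), dist_comm]
        exact key t ht s hs hst
    rw [← inv_mul_le_iff₀ (by linarith)] at h1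
    linarith
  · have h1 := hlip s hs t ht
    nlinarith [abs_nonneg (s - t)]

/-- Connecting the points of a sequence by geodesics. -/
theorem exists_path_of_seq [GeodesicSpace X] (f : ℕ → X) {δ : ℝ}
    (hδ : ∀ i, dist (f i) (f (i + 1)) ≤ δ) : ∃ q : ℝ → X, (∀ i : ℕ, q i = f i) ∧
      ∀ s ∈ Ici (0 : ℝ), ∀ t ∈ Ici (0 : ℝ), dist (q s) (q t) ≤ δ * |s - t| := by
  choose σ hσ using fun i => GeodesicSpace.exists_geodesic (f i) (f (i + 1))
  have hδ0 : 0 ≤ δ := dist_nonneg.trans (hδ 0)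
  have hm : ∀ (i : ℕ) (x : ℝ), 0 ≤ x → x ≤ 1 →
      x * dist (f i) (f (i + 1)) ∈ Icc 0 (dist (f i) (f (i + 1))) := fun i x h0 h1 =>
    ⟨by positivity, mul_le_of_le_one_left dist_nonneg h1⟩
  have hseg : ∀ (i : ℕ) (x y : ℝ), 0 ≤ x → x ≤ 1 → 0 ≤ y → y ≤ 1 →
      dist (σ i (x * dist (f i) (f (i + 1)))) (σ i (y * dist (f i) (f (i + 1)))) ≤
        δ * |x - y| := by
    intro i x y hx hx' hy hy'
    rw [(hσ i).geodOn _ (hm i x hx hx') _ (hm i y hy hy'), ← sub_mul, abs_mul,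
      abs_of_nonneg dist_nonneg, mul_comm]
    exact mul_le_mul_of_nonneg_right (hδ i) (abs_nonneg _)
  have hseg0 : ∀ i, σ i (0 * dist (f i) (f (i + 1))) = f i := fun i => by
    rw [zero_mul, (hσ i).1]
  have hseg1 : ∀ i, σ i (1 * dist (f i) (f (i + 1))) = f (i + 1) := fun i => by
    rw [one_mul, (hσ i).2.1]
  refine ⟨fun t => σ ⌊t⌋₊ ((t - ⌊t⌋₊) * dist (f ⌊t⌋₊) (f (⌊t⌋₊ + 1))), fun i => ?_, ?_⟩
  · simp only [Nat.floor_natCast, sub_self]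
    exact hseg0 i
  have key : ∀ s ∈ Ici (0 : ℝ), ∀ t ∈ Ici (0 : ℝ), s ≤ t →
      dist (σ ⌊s⌋₊ ((s - ⌊s⌋₊) * dist (f ⌊s⌋₊) (f (⌊s⌋₊ + 1))))
        (σ ⌊t⌋₊ ((t - ⌊t⌋₊) * dist (f ⌊t⌋₊) (f (⌊t⌋₊ + 1)))) ≤ δ * |s - t| := by
    intro s hs t ht hst
    have s1 := Nat.floor_le (mem_Ici.1 hs)
    have s2 := Nat.lt_floor_add_one s
    have t1 := Nat.floor_le (mem_Ici.1 ht)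
    have t2 := Nat.lt_floor_add_one t
    rcases (Nat.floor_le_floor hst).eq_or_lt with heq | hlt
    · rw [← heq] at t1 t2 ⊢
      refine (hseg _ _ _ (by linarith) (by linarith) (by linarith) (by linarith)).trans (le_of_eq ?_)
      congr 2; ring
    · have d1 := hseg ⌊s⌋₊ (s - ⌊s⌋₊) 1 (by linarith) (by linarith) zero_le_one le_rfl
      have d2 := hseg ⌊t⌋₊ 0 (t - ⌊t⌋₊) le_rfl zero_le_one (by linarith) (by linarith)
      rw [hseg1, abs_of_nonpos (by linarith)] at d1
      rw [hseg0, abs_of_nonpos (by linarith)] at d2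
      have d3 : dist (f (⌊s⌋₊ + 1)) (f ⌊t⌋₊) ≤ δ * (⌊t⌋₊ - (⌊s⌋₊ + 1)) := by
        refine (dist_le_Ico_sum_dist f hlt).trans ((Finset.sum_le_sum fun i _ => hδ i).trans ?_)
        rw [Finset.sum_const, Nat.card_Ico, nsmul_eq_mul, Nat.cast_sub hlt]
        push_cast
        rw [mul_comm]
      have d4 := dist_triangle4 (σ ⌊s⌋₊ ((s - ⌊s⌋₊) * dist (f ⌊s⌋₊) (f (⌊s⌋₊ + 1))))
        (f (⌊s⌋₊ + 1)) (f ⌊t⌋₊) (σ ⌊t⌋₊ ((t - ⌊t⌋₊) * dist (f ⌊t⌋₊) (f (⌊t⌋₊ + 1))))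
      rw [abs_of_nonpos (by linarith)]
      nlinarith
  intro s hs t ht
  rcases le_total s t with hst | hst
  · exact key s hs t ht hst
  · rw [dist_comm, abs_sub_comm]
    exact key t ht s hs hst

/-- Connecting the points of a discrete quasi-geodesic by geodesics gives a quasi-geodesic. -/
theorem isQuasiGeodesicOn_of_seq {q : ℝ → X} {l e δ : ℝ} (hl : 1 ≤ l) (hδl : δ ≤ l)
    (he : 0 ≤ e)
    (hlip : ∀ s ∈ Ici (0 : ℝ), ∀ t ∈ Ici (0 : ℝ), dist (q s) (q t) ≤ δ * |s - t|) {J : Set ℝ}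
    (hJ : ∀ t ∈ J, 0 ≤ t ∧ (⌊t⌋₊ : ℝ) ∈ J)
    (h : ∀ i j : ℕ, (i : ℝ) ∈ J → (j : ℝ) ∈ J →
      l⁻¹ * |(i : ℝ) - j| - e ≤ dist (q i) (q j)) :
    IsQuasiGeodesicOn l (e + 2 * l + 1) q J := by
  have hlip' : ∀ s ∈ J, ∀ t ∈ J, dist (q s) (q t) ≤ l * |s - t| := fun s hs t ht =>
    (hlip s (hJ s hs).1 t (hJ t ht).1).trans (mul_le_mul_of_nonneg_right hδl (abs_nonneg _))
  refine ⟨?_, fun s hs t ht => ⟨?_, ?_⟩⟩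
  · rw [Metric.continuousOn_iff]
    intro b hb ε hε
    refine ⟨ε / l, by positivity, fun a ha hab => (hlip' a ha b hb).trans_lt ?_⟩
    rw [Real.dist_eq, lt_div_iff₀ (by linarith)] at hab
    linarith
  · have hfl : ∀ t ∈ J, dist (q t) (q ⌊t⌋₊) ≤ l ∧ |t - ⌊t⌋₊| ≤ 1 := by
      intro t ht
      have t1 := Nat.floor_le (hJ t ht).1
      have t2 := Nat.lt_floor_add_one t
      have h1 : |t - ⌊t⌋₊| ≤ 1 := by rw [abs_of_nonneg (by linarith)]; linarith
      exact ⟨(hlip' t ht _ (hJ t ht).2).trans (mul_le_of_le_one_right (by linarith) h1), h1⟩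
    obtain ⟨s1, s2⟩ := hfl s hs
    obtain ⟨t1, t2⟩ := hfl t ht
    have h1 := h _ _ (hJ s hs).2 (hJ t ht).2
    have h2 := dist_triangle4 (q ⌊s⌋₊) (q s) (q t) (q ⌊t⌋₊)
    rw [dist_comm (q ⌊s⌋₊) (q s)] at h2
    have s1' := Nat.floor_le (hJ s hs).1
    have s2' := Nat.lt_floor_add_one s
    have t1' := Nat.floor_le (hJ t ht).1
    have t2' := Nat.lt_floor_add_one t
    have h3 : |s - t| ≤ |(⌊s⌋₊ : ℝ) - ⌊t⌋₊| + 1 := by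
      rcases le_total 0 (s - t) with h0 | h0
      · rw [abs_of_nonneg h0]; linarith [le_abs_self ((⌊s⌋₊ : ℝ) - ⌊t⌋₊)]
      · rw [abs_of_nonpos h0]; linarith [neg_abs_le ((⌊s⌋₊ : ℝ) - ⌊t⌋₊)]
    have h4 := mul_le_mul_of_nonneg_left h3 (by positivity : 0 ≤ l⁻¹)
    have h5 : l⁻¹ ≤ 1 := inv_le_one_of_one_le₀ hl
    rw [mul_add, mul_one] at h4
    linarith
  · have := hlip' s hs t ht
    linarith

end Rays

/-! ### The geometric realisation of a graph as a geodesic space -/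

namespace GeomReal

variable {V : Type*} {G : SimpleGraph V}

theorem dist_le_of_onEdge [Fact G.Connected] {x y : GeomReal G} {a b : V} (h : OnEdge x y a b) :
    dist x y ≤ |x.coord a - y.coord a| :=
  csInf_le (pathLengths_bddBelow x y) (Or.inr ⟨a, b, h, rfl⟩)

theorem dist_vertex_le [Fact G.Connected] {x : GeomReal G} {u : V} (hu : u ∈ x.coord.support) :
    dist x (vertex G u) ≤ 1 - x.coord u := by
  refine csInf_le (pathLengths_bddBelow _ _) (Or.inl ⟨u, hu, u, ?_, ?_⟩)
  · simp [vertex]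
  · simp [vertex]

theorem exists_dist_vertex_lt [Fact G.Connected] (x : GeomReal G) :
    ∃ u, dist x (vertex G u) < 1 := by
  obtain ⟨u, hu⟩ := x.support_nonempty
  refine ⟨u, (dist_vertex_le hu).trans_lt ?_⟩
  have := (x.coord_nonneg u).lt_of_ne (Ne.symm (Finsupp.mem_support_iff.1 hu))
  linarith

open Classical in
/-- The point with barycentric coordinates `r` and `1 - r` on the edge `ab`. -/
noncomputable def onEdgePoint (a b : V) (h : a = b ∨ G.Adj a b) (r : ℝ) : GeomReal G where
  coord := Finsupp.single a (max 0 (min 1 r)) + Finsupp.single b (1 - max 0 (min 1 r))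
  carried := by
    refine ⟨b, a, max 0 (min 1 r), ?_, le_max_left _ _, max_le zero_le_one (min_le_left _ _), ?_⟩
    · exact h.imp Eq.symm SimpleGraph.Adj.symm
    · rw [add_comm]

theorem onEdgePoint_support {a b : V} (h : a = b ∨ G.Adj a b) (r : ℝ) :
    ((onEdgePoint a b h r).coord.support : Set V) ⊆ {a, b} := by
  classical
  intro w hw
  by_contra hne
  simp only [mem_insert_iff, mem_singleton_iff, not_or] at hne
  rw [Finset.mem_coe, Finsupp.mem_support_iff] at hw
  exact hw (by simp [onEdgePoint, Ne.symm hne.1, Ne.symm hne.2])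

theorem onEdgePoint_coord {a b : V} (hab : G.Adj a b) {r : ℝ} :
    (onEdgePoint a b (Or.inr hab) r).coord a = max 0 (min 1 r) := by
  classical
  simp [onEdgePoint, hab.ne']

theorem onEdgePoint_eq {a b : V} (hab : G.Adj a b) {x : GeomReal G}
    (h : (x.coord.support : Set V) ⊆ {a, b}) :
    onEdgePoint a b (Or.inr hab) (x.coord a) = x := by
  classical
  have hmax : max 0 (min 1 (x.coord a)) = x.coord a := by
    rw [min_eq_right (x.coord_le_one a), max_eq_right (x.coord_nonneg a)]
  have ha := onEdgePoint_coord hab (r := x.coord a)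
  rw [hmax] at ha
  ext w
  rcases eq_or_ne w a with rfl | hwa
  · exact ha
  rcases eq_or_ne w b with rfl | hwb
  · have h1 := coord_add _ hab.ne h
    have h2 := coord_add _ hab.ne (onEdgePoint_support (Or.inr hab) (x.coord a))
    linarith
  · rw [x.coord_eq_zero h hwa hwb, coord_eq_zero _ (onEdgePoint_support _ _) hwa hwb]

theorem dist_onEdgePoint_le [Fact G.Connected] {a b : V} (hab : G.Adj a b) (r r' : ℝ) :
    dist (onEdgePoint a b (Or.inr hab) r) (onEdgePoint a b (Or.inr hab) r') ≤ |r - r'| := by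
  refine (dist_le_of_onEdge ⟨Or.inr hab, onEdgePoint_support _ _, onEdgePoint_support _ _⟩).trans ?_
  rw [onEdgePoint_coord hab, onEdgePoint_coord hab]
  rw [max_comm 0, max_comm 0]
  exact (abs_max_sub_max_le_abs _ _ _).trans <| by simpa using abs_min_sub_min_le_max 1 r 1 r'

end GeomReal

/-- There is a `1`-Lipschitz path of length `L` from `x` to `y`. -/
def HasPath {X : Type*} [MetricSpace X] (x y : X) (L : ℝ) : Prop :=
  0 ≤ L ∧ ∃ γ : ℝ → X, γ 0 = x ∧ γ L = y ∧
    ∀ s ∈ Icc 0 L, ∀ t ∈ Icc 0 L, dist (γ s) (γ t) ≤ |s - t|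

namespace HasPath

variable {X : Type*} [MetricSpace X] {x y z : X} {L L' : ℝ}

theorem refl (x : X) : HasPath x x 0 := ⟨le_rfl, fun _ => x, rfl, rfl, fun s _ t _ => by simp⟩

theorem symm (h : HasPath x y L) : HasPath y x L := by
  obtain ⟨hL, γ, h0, h1, h⟩ := h
  refine ⟨hL, fun t => γ (L - t), by simpa, by simpa, fun s hs t ht => ?_⟩
  have := h (L - s) ⟨by linarith [hs.2], by linarith [hs.1]⟩ (L - t)
    ⟨by linarith [ht.2], by linarith [ht.1]⟩
  rwa [show L - s - (L - t) = -(s - t) by ring, abs_neg] at this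

theorem trans (h : HasPath x y L) (h' : HasPath y z L') : HasPath x z (L + L') := by
  obtain ⟨hL, γ, h0, h1, h⟩ := h
  obtain ⟨hL', γ', h0', h1', h'⟩ := h'
  have hg : γ L = γ' 0 := h1.trans h0'.symm
  refine ⟨by positivity, joinPath γ L γ', by rw [joinPath_of_le hL, h0], ?_, ?_⟩
  · rw [joinPath_of_ge hg (by linarith), add_sub_cancel_left, h1']
  have key : ∀ s ∈ Icc 0 (L + L'), ∀ t ∈ Icc 0 (L + L'), s ≤ t →
      dist (joinPath γ L γ' s) (joinPath γ L γ' t) ≤ |s - t| := by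
    intro s hs t ht hst
    rcases le_total t L with htL | htL
    · rw [joinPath_of_le (hst.trans htL), joinPath_of_le htL]
      exact h s ⟨hs.1, hst.trans htL⟩ t ⟨ht.1, htL⟩
    · rcases le_total s L with hsL | hsL
      · rw [joinPath_of_le hsL, joinPath_of_ge hg htL]
        have d1 := h s ⟨hs.1, hsL⟩ L ⟨hL, le_rfl⟩
        have d2 := h' 0 ⟨le_rfl, hL'⟩ (t - L) ⟨by linarith, by linarith [ht.2]⟩
        rw [abs_of_nonpos (by linarith)] at d1 d2 ⊢
        rw [hg] at d1
        have := dist_triangle (γ s) (γ' 0) (γ' (t - L))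
        linarith
      · rw [joinPath_of_ge hg hsL, joinPath_of_ge hg htL, show s - t = (s - L) - (t - L) by ring]
        exact h' _ ⟨by linarith, by linarith [hs.2]⟩ _ ⟨by linarith, by linarith [ht.2]⟩
  intro s hs t ht
  rcases le_total s t with hst | hst
  · exact key s hs t ht hst
  · rw [dist_comm, abs_sub_comm]
    exact key t ht s hs hst

/-- A loss of distance between two intermediate points would make the whole path shorter than the
distance of its endpoints. -/
theorem exists_geodesic (h : HasPath x y (dist x y)) : ∃ γ, IsGeodesicSegment γ x y := by
  obtain ⟨-, γ, h0, h1, h⟩ := h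
  have key : ∀ s ∈ Icc 0 (dist x y), ∀ t ∈ Icc 0 (dist x y), s ≤ t →
      dist (γ s) (γ t) = |s - t| := by
    intro s hs t ht hst
    refine le_antisymm (h s hs t ht) ?_
    have d1 := h 0 ⟨le_rfl, dist_nonneg⟩ s hs
    have d2 := h t ht (dist x y) ⟨dist_nonneg, le_rfl⟩
    rw [h0, abs_of_nonpos (by linarith [hs.1])] at d1
    rw [h1, abs_of_nonpos (by linarith [ht.2])] at d2
    have := dist_triangle4 x (γ s) (γ t) y
    rw [abs_of_nonpos (by linarith)]
    linarith
  refine ⟨γ, h0, h1, fun s hs t ht => ?_⟩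
  rcases le_total s t with hst | hst
  · exact key s hs t ht hst
  · rw [dist_comm, abs_sub_comm]
    exact key t ht s hs hst

end HasPath

namespace GeomReal

variable {V : Type*} {G : SimpleGraph V}

theorem hasPath_of_onEdge [Fact G.Connected] {x y : GeomReal G} {a b : V} (h : OnEdge x y a b) :
    HasPath x y |x.coord a - y.coord a| := by
  have key : ∀ x y : GeomReal G, OnEdge x y a b → x.coord a ≤ y.coord a →
      HasPath x y |x.coord a - y.coord a| := by
    rintro x y ⟨hab, hx, hy⟩ hle
    rw [abs_of_nonpos (by linarith), neg_sub]
    rcases hab with rfl | hab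
    · have h1 := x.coord_self (a := a) (by simpa using hx)
      have h2 := y.coord_self (a := a) (by simpa using hy)
      have hxy : x = y := by
        have := dist_le_of_onEdge (x := x) (y := y) ⟨Or.inl rfl, hx, hy⟩
        rw [h1, h2, sub_self, abs_zero] at this
        exact dist_le_zero.1 this
      rw [hxy, sub_self]
      exact HasPath.refl y
    · refine ⟨by linarith, fun t => onEdgePoint a b (Or.inr hab) (x.coord a + t), ?_, ?_, ?_⟩
      · simp only [add_zero]
        exact onEdgePoint_eq hab hx
      · simp only [add_sub_cancel]
        exact onEdgePoint_eq hab hy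
      · intro s _ t _
        refine (dist_onEdgePoint_le hab _ _).trans (le_of_eq ?_)
        congr 1; ring
  rcases le_total (x.coord a) (y.coord a) with hle | hle
  · exact key x y h hle
  · rw [abs_sub_comm]
    exact (key y x ⟨h.1, h.2.2, h.2.1⟩ hle).symm

theorem hasPath_vertex [Fact G.Connected] {x : GeomReal G} {u : V} (hu : u ∈ x.coord.support) :
    HasPath x (vertex G u) (1 - x.coord u) := by
  have key : ∀ b, (u = b ∨ G.Adj u b) → (x.coord.support : Set V) ⊆ {u, b} →
      HasPath x (vertex G u) (1 - x.coord u) := by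
    intro b hub h
    have := hasPath_of_onEdge (x := x) (y := vertex G u) (a := u) (b := b)
      ⟨hub, h, by simp [vertex]⟩
    rwa [abs_sub_comm, show (vertex G u).coord u = 1 by simp [vertex],
      abs_of_nonneg (by linarith [x.coord_le_one u])] at this
  obtain ⟨a, b, hab, h⟩ := x.exists_edge
  rcases h (Finset.mem_coe.2 hu) with rfl | hub
  · exact key b hab h
  · rw [mem_singleton_iff] at hub
    subst hub
    exact key a (hab.imp Eq.symm SimpleGraph.Adj.symm) (by rwa [pair_comm])

theorem hasPath_walk [Fact G.Connected] {u v : V} (w : G.Walk u v) :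
    HasPath (vertex G u) (vertex G v) w.length := by
  induction w with
  | nil => simpa using HasPath.refl _
  | @cons u v w h p ih =>
    have := hasPath_of_onEdge (x := vertex G u) (y := vertex G v) (a := u) (b := v)
      ⟨Or.inr h, by simp [vertex], by simp [vertex]⟩
    rw [show |(vertex G u).coord u - (vertex G v).coord u| = 1 by simp [vertex, h.ne']] at this
    rw [SimpleGraph.Walk.length_cons, Nat.cast_add, Nat.cast_one, add_comm]
    exact this.trans ih

instance [hG : Fact G.Connected] : GeodesicSpace (GeomReal G) where
  exists_geodesic x y := by
    refine HasPath.exists_geodesic ?_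
    rcases (pathLengths_nonempty x y).csInf_mem (pathLengths_finite x y) with
      ⟨u, hu, v, hv, h⟩ | ⟨a, b, hab, h⟩
    · rw [show dist x y = _ from h]
      obtain ⟨w, hw⟩ := hG.out.exists_walk_length_eq_dist u v
      rw [← hw]
      exact ((hasPath_vertex hu).trans (hasPath_walk w)).trans (hasPath_vertex hv).symm
    · rw [show dist x y = _ from h]
      exact hasPath_of_onEdge hab

theorem finite_ball_vertex (hG : G.Connected) (hfin : ∀ v, (G.neighborSet v).Finite) (u : V)
    (N : ℕ) : {v | G.dist u v ≤ N}.Finite := by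
  induction N with
  | zero =>
    refine (finite_singleton u).subset fun v hv => ?_
    exact (hG.dist_eq_zero_iff.1 (Nat.le_zero.1 hv)).symm
  | succ N ih =>
    refine (ih.union (ih.biUnion fun v _ => hfin v)).subset fun v hv => ?_
    rcases Nat.lt_or_ge (G.dist u v) (N + 1) with h | h
    · exact Or.inl (Nat.lt_succ_iff.1 h)
    · have heq : G.dist v u = N + 1 := by rw [SimpleGraph.dist_comm]; exact le_antisymm hv h
      obtain ⟨w, hw⟩ := hG.exists_walk_length_eq_dist v u
      right
      cases w with
      | nil => simp at heq
      | @cons _ v' _ hadj p =>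
        rw [SimpleGraph.Walk.length_cons, heq] at hw
        refine mem_biUnion (x := v') ?_ hadj.symm
        rw [mem_ofPred_eq, SimpleGraph.dist_comm]
        exact (SimpleGraph.dist_le p).trans (by omega)

/-- The realisation of a locally finite connected graph is proper. -/
theorem properSpace [hG : Fact G.Connected] (hfin : ∀ v, (G.neighborSet v).Finite) :
    ProperSpace (GeomReal G) := by
  refine ⟨fun x r => ?_⟩
  obtain ⟨u, hu⟩ := x.exists_dist_vertex_lt
  -- Both `x` and a point of the ball are within `1` of a vertex, whence `r + 2`. The ball is
  -- contained in the finitely many closed edges at the vertices of `F`.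
  let F : Set V := {v | G.dist u v ≤ ⌈r + 2⌉₊}
  have hF : F.Finite := finite_ball_vertex hG.out hfin u _
  have hE : ∀ a b, G.Adj a b → IsCompact {y : GeomReal G | (y.coord.support : Set V) ⊆ {a, b}} := by
    intro a b hab
    have hc : Continuous fun r : ℝ => onEdgePoint a b (Or.inr hab) r := by
      refine (LipschitzWith.of_dist_le_mul (K := 1) fun r r' => ?_).continuous
      simpa [Real.dist_eq] using dist_onEdgePoint_le hab r r'
    refine ((isCompact_Icc (a := (0 : ℝ)) (b := 1)).image hc).of_isClosed_subset ?_ ?_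
    · have : {y : GeomReal G | (y.coord.support : Set V) ⊆ {a, b}} =
          (fun r : ℝ => onEdgePoint a b (Or.inr hab) r) '' Icc 0 1 := by
        ext y
        constructor
        · exact fun hy => ⟨_, ⟨y.coord_nonneg a, y.coord_le_one a⟩, onEdgePoint_eq hab hy⟩
        · rintro ⟨r, -, rfl⟩
          exact onEdgePoint_support _ _
      rw [this]
      exact (isCompact_Icc.image hc).isClosed
    · exact fun y hy => ⟨_, ⟨y.coord_nonneg a, y.coord_le_one a⟩, onEdgePoint_eq hab hy⟩
  have hK : IsCompact (⋃ v ∈ F, ({vertex G v} ∪ ⋃ w ∈ G.neighborSet v,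
      {y : GeomReal G | (y.coord.support : Set V) ⊆ {v, w}})) :=
    hF.isCompact_biUnion fun v _ => isCompact_singleton.union
      ((hfin v).isCompact_biUnion fun w hw => hE v w hw)
  refine hK.of_isClosed_subset Metric.isClosed_closedBall fun y hy => ?_
  obtain ⟨v, hv⟩ := y.support_nonempty
  have hvF : v ∈ F := by
    have h1 := dist_vertex_le hv
    have h2 := dist_triangle4 (vertex G u) x y (vertex G v)
    rw [dist_vertex, dist_comm _ x, dist_comm x y] at h2
    have h3 := Metric.mem_closedBall.1 hy
    have h4 := y.coord_nonneg v
    have h5 : (G.dist u v : ℝ) ≤ ⌈r + 2⌉₊ := (by linarith : (G.dist u v : ℝ) ≤ r + 2).trans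
      (Nat.le_ceil _)
    exact_mod_cast h5
  refine mem_biUnion hvF ?_
  obtain ⟨a, b, hab, h⟩ := y.exists_edge
  rcases hab with rfl | hab
  · left
    have hva : v = a := by simpa using h (Finset.mem_coe.2 hv)
    subst hva
    have := dist_vertex_le hv
    rw [y.coord_self (by simpa using h), sub_self] at this
    exact dist_le_zero.1 this
  · right
    rcases h (Finset.mem_coe.2 hv) with rfl | hvb
    · exact mem_biUnion (x := b) hab h
    · rw [mem_singleton_iff] at hvb
      subst hvb
      exact mem_biUnion (x := a) hab.symm (by rwa [mem_ofPred_eq, pair_comm])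

/-- Sum along a shortest walk. The Lipschitz estimates between Cayley graphs, the Bass–Serre space
and the tree reduce to single edges in this way. -/
theorem dist_le_mul_of_adj {W : Type*} {G' : SimpleGraph W} (hG : G.Connected)
    (hG' : G'.Connected) {φ : V → W} {K : ℕ} (h : ∀ u v, G.Adj u v → G'.dist (φ u) (φ v) ≤ K)
    (u v : V) : G'.dist (φ u) (φ v) ≤ K * G.dist u v := by
  obtain ⟨w, hw⟩ := hG.exists_walk_length_eq_dist u v
  rw [← hw]
  clear hw
  induction w with
  | nil => simp
  | @cons u v w hadj p ih =>
    rw [SimpleGraph.Walk.length_cons, mul_add, mul_one]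
    have := hG'.dist_triangle (u := φ u) (v := φ v) (w := φ w)
    have := h u v hadj
    omega

section Map

variable {W : Type*} {G' : SimpleGraph W} {φ : V → W}
  {hφ : ∀ u v, G.Adj u v → φ u = φ v ∨ G'.Adj (φ u) (φ v)}

theorem map_vertex (u : V) : map φ hφ (vertex G u) = vertex G' (φ u) := by
  apply GeomReal.ext
  simp [map, vertex, Finsupp.mapDomain_single]

theorem coord_eq_pair (x : GeomReal G) {a b : V} (hab : a ≠ b)
    (h : (x.coord.support : Set V) ⊆ {a, b}) :
    x.coord = Finsupp.single a (x.coord a) + Finsupp.single b (x.coord b) := by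
  classical
  ext w
  rcases eq_or_ne w a with rfl | hwa
  · simp [hab.symm]
  rcases eq_or_ne w b with rfl | hwb
  · simp [hab]
  · simp [x.coord_eq_zero h hwa hwb, hwa.symm, hwb.symm]

/-- Simplicial maps are `1`-Lipschitz. -/
theorem dist_map_le [hG : Fact G.Connected] [hG' : Fact G'.Connected] (x y : GeomReal G) :
    dist (map φ hφ x) (map φ hφ y) ≤ dist x y := by
  classical
  -- Vertices with the same image have their weights added, so no coordinate decreases.
  have hcoord : ∀ (x : GeomReal G) (u : V), x.coord u ≤ (map φ hφ x).coord (φ u) := by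
    intro x u
    by_cases hu : u ∈ x.coord.support
    · change _ ≤ Finsupp.mapDomain φ x.coord (φ u)
      rw [Finsupp.mapDomain, Finsupp.sum, Finsupp.finsetSum_apply]
      refine le_trans (le_of_eq ?_) (Finset.single_le_sum (f := fun i =>
        (Finsupp.single (φ i) (x.coord i)) (φ u)) (fun i _ => ?_) hu)
      · simp
      · simp only [Finsupp.single_apply]
        split_ifs
        · exact x.coord_nonneg i
        · exact le_rfl
    · rw [Finsupp.notMem_support_iff.1 hu]
      exact coord_nonneg _ _
  have hvert : ∀ (x : GeomReal G) (u : V), u ∈ x.coord.support →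
      dist (map φ hφ x) (vertex G' (φ u)) ≤ 1 - x.coord u := by
    intro x u hu
    have h1 := (x.coord_nonneg u).lt_of_ne (Ne.symm (Finsupp.mem_support_iff.1 hu))
    have h2 := hcoord x u
    exact (dist_vertex_le (Finsupp.mem_support_iff.2 (by linarith))).trans (by linarith)
  have hdist : ∀ u v, G'.dist (φ u) (φ v) ≤ G.dist u v := by
    intro u v
    have := dist_le_mul_of_adj hG.out hG'.out (φ := φ) (K := 1) (fun u v h => by
      rcases hφ u v h with h | h
      · simp [h]
      · exact (SimpleGraph.dist_eq_one_iff_adj.2 h).le) u v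
    rwa [one_mul] at this
  rcases (pathLengths_nonempty x y).csInf_mem (pathLengths_finite x y) with
    ⟨u, hu, v, hv, h⟩ | ⟨a, b, ⟨hab, hx, hy⟩, h⟩
  · rw [show dist x y = _ from h]
    have h1 := dist_triangle4 (map φ hφ x) (vertex G' (φ u)) (vertex G' (φ v)) (map φ hφ y)
    rw [dist_vertex, dist_comm (vertex G' (φ v)) (map φ hφ y)] at h1
    have h2 : (G'.dist (φ u) (φ v) : ℝ) ≤ G.dist u v := Nat.cast_le.2 (hdist u v)
    linarith [hvert x u hu, hvert y v hv]
  · rw [show dist x y = _ from h]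
    rcases hab with rfl | hab
    · have h1 := dist_le_of_onEdge (x := x) (y := y) ⟨Or.inl rfl, hx, hy⟩
      rw [x.coord_self (by simpa using hx), y.coord_self (by simpa using hy), sub_self,
        abs_zero] at h1
      rw [dist_le_zero.1 h1]
      simp
    · have hc : ∀ z : GeomReal G, (z.coord.support : Set V) ⊆ {a, b} → (map φ hφ z).coord =
          Finsupp.single (φ a) (z.coord a) + Finsupp.single (φ b) (z.coord b) := by
        intro z hz
        change Finsupp.mapDomain φ z.coord = _
        conv_lhs => rw [z.coord_eq_pair hab.ne hz]
        rw [Finsupp.mapDomain_add, Finsupp.mapDomain_single, Finsupp.mapDomain_single]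
      rcases hφ a b hab with heq | hadj
      · have : map φ hφ x = map φ hφ y := by
          apply GeomReal.ext
          rw [hc x hx, hc y hy, heq, ← Finsupp.single_add, ← Finsupp.single_add,
            x.coord_add hab.ne hx, y.coord_add hab.ne hy]
        rw [this, dist_self]
        exact abs_nonneg _
      · have hs : ∀ z : GeomReal G, (z.coord.support : Set V) ⊆ {a, b} →
            ((map φ hφ z).coord.support : Set W) ⊆ {φ a, φ b} := by
          intro z hz w hw
          by_contra hne
          simp only [mem_insert_iff, mem_singleton_iff, not_or] at hne
          rw [Finset.mem_coe, Finsupp.mem_support_iff, hc z hz] at hw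
          exact hw (by simp [Ne.symm hne.1, Ne.symm hne.2])
        have h1 := dist_le_of_onEdge (x := map φ hφ x) (y := map φ hφ y)
          ⟨Or.inr hadj, hs x hx, hs y hy⟩
        have h2 : ∀ z : GeomReal G, (z.coord.support : Set V) ⊆ {a, b} →
            (map φ hφ z).coord (φ a) = z.coord a := by
          intro z hz
          rw [hc z hz]
          simp [hadj.ne']
        rwa [h2 x hx, h2 y hy] at h1

end Map

end GeomReal

/-! ### Homomorphisms from the fundamental group of a star of groups -/

namespace GraphOfGroups

variable {n : ℕ} {E : Type*} [Finite E] (𝒢 : GraphOfGroups n E)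

theorem t_rev (α : E × Bool) : 𝒢.t (α.1, !α.2) = (𝒢.t α)⁻¹ := by
  rw [eq_inv_iff_mul_eq_one]
  exact (QuotientGroup.eq_one_iff _).2 (Subgroup.subset_normalClosure (Or.inl (Or.inl ⟨α, rfl⟩)))

/-- No clause for inverses is needed, as the inverse of `t_α` is the generator of the reversed edge.
-/
theorem fundGroup_induction {p : 𝒢.FundGroup → Prop} (hι : ∀ v g, p (𝒢.ι v g))
    (ht : ∀ α, p (𝒢.t α)) (hmul : ∀ x y, p x → p y → p (x * y)) (x : 𝒢.FundGroup) : p x := by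
  have h1 : p 1 := by simpa using hι 0 1
  obtain ⟨x, rfl⟩ := QuotientGroup.mk'_surjective (Subgroup.normalClosure 𝒢.relators) x
  induction x using Monoid.Coprod.induction_on with
  | inl m =>
    induction m using Monoid.CoprodI.induction_on with
    | one => simpa using h1
    | of v y => exact hι v y
    | mul a b ha hb => simpa only [map_mul] using hmul _ _ ha hb
  | inr m =>
    induction m using FreeGroup.induction_on with
    | C1 => simpa using h1
    | of α => exact ht α
    | inv_of α h =>
      have := ht (α.1, !α.2)
      rw [t_rev] at this
      rw [map_inv, map_inv]
      exact this
    | mul a b ha hb => simpa only [map_mul] using hmul _ _ ha hb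
  | mul a b ha hb => simpa only [map_mul] using hmul _ _ ha hb

/-- In a star, the spanning tree consists of one edge from `0` to each other vertex. -/
theorem exists_tree_edges (star : ∀ e, 𝒢.vtx e true = 0 ∨ 𝒢.vtx e false = 0) :
    ∃ d : ∀ v : Fin (n + 1), v ≠ 0 → E × Bool,
      (∀ v hv, (d v hv).1 ∈ 𝒢.tree ∧ 𝒢.src (d v hv) = 0 ∧ 𝒢.tgt (d v hv) = v) ∧
      ∀ α : E × Bool, α.1 ∈ 𝒢.tree → ∃ v hv, α = d v hv ∨ α = ((d v hv).1, !(d v hv).2) := by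
  classical
  -- The direction in which an edge points away from `0`; a loop at `0` gets an arbitrary one.
  let dir : E → Bool := fun e => if 𝒢.vtx e false = 0 then true else false
  have hdir : ∀ e, 𝒢.vtx e (!dir e) = 0 := by
    intro e
    by_cases h : 𝒢.vtx e false = 0
    · simp [dir, h]
    · simpa [dir, h] using star e
  let far : E → Fin (n + 1) := fun e => 𝒢.vtx e (dir e)
  have hsurj : ∀ v ≠ 0, ∃ e ∈ 𝒢.tree, far e = v := by
    intro v hv
    rcases (𝒢.tree_connected 0 v).cases_tail with h | ⟨a, -, e, he, b, -, hb⟩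
    · exact absurd h hv
    · refine ⟨e, he, ?_⟩
      have : b = dir e := by
        by_contra hne
        have : b = !dir e := by
          revert hne; cases b <;> cases dir e <;> simp
        rw [this, hdir] at hb
        exact hv hb.symm
      rw [← hb, this]
  have hsub : Finset.univ.erase (0 : Fin (n + 1)) ⊆ 𝒢.tree.image far := by
    intro v hv
    obtain ⟨e, he, hev⟩ := hsurj v (Finset.ne_of_mem_erase hv)
    exact Finset.mem_image.2 ⟨e, he, hev⟩
  have hcard : (Finset.univ.erase (0 : Fin (n + 1))).card = n := by
    rw [Finset.card_erase_of_mem (Finset.mem_univ _)]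
    simp
  have hle : (𝒢.tree.image far).card ≤ n := Finset.card_image_le.trans 𝒢.tree_card.le
  have heq : Finset.univ.erase (0 : Fin (n + 1)) = 𝒢.tree.image far :=
    Finset.eq_of_subset_of_card_le hsub (hle.trans hcard.ge)
  -- The `n` edges of the tree have exactly the `n` nonzero vertices as far ends, so no two share
  -- one.
  have hinj : Set.InjOn far 𝒢.tree := by
    rw [← Finset.card_image_iff, ← heq, hcard, 𝒢.tree_card]
  choose e he hfar using hsurj
  refine ⟨fun v hv => (e v hv, dir (e v hv)), fun v hv => ⟨he v hv, hdir _, hfar v hv⟩, ?_⟩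
  rintro ⟨e', b⟩ he'
  have h0 : far e' ≠ 0 := by
    have : far e' ∈ 𝒢.tree.image far := Finset.mem_image_of_mem _ he'
    rw [← heq] at this
    exact Finset.ne_of_mem_erase this
  have hee : e (far e') h0 = e' := hinj (he _ h0) he' (hfar _ h0)
  refine ⟨far e', h0, ?_⟩
  simp only [hee, Prod.mk.injEq, true_and]
  cases b <;> cases dir e' <;> simp

/-- Compatible homomorphisms from the vertex groups extend to the fundamental group, up to
conjugation. -/
theorem exists_hom (star : ∀ e, 𝒢.vtx e true = 0 ∨ 𝒢.vtx e false = 0) {P : Type*} [Group P]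
    (φ : ∀ v, 𝒢.G v →* P) (τ : E × Bool → P) (hτ : ∀ α, τ (α.1, !α.2) = (τ α)⁻¹)
    (hconj : ∀ (α : E × Bool) (h : 𝒢.H α.1),
      φ _ (𝒢.f α.1 (!α.2) h) = τ α * φ _ (𝒢.f α.1 α.2 h) * (τ α)⁻¹) :
    ∃ (θ : Fin (n + 1) → P) (ψ : 𝒢.FundGroup →* P),
      (∀ v, θ v = 1 ∨ ∃ α : E × Bool, α.1 ∈ 𝒢.tree ∧ θ v = τ α) ∧
      (∀ v g, ψ (𝒢.ι v g) = θ v * φ v g * (θ v)⁻¹) ∧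
      ∀ α, ψ (𝒢.t α) = θ (𝒢.src α) * τ α * (θ (𝒢.tgt α))⁻¹ := by
  classical
  obtain ⟨d, hd, hd'⟩ := 𝒢.exists_tree_edges star
  -- The data need not send tree edges to `1`. Conjugating at `v` by the value of `τ` on the tree
  -- edge from `0` to `v` corrects this.
  let θ : Fin (n + 1) → P := fun v => if hv : v = 0 then 1 else τ (d v hv)
  let F : 𝒢.FG →* P := Monoid.Coprod.lift
    (Monoid.CoprodI.lift fun v => (MulAut.conj (θ v)).toMonoidHom.comp (φ v))
    (FreeGroup.lift fun α => θ (𝒢.src α) * τ α * (θ (𝒢.tgt α))⁻¹)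
  have hFv : ∀ v g, F (𝒢.vertexInFG v g) = θ v * φ v g * (θ v)⁻¹ := by
    intro v g
    simp [F, vertexInFG]
  have hFt : ∀ α, F (𝒢.tInFG α) = θ (𝒢.src α) * τ α * (θ (𝒢.tgt α))⁻¹ := by
    intro α
    simp [F, tInFG]
  have hrev : ∀ α : E × Bool, F (𝒢.tInFG (α.1, !α.2)) = (F (𝒢.tInFG α))⁻¹ := by
    intro α
    rw [hFt, hFt, hτ]
    simp [src, tgt, mul_assoc]
  have hker : Subgroup.normalClosure 𝒢.relators ≤ F.ker := by
    refine Subgroup.normalClosure_le_normal ?_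
    rintro x ((⟨α, rfl⟩ | ⟨α, hα, rfl⟩) | ⟨α, h, rfl⟩)
    · simp only [SetLike.mem_coe, MonoidHom.mem_ker, map_mul, hrev, inv_mul_cancel]
    · simp only [SetLike.mem_coe, MonoidHom.mem_ker]
      obtain ⟨v, hv, hαv⟩ := hd' α hα
      have h1 : F (𝒢.tInFG (d v hv)) = 1 := by
        rw [hFt, (hd v hv).2.1, (hd v hv).2.2]
        simp [θ, hv]
      rcases hαv with rfl | rfl
      · exact h1
      · rw [hrev, h1, inv_one]
    · simp only [SetLike.mem_coe, MonoidHom.mem_ker, map_mul, map_inv]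
      rw [hFv, hFv, hFt, hconj]
      simp only [src, tgt]
      group
  refine ⟨θ, QuotientGroup.lift _ F hker, fun v => ?_, hFv, hFt⟩
  by_cases hv : v = 0
  · exact Or.inl (dif_pos hv)
  · exact Or.inr ⟨d v hv, (hd v hv).1, dif_neg hv⟩

/-! ### The signed number of crossings of an edge of the Bass–Serre tree -/

open Classical in
/-- Change of the crossing number of the base edge over `α` on the way from `((t_β x)⁻¹, β⁻)`
back to `(x⁻¹, β⁺)`. -/
noncomputable def crossStep (α β : E × Bool) (x : 𝒢.FundGroup) : ℤ :=
  (if (β.1, !β.2) = α ∧ 𝒢.t β * x ∈ 𝒢.edgeSubgroup α then 1 else 0) -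
    (if β = α ∧ x ∈ 𝒢.edgeSubgroup α then 1 else 0)

/-- Crossing an edge backwards cancels its contribution; this makes the permutation of the reversed
edge the inverse in `exists_crossing`. -/
theorem crossStep_rev (α β : E × Bool) (x : 𝒢.FundGroup) :
    𝒢.crossStep α (β.1, !β.2) (𝒢.t β * x) = -𝒢.crossStep α β x := by
  have h1 : 𝒢.t (β.1, !β.2) * (𝒢.t β * x) = x := by rw [t_rev, inv_mul_cancel_left]
  unfold crossStep
  rw [h1, show ((β.1, !!β.2) : E × Bool) = β by simp]
  ring

/-- The edge group does not change which edge of the tree is crossed, as needed for the conjugation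
relation in `exists_crossing`. -/
theorem crossStep_edge (α β : E × Bool) (h : 𝒢.H β.1) (x : 𝒢.FundGroup) :
    𝒢.crossStep α β (𝒢.ι _ (𝒢.f β.1 β.2 h) * x) = 𝒢.crossStep α β x := by
  have h1 : ∀ γ : E × Bool, ∀ h : 𝒢.H γ.1, ∀ x, (𝒢.ι _ (𝒢.f γ.1 γ.2 h) * x ∈ 𝒢.edgeSubgroup γ ↔
      x ∈ 𝒢.edgeSubgroup γ) := by
    intro γ h x
    exact Subgroup.mul_mem_cancel_left _ ⟨h, rfl⟩
  have h2 : 𝒢.t β * (𝒢.ι _ (𝒢.f β.1 β.2 h) * x) = 𝒢.ι _ (𝒢.f β.1 (!β.2) h) * (𝒢.t β * x) := by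
    rw [𝒢.t_conj]
    group
  unfold crossStep
  rw [h2]
  congr 1
  · by_cases hβ : (β.1, !β.2) = α
    · subst hβ
      have := h1 (β.1, !β.2) h (𝒢.t β * x)
      split_ifs with a b b
      · rfl
      · exact absurd ⟨a.1, this.1 a.2⟩ b
      · exact absurd ⟨b.1, this.2 b.2⟩ a
      · rfl
    · simp [hβ]
  · by_cases hβ : β = α
    · subst hβ
      have := h1 β h x
      split_ifs with a b b
      · rfl
      · exact absurd ⟨a.1, this.1 a.2⟩ b
      · exact absurd ⟨b.1, this.2 b.2⟩ a
      · rfl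
    · simp [hβ]

/-- Let vertex groups act on `FundGroup × ℤ` by left translation of the first factor, and let `t_β`
in addition change the integer by `crossStep`. The relations hold, so up to conjugation by `θ` the
fundamental group acts. The integer coordinate of the image of `(1, 0)` under `g⁻¹`, corrected by `θ
v`, counts signed crossings of the base edge over `α`: it is constant on cosets of vertex groups,
and changes across an edge of the tree only if this edge is the base edge over `α` or its reverse.
-/
theorem exists_crossing (star : ∀ e, 𝒢.vtx e true = 0 ∨ 𝒢.vtx e false = 0) (α : E × Bool) :
    ∃ χ : 𝒢.XVert → ℤ, (∀ g v s, χ (g * 𝒢.ι v s, v) = χ (g, v)) ∧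
      ∀ β g, χ (g, 𝒢.src β) = χ (g * 𝒢.t β, 𝒢.tgt β) + 𝒢.crossStep α β (g * 𝒢.t β)⁻¹ := by
  let φ : ∀ v, 𝒢.G v →* Equiv.Perm (𝒢.FundGroup × ℤ) := fun v =>
    { toFun := fun w => (Equiv.mulLeft (𝒢.ι v w)).prodCongr (Equiv.refl ℤ)
      map_one' := by ext x <;> simp
      map_mul' := fun a b => by ext x <;> simp [mul_assoc] }
  let τ : E × Bool → Equiv.Perm (𝒢.FundGroup × ℤ) := fun β =>
    { toFun := fun x => (𝒢.t β * x.1, x.2 + 𝒢.crossStep α β x.1)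
      invFun := fun x => ((𝒢.t β)⁻¹ * x.1, x.2 - 𝒢.crossStep α β ((𝒢.t β)⁻¹ * x.1))
      left_inv := fun x => by simp
      right_inv := fun x => by simp }
  have hτa : ∀ β x, τ β x = (𝒢.t β * x.1, x.2 + 𝒢.crossStep α β x.1) := fun _ _ => rfl
  have hφa : ∀ v w x, φ v w x = (𝒢.ι v w * x.1, x.2) := fun _ _ _ => rfl
  have hτ : ∀ β : E × Bool, τ (β.1, !β.2) = (τ β)⁻¹ := by
    intro β
    rw [eq_inv_iff_mul_eq_one]
    ext x
    · simp [hτa, t_rev]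
    · simp [hτa, crossStep_rev]
  obtain ⟨θ, ψ, hθ, hψι, hψt⟩ := 𝒢.exists_hom star φ τ hτ (by
    intro β h
    rw [eq_mul_inv_iff_mul_eq]
    ext x
    · simp [hτa, hφa, 𝒢.t_conj, mul_assoc]
    · simp [hτa, hφa, crossStep_edge])
  have hθ1 : ∀ v x, (θ v x).1 = x.1 := by
    intro v x
    rcases hθ v with h | ⟨β, hβ, h⟩
    · simp [h]
    · simp [h, hτa, 𝒢.t_tree hβ]
  have hθ2 : ∀ v x, ((θ v)⁻¹ x).1 = x.1 := by
    intro v x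
    rw [← hθ1 v, ← Equiv.Perm.mul_apply, mul_inv_cancel, Equiv.Perm.one_apply]
  have hψ1 : ∀ y x, (ψ y x).1 = y * x.1 := by
    refine fun y => 𝒢.fundGroup_induction (p := fun y => ∀ x, (ψ y x).1 = y * x.1) ?_ ?_ ?_ y
    · intro v g x
      rw [hψι]
      simp only [Equiv.Perm.mul_apply, hθ1, hθ2, hφa]
    · intro β x
      rw [hψt]
      simp only [Equiv.Perm.mul_apply, hθ1, hθ2, hτa]
    · intro a b ha hb x
      rw [map_mul, Equiv.Perm.mul_apply, ha, hb, mul_assoc]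
  refine ⟨fun x => ((θ x.2)⁻¹ (ψ x.1⁻¹ (1, 0))).2, ?_, ?_⟩
  · intro g v s
    have : (θ v)⁻¹ * ψ (g * 𝒢.ι v s)⁻¹ = φ v s⁻¹ * ((θ v)⁻¹ * ψ g⁻¹) := by
      rw [mul_inv_rev, map_mul, ← map_inv, hψι]
      group
    have h := congrArg (fun p : Equiv.Perm (𝒢.FundGroup × ℤ) => (p (1, 0)).2) this
    simp only [Equiv.Perm.mul_apply, hφa] at h
    exact h
  · intro β g
    have : (θ (𝒢.src β))⁻¹ * ψ g⁻¹ = τ β * ((θ (𝒢.tgt β))⁻¹ * ψ (g * 𝒢.t β)⁻¹) := by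
      rw [mul_inv_rev, map_mul, map_inv ψ (𝒢.t β), hψt]
      group
    have h := congrArg (fun p : Equiv.Perm (𝒢.FundGroup × ℤ) => (p (1, 0)).2) this
    simp only [Equiv.Perm.mul_apply, hτa, hθ2, hψ1, mul_one] at h
    exact h

end GraphOfGroups

theorem SimpleGraph.Walk.exists_crossing {V : Type*} {G : SimpleGraph V} {u v : V}
    (w : G.Walk u v) {S : V → Prop} (hu : ¬ S u) (hv : S v) :
    ∃ (a b : V) (w₁ : G.Walk u a) (w₂ : G.Walk b v), G.Adj a b ∧ ¬ S a ∧ S b ∧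
      w.length = w₁.length + 1 + w₂.length := by
  induction w with
  | nil => exact absurd hv hu
  | @cons u u' v h p ih =>
    by_cases hS : S u'
    · exact ⟨u, u', .nil, p, h, hu, hS, by simp [add_comm]⟩
    · obtain ⟨a, b, w₁, w₂, hab, ha, hb, hl⟩ := ih hS hv
      exact ⟨a, b, .cons h w₁, w₂, hab, ha, hb, by simp [hl]; ring⟩

/-! ### Vertex groups embed in the fundamental group -/

/-- For a subgroup acting on `K × List K` by left translations, the orbit decomposition is
indexed by `List K`. -/
theorem exists_equiv_prod_list {H K : Type*} [Group H] [Group K] (j : H →* K)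
    (hj : Function.Injective j) : ∃ F : K × List K ≃ H × List K,
      ∀ h k i, F (j h * k, i) = (h * (F (k, i)).1, (F (k, i)).2) := by
  let r : Setoid (K × List K) :=
    { r := fun x y => ∃ h, y = (j h * x.1, x.2)
      iseqv := by
        refine ⟨fun x => ⟨1, by simp⟩, ?_, ?_⟩
        · rintro x y ⟨h, rfl⟩
          exact ⟨h⁻¹, by simp⟩
        · rintro x y z ⟨h, rfl⟩ ⟨h', rfl⟩
          exact ⟨h' * h, by simp [mul_assoc]⟩ }
  have hex : ∀ x : K × List K, ∃ h, x = (j h * (Quotient.mk r x).out.1, (Quotient.mk r x).out.2) :=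
    fun x => Quotient.exact (Quotient.out_eq (Quotient.mk r x))
  choose c hc using hex
  let F₁ : K × List K ≃ H × Quotient r :=
    { toFun := fun x => (c x, Quotient.mk r x)
      invFun := fun y => (j y.1 * y.2.out.1, y.2.out.2)
      left_inv := fun x => (hc x).symm
      right_inv := by
        rintro ⟨h, q⟩
        have hq : Quotient.mk r (j h * q.out.1, q.out.2) = q := by
          conv_rhs => rw [← q.out_eq]
          exact (Quotient.sound ⟨h, rfl⟩ : Quotient.mk r q.out = _).symm
        refine Prod.ext ?_ hq
        have := hc (j h * q.out.1, q.out.2)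
        rw [hq] at this
        have := (Prod.ext_iff.1 this).1
        exact (hj (mul_right_cancel this)).symm }
  have hF₁ : ∀ h k i, F₁ (j h * k, i) = (h * (F₁ (k, i)).1, (F₁ (k, i)).2) := by
    intro h k i
    have hq : Quotient.mk r (j h * k, i) = Quotient.mk r (k, i) :=
      (Quotient.sound ⟨h, rfl⟩ : Quotient.mk r (k, i) = _).symm
    refine Prod.ext ?_ hq
    change c (j h * k, i) = h * c (k, i)
    have h1 := (Prod.ext_iff.1 (hc (j h * k, i))).1
    have h2 := (Prod.ext_iff.1 (hc (k, i))).1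
    rw [hq] at h1
    simp only at h1 h2
    apply hj
    rw [map_mul]
    apply mul_right_cancel (b := (Quotient.mk r (k, i)).out.1)
    rw [← h1, mul_assoc, ← h2]
  -- The orbits embed in `List K` by putting the first coordinate of a representative in front of
  -- the list. Conversely `List K` embeds in the orbits, since the second coordinate is fixed by the
  -- action. By Schröder–Bernstein the number of orbits does not depend on `H`.
  let i₁ : Quotient r ↪ List K :=
    ⟨fun q => q.out.1 :: q.out.2, fun q q' h => by
      simp only [List.cons.injEq] at h
      rw [← q.out_eq, ← q'.out_eq, Prod.ext h.1 h.2]⟩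
  let i₂ : List K ↪ Quotient r :=
    ⟨fun i => Quotient.mk r (1, i), fun i i' h => by
      obtain ⟨x, hx⟩ := Quotient.exact h
      exact (Prod.ext_iff.1 hx).2.symm⟩
  obtain ⟨e⟩ := Function.Embedding.antisymm i₁ i₂
  exact ⟨F₁.trans ((Equiv.refl H).prodCongr e), fun h k i => by simp [hF₁]⟩

namespace GraphOfGroups

variable {n : ℕ} {E : Type*} [Finite E] (𝒢 : GraphOfGroups n E)

/-- All edges are incident to the vertex `0`. -/
def IsStar : Prop := ∀ e, 𝒢.vtx e true = 0 ∨ 𝒢.vtx e false = 0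

variable {𝒢}

/-- Let `K` be the product of all vertex groups. Each vertex group acts faithfully on `K × List K`
by left translation. Both images of an edge group act freely with orbits indexed by `List K`, so a
permutation conjugates one action into the other and can serve as the image of `t_α`. The resulting
homomorphism is, up to conjugation, faithful on each vertex group. -/
theorem ι_injective (star : 𝒢.IsStar) (v : Fin (n + 1)) : Function.Injective (𝒢.ι v) := by
  classical
  let K := ∀ v, 𝒢.G v
  let φ : ∀ v, 𝒢.G v →* Equiv.Perm (K × List K) := fun v =>
    { toFun := fun w => (Equiv.mulLeft (Pi.mulSingle v w : K)).prodCongr (Equiv.refl _)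
      map_one' := by ext1 x; simp
      map_mul' := fun a b => by
        ext1 x
        exact Prod.ext (by simp [Pi.mulSingle_mul, mul_assoc]) rfl }
  have hφ : ∀ v w x, φ v w x = (Pi.mulSingle v w * x.1, x.2) := fun _ _ _ => rfl
  let j : ∀ e b, 𝒢.H e →* K := fun e b => (MonoidHom.mulSingle 𝒢.G (𝒢.vtx e b)).comp (𝒢.f e b)
  have hj : ∀ e b, Function.Injective (j e b) := fun e b =>
    (Pi.mulSingle_injective (M := 𝒢.G) (𝒢.vtx e b)).comp (𝒢.f_inj e b)
  choose F hF using fun e b => exists_equiv_prod_list (j e b) (hj e b)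
  let T : E → Equiv.Perm (K × List K) := fun e => (F e true).trans (F e false).symm
  have hT : ∀ e h, φ _ (𝒢.f e false h) * T e = T e * φ _ (𝒢.f e true h) := by
    intro e h
    ext1 x
    rw [Equiv.Perm.mul_apply, Equiv.Perm.mul_apply]
    apply (F e false).injective
    have h1 := hF e false h (T e x).1 (T e x).2
    have h2 := hF e true h x.1 x.2
    rw [show φ (𝒢.vtx e false) (𝒢.f e false h) (T e x) = (j e false h * (T e x).1, (T e x).2) from rfl,
      show φ (𝒢.vtx e true) (𝒢.f e true h) x = (j e true h * x.1, x.2) from rfl, h1]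
    simp [T, h2]
  let τ : E × Bool → Equiv.Perm (K × List K) := fun α => cond α.2 (T α.1) (T α.1)⁻¹
  obtain ⟨θ, ψ, -, hψ, -⟩ := 𝒢.exists_hom star φ τ (by rintro ⟨e, _ | _⟩ <;> simp [τ]) (by
    rintro ⟨e, _ | _⟩ h
    · change φ _ (𝒢.f e true h) = (T e)⁻¹ * φ _ (𝒢.f e false h) * ((T e)⁻¹)⁻¹
      rw [inv_inv, mul_assoc, hT, inv_mul_cancel_left]
    · change φ _ (𝒢.f e false h) = T e * φ _ (𝒢.f e true h) * (T e)⁻¹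
      rw [← hT, mul_inv_cancel_right])
  intro a b hab
  have h1 := congrArg ψ hab
  rw [hψ, hψ, mul_left_inj, mul_right_inj] at h1
  have h2 := congrArg (fun p : Equiv.Perm (K × List K) => (p (1, [])).1) h1
  simp only [hφ, mul_one] at h2
  exact Pi.mulSingle_injective (M := 𝒢.G) v h2

variable (𝒢)

/-! ### The Bass–Serre tree -/

/-- The projection of the vertices of the Bass–Serre space to the Bass–Serre tree. -/
def proj (x : 𝒢.XVert) : 𝒢.TVert := ⟨x.2, (x.1 : 𝒢.FundGroup ⧸ 𝒢.vertexSubgroup x.2)⟩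

theorem proj_surjective (u : 𝒢.TVert) : ∃ x, 𝒢.proj x = u := by
  obtain ⟨v, q⟩ := u
  obtain ⟨g, rfl⟩ := QuotientGroup.mk_surjective q
  exact ⟨(g, v), rfl⟩

theorem proj_eq_iff {g g' : 𝒢.FundGroup} {v : Fin (n + 1)} :
    𝒢.proj (g, v) = 𝒢.proj (g', v) ↔ ∃ s, g' = g * 𝒢.ι v s := by
  simp only [proj, Sigma.mk.injEq, heq_eq_eq, true_and]
  rw [QuotientGroup.eq]
  constructor
  · rintro ⟨s, hs⟩
    exact ⟨s, by rw [hs, mul_inv_cancel_left]⟩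
  · rintro ⟨s, rfl⟩
    exact ⟨s, by simp⟩

/-- The reverse of an edge of the Bass–Serre tree. -/
def trev (ε : 𝒢.TEdge) : 𝒢.TEdge :=
  ⟨(ε.1.1, !ε.1.2), Quotient.map' (s₁ := QuotientGroup.leftRel (𝒢.edgeSubgroup ε.1))
    (s₂ := QuotientGroup.leftRel (𝒢.edgeSubgroup (ε.1.1, !ε.1.2)))
    (fun g => g * (𝒢.t ε.1)⁻¹) (by
      intro a b h
      rw [QuotientGroup.leftRel_apply] at h ⊢
      obtain ⟨x, hx⟩ := h
      refine ⟨x, ?_⟩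
      have h1 := 𝒢.t_conj ε.1 x
      have h2 : 𝒢.ι _ (𝒢.f ε.1.1 ε.1.2 x) = a⁻¹ * b := hx
      rw [h2] at h1
      refine Eq.trans h1 ?_
      group) ε.2⟩

theorem tedge_cases (ε : 𝒢.TEdge) : ∃ (β : E × Bool) (g : 𝒢.FundGroup),
    ε = ⟨β, (g : 𝒢.FundGroup ⧸ 𝒢.edgeSubgroup β)⟩ := by
  obtain ⟨β, q⟩ := ε
  obtain ⟨g, rfl⟩ := QuotientGroup.mk_surjective q
  exact ⟨β, g, rfl⟩

theorem tSrc_mk (β : E × Bool) (g : 𝒢.FundGroup) :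
    𝒢.tSrc ⟨β, (g : 𝒢.FundGroup ⧸ 𝒢.edgeSubgroup β)⟩ = 𝒢.proj (g * (𝒢.t β)⁻¹, 𝒢.src β) := rfl

theorem tTgt_mk (β : E × Bool) (g : 𝒢.FundGroup) :
    𝒢.tTgt ⟨β, (g : 𝒢.FundGroup ⧸ 𝒢.edgeSubgroup β)⟩ = 𝒢.proj (g, 𝒢.tgt β) := rfl

theorem trev_mk (β : E × Bool) (g : 𝒢.FundGroup) :
    𝒢.trev ⟨β, (g : 𝒢.FundGroup ⧸ 𝒢.edgeSubgroup β)⟩ =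
      ⟨(β.1, !β.2), ((g * (𝒢.t β)⁻¹ : 𝒢.FundGroup) : 𝒢.FundGroup ⧸ _)⟩ := rfl

theorem tTgt_trev (ε : 𝒢.TEdge) : 𝒢.tTgt (𝒢.trev ε) = 𝒢.tSrc ε := by
  obtain ⟨β, g, rfl⟩ := 𝒢.tedge_cases ε
  rfl

theorem trev_trev (ε : 𝒢.TEdge) : 𝒢.trev (𝒢.trev ε) = ε := by
  obtain ⟨⟨e, b⟩, g, rfl⟩ := 𝒢.tedge_cases ε
  rw [trev_mk, trev_mk, 𝒢.t_rev (e, b), inv_inv, inv_mul_cancel_right]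
  cases b <;> rfl

theorem tSrc_trev (ε : 𝒢.TEdge) : 𝒢.tSrc (𝒢.trev ε) = 𝒢.tTgt ε := by
  rw [← tTgt_trev, trev_trev]

/-- The vertices of the Bass–Serre space over the same vertex of the tree, or an edge over an edge
of the tree. -/
theorem adj_cases {x y : 𝒢.XVert} (h : 𝒢.xGraph.Adj x y) :
    (∃ s ∈ 𝒢.SG x.2, y = (x.1 * 𝒢.ι x.2 s, x.2)) ∨
    ∃ ε, 𝒢.tSrc ε = 𝒢.proj x ∧ 𝒢.tTgt ε = 𝒢.proj y ∧ y ∈ 𝒢.edgeFibre ε ∧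
      x ∈ 𝒢.edgeFibre (𝒢.trev ε) := by
  rw [xGraph, SimpleGraph.fromRel_adj] at h
  obtain ⟨-, (⟨s, hs, rfl⟩ | ⟨α, hα, rfl⟩) | (⟨s, hs, rfl⟩ | ⟨α, hα, rfl⟩)⟩ := h
  · exact Or.inl ⟨s, hs, rfl⟩
  · right
    obtain ⟨g, v⟩ := x
    simp only at hα
    subst hα
    refine ⟨⟨α, ((g * 𝒢.t α : 𝒢.FundGroup) : 𝒢.FundGroup ⧸ _)⟩, ?_, rfl, ⟨rfl, rfl⟩, rfl, ?_⟩
    · rw [tSrc_mk, mul_inv_cancel_right]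
    · rw [trev_mk, mul_inv_cancel_right]
  · left
    exact ⟨s⁻¹, 𝒢.SG_symm _ s hs, by simp⟩
  · right
    obtain ⟨g, v⟩ := y
    simp only at hα
    subst hα
    refine ⟨𝒢.trev ⟨α, ((g * 𝒢.t α : 𝒢.FundGroup) : 𝒢.FundGroup ⧸ _)⟩, ?_, ?_, ?_, ?_⟩
    · rw [tSrc_trev]; rfl
    · rw [tTgt_trev, tSrc_mk, mul_inv_cancel_right]
    · refine ⟨rfl, ?_⟩
      rw [trev_mk, mul_inv_cancel_right]
    · rw [trev_trev]
      exact ⟨rfl, rfl⟩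

theorem proj_of_mem_edgeFibre {ε : 𝒢.TEdge} {x : 𝒢.XVert} (h : x ∈ 𝒢.edgeFibre ε) :
    𝒢.proj x = 𝒢.tTgt ε := by
  obtain ⟨β, g, rfl⟩ := 𝒢.tedge_cases ε
  obtain ⟨x, v⟩ := x
  obtain ⟨h1, h2⟩ := h
  simp only at h1 h2
  subst h1
  rw [tTgt_mk, proj_eq_iff]
  rw [QuotientGroup.eq] at h2
  obtain ⟨s, hs⟩ := h2
  exact ⟨𝒢.f β.1 β.2 s, by
    rw [show 𝒢.ι (𝒢.tgt β) (𝒢.f β.1 β.2 s) = x⁻¹ * g from hs, mul_inv_cancel_left]⟩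

theorem exists_adj_of_mem_edgeFibre {ε : 𝒢.TEdge} {x : 𝒢.XVert} (h : x ∈ 𝒢.edgeFibre ε) :
    ∃ y ∈ 𝒢.edgeFibre (𝒢.trev ε), x = y ∨ 𝒢.xGraph.Adj x y := by
  obtain ⟨β, g, rfl⟩ := 𝒢.tedge_cases ε
  obtain ⟨x, v⟩ := x
  obtain ⟨h1, h2⟩ := h
  simp only at h1 h2
  subst h1
  refine ⟨(x * (𝒢.t β)⁻¹, 𝒢.src β), ⟨rfl, ?_⟩, ?_⟩
  · rw [trev_mk]
    have h3 : 𝒢.trev ⟨β, (x : 𝒢.FundGroup ⧸ 𝒢.edgeSubgroup β)⟩ = 𝒢.trev ⟨β, g⟩ := by rw [h2]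
    rw [trev_mk, trev_mk, Sigma.mk.injEq] at h3
    exact eq_of_heq h3.2
  · by_cases he : ((x, 𝒢.tgt β) : 𝒢.XVert) = (x * (𝒢.t β)⁻¹, 𝒢.src β)
    · exact Or.inl he
    · right
      rw [xGraph, SimpleGraph.fromRel_adj]
      exact ⟨he, Or.inr (Or.inr ⟨β, rfl, by simp⟩)⟩

/-- `u` lies on the side of the target of `ε` in the Bass–Serre tree. -/
def Beyond (ε : 𝒢.TEdge) (u : 𝒢.TVert) : Prop :=
  ∀ S : 𝒢.TVert → Prop, ¬ S (𝒢.tSrc ε) → S (𝒢.tTgt ε) →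
    (∀ ε', ε' ≠ ε → ε' ≠ 𝒢.trev ε → (S (𝒢.tSrc ε') ↔ S (𝒢.tTgt ε'))) → S u

theorem beyond_tgt (ε : 𝒢.TEdge) : 𝒢.Beyond ε (𝒢.tTgt ε) := fun _ _ h _ => h

theorem beyond_iff {ε ε' : 𝒢.TEdge} (h : ε' ≠ ε) (h' : ε' ≠ 𝒢.trev ε) :
    𝒢.Beyond ε (𝒢.tSrc ε') ↔ 𝒢.Beyond ε (𝒢.tTgt ε') :=
  ⟨fun hb S h1 h2 h3 => (h3 ε' h h').1 (hb S h1 h2 h3),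
    fun hb S h1 h2 h3 => (h3 ε' h h').2 (hb S h1 h2 h3)⟩

theorem bsTree_adj_of_edge {ε : 𝒢.TEdge} (h : 𝒢.tSrc ε ≠ 𝒢.tTgt ε) :
    𝒢.bsTree.Adj (𝒢.tSrc ε) (𝒢.tTgt ε) := by
  rw [bsTree, SimpleGraph.fromRel_adj]
  exact ⟨h, Or.inl ⟨ε, rfl, rfl⟩⟩

theorem exists_edge_of_adj {u v : 𝒢.TVert} (h : 𝒢.bsTree.Adj u v) :
    ∃ ε, 𝒢.tSrc ε = u ∧ 𝒢.tTgt ε = v := by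
  rw [bsTree, SimpleGraph.fromRel_adj] at h
  obtain ⟨-, ⟨ε, h1, h2⟩ | ⟨ε, h1, h2⟩⟩ := h
  · exact ⟨ε, h1, h2⟩
  · exact ⟨𝒢.trev ε, by rw [tSrc_trev, h2], by rw [tTgt_trev, h1]⟩

theorem proj_eq_or_adj {x y : 𝒢.XVert} (h : 𝒢.xGraph.Adj x y) :
    𝒢.proj x = 𝒢.proj y ∨ 𝒢.bsTree.Adj (𝒢.proj x) (𝒢.proj y) := by
  rcases 𝒢.adj_cases h with ⟨s, -, rfl⟩ | ⟨ε, h1, h2, -, -⟩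
  · exact Or.inl (𝒢.proj_eq_iff.2 ⟨s, rfl⟩)
  · rw [← h1, ← h2]
    by_cases hne : 𝒢.tSrc ε = 𝒢.tTgt ε
    · exact Or.inl hne
    · exact Or.inr (𝒢.bsTree_adj_of_edge hne)

theorem bsTree_connected : 𝒢.bsTree.Connected := by
  have : Nonempty 𝒢.TVert := ⟨𝒢.root⟩
  refine ⟨fun u v => ?_⟩
  obtain ⟨x, rfl⟩ := 𝒢.proj_surjective u
  obtain ⟨y, rfl⟩ := 𝒢.proj_surjective v
  obtain ⟨w⟩ := 𝒢.xGraph_connected x y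
  induction w with
  | nil => exact SimpleGraph.Reachable.refl _
  | cons h p ih =>
    rcases 𝒢.proj_eq_or_adj h with h | h
    · rwa [h]
    · exact h.reachable.trans ih

theorem bsTree_dist_le (x y : 𝒢.XVert) :
    𝒢.bsTree.dist (𝒢.proj x) (𝒢.proj y) ≤ 𝒢.xGraph.dist x y := by
  have := GeomReal.dist_le_mul_of_adj 𝒢.xGraph_connected 𝒢.bsTree_connected (φ := 𝒢.proj) (K := 1)
    (fun x y h => by
      rcases 𝒢.proj_eq_or_adj h with h | h
      · simp [h]
      · exact (SimpleGraph.dist_eq_one_iff_adj.2 h).le) x y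
  rwa [one_mul] at this

/-- A property of the target of `ε` which is inherited by neighbours holds on the whole side. -/
theorem beyond_induction {ε : 𝒢.TEdge} {Q : 𝒢.TVert → Prop} (h0 : Q (𝒢.tTgt ε))
    (h : ∀ ε', 𝒢.Beyond ε (𝒢.tSrc ε') → 𝒢.Beyond ε (𝒢.tTgt ε') → Q (𝒢.tSrc ε') → Q (𝒢.tTgt ε'))
    {u : 𝒢.TVert} (hu : 𝒢.Beyond ε u) : Q u := by
  have key : ∀ {a b : 𝒢.TVert}, 𝒢.bsTree.Walk a b → b = 𝒢.tTgt ε → 𝒢.Beyond ε a → Q a := by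
    intro a b w hb
    subst hb
    generalize hb : 𝒢.tTgt ε = b at w
    induction w with
    | nil => exact fun _ => hb ▸ h0
    | @cons a a' b hadj p ih =>
      intro ha
      obtain ⟨ε', rfl, rfl⟩ := 𝒢.exists_edge_of_adj hadj
      by_cases ha' : 𝒢.Beyond ε (𝒢.tTgt ε')
      · have := h (𝒢.trev ε')
        rw [tSrc_trev, tTgt_trev] at this
        exact this ha' ha (ih hb ha')
      · by_cases h1 : ε' = ε
        · exact absurd (h1 ▸ 𝒢.beyond_tgt ε) ha'
        · by_cases h2 : ε' = 𝒢.trev ε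
          · rw [h2, tSrc_trev]
            exact h0
          · exact absurd ((𝒢.beyond_iff h1 h2).1 ha) ha'
  obtain ⟨w⟩ := 𝒢.bsTree_connected u (𝒢.tTgt ε)
  exact key w rfl hu

variable {𝒢} in
-- Edges other than `ε` and its reverse have both ends on the same side, and the reverse starts at
-- the target of `ε`.
theorem eq_of_crosses {ε ε' : 𝒢.TEdge} (h1 : ¬ 𝒢.Beyond ε (𝒢.tSrc ε'))
    (h2 : 𝒢.Beyond ε (𝒢.tTgt ε')) : ε' = ε := by
  by_contra hne
  by_cases hrev : ε' = 𝒢.trev ε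
  · rw [hrev, tSrc_trev] at h1
    exact h1 (𝒢.beyond_tgt ε)
  · exact h1 ((𝒢.beyond_iff hne hrev).2 h2)

variable {𝒢} in
-- A shortest path from `G_0` to a vertex beyond `ε` enters the far side, and it can do so only
-- through `ε`.
theorem dist_lt_of_not_beyond {ε : 𝒢.TEdge} (h : ¬ 𝒢.Beyond ε 𝒢.root) :
    𝒢.bsTree.dist 𝒢.root (𝒢.tSrc ε) < 𝒢.bsTree.dist 𝒢.root (𝒢.tTgt ε) ∧
    ∀ u, 𝒢.Beyond ε u → 𝒢.bsTree.dist 𝒢.root (𝒢.tTgt ε) ≤ 𝒢.bsTree.dist 𝒢.root u := by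
  have key : ∀ u, 𝒢.Beyond ε u → 𝒢.bsTree.dist 𝒢.root (𝒢.tSrc ε) < 𝒢.bsTree.dist 𝒢.root u ∧
      𝒢.bsTree.dist 𝒢.root (𝒢.tTgt ε) ≤ 𝒢.bsTree.dist 𝒢.root u := by
    intro u hu
    obtain ⟨w, hw⟩ := 𝒢.bsTree_connected.exists_walk_length_eq_dist 𝒢.root u
    obtain ⟨a, b, w₁, w₂, hab, ha, hb, hl⟩ := w.exists_crossing h hu
    obtain ⟨ε', rfl, rfl⟩ := 𝒢.exists_edge_of_adj hab
    obtain rfl := eq_of_crosses ha hb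
    have h1 := SimpleGraph.dist_le w₁
    have h2 := SimpleGraph.dist_le (w₁.concat hab)
    rw [SimpleGraph.Walk.length_concat] at h2
    omega
  exact ⟨(key _ (𝒢.beyond_tgt ε)).1, fun u hu => (key u hu).2⟩

/-! ### Every edge separates the Bass–Serre tree -/

section Star

variable {𝒢} (star : 𝒢.IsStar)
include star

/-- Since `Beyond` quantifies over all candidate sides, what has to be found is one set of vertices
which contains the target but not the source and is crossed by no edge except `ε` and its reverse.
The vertices whose crossing number for `ε` differs from that of the source form such a set. -/
theorem not_beyond_src (ε : 𝒢.TEdge) : ¬ 𝒢.Beyond ε (𝒢.tSrc ε) := by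
  obtain ⟨α, g₀, rfl⟩ := 𝒢.tedge_cases ε
  obtain ⟨χ, hχ, hχ'⟩ := 𝒢.exists_crossing star α
  let κ : 𝒢.XVert → ℤ := fun x => χ (g₀⁻¹ * x.1, x.2)
  have hκ : ∀ x y, 𝒢.proj x = 𝒢.proj y → κ x = κ y := by
    rintro ⟨g, v⟩ ⟨g', v'⟩ h
    obtain rfl : v = v' := congrArg Sigma.fst h
    obtain ⟨s, rfl⟩ := 𝒢.proj_eq_iff.1 h
    simp only [κ, ← mul_assoc, hχ]
  let S : 𝒢.TVert → Prop := fun u => ∃ x, 𝒢.proj x = u ∧ κ x ≠ κ (g₀ * (𝒢.t α)⁻¹, 𝒢.src α)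
  have hS : ∀ x, S (𝒢.proj x) ↔ κ x ≠ κ (g₀ * (𝒢.t α)⁻¹, 𝒢.src α) := by
    intro x
    constructor
    · rintro ⟨y, hy, hne⟩
      rwa [← hκ y x hy]
    · exact fun h => ⟨x, rfl, h⟩
  have hκ' : ∀ β g, κ (g * (𝒢.t β)⁻¹, 𝒢.src β) =
      κ (g, 𝒢.tgt β) + 𝒢.crossStep α β (g₀⁻¹ * g)⁻¹ := by
    intro β g
    have := hχ' β (g₀⁻¹ * (g * (𝒢.t β)⁻¹))
    simpa only [κ, mul_assoc, inv_mul_cancel, mul_one] using this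
  intro hb
  have := hb S
  rw [tSrc_mk, tTgt_mk, hS, hS] at this
  refine this (by simp) ?_ ?_ rfl
  · rw [hκ']
    unfold crossStep
    have : ¬ (α.1, !α.2) = α := by
      intro h
      have := (Prod.ext_iff.1 h).2
      simp at this
    simp [this, one_mem]
  · intro ε' h1 h2
    obtain ⟨β, g, rfl⟩ := 𝒢.tedge_cases ε'
    rw [tSrc_mk, tTgt_mk, hS, hS, hκ' β g]
    have : 𝒢.crossStep α β (g₀⁻¹ * g)⁻¹ = 0 := by
      unfold crossStep
      have e1 : ¬ ((β.1, !β.2) = α ∧ 𝒢.t β * (g₀⁻¹ * g)⁻¹ ∈ 𝒢.edgeSubgroup α) := by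
        rintro ⟨rfl, hmem⟩
        apply h2
        rw [← 𝒢.trev_trev ⟨β, _⟩, trev_mk]
        congr 2
        rw [QuotientGroup.eq]
        have := inv_mem hmem
        refine (Subgroup.inv_mem_iff _).1 ?_
        simpa [mul_assoc] using this
      have e2 : ¬ (β = α ∧ (g₀⁻¹ * g)⁻¹ ∈ 𝒢.edgeSubgroup α) := by
        rintro ⟨rfl, hmem⟩
        apply h1
        congr 1
        rw [QuotientGroup.eq]
        simpa using hmem
      rw [if_neg e1, if_neg e2, sub_zero]
    rw [this, add_zero]

theorem tSrc_ne_tTgt (ε : 𝒢.TEdge) : 𝒢.tSrc ε ≠ 𝒢.tTgt ε := fun h =>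
  not_beyond_src star ε (h ▸ 𝒢.beyond_tgt ε)

/-- The complement of the far side of `ε` is one of the sets over which `Beyond` quantifies for the
reversed edge. -/
theorem not_beyond_trev {ε : 𝒢.TEdge} {u : 𝒢.TVert} (h : 𝒢.Beyond ε u) :
    ¬ 𝒢.Beyond (𝒢.trev ε) u := by
  intro h'
  refine h' (fun u => ¬ 𝒢.Beyond ε u) ?_ ?_ ?_ h
  · rw [tSrc_trev, not_not]
    exact 𝒢.beyond_tgt ε
  · rw [tTgt_trev]
    exact not_beyond_src star ε
  · intro ε' h1 h2
    rw [trev_trev] at h2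
    exact not_congr (𝒢.beyond_iff h2 h1)

theorem outgoing_iff {ε : 𝒢.TEdge} : 𝒢.Outgoing ε ↔ ¬ 𝒢.Beyond ε 𝒢.root := by
  constructor
  · intro h hb
    have := (dist_lt_of_not_beyond (not_beyond_trev star hb)).1
    rw [tSrc_trev, tTgt_trev] at this
    exact lt_asymm h this
  · exact fun h => (dist_lt_of_not_beyond h).1

theorem dist_root_tTgt {ε : 𝒢.TEdge} (h : 𝒢.Outgoing ε) :
    𝒢.bsTree.dist 𝒢.root (𝒢.tTgt ε) = 𝒢.bsTree.dist 𝒢.root (𝒢.tSrc ε) + 1 := by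
  have h1 : 𝒢.bsTree.dist 𝒢.root (𝒢.tSrc ε) < 𝒢.bsTree.dist 𝒢.root (𝒢.tTgt ε) := h
  have h2 := 𝒢.bsTree_connected.dist_triangle (u := 𝒢.root) (v := 𝒢.tSrc ε) (w := 𝒢.tTgt ε)
  rw [SimpleGraph.dist_eq_one_iff_adj.2 (𝒢.bsTree_adj_of_edge (tSrc_ne_tTgt star ε))] at h2
  omega

/-- If the edges differed, the source of `ε'` would lie beyond `ε` although it is nearer to `G_0`
than the common target. -/
theorem outgoing_unique {ε ε' : 𝒢.TEdge} (h : 𝒢.Outgoing ε) (h' : 𝒢.Outgoing ε')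
    (heq : 𝒢.tTgt ε = 𝒢.tTgt ε') : ε = ε' := by
  by_contra hne
  have h1 : ε' ≠ 𝒢.trev ε := by
    rintro rfl
    rw [tTgt_trev] at heq
    exact tSrc_ne_tTgt star ε heq.symm
  have h2 : 𝒢.Beyond ε (𝒢.tSrc ε') := by
    rw [𝒢.beyond_iff (Ne.symm hne) h1, ← heq]
    exact 𝒢.beyond_tgt ε
  have h3 := (dist_lt_of_not_beyond ((outgoing_iff star).1 h)).2 _ h2
  rw [heq] at h3
  exact absurd h' (not_lt.2 h3)

/-- Moving about beyond `β`, one could leave the far side of `α` only through the reverse of `α`,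
which starts at the source of `β`; but this vertex is not beyond `β`. -/
theorem beyond_of_beyond {α β : 𝒢.TEdge} (hα : 𝒢.Outgoing α) (hβ : 𝒢.Outgoing β)
    (h : 𝒢.tSrc β = 𝒢.tTgt α) {u : 𝒢.TVert} (hu : 𝒢.Beyond β u) : 𝒢.Beyond α u := by
  refine 𝒢.beyond_induction (Q := 𝒢.Beyond α) ?_ ?_ hu
  · have h1 : β ≠ α := by
      rintro rfl
      exact tSrc_ne_tTgt star β h
    have h2 : β ≠ 𝒢.trev α := by
      rintro rfl
      rw [outgoing_iff star] at hα hβ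
      have := dist_lt_of_not_beyond hα
      have := dist_lt_of_not_beyond hβ
      rw [tSrc_trev, tTgt_trev] at this
      omega
    rw [← 𝒢.beyond_iff h1 h2, h]
    exact 𝒢.beyond_tgt α
  · intro ε' h1 h2 h3
    by_cases he : ε' = α
    · rw [he]; exact 𝒢.beyond_tgt α
    · by_cases he' : ε' = 𝒢.trev α
      · rw [he', tSrc_trev, ← h] at h1
        exact absurd h1 (not_beyond_src star β)
      · exact (𝒢.beyond_iff he he').1 h3

/-- The far side of `β` can be entered only through `β`, hence from the common source of both edges,
which is not beyond `α`. -/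
theorem not_beyond_of_beyond {α β : 𝒢.TEdge} (hα : 𝒢.Outgoing α) (hβ : 𝒢.Outgoing β)
    (h : 𝒢.tSrc α = 𝒢.tSrc β) (hne : α ≠ β) {u : 𝒢.TVert} (hu : 𝒢.Beyond α u) :
    ¬ 𝒢.Beyond β u := by
  refine 𝒢.beyond_induction (Q := fun u => ¬ 𝒢.Beyond β u) ?_ ?_ hu
  · have h2 : α ≠ 𝒢.trev β := by
      rintro rfl
      rw [tSrc_trev] at h
      exact tSrc_ne_tTgt star β h.symm
    rw [← 𝒢.beyond_iff hne h2, h]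
    exact not_beyond_src star β
  · intro ε' h1 h2 h3 h4
    obtain rfl := eq_of_crosses h3 h4
    rw [← h] at h1
    exact not_beyond_src star α h1

theorem outgoing_or_outgoing_trev (ε : 𝒢.TEdge) : 𝒢.Outgoing ε ∨ 𝒢.Outgoing (𝒢.trev ε) := by
  by_cases h : 𝒢.Beyond ε 𝒢.root
  · exact Or.inr ((outgoing_iff star).2 (not_beyond_trev star h))
  · exact Or.inl ((outgoing_iff star).2 h)

/-- A vertex beyond `α` is the target of `α` or lies beyond an outgoing edge from there. -/
theorem eq_or_beyond {α : 𝒢.TEdge} (hα : 𝒢.Outgoing α) {u : 𝒢.TVert} (hu : 𝒢.Beyond α u) :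
    u = 𝒢.tTgt α ∨ ∃ β, 𝒢.Outgoing β ∧ 𝒢.tSrc β = 𝒢.tTgt α ∧ 𝒢.Beyond β u := by
  refine 𝒢.beyond_induction (Q := fun u => u = 𝒢.tTgt α ∨ ∃ β, 𝒢.Outgoing β ∧
    𝒢.tSrc β = 𝒢.tTgt α ∧ 𝒢.Beyond β u) (Or.inl rfl) ?_ hu
  intro ε' h1 h2 h3
  rcases h3 with h3 | ⟨β, hβ, hβα, hb⟩
  · right
    refine ⟨ε', ?_, h3, 𝒢.beyond_tgt ε'⟩
    rcases outgoing_or_outgoing_trev star ε' with h | h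
    · exact h
    · have := outgoing_unique star h hα (by rw [tTgt_trev, h3])
      rw [← this, ← tSrc_trev] at h2
      exact absurd h2 (not_beyond_src star _)
  · by_cases hb' : 𝒢.Beyond β (𝒢.tTgt ε')
    · exact Or.inr ⟨β, hβ, hβα, hb'⟩
    · left
      have := eq_of_crosses (ε := β) (ε' := 𝒢.trev ε') (by rwa [tSrc_trev])
        (by rwa [tTgt_trev])
      rw [← tSrc_trev, this, hβα]

theorem eq_root_or_beyond (u : 𝒢.TVert) :
    u = 𝒢.root ∨ ∃ β, 𝒢.Outgoing β ∧ 𝒢.tSrc β = 𝒢.root ∧ 𝒢.Beyond β u := by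
  obtain ⟨w⟩ := 𝒢.bsTree_connected u 𝒢.root
  generalize hr : 𝒢.root = r at w
  induction w with
  | nil => exact Or.inl rfl
  | @cons u u' r hadj p ih =>
    obtain ⟨ε', rfl, rfl⟩ := 𝒢.exists_edge_of_adj hadj
    rcases ih hr with h3 | ⟨β, hβ, hβα, hb⟩
    · right
      refine ⟨𝒢.trev ε', ?_, by rw [tSrc_trev, h3], by
        rw [← tTgt_trev]; exact 𝒢.beyond_tgt _⟩
      unfold Outgoing
      rw [tSrc_trev, tTgt_trev, h3, hr, SimpleGraph.dist_self]
      refine 𝒢.bsTree_connected.pos_dist_of_ne ?_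
      rw [← h3.trans rfl]
      exact (tSrc_ne_tTgt star ε').symm
    · by_cases hb' : 𝒢.Beyond β (𝒢.tSrc ε')
      · exact Or.inr ⟨β, hβ, hβα, hb'⟩
      · left
        have := eq_of_crosses hb' hb
        rw [this, hβα]

end Star

end GraphOfGroups

/-! ### Word metrics and undistorted subgroups -/

section Cayley

variable {Γ : Type*} [Group Γ]

theorem mulCayley_dist_mul_le {S : Set Γ} (hS : Subgroup.closure S = ⊤) (g x y : Γ) :
    (SimpleGraph.mulCayley S).dist (g * x) (g * y) ≤ (SimpleGraph.mulCayley S).dist x y := by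
  have h := GeomReal.dist_le_mul_of_adj (mulCayley_connected hS) (mulCayley_connected hS)
    (φ := fun x => g * x) (K := 1) (fun u v huv => by
      refine (SimpleGraph.dist_eq_one_iff_adj.2 ?_).le
      rw [SimpleGraph.mulCayley_adj'] at huv ⊢
      obtain ⟨hne, s, hs, h⟩ := huv
      exact ⟨by simpa using hne, s, hs, by simpa [mul_assoc] using h⟩) x y
  rwa [one_mul] at h

theorem mulCayley_dist_mul {S : Set Γ} (hS : Subgroup.closure S = ⊤) (g x y : Γ) :
    (SimpleGraph.mulCayley S).dist (g * x) (g * y) = (SimpleGraph.mulCayley S).dist x y := by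
  refine (mulCayley_dist_mul_le hS g x y).antisymm ?_
  simpa using mulCayley_dist_mul_le hS g⁻¹ (g * x) (g * y)

theorem exists_mulCayley_dist_le {A S : Set Γ} (hA : A.Finite) (hA' : Subgroup.closure A = ⊤)
    (hS : Subgroup.closure S = ⊤) : ∃ K : ℕ, ∀ x y,
      (SimpleGraph.mulCayley S).dist x y ≤ K * (SimpleGraph.mulCayley A).dist x y := by
  obtain ⟨K, hK⟩ := (hA.image fun a => (SimpleGraph.mulCayley S).dist 1 a).bddAbove
  refine ⟨K, GeomReal.dist_le_mul_of_adj (φ := id) (mulCayley_connected hA')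
    (mulCayley_connected hS) fun u v huv => ?_⟩
  rw [SimpleGraph.mulCayley_adj'] at huv
  obtain ⟨-, s, hs, rfl | rfl⟩ := huv
  · have := mulCayley_dist_mul hS u 1 s
    rw [mul_one] at this
    simp only [id, this]
    exact hK ⟨s, hs, rfl⟩
  · have := mulCayley_dist_mul hS v 1 s
    rw [mul_one] at this
    rw [SimpleGraph.dist_comm]
    simp only [id, this]
    exact hK ⟨s, hs, rfl⟩

end Cayley

namespace GraphOfGroups

variable {n : ℕ} {E : Type*} [Finite E] {𝒢 : GraphOfGroups n E}

instance (e : E) : Fact (SimpleGraph.mulCayley (𝒢.SH e)).Connected :=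
  ⟨mulCayley_connected (𝒢.SH_gen e)⟩

variable (𝒢) in
/-- The distance of group elements is at most proportional to that in the Bass–Serre space. -/
theorem exists_mulCayley_dist_le_xGraph {B : Set 𝒢.FundGroup} (hB : Subgroup.closure B = ⊤) :
    ∃ K : ℕ, ∀ x y : 𝒢.XVert, (SimpleGraph.mulCayley B).dist x.1 y.1 ≤ K * 𝒢.xGraph.dist x y := by
  have h1 : (⋃ v, 𝒢.ι v '' 𝒢.SG v).Finite := finite_iUnion fun v => (𝒢.SG_finite v).image _
  have h2 : (Set.range 𝒢.t).Finite := Set.finite_range _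
  obtain ⟨K, hK⟩ := ((h1.union h2).image fun a => (SimpleGraph.mulCayley B).dist 1 a).bddAbove
  have key : ∀ u v : 𝒢.XVert, ((∃ s ∈ 𝒢.SG u.2, v = (u.1 * 𝒢.ι u.2 s, u.2)) ∨
      ∃ α : E × Bool, u.2 = 𝒢.src α ∧ v = (u.1 * 𝒢.t α, 𝒢.tgt α)) →
      (SimpleGraph.mulCayley B).dist u.1 v.1 ≤ K := by
    rintro u v (⟨s, hs, rfl⟩ | ⟨α, -, rfl⟩)
    · have := mulCayley_dist_mul hB u.1 1 (𝒢.ι u.2 s)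
      rw [mul_one] at this
      simp only [this]
      exact hK ⟨_, Or.inl (mem_iUnion.2 ⟨u.2, s, hs, rfl⟩), rfl⟩
    · have := mulCayley_dist_mul hB u.1 1 (𝒢.t α)
      rw [mul_one] at this
      simp only [this]
      exact hK ⟨_, Or.inr ⟨α, rfl⟩, rfl⟩
  refine ⟨K, GeomReal.dist_le_mul_of_adj 𝒢.xGraph_connected (mulCayley_connected hB)
    fun u v huv => ?_⟩
  rw [xGraph, SimpleGraph.fromRel_adj] at huv
  rcases huv.2 with h | h
  · exact key u v h
  · rw [SimpleGraph.dist_comm]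
    exact key v u h

/-- Undistortedness refers to unspecified generating sets; it is transferred to the fixed generators
and to distances in the Bass–Serre space, with one constant for the finitely many edges. -/
theorem exists_edge_undistorted (hs : 𝒢.IsMorselessStar) : ∃ C : ℕ, ∀ (α : E × Bool) (h : 𝒢.H α.1)
    (g : 𝒢.FundGroup) (v w), (SimpleGraph.mulCayley (𝒢.SH α.1)).dist 1 h ≤
      C * 𝒢.xGraph.dist (g, v) (g * 𝒢.edgeHom α h, w) + C := by
  have key : ∀ α : E × Bool, ∃ C : ℕ, ∀ (h : 𝒢.H α.1)
    (g : 𝒢.FundGroup) (v w), (SimpleGraph.mulCayley (𝒢.SH α.1)).dist 1 h ≤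
      C * 𝒢.xGraph.dist (g, v) (g * 𝒢.edgeHom α h, w) + C := by
    intro α
    obtain ⟨A, B, hA, -, hA', hB', C, hC⟩ := hs.undistorted α
    obtain ⟨K₁, hK₁⟩ := exists_mulCayley_dist_le hA hA' (𝒢.SH_gen α.1)
    obtain ⟨K₂, hK₂⟩ := 𝒢.exists_mulCayley_dist_le_xGraph hB'
    obtain ⟨C', hC'⟩ := exists_nat_ge C
    refine ⟨K₁ * C' * K₂ + K₁ * C', fun h g v w => ?_⟩
    have h1 := hK₁ 1 h
    have h2 := hK₂ (g, v) (g * 𝒢.edgeHom α h, w)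
    have h3 := mulCayley_dist_mul hB' g 1 (𝒢.edgeHom α h)
    rw [mul_one] at h3
    simp only [h3] at h2
    have h4 : (SimpleGraph.mulCayley A).dist 1 h ≤
        C' * (SimpleGraph.mulCayley B).dist 1 (𝒢.edgeHom α h) + C' := by
      have := hC h
      have h5 : C * ((SimpleGraph.mulCayley B).dist 1 (𝒢.edgeHom α h) : ℝ) ≤
          C' * (SimpleGraph.mulCayley B).dist 1 (𝒢.edgeHom α h) :=
        mul_le_mul_of_nonneg_right hC' (Nat.cast_nonneg _)
      exact_mod_cast (by linarith : ((SimpleGraph.mulCayley A).dist 1 h : ℝ) ≤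
        C' * (SimpleGraph.mulCayley B).dist 1 (𝒢.edgeHom α h) + C')
    generalize 𝒢.xGraph.dist (g, v) (g * 𝒢.edgeHom α h, w) = d at *
    calc _ ≤ K₁ * (SimpleGraph.mulCayley A).dist 1 h := h1
      _ ≤ K₁ * (C' * (K₂ * d) + C') :=
        Nat.mul_le_mul_left _ (h4.trans (Nat.add_le_add_right (Nat.mul_le_mul_left _ h2) _))
      _ ≤ _ := by nlinarith [Nat.zero_le (K₁ * C' * d), Nat.zero_le (K₁ * C' * K₂)]
  choose C hC using key
  obtain ⟨C', hC'⟩ := (Set.finite_range C).bddAbove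
  refine ⟨C', fun α h g v w => (hC α h g v w).trans ?_⟩
  have := hC' ⟨α, rfl⟩
  gcongr

variable (𝒢) in
/-- The injection of the edge group of `α` into the vertex group of its target. -/
def fTgt (α : E × Bool) : 𝒢.H α.1 →* 𝒢.G (𝒢.tgt α) := 𝒢.f α.1 α.2

theorem edgeHom_apply (α : E × Bool) (h : 𝒢.H α.1) :
    𝒢.edgeHom α h = 𝒢.ι (𝒢.tgt α) (𝒢.fTgt α h) := rfl

theorem cay_dist_fTgt_le (α : E × Bool) (h h' : 𝒢.H α.1) :
    (𝒢.cay (𝒢.tgt α)).dist (𝒢.fTgt α h) (𝒢.fTgt α h') ≤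
      (SimpleGraph.mulCayley (𝒢.SH α.1)).dist h h' := by
  have := GeomReal.dist_le_mul_of_adj (mulCayley_connected (𝒢.SH_gen α.1))
    (mulCayley_connected (𝒢.SG_gen (𝒢.tgt α))) (φ := 𝒢.fTgt α) (K := 1) (fun u v huv => by
      refine (SimpleGraph.dist_eq_one_iff_adj.2 ?_).le
      rw [SimpleGraph.mulCayley_adj'] at huv ⊢
      obtain ⟨hne, s, hs, h⟩ := huv
      refine ⟨fun he => hne (𝒢.f_inj _ _ he), 𝒢.fTgt α s, 𝒢.f_SH _ _ _ hs, ?_⟩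
      exact h.imp (fun h => by rw [← h, map_mul]) (fun h => by rw [h, map_mul])) h h'
  rwa [one_mul] at this

theorem edgeFibre_pair {ε : 𝒢.TEdge} {x y : 𝒢.XVert} (hx : x ∈ 𝒢.edgeFibre ε)
    (hy : y ∈ 𝒢.edgeFibre ε) :
    x.2 = 𝒢.tgt ε.1 ∧ ∃ h, y = (x.1 * 𝒢.edgeHom ε.1 h, 𝒢.tgt ε.1) := by
  refine ⟨hx.1, ?_⟩
  have := hx.2.trans hy.2.symm
  rw [QuotientGroup.eq] at this
  obtain ⟨h, hh⟩ := this
  exact ⟨h, Prod.ext (by simp [hh]) hy.1⟩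

theorem mem_edgeFibre_mul {ε : 𝒢.TEdge} {x : 𝒢.XVert} (hx : x ∈ 𝒢.edgeFibre ε) (h : 𝒢.H ε.1.1) :
    (x.1 * 𝒢.edgeHom ε.1 h, 𝒢.tgt ε.1) ∈ 𝒢.edgeFibre ε := by
  refine ⟨rfl, ?_⟩
  rw [← hx.2, QuotientGroup.eq]
  exact ⟨h⁻¹, by simp⟩

/-- Vertex groups are undistorted in the Bass–Serre space. -/
theorem exists_vertex_undistorted (hs : 𝒢.IsMorselessStar) : ∃ C : ℕ, ∀ v (x y : 𝒢.G v),
    (𝒢.cay v).dist x y ≤ C * 𝒢.xGraph.dist (𝒢.ι v x, v) (𝒢.ι v y, v) := by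
  have star : 𝒢.IsStar := hs.star
  obtain ⟨C, hC⟩ := exists_edge_undistorted hs
  -- Induction on the length of a walk between points of one coset. A first step inside the coset
  -- costs one generator; a first step out of it starts an excursion.
  have key : ∀ (N : ℕ) (v : Fin (n + 1)) (g : 𝒢.FundGroup) (s : 𝒢.G v)
      (w : 𝒢.xGraph.Walk (g, v) (g * 𝒢.ι v s, v)), w.length ≤ N →
      (𝒢.cay v).dist 1 s ≤ (3 * C + 1) * w.length := by
    intro N
    induction N with
    | zero =>
      intro v g s w hw
      have h0 := SimpleGraph.Walk.eq_of_length_eq_zero (Nat.le_zero.1 hw)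
      have h1 : 𝒢.ι v s = 1 := by simpa using (Prod.ext_iff.1 h0).1
      have h2 : s = 1 := ι_injective star v (by rw [h1, map_one])
      simp [h2]
    | succ N ih =>
      intro v g s w hw
      generalize hx : ((g, v) : 𝒢.XVert) = x at w
      generalize hy : ((g * 𝒢.ι v s, v) : 𝒢.XVert) = y at w
      cases w with
      | nil =>
        have h0 := hx.trans hy.symm
        have h1 : 𝒢.ι v s = 1 := by simpa using (Prod.ext_iff.1 h0).1
        have h2 : s = 1 := ι_injective star v (by rw [h1, map_one])
        simp [h2]
      | @cons _ u _ hadj p =>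
        rw [SimpleGraph.Walk.length_cons] at hw ⊢
        have hproj : 𝒢.proj x = 𝒢.proj y := by
          rw [← hx, ← hy]; exact 𝒢.proj_eq_iff.2 ⟨s, rfl⟩
        rcases 𝒢.adj_cases hadj with ⟨s', hs', hu⟩ | ⟨ε, h1, h2, h3, h4⟩
        · subst hx
          have hy' : y = (g * 𝒢.ι v s' * 𝒢.ι v (s'⁻¹ * s), v) := by
            rw [← hy, mul_assoc, ← map_mul, mul_inv_cancel_left]
          subst hy'
          subst hu
          have h5 := ih v _ _ p (by omega)
          have h6 := mulCayley_dist_mul (𝒢.SG_gen v) s' 1 (s'⁻¹ * s)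
          rw [mul_one, mul_inv_cancel_left] at h6
          have h7 : (𝒢.cay v).dist 1 s' ≤ 1 := by
            rcases eq_or_ne 1 s' with h | h
            · simp [← h]
            · refine (SimpleGraph.dist_eq_one_iff_adj.2 ?_).le
              rw [SimpleGraph.mulCayley_adj']
              exact ⟨h, s', hs', Or.inl (by simp)⟩
          have h8 := (mulCayley_connected (𝒢.SG_gen v)).dist_triangle (u := 1) (v := s') (w := s)
          rw [← h6] at h5
          change (𝒢.cay v).dist 1 s ≤ (𝒢.cay v).dist 1 s' + (𝒢.cay v).dist s' s at h8
          rw [mul_add]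
          change (𝒢.cay v).dist s' s ≤ _ at h5
          omega
        -- By separation the walk returns through the edge by which it left. The excursion, of
        -- length `w₁.length + 2`, therefore starts and ends in one fibre, and edge group
        -- undistortedness replaces it by at most `C * (w₁.length + 2) + C` generators.
        · obtain ⟨a, b, w₁, w₂, hab, ha, hb, hl⟩ := p.exists_crossing
            (S := fun u => ¬ 𝒢.Beyond ε (𝒢.proj u)) (by
              rw [← h2, not_not]; exact 𝒢.beyond_tgt ε) (by
              rw [← hproj, ← h1]; exact not_beyond_src star ε)
          rw [not_not] at ha
          rcases 𝒢.adj_cases hab with ⟨s', hs', hu⟩ | ⟨ε', h1', h2', h3', h4'⟩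
          · exact absurd (by rw [hu, ← 𝒢.proj_eq_iff.2 ⟨s', rfl⟩]; exact ha) hb
          have he : 𝒢.trev ε' = ε := eq_of_crosses (by rwa [tSrc_trev, h2'])
            (by rwa [tTgt_trev, h1'])
          rw [← he, trev_trev] at h4
          obtain ⟨hv, h, hbh⟩ := edgeFibre_pair h4 h3'
          rw [← hx] at hv hbh
          simp only at hv hbh
          subst hv
          have hdist : 𝒢.xGraph.dist x b ≤ w₁.length + 2 := by
            have := SimpleGraph.dist_le ((SimpleGraph.Walk.cons hadj w₁).concat hab)
            simpa using this
          have hH := hC ε'.1 h g (𝒢.tgt ε'.1) (𝒢.tgt ε'.1)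
          rw [← hbh, hx] at hH
          have hf := cay_dist_fTgt_le ε'.1 1 h
          rw [map_one] at hf
          have hy' : y = (g * 𝒢.edgeHom ε'.1 h * 𝒢.ι _ ((𝒢.fTgt ε'.1 h)⁻¹ * s),
              𝒢.tgt ε'.1) := by
            rw [← hy, edgeHom_apply]
            refine Prod.ext ?_ rfl
            change g * _ = g * _ * _
            rw [mul_assoc, ← map_mul, mul_inv_cancel_left]
          subst hy'
          subst hbh
          have h5 := ih _ _ _ w₂ (by omega)
          have h6 := mulCayley_dist_mul (𝒢.SG_gen (𝒢.tgt ε'.1)) (𝒢.fTgt ε'.1 h) 1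
            ((𝒢.fTgt ε'.1 h)⁻¹ * s)
          rw [mul_one, mul_inv_cancel_left] at h6
          have h8 := (mulCayley_connected (𝒢.SG_gen (𝒢.tgt ε'.1))).dist_triangle (u := 1)
            (v := 𝒢.fTgt ε'.1 h) (w := s)
          have h9 : C * 𝒢.xGraph.dist x (g * 𝒢.edgeHom ε'.1 h, 𝒢.tgt ε'.1) ≤
            C * (w₁.length + 2) := Nat.mul_le_mul_left _ hdist
          have h10 : (SimpleGraph.mulCayley (𝒢.SG (𝒢.tgt ε'.1))).dist 1 s ≤
            (C * (w₁.length + 2) + C) + (3 * C + 1) * w₂.length := by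
            refine h8.trans (add_le_add (hf.trans (hH.trans (by omega))) (h6.le.trans h5))
          refine h10.trans ?_
          rw [hl]
          nlinarith [Nat.zero_le (C * w₁.length)]
  refine ⟨3 * C + 1, fun v x y => ?_⟩
  obtain ⟨w, hw⟩ := 𝒢.xGraph_connected.exists_walk_length_eq_dist (𝒢.ι v x, v) (𝒢.ι v y, v)
  rw [← hw]
  have hy : ((𝒢.ι v y, v) : 𝒢.XVert) = (𝒢.ι v x * 𝒢.ι v (x⁻¹ * y), v) := by
    rw [← map_mul, mul_inv_cancel_left]
  have h6 := mulCayley_dist_mul (𝒢.SG_gen v) x 1 (x⁻¹ * y)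
  rw [mul_one, mul_inv_cancel_left] at h6
  change (SimpleGraph.mulCayley (𝒢.SG v)).dist x y ≤ _
  rw [h6]
  clear hw
  generalize ((𝒢.ι v y, v) : 𝒢.XVert) = z at w hy
  subst hy
  exact key _ v _ _ w le_rfl

/-! ### Properness, the action by translations, cosets and edge fibres -/

variable (𝒢) in
theorem xGraph_finite_neighborSet (x : 𝒢.XVert) : (𝒢.xGraph.neighborSet x).Finite := by
  have h1 : ((fun s => ((x.1 * 𝒢.ι x.2 s, x.2) : 𝒢.XVert)) '' 𝒢.SG x.2).Finite :=
    (𝒢.SG_finite x.2).image _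
  have h2 : (Set.range fun α : E × Bool => ((x.1 * 𝒢.t α, 𝒢.tgt α) : 𝒢.XVert)).Finite :=
    Set.finite_range _
  have h3 : (Set.range fun α : E × Bool => ((x.1 * (𝒢.t α)⁻¹, 𝒢.src α) : 𝒢.XVert)).Finite :=
    Set.finite_range _
  refine (h1.union (h2.union h3)).subset fun y hy => ?_
  rw [SimpleGraph.mem_neighborSet, xGraph, SimpleGraph.fromRel_adj] at hy
  obtain ⟨-, (⟨s, hs, rfl⟩ | ⟨α, hα, rfl⟩) | (⟨s, hs, rfl⟩ | ⟨α, hα, rfl⟩)⟩ := hy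
  · exact Or.inl ⟨s, hs, rfl⟩
  · exact Or.inr (Or.inl ⟨α, rfl⟩)
  · exact Or.inl ⟨s⁻¹, 𝒢.SG_symm _ s hs, by simp⟩
  · exact Or.inr (Or.inr ⟨α, Prod.ext (by simp) hα.symm⟩)

instance : ProperSpace 𝒢.X := GeomReal.properSpace 𝒢.xGraph_finite_neighborSet

instance (v : Fin (n + 1)) : ProperSpace (GeomReal (𝒢.cay v)) := by
  refine GeomReal.properSpace fun x => ?_
  refine ((𝒢.SG_finite v).image (fun s => x * s) |>.union
    ((𝒢.SG_finite v).image (fun s => x * s⁻¹))).subset fun y hy => ?_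
  rw [SimpleGraph.mem_neighborSet, SimpleGraph.mulCayley_adj'] at hy
  obtain ⟨-, s, hs, rfl | rfl⟩ := hy
  · exact Or.inl ⟨s, hs, rfl⟩
  · exact Or.inr ⟨s, hs, by simp⟩

theorem translate_pt (g : 𝒢.FundGroup) (x : 𝒢.XVert) :
    𝒢.translate g (𝒢.pt x) = 𝒢.pt (g * x.1, x.2) := GeomReal.map_vertex _

theorem translate_translate (g g' : 𝒢.FundGroup) (x : 𝒢.X) :
    𝒢.translate g (𝒢.translate g' x) = 𝒢.translate (g * g') x := by
  apply GeomReal.ext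
  simp only [translate, GeomReal.map, ← Finsupp.mapDomain_comp]
  congr 1
  ext y <;> simp [mul_assoc]

theorem translate_one (x : 𝒢.X) : 𝒢.translate 1 x = x := by
  apply GeomReal.ext
  simp only [translate, GeomReal.map, one_mul]
  exact Finsupp.mapDomain_id

theorem dist_translate (g : 𝒢.FundGroup) (x y : 𝒢.X) :
    dist (𝒢.translate g x) (𝒢.translate g y) = dist x y := by
  refine le_antisymm (GeomReal.dist_map_le x y) ?_
  have := GeomReal.dist_map_le (𝒢.translate g x) (𝒢.translate g y) (φ := _)
    (hφ := _) |> fun h => (show dist (𝒢.translate g⁻¹ (𝒢.translate g x))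
      (𝒢.translate g⁻¹ (𝒢.translate g y)) ≤ _ from h)
  simpa [translate_translate, translate_one] using this

theorem isometry_translate (g : 𝒢.FundGroup) : Isometry (𝒢.translate g) :=
  Isometry.of_dist_eq (dist_translate g)

theorem isMorseSet_translate {M : MorseGauge} {A : Set 𝒢.X} (h : IsMorseSet M A)
    (g : 𝒢.FundGroup) : IsMorseSet M (𝒢.translate g '' A) := by
  intro l e T η hT hη h0 h1
  rintro _ ⟨t, ht, rfl⟩
  have hinv : ∀ x, 𝒢.translate g⁻¹ (𝒢.translate g x) = x := fun x => by
    rw [translate_translate, inv_mul_cancel, translate_one]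
  have hinv' : ∀ x, 𝒢.translate g (𝒢.translate g⁻¹ x) = x := fun x => by
    rw [translate_translate, mul_inv_cancel, translate_one]
  have := h l e T (fun t => 𝒢.translate g⁻¹ (η t)) hT
    ⟨(isometry_translate g⁻¹).continuous.comp_continuousOn hη.1, fun s hs t ht => by
      rw [dist_translate]; exact hη.2 s hs t ht⟩
    (by obtain ⟨a, ha, hae⟩ := h0; simpa [← hae, hinv] using ha)
    (by obtain ⟨a, ha, hae⟩ := h1; simpa [← hae, hinv] using ha) (mem_image_of_mem _ ht)
  rw [Metric.mem_cthickening_iff] at this ⊢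
  rwa [← hinv' (η t), Metric.infEDist_image (isometry_translate g)]

theorem inclusion_vertex (v : Fin (n + 1)) (x : 𝒢.G v) :
    𝒢.inclusion v (GeomReal.vertex _ x) = 𝒢.pt (𝒢.ι v x, v) := GeomReal.map_vertex _

theorem dist_inclusion_le (v : Fin (n + 1)) (x y : GeomReal (𝒢.cay v)) :
    dist (𝒢.inclusion v x) (𝒢.inclusion v y) ≤ dist x y := GeomReal.dist_map_le x y

theorem exists_dist_le_inclusion (hs : 𝒢.IsMorselessStar) : ∃ C : ℝ, 1 ≤ C ∧
    ∀ v (x y : GeomReal (𝒢.cay v)),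
      dist x y ≤ C * dist (𝒢.inclusion v x) (𝒢.inclusion v y) + C := by
  obtain ⟨C, hC⟩ := exists_vertex_undistorted hs
  refine ⟨2 * C + 2, by have : (0 : ℝ) ≤ C := Nat.cast_nonneg _; linarith, fun v x y => ?_⟩
  obtain ⟨a, ha⟩ := GeomReal.exists_dist_vertex_lt x
  obtain ⟨b, hb⟩ := GeomReal.exists_dist_vertex_lt y
  have h1 := dist_triangle4 x (GeomReal.vertex _ a) (GeomReal.vertex _ b) y
  have h2 := dist_inclusion_le v x (GeomReal.vertex _ a)
  have h3 := dist_inclusion_le v y (GeomReal.vertex _ b)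
  have h4 := dist_triangle4 (𝒢.inclusion v (GeomReal.vertex _ a)) (𝒢.inclusion v x)
    (𝒢.inclusion v y) (𝒢.inclusion v (GeomReal.vertex _ b))
  rw [dist_comm (GeomReal.vertex _ b) y] at h1
  rw [dist_comm _ (𝒢.inclusion v x)] at h4
  have h5 : dist (GeomReal.vertex (𝒢.cay v) a) (GeomReal.vertex (𝒢.cay v) b) ≤
      C * dist (𝒢.inclusion v (GeomReal.vertex _ a)) (𝒢.inclusion v (GeomReal.vertex _ b)) := by
    rw [inclusion_vertex, inclusion_vertex, GeomReal.dist_vertex, GeomReal.dist_vertex]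
    exact_mod_cast hC v a b
  have h6 : (C : ℝ) * dist (𝒢.inclusion v (GeomReal.vertex _ a))
      (𝒢.inclusion v (GeomReal.vertex _ b)) ≤
      C * (dist (𝒢.inclusion v x) (𝒢.inclusion v y) + 2) :=
    mul_le_mul_of_nonneg_left (by linarith) (Nat.cast_nonneg _)
  have h7 : (0 : ℝ) ≤ C * dist (𝒢.inclusion v x) (𝒢.inclusion v y) := by positivity
  have h8 : (0 : ℝ) ≤ dist (𝒢.inclusion v x) (𝒢.inclusion v y) := dist_nonneg
  nlinarith

/-- Points of an edge fibre are joined by quasi-geodesics close to the fibre. -/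
theorem exists_fibre_path (hs : 𝒢.IsMorselessStar) : ∃ C : ℝ, 1 ≤ C ∧
    ∀ (ε : 𝒢.TEdge), ∀ x ∈ 𝒢.edgeFibre ε, ∀ y ∈ 𝒢.edgeFibre ε, ∃ T η, 0 ≤ T ∧
      IsQuasiGeodesicOn C C η (Icc 0 T) ∧ η 0 = 𝒢.pt x ∧ η T = 𝒢.pt y ∧
      ∀ t ∈ Icc 0 T, Near 1 (𝒢.pt '' 𝒢.edgeFibre ε) (η t) := by
  obtain ⟨C, hC⟩ := exists_edge_undistorted hs
  have hC0 : (0 : ℝ) ≤ C := Nat.cast_nonneg _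
  refine ⟨3 * C + 2, by linarith, ?_⟩
  intro ε x hx y hy
  obtain ⟨hx2, h, rfl⟩ := edgeFibre_pair hx hy
  -- The fibre is an orbit of the edge group. A geodesic of the Cayley graph of the edge group is
  -- pushed forward to it; undistortedness gives the lower bound of a quasi-geodesic.
  let φ : 𝒢.H ε.1.1 → 𝒢.XVert := fun u => (x.1 * 𝒢.edgeHom ε.1 u, 𝒢.tgt ε.1)
  have hφ : ∀ u v, (SimpleGraph.mulCayley (𝒢.SH ε.1.1)).Adj u v →
      φ u = φ v ∨ 𝒢.xGraph.Adj (φ u) (φ v) := by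
    intro u v huv
    by_cases he : φ u = φ v
    · exact Or.inl he
    · right
      rw [SimpleGraph.mulCayley_adj'] at huv
      rw [xGraph, SimpleGraph.fromRel_adj]
      refine ⟨he, ?_⟩
      obtain ⟨-, s, hs, rfl | rfl⟩ := huv
      · exact Or.inl (Or.inl ⟨𝒢.f ε.1.1 ε.1.2 s, 𝒢.f_SH _ _ _ hs, by
          simp only [φ, map_mul, mul_assoc]; rfl⟩)
      · exact Or.inr (Or.inl ⟨𝒢.f ε.1.1 ε.1.2 s, 𝒢.f_SH _ _ _ hs, by
          simp only [φ, map_mul, mul_assoc]; rfl⟩)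
  have hlip : ∀ a b, dist (GeomReal.map φ hφ a) (GeomReal.map φ hφ b) ≤ dist a b :=
    fun a b => GeomReal.dist_map_le a b
  have hlow : ∀ a b, dist a b ≤
      C * dist (GeomReal.map φ hφ a) (GeomReal.map φ hφ b) + (3 * C + 2) := by
    intro a b
    obtain ⟨u, hu⟩ := GeomReal.exists_dist_vertex_lt a
    obtain ⟨v, hv⟩ := GeomReal.exists_dist_vertex_lt b
    have h1 := dist_triangle4 a (GeomReal.vertex _ u) (GeomReal.vertex _ v) b
    have h2 := hlip a (GeomReal.vertex _ u)
    have h3 := hlip b (GeomReal.vertex _ v)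
    have h4 := dist_triangle4 (GeomReal.map φ hφ (GeomReal.vertex _ u)) (GeomReal.map φ hφ a)
      (GeomReal.map φ hφ b) (GeomReal.map φ hφ (GeomReal.vertex _ v))
    rw [dist_comm (GeomReal.vertex _ v) b] at h1
    rw [dist_comm _ (GeomReal.map φ hφ a)] at h4
    have h5 : dist (GeomReal.vertex (SimpleGraph.mulCayley (𝒢.SH ε.1.1)) u)
        (GeomReal.vertex _ v) ≤ C * dist (GeomReal.map φ hφ (GeomReal.vertex _ u))
        (GeomReal.map φ hφ (GeomReal.vertex _ v)) + C := by
      rw [GeomReal.map_vertex, GeomReal.map_vertex, GeomReal.dist_vertex, GeomReal.dist_vertex]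
      have h6 := hC ε.1 (u⁻¹ * v) (x.1 * 𝒢.edgeHom ε.1 u) (𝒢.tgt ε.1) (𝒢.tgt ε.1)
      have h7 := mulCayley_dist_mul (𝒢.SH_gen ε.1.1) u 1 (u⁻¹ * v)
      rw [mul_one, mul_inv_cancel_left] at h7
      rw [← h7, mul_assoc, ← map_mul, mul_inv_cancel_left] at h6
      exact_mod_cast h6
    have h6 : (C : ℝ) * dist (GeomReal.map φ hφ (GeomReal.vertex _ u))
        (GeomReal.map φ hφ (GeomReal.vertex _ v)) ≤
        C * (dist (GeomReal.map φ hφ a) (GeomReal.map φ hφ b) + 2) :=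
      mul_le_mul_of_nonneg_left (by linarith) hC0
    linarith
  obtain ⟨γ, hγ0, hγ1, hγ⟩ := GeodesicSpace.exists_geodesic
    (GeomReal.vertex (SimpleGraph.mulCayley (𝒢.SH ε.1.1)) 1) (GeomReal.vertex _ h)
  have hφ1 : φ 1 = x := Prod.ext (by simp [φ]) hx2.symm
  refine ⟨dist (GeomReal.vertex (SimpleGraph.mulCayley (𝒢.SH ε.1.1)) 1) (GeomReal.vertex _ h),
    fun t => GeomReal.map φ hφ (γ t), dist_nonneg, ⟨?_, ?_⟩, ?_, ?_, ?_⟩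
  · have : GeodOn γ (Icc 0 _) := hγ
    exact (LipschitzWith.of_dist_le_mul (K := 1) (by simpa using hlip)).continuous.comp_continuousOn
      this.continuousOn
  · intro s hs t ht
    have h1 := hlip (γ s) (γ t)
    have h2 := hlow (γ s) (γ t)
    rw [hγ s hs t ht] at h1 h2
    have h3 : (0 : ℝ) ≤ dist (GeomReal.map φ hφ (γ s)) (GeomReal.map φ hφ (γ t)) := dist_nonneg
    have h4 : (0 : ℝ) ≤ |s - t| := abs_nonneg _
    constructor
    · rw [sub_le_iff_le_add, inv_mul_le_iff₀ (by linarith)]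
      nlinarith
    · nlinarith
  · simp only [hγ0, GeomReal.map_vertex, hφ1]
  · simp only [hγ1, GeomReal.map_vertex, φ]
  · intro t ht
    obtain ⟨u, hu⟩ := GeomReal.exists_dist_vertex_lt (γ t)
    refine ⟨_, ⟨φ u, mem_edgeFibre_mul hx u, rfl⟩, ?_⟩
    have := hlip (γ t) (GeomReal.vertex _ u)
    rw [GeomReal.map_vertex] at this
    exact this.trans hu.le

end GraphOfGroups

/-! ### Asymptotic cones and Morse geodesics between points of one fibre -/

/-- Points of a cone which are limits of points on Morse geodesics separate the endpoints. -/
theorem not_joinedIn_of_isMorseSet {X Y : Type*} [MetricSpace X] [GeodesicSpace X] [MetricSpace Y]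
    {inc : Y → X} {C : ℝ} (hC : 1 ≤ C) (hinc : ∀ a b, dist (inc a) (inc b) ≤ dist a b)
    (hinc' : ∀ a b, dist a b ≤ C * dist (inc a) (inc b) + C) {D : ConeData} {b : Y}
    {x y p : ConeSeq D b} {M : MorseGauge} {γ : ℕ → ℝ → X} {L τ : ℕ → ℝ} {K₀ : ℝ}
    (hγ : ∀ n, GeodOn (γ n) (Icc 0 (L n))) (hM : ∀ n, IsMorseSet M (γ n '' Icc 0 (L n)))
    (h0 : ∀ n, γ n 0 = inc (x.seq n)) (hL : ∀ n, γ n (L n) = inc (y.seq n))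
    (hτ : ∀ n, τ n ∈ Icc 0 (L n)) (hp : ∀ n, dist (γ n (τ n)) (inc (p.seq n)) ≤ K₀) :
    ¬ JoinedIn {SeparationQuotient.mk p}ᶜ (SeparationQuotient.mk x : AsymptoticCone D b)
      (SeparationQuotient.mk y) := by
  rintro ⟨path, hpath⟩
  obtain ⟨t₀, -, ht₀⟩ := isCompact_univ.exists_isMinOn (univ_nonempty)
    ((path.continuous.dist (continuous_const (y := SeparationQuotient.mk p))).continuousOn)
  -- By compactness the path keeps a positive distance `r` from `p`. It is subdivided into steps
  -- shorter than `r / (8 * C)`, and the division points are lifted to sequences.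
  set r := dist (path t₀) (SeparationQuotient.mk p) with hr
  have hr0 : 0 < r := dist_pos.2 (hpath t₀)
  have hrle : ∀ t, r ≤ dist (path t) (SeparationQuotient.mk p) := fun t => ht₀ (mem_univ t)
  have hc0 : 0 < r / (8 * C) := by positivity
  obtain ⟨δ, hδ, hunif⟩ := Metric.uniformContinuous_iff.1
    (CompactSpace.uniformContinuous_of_continuous path.continuous) _ hc0
  obtain ⟨k, hk⟩ := exists_nat_one_div_lt hδ
  have hk0 : (0 : ℝ) < (k + 1 : ℕ) := by positivity
  let u : ℕ → unitInterval := fun i => projIcc 0 1 zero_le_one ((i : ℝ) / (k + 1 : ℕ))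
  have hu : ∀ i, dist (u i) (u (i + 1)) < δ := by
    intro i
    refine lt_of_le_of_lt ?_ hk
    rw [Subtype.dist_eq, Real.dist_eq]
    refine (abs_projIcc_sub_projIcc zero_le_one).trans ?_
    rw [← sub_div, abs_div, abs_of_pos hk0]
    simp
  let out : AsymptoticCone D b → ConeSeq D b :=
    Function.surjInv SeparationQuotient.surjective_mk
  let q : ℕ → ConeSeq D b := fun i => if i = 0 then x else if i = k + 1 then y else out (path (u i))
  have hq : ∀ i, SeparationQuotient.mk (q i) = path (u i) := by
    intro i
    simp only [q]
    split_ifs with h1 h2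
    · have : u i = 0 := by simp [u, h1]
      rw [this, path.source]
    · have : u i = 1 := by
        simp only [u, h2]
        rw [div_self hk0.ne']
        simp
      rw [this, path.target]
    · exact Function.surjInv_eq SeparationQuotient.surjective_mk _
  have hq0 : q 0 = x := by simp [q]
  have hqk : q (k + 1) = y := by simp [q]
  have hd : ∀ z z' : ConeSeq D b,
      Tendsto (fun n => dist (z.seq n) (z'.seq n) / D.scale n) D.ω
        (𝓝 (dist (SeparationQuotient.mk z : AsymptoticCone D b) (SeparationQuotient.mk z'))) :=
    fun z z' => ConeSeq.tendsto_dist z z'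
  have hω : (D.ω : Filter ℕ) ≤ atTop := by
    rw [← Nat.cofinite_eq_atTop]
    exact D.nonprincipal
  -- `Λ` depends only on the number of division points and not on the scale, so one value of the
  -- gauge works for all `n`.
  obtain ⟨Λ, hΛ, hchain⟩ := exists_quasiGeodesic_of_chain (X := X) (k + 1)
  set m := 3 * M.bd Λ 0 + 3 + K₀ with hm
  have e1 : ∀ᶠ n in D.ω, ∀ i ∈ Finset.range (k + 1),
      dist ((q i).seq n) ((q (i + 1)).seq n) / D.scale n < r / (8 * C) := by
    rw [eventually_all_finset]
    intro i _
    refine (hd (q i) (q (i + 1))).eventually_lt_const ?_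
    rw [hq, hq]
    exact hunif (hu i)
  have e2 : ∀ᶠ n in D.ω, ∀ i ∈ Finset.range (k + 2),
      r / 2 < dist ((q i).seq n) (p.seq n) / D.scale n := by
    rw [eventually_all_finset]
    intro i _
    refine (hd (q i) p).eventually_const_lt ?_
    rw [hq]
    exact (half_lt_self hr0).trans_le (hrle _)
  have e3 : ∀ᶠ n in D.ω, 4 * C * (m + 1) / r < D.scale n :=
    (D.scale_tendsto.mono_left hω).eventually_gt_atTop _
  obtain ⟨n, h1, h2, h3⟩ := (e1.and (e2.and e3)).exists
  have hs := D.scale_pos n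
  obtain ⟨T, η, hT, hη, hη0, hηT, hclose⟩ := hchain (fun i => inc ((q i).seq n))
    (r / (8 * C) * D.scale n) (by positivity) (fun i hi => by
      refine (hinc _ _).trans ?_
      have := h1 i (Finset.mem_range.2 hi)
      rw [div_lt_iff₀ hs] at this
      exact this.le)
  simp only [hq0, hqk] at hη0 hηT
  have hLn : 0 ≤ L n := (hτ n).1.trans (hτ n).2
  have hnear : ∀ t ∈ Icc 0 T, Near (M.bd Λ 0) (γ n '' Icc 0 (L n)) (η t) := fun t ht =>
    (hM n).near hΛ le_rfl hT hη (by rw [hη0, ← h0]; exact ⟨0, ⟨le_rfl, hLn⟩, rfl⟩)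
      (by rw [hηT, ← hL]; exact ⟨L n, ⟨hLn, le_rfl⟩, rfl⟩) ht
  obtain ⟨t, ht, hdt⟩ := exists_near_of_crosses (hγ n) (hτ n) hT hη.1
    (near_self (x := η 0) (A := γ n '' (Icc 0 (L n) ∩ Iic (τ n)))
      (by rw [hη0, ← h0]; exact ⟨0, ⟨⟨le_rfl, hLn⟩, (hτ n).1⟩, rfl⟩) |>.mono (M.bd_pos _ _).le
        Subset.rfl)
    (near_self (x := η T) (A := γ n '' (Icc 0 (L n) ∩ Ici (τ n)))
      (by rw [hηT, ← hL]; exact ⟨L n, ⟨⟨hLn, le_rfl⟩, (hτ n).2⟩, rfl⟩) |>.mono (M.bd_pos _ _).le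
        Subset.rfl) hnear
  obtain ⟨i, hi, hdi⟩ := hclose t ht
  have h4 := h2 i (Finset.mem_range.2 (by omega))
  rw [lt_div_iff₀ hs] at h4
  -- The quasi-geodesic passes near `γ n (τ n)`, so some division point is within `r / 8 * D.scale n
  -- + C * (m + 1)` of `p.seq n`; for large scale this is less than `r / 2 * D.scale n`.
  have h5 := hinc' ((q i).seq n) (p.seq n)
  have h6 := dist_triangle4 (inc ((q i).seq n)) (η t) (γ n (τ n)) (inc (p.seq n))
  rw [dist_comm _ (η t)] at h6
  have h7 := hp n
  have h8 : C * dist (inc ((q i).seq n)) (inc (p.seq n)) ≤ C * (r / (8 * C) * D.scale n + m) :=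
    mul_le_mul_of_nonneg_left (by linarith) (by linarith)
  have h9 : C * (r / (8 * C) * D.scale n + m) = r / 8 * D.scale n + C * m := by
    field_simp
  rw [div_lt_iff₀ hr0] at h3
  nlinarith

namespace GraphOfGroups

variable {n : ℕ} {E : Type*} [Finite E] {𝒢 : GraphOfGroups n E}

/-- If the lengths `s k` were unbounded, the cone of the vertex group with scale `s k` would contain
limits of `1` and `h k` separated by the limit of edge group elements `p k` near the midpoints,
contrary to relative wideness. -/
theorem exists_bound_edgeHom (hs : 𝒢.IsMorselessStar) (M : MorseGauge) (α : E × Bool) :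
    ∃ D : ℝ, ∀ (h : 𝒢.H α.1) (γ : ℝ → 𝒢.X),
      IsGeodesicSegment γ (𝒢.pt (1, 𝒢.tgt α)) (𝒢.pt (𝒢.edgeHom α h, 𝒢.tgt α)) →
      IsMorseSet M (segImage γ (𝒢.pt (1, 𝒢.tgt α)) (𝒢.pt (𝒢.edgeHom α h, 𝒢.tgt α))) →
      dist (𝒢.pt (1, 𝒢.tgt α)) (𝒢.pt (𝒢.edgeHom α h, 𝒢.tgt α)) ≤ D := by
  by_contra hcon
  push Not at hcon
  choose h γ hγ hM hlt using fun k : ℕ => hcon (k + 1)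
  obtain ⟨C, hC1, hC⟩ := exists_dist_le_inclusion hs
  obtain ⟨C', hC1', hpath⟩ := exists_fibre_path hs
  set v := 𝒢.tgt α with hv
  let ε : 𝒢.TEdge := ⟨α, ((1 : 𝒢.FundGroup) : 𝒢.FundGroup ⧸ 𝒢.edgeSubgroup α)⟩
  have hmem : ∀ h : 𝒢.H α.1, ((𝒢.edgeHom α h, v) : 𝒢.XVert) ∈ 𝒢.edgeFibre ε := fun h =>
    ⟨rfl, by
      change ((𝒢.edgeHom α h : 𝒢.FundGroup) : 𝒢.FundGroup ⧸ 𝒢.edgeSubgroup α) = _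
      rw [QuotientGroup.eq]; exact ⟨h⁻¹, by simp⟩⟩
  let s : ℕ → ℝ := fun k => dist (𝒢.pt (1, v)) (𝒢.pt (𝒢.edgeHom α (h k), v))
  have hs1 : ∀ k, 1 ≤ s k := fun k => by
    have := hlt k
    have h0 : (0 : ℝ) ≤ k := Nat.cast_nonneg _
    simp only [s]
    linarith
  have hmid : ∀ k, s k / 2 ∈ Icc 0 (s k) := fun k => ⟨by linarith [hs1 k], by linarith [hs1 k]⟩
  -- The quasi-geodesic along the fibre has the same endpoints as `γ k`; it stays near `γ k` and
  -- hence passes near its midpoint.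
  have hex : ∀ k, ∃ p : 𝒢.H α.1, dist (γ k (s k / 2)) (𝒢.pt (𝒢.edgeHom α p, v)) ≤
      3 * M.bd C' C' + 4 := by
    intro k
    obtain ⟨T, η, hT, hη, hη0, hηT, hnear⟩ := hpath ε _ (hmem 1) _ (hmem (h k))
    rw [map_one] at hη0
    have h0 : η 0 = γ k 0 := by rw [hη0, (hγ k).1]
    have h1 : η T = γ k (s k) := by rw [hηT]; exact (hγ k).2.1.symm
    have h2 : ∀ t ∈ Icc 0 T, Near (M.bd C' C') (γ k '' Icc 0 (s k)) (η t) := fun t ht =>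
      (hM k).near hC1' (by linarith) hT hη
        (by rw [h0]; exact ⟨0, ⟨le_rfl, dist_nonneg⟩, rfl⟩)
        (by rw [h1]; exact ⟨s k, ⟨dist_nonneg, le_rfl⟩, rfl⟩) ht
    obtain ⟨t, ht, hdt⟩ := exists_near_of_crosses (hγ k).geodOn (hmid k) hT hη.1
      (near_self (x := η 0) (A := γ k '' (Icc 0 (s k) ∩ Iic (s k / 2)))
        (by rw [h0]; exact ⟨0, ⟨⟨le_rfl, dist_nonneg⟩, (hmid k).1⟩, rfl⟩) |>.mono
        (M.bd_pos _ _).le Subset.rfl)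
      (near_self (x := η T) (A := γ k '' (Icc 0 (s k) ∩ Ici (s k / 2)))
        (by rw [h1]; exact ⟨s k, ⟨⟨dist_nonneg, le_rfl⟩, (hmid k).2⟩, rfl⟩) |>.mono
        (M.bd_pos _ _).le Subset.rfl) h2
    obtain ⟨_, ⟨z, hz, rfl⟩, hzd⟩ := hnear t ht
    obtain ⟨-, p, rfl⟩ := edgeFibre_pair (hmem 1) hz
    refine ⟨p, ?_⟩
    simp only [map_one, one_mul] at hzd
    have := dist_triangle_left (γ k (s k / 2)) (𝒢.pt (𝒢.edgeHom α p, v)) (η t)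
    refine this.trans ?_
    change dist (η t) (𝒢.pt (𝒢.edgeHom α p, v)) ≤ 1 at hzd
    linarith
  choose p hp using hex
  let D : ConeData :=
    { ω := hyperfilter ℕ
      nonprincipal := hyperfilter_le_cofinite
      scale := s
      scale_pos := fun k => by linarith [hs1 k]
      scale_tendsto := tendsto_atTop_mono (f := fun k : ℕ => (k : ℝ)) (fun k => by
        have := hlt k
        simp only [s]
        linarith) tendsto_natCast_atTop_atTop }
  let b := GeomReal.vertex (𝒢.cay v) 1
  have hinc : ∀ z : 𝒢.H α.1, 𝒢.inclusion v (GeomReal.vertex _ (𝒢.fTgt α z)) =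
      𝒢.pt (𝒢.edgeHom α z, v) := fun z => inclusion_vertex v _
  have hinc1 : 𝒢.inclusion v b = 𝒢.pt (1, v) := by
    rw [inclusion_vertex, map_one]
  set K₀ := 3 * M.bd C' C' + 4 with hK₀
  have hK₀0 : 0 ≤ K₀ := by have := M.bd_pos C' C'; linarith
  have hupper : ∀ k, dist (𝒢.pt (1, v)) (𝒢.pt (𝒢.edgeHom α (p k), v)) ≤ s k / 2 + K₀ := by
    intro k
    have h1 := dist_triangle (𝒢.pt (1, v)) (γ k (s k / 2)) (𝒢.pt (𝒢.edgeHom α (p k), v))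
    have h2 := (hγ k).2.2 0 ⟨le_rfl, dist_nonneg⟩ (s k / 2) (hmid k)
    rw [(hγ k).1, zero_sub, abs_neg, abs_of_nonneg (hmid k).1] at h2
    linarith [hp k]
  have hlow1 : ∀ k, s k / 2 - K₀ ≤ dist (𝒢.pt (1, v)) (𝒢.pt (𝒢.edgeHom α (p k), v)) := by
    intro k
    have h1 := dist_triangle_right (𝒢.pt (1, v)) (γ k (s k / 2)) (𝒢.pt (𝒢.edgeHom α (p k), v))
    have h2 := (hγ k).2.2 0 ⟨le_rfl, dist_nonneg⟩ (s k / 2) (hmid k)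
    rw [(hγ k).1, zero_sub, abs_neg, abs_of_nonneg (hmid k).1] at h2
    linarith [hp k]
  have hlow2 : ∀ k, s k / 2 - K₀ ≤
      dist (𝒢.pt (𝒢.edgeHom α (h k), v)) (𝒢.pt (𝒢.edgeHom α (p k), v)) := by
    intro k
    have h1 := dist_triangle_right (𝒢.pt (𝒢.edgeHom α (h k), v)) (γ k (s k / 2))
      (𝒢.pt (𝒢.edgeHom α (p k), v))
    have h2 := (hγ k).2.2 (s k) ⟨dist_nonneg, le_rfl⟩ (s k / 2) (hmid k)
    rw [show γ k (s k) = _ from (hγ k).2.1, sub_half, abs_of_nonneg (hmid k).1] at h2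
    linarith [hp k]
  let x : ConeSeq D b := ⟨fun _ => b, 0, fun k => by simp⟩
  let y : ConeSeq D b := ⟨fun k => GeomReal.vertex _ (𝒢.fTgt α (h k)), 2 * C, fun k => by
    have := hC v (GeomReal.vertex _ (𝒢.fTgt α (h k))) b
    rw [hinc, hinc1, dist_comm (𝒢.pt _)] at this
    change _ ≤ 2 * C * s k
    change _ ≤ C * s k + C at this
    nlinarith [hs1 k]⟩
  let P : ConeSeq D b := ⟨fun k => GeomReal.vertex _ (𝒢.fTgt α (p k)), C * (2 + K₀), fun k => by
    have := hC v (GeomReal.vertex _ (𝒢.fTgt α (p k))) b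
    rw [hinc, hinc1, dist_comm (𝒢.pt _)] at this
    change _ ≤ C * (2 + K₀) * s k
    have h1 : C * dist (𝒢.pt (1, v)) (𝒢.pt (𝒢.edgeHom α (p k), v)) ≤ C * (s k / 2 + K₀) :=
      mul_le_mul_of_nonneg_left (hupper k) (by linarith)
    have h2 : K₀ ≤ K₀ * s k := by nlinarith [hs1 k]
    have h3 : C * K₀ ≤ C * (K₀ * s k) := mul_le_mul_of_nonneg_left h2 (by linarith)
    nlinarith [hs1 k]⟩
  -- The midpoint is at distance `s k / 2` from the ends, up to a constant, so in the cone its limit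
  -- is different from both.
  have hne : ∀ z : ConeSeq D b, (∀ k, s k / 2 - K₀ ≤ dist (P.seq k) (z.seq k)) →
      (SeparationQuotient.mk P : AsymptoticCone D b) ≠ SeparationQuotient.mk z := by
    intro z hz heq
    have h1 : Tendsto (fun k => dist (P.seq k) (z.seq k) / s k) D.ω
        (𝓝 (dist (SeparationQuotient.mk P : AsymptoticCone D b) (SeparationQuotient.mk z))) :=
      ConeSeq.tendsto_dist P z
    rw [heq, dist_self] at h1
    have hω : (D.ω : Filter ℕ) ≤ atTop := by
      rw [← Nat.cofinite_eq_atTop]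
      exact D.nonprincipal
    have e1 := h1.eventually_lt_const (show (0 : ℝ) < 1 / 4 by norm_num)
    have e2 := (D.scale_tendsto.mono_left hω).eventually_gt_atTop (4 * K₀)
    obtain ⟨k, h2, h3⟩ := (e1.and e2).exists
    have hsk := hs1 k
    rw [div_lt_iff₀ (by linarith)] at h2
    have h4 := hz k
    change 4 * K₀ < s k at h3
    linarith
  refine not_joinedIn_of_isMorseSet (inc := 𝒢.inclusion v) hC1 (dist_inclusion_le v) (hC v)
    (x := x) (y := y) (p := P) (M := M) (γ := γ) (L := s) (τ := fun k => s k / 2) (K₀ := K₀)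
    (fun k => (hγ k).geodOn) hM (fun k => ?_) (fun k => ?_) hmid (fun k => ?_) ?_
  · rw [(hγ k).1]; exact hinc1.symm
  · exact (hγ k).2.1.trans (hinc _).symm
  · change dist _ (𝒢.inclusion v (GeomReal.vertex _ (𝒢.fTgt α (p k)))) ≤ _
    rw [hinc]
    exact hp k
  · refine hs.wide α.1 α.2 D x y (fun k => ⟨1, one_mem _, rfl⟩) (fun k => ⟨_, ⟨h k, rfl⟩, rfl⟩)
      (SeparationQuotient.mk P) (hne x fun k => ?_) (hne y fun k => ?_)
    · refine (hlow1 k).trans ?_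
      rw [dist_comm, ← hinc1, ← hinc]
      exact dist_inclusion_le v _ _
    · refine (hlow2 k).trans ?_
      rw [dist_comm, ← hinc, ← hinc]
      exact dist_inclusion_le v _ _

/-- Morse geodesics between points of an edge fibre are short. -/
theorem exists_bound_fibre (hs : 𝒢.IsMorselessStar) (M : MorseGauge) :
    ∃ D : ℝ, ∀ (ε : 𝒢.TEdge), ∀ x ∈ 𝒢.edgeFibre ε, ∀ y ∈ 𝒢.edgeFibre ε, ∀ γ : ℝ → 𝒢.X,
      IsGeodesicSegment γ (𝒢.pt x) (𝒢.pt y) → IsMorseSet M (segImage γ (𝒢.pt x) (𝒢.pt y)) →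
      dist (𝒢.pt x) (𝒢.pt y) ≤ D := by
  choose D hD using exists_bound_edgeHom hs M
  obtain ⟨D', hD'⟩ := (Set.finite_range D).bddAbove
  refine ⟨D', fun ε x hx y hy γ hγ hM => le_trans ?_ (hD' ⟨ε.1, rfl⟩)⟩
  obtain ⟨hx2, h, rfl⟩ := edgeFibre_pair hx hy
  obtain ⟨g, v⟩ := x
  simp only at hx2
  subst hx2
  simp only at hγ hM ⊢
  have e1 : 𝒢.translate g⁻¹ (𝒢.pt (g, 𝒢.tgt ε.1)) = 𝒢.pt (1, 𝒢.tgt ε.1) := by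
    rw [translate_pt, inv_mul_cancel]
  have e2 : 𝒢.translate g⁻¹ (𝒢.pt (g * 𝒢.edgeHom ε.1 h, 𝒢.tgt ε.1)) =
      𝒢.pt (𝒢.edgeHom ε.1 h, 𝒢.tgt ε.1) := by
    rw [translate_pt, inv_mul_cancel_left]
  have e3 := dist_translate g⁻¹ (𝒢.pt (g, 𝒢.tgt ε.1))
    (𝒢.pt (g * 𝒢.edgeHom ε.1 h, 𝒢.tgt ε.1))
  rw [e1, e2] at e3
  rw [← e3]
  refine hD ε.1 h (fun t => 𝒢.translate g⁻¹ (γ t)) ⟨?_, ?_, ?_⟩ ?_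
  · simp only [hγ.1, e1]
  · simp only [e3, hγ.2.1, e2]
  · rw [e3]
    intro s hs t ht
    rw [dist_translate]
    exact hγ.2.2 s hs t ht
  · have := isMorseSet_translate hM g⁻¹
    rw [segImage, ← image_comp] at this
    rw [segImage, e3]
    exact this

/-- Points on a Morse geodesic which are close to an edge fibre are close to each other. -/
theorem exists_bound_near_fibre (hs : 𝒢.IsMorselessStar) (M : MorseGauge) (K : ℝ) :
    ∃ D : ℝ, ∀ {ρ : ℝ → 𝒢.X} {J : Set ℝ} [J.OrdConnected], GeodOn ρ J → IsMorseSet M (ρ '' J) →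
      ∀ (ε : 𝒢.TEdge), ∀ s ∈ J, ∀ t ∈ J, Near K (𝒢.pt '' 𝒢.edgeFibre ε) (ρ s) →
      Near K (𝒢.pt '' 𝒢.edgeFibre ε) (ρ t) → |s - t| ≤ D := by
  obtain ⟨K', hK'⟩ := near_of_endpoints_near (X := 𝒢.X) M K
  obtain ⟨D, hD⟩ := exists_bound_fibre hs (M.half.half.shift K')
  refine ⟨D + 2 * K, fun {ρ J} _ hρ hM ε => ?_⟩
  have key : ∀ s ∈ J, ∀ t ∈ J, s ≤ t → Near K (𝒢.pt '' 𝒢.edgeFibre ε) (ρ s) →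
      Near K (𝒢.pt '' 𝒢.edgeFibre ε) (ρ t) → |s - t| ≤ D + 2 * K := by
    rintro s hs t ht hst ⟨_, ⟨x, hx, rfl⟩, hxd⟩ ⟨_, ⟨y, hy, rfl⟩, hyd⟩
    -- `σ` follows the subsegment of `ρ` between the two times, so its gauge depends on `M` and `K`
    -- only, and the bound for geodesics between fibre points applies.
    obtain ⟨σ, hσ⟩ := GeodesicSpace.exists_geodesic (𝒢.pt x) (𝒢.pt y)
    obtain ⟨h1, h2⟩ := hK' hρ hM hσ hs ht hst (by rwa [dist_comm]) (by rwa [dist_comm])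
    have h3 := hD ε x hx y hy σ hσ ((hM.of_Icc hρ hs ht hst).transfer h1 h2)
    have h4 := dist_triangle4 (ρ s) (𝒢.pt x) (𝒢.pt y) (ρ t)
    rw [dist_comm (𝒢.pt y) (ρ t), hρ s hs t ht] at h4
    linarith
  intro s hs t ht h1 h2
  rcases le_total s t with hst | hst
  · exact key s hs t ht hst h1 h2
  · rw [abs_sub_comm]
    exact key t ht s hs hst h2 h1

end GraphOfGroups

theorem MorseGauge.le_half (M : MorseGauge) : M ≤ M.half := by
  intro l e
  change M.toFun l e ≤ l.1.toNNReal * (l.1.toNNReal * (6 * M.toFun l e + 12 + e)) + e +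
    (3 * M.toFun l e + 6)
  have : M.toFun l e ≤ 3 * M.toFun l e := le_mul_of_one_le_left (zero_le) (by norm_num)
  exact this.trans (le_self_add.trans le_add_self)

/-! ### The two sides of an edge in the Bass–Serre space -/

namespace GraphOfGroups

variable {n : ℕ} {E : Type*} [Finite E] {𝒢 : GraphOfGroups n E}

variable (𝒢) in
/-- The point `p` is close to a vertex beyond `ε`. -/
def Side (ε : 𝒢.TEdge) (p : 𝒢.X) : Prop := ∃ x, 𝒢.Beyond ε (𝒢.proj x) ∧ dist p (𝒢.pt x) < 1

variable (𝒢) in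
/-- The point `p` is close to a vertex which is not beyond `ε`. -/
def CoSide (ε : 𝒢.TEdge) (p : 𝒢.X) : Prop :=
  ∃ x, ¬ 𝒢.Beyond ε (𝒢.proj x) ∧ dist p (𝒢.pt x) < 1

variable (𝒢) in
/-- The edge fibre as a set of points of the Bass–Serre space. -/
def fibre (ε : 𝒢.TEdge) : Set 𝒢.X := 𝒢.pt '' 𝒢.edgeFibre ε

theorem side_pt {ε : 𝒢.TEdge} {x : 𝒢.XVert} (h : 𝒢.Beyond ε (𝒢.proj x)) : 𝒢.Side ε (𝒢.pt x) :=
  ⟨x, h, by simp⟩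

theorem coSide_pt {ε : 𝒢.TEdge} {x : 𝒢.XVert} (h : ¬ 𝒢.Beyond ε (𝒢.proj x)) :
    𝒢.CoSide ε (𝒢.pt x) := ⟨x, h, by simp⟩

theorem side_or_coSide (ε : 𝒢.TEdge) (p : 𝒢.X) : 𝒢.Side ε p ∨ 𝒢.CoSide ε p := by
  obtain ⟨x, hx⟩ := GeomReal.exists_dist_vertex_lt p
  by_cases h : 𝒢.Beyond ε (𝒢.proj x)
  · exact Or.inl ⟨x, h, hx⟩
  · exact Or.inr ⟨x, h, hx⟩

theorem isOpen_side (ε : 𝒢.TEdge) : IsOpen {p | 𝒢.Side ε p} := by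
  have : {p | 𝒢.Side ε p} = ⋃ x ∈ {x | 𝒢.Beyond ε (𝒢.proj x)}, Metric.ball (𝒢.pt x) 1 := by
    ext p
    simp [Side]
  rw [this]
  exact isOpen_biUnion fun x _ => Metric.isOpen_ball

theorem isOpen_coSide (ε : 𝒢.TEdge) : IsOpen {p | 𝒢.CoSide ε p} := by
  have : {p | 𝒢.CoSide ε p} = ⋃ x ∈ {x | ¬ 𝒢.Beyond ε (𝒢.proj x)}, Metric.ball (𝒢.pt x) 1 := by
    ext p
    simp [CoSide]
  rw [this]
  exact isOpen_biUnion fun x _ => Metric.isOpen_ball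

/-- The two sides are open and overlap. A point of the overlap is within distance less than `1` of
vertices on different sides, which are then adjacent, and the only edge of the tree which changes
sides is `ε`. -/
theorem near_fibre_of_side {ε : 𝒢.TEdge} {p : 𝒢.X} (h : 𝒢.Side ε p) (h' : 𝒢.CoSide ε p) :
    Near 1 (𝒢.fibre ε) p := by
  obtain ⟨x, hx, hxd⟩ := h
  obtain ⟨y, hy, hyd⟩ := h'
  have h1 : 𝒢.xGraph.dist y x < 2 := by
    have := dist_triangle_left (𝒢.pt y) (𝒢.pt x) p
    rw [GeomReal.dist_vertex] at this
    exact_mod_cast this.trans_lt (add_lt_add hyd hxd |>.trans_eq one_add_one_eq_two)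
  have hne : y ≠ x := by rintro rfl; exact hy hx
  have h2 : 𝒢.xGraph.Adj y x := by
    rw [← SimpleGraph.dist_eq_one_iff_adj]
    have := 𝒢.xGraph_connected.pos_dist_of_ne hne
    omega
  rcases 𝒢.adj_cases h2 with ⟨s, -, rfl⟩ | ⟨ε', h3, h4, h5, -⟩
  · rw [← 𝒢.proj_eq_iff.2 ⟨s, rfl⟩] at hx
    exact absurd hx hy
  · rw [← h3] at hy
    rw [← h4] at hx
    obtain rfl := eq_of_crosses hy hx
    exact ⟨_, ⟨x, h5, rfl⟩, hxd.le⟩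

/-- A path which changes sides passes close to the edge fibre. -/
theorem exists_near_fibre {ε : 𝒢.TEdge} {η : ℝ → 𝒢.X} {a b u v : ℝ}
    (hη : ContinuousOn η (Icc a b)) (hu : u ∈ Icc a b) (hv : v ∈ Icc a b)
    (h : 𝒢.Side ε (η u)) (h' : 𝒢.CoSide ε (η v)) :
    ∃ t ∈ Icc a b, Near 1 (𝒢.fibre ε) (η t) := by
  obtain ⟨_, ⟨t, ht, rfl⟩, h1, h2⟩ := (isPreconnected_Icc.image η hη) _ _ (isOpen_side ε)
    (isOpen_coSide ε) (fun p _ => side_or_coSide ε p) ⟨η u, ⟨u, hu, rfl⟩, h⟩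
    ⟨η v, ⟨v, hv, rfl⟩, h'⟩
  exact ⟨t, ht, near_fibre_of_side h1 h2⟩

/-- A geodesic from `p` to `q` meets the neighbourhood of the fibre. -/
theorem near_fibre_of_dist {ε : 𝒢.TEdge} {p q : 𝒢.X} (h : 𝒢.Side ε p) (h' : 𝒢.CoSide ε q) :
    Near (dist p q + 1) (𝒢.fibre ε) p ∧ Near (dist p q + 1) (𝒢.fibre ε) q := by
  obtain ⟨σ, hσ⟩ := GeodesicSpace.exists_geodesic p q
  have h0 : (0 : ℝ) ∈ Icc 0 (dist p q) := ⟨le_rfl, dist_nonneg⟩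
  have h1 : dist p q ∈ Icc 0 (dist p q) := ⟨dist_nonneg, le_rfl⟩
  obtain ⟨t, ht, hn⟩ := exists_near_fibre (ε := ε) hσ.geodOn.continuousOn h0 h1
    (by rwa [hσ.1]) (by rwa [hσ.2.1])
  have e1 := hσ.2.2 0 h0 t ht
  have e2 := hσ.2.2 _ h1 t ht
  rw [hσ.1, zero_sub, abs_neg, abs_of_nonneg ht.1] at e1
  rw [hσ.2.1, abs_of_nonneg (by linarith [ht.2])] at e2
  exact ⟨hn.trans_dist (by linarith [ht.2]), hn.trans_dist (by linarith [ht.1])⟩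

theorem near_of_mem_fibre {ε : 𝒢.TEdge} {p q : 𝒢.X} {K : ℝ} (h : q ∈ 𝒢.fibre ε)
    (hd : dist p q ≤ K) : Near K (𝒢.fibre ε) p := ⟨q, h, hd⟩

/-- A Morse ray from the base point which comes close to the fibre of an outgoing edge is there
close to the chosen point of the fibre. -/
theorem exists_bound_edgeBase (hs : 𝒢.IsMorselessStar) (M : MorseGauge) (K : ℝ) (hK : 0 ≤ K) :
    ∃ D : ℝ, 0 ≤ D ∧ ∀ {c : 𝒢.Choices} {ρ : ℝ → 𝒢.X}, ρ 0 = 𝒢.pt 𝒢.one → IsGeodesicRay ρ →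
      IsMorseSet M (rayImage ρ) → ∀ (ε : 𝒢.TEdge), 𝒢.Outgoing ε → ∀ t ∈ Ici (0 : ℝ),
      Near K (𝒢.fibre ε) (ρ t) → dist (ρ t) (𝒢.pt (c.edgeBase ε)) ≤ D := by
  obtain ⟨C, hC, hpath⟩ := exists_fibre_path hs
  set B := M.bd (2 * C + 1) (C + 1 + 4 * K) with hB
  have hB0 : 0 < B := M.bd_pos _ _
  obtain ⟨D, hD⟩ := exists_bound_near_fibre hs M (K + B)
  refine ⟨max D 0 + B, by positivity, ?_⟩
  rintro c ρ h0 hρ hM ε hε t ht ⟨_, ⟨x, hx, rfl⟩, hxd⟩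
  obtain ⟨γ, hγ⟩ := GeodesicSpace.exists_geodesic (𝒢.pt 𝒢.one) (𝒢.pt (c.edgeBase ε))
  obtain ⟨T, η, hT, hη, hη0, hηT, hnear⟩ := hpath ε _ (c.edgeBase_mem ε hε) x hx
  set L := dist (𝒢.pt 𝒢.one) (𝒢.pt (c.edgeBase ε)) with hL
  have hL0 : 0 ≤ L := dist_nonneg
  have hjoin : γ L = η 0 := by rw [hη0]; exact hγ.2.1
  -- The path along the fibre stays within `1` of it, so `ε^*` is nearest on this path up to `1`.
  -- The resulting quasi-geodesic passes through `ε^*`, which is thus near some `ρ s`; both `ρ s`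
  -- and `ρ t` are near the fibre, and `|s - t|` is bounded.
  have hq := hη.join_nearest hC (by linarith) zero_le_one hL0 hT hγ.geodOn hjoin (by
    intro u hu
    rw [hγ.1, hγ.2.1]
    obtain ⟨_, ⟨y, hy, rfl⟩, hyd⟩ := hnear u hu
    have h1 := c.edgeBase_min ε hε y hy
    have h2 := dist_triangle (𝒢.pt 𝒢.one) (η u) (𝒢.pt y)
    linarith)
  have hL1 : L ∈ Icc 0 (L + T) := ⟨hL0, by linarith⟩
  obtain ⟨T', η', hT', hη', h0', h1', hsub⟩ := exists_extension (K := K) (x := ρ 0) (y := ρ t)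
    (by linarith) (by linarith) (by linarith) hq
    (by rw [joinPath_of_le hL0, hγ.1, h0, dist_self]; exact hK)
    (by rw [joinPath_of_ge hjoin (by linarith), add_sub_cancel_left, hηT, dist_comm]; exact hxd)
  obtain ⟨u, hu, hue⟩ := hsub ⟨L, hL1, rfl⟩
  rw [joinPath_of_le le_rfl, hγ.2.1] at hue
  obtain ⟨_, ⟨s, hs, rfl⟩, hsd⟩ := hM.near (by linarith) (by linarith) hT' hη'
    (by rw [h0']; exact ⟨0, mem_Ici.2 le_rfl, rfl⟩) (by rw [h1']; exact ⟨t, ht, rfl⟩) hu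
  rw [hue] at hsd
  have h2 : |s - t| ≤ D := hD (J := Ici 0) hρ hM ε s hs t ht
    ⟨_, ⟨_, c.edgeBase_mem ε hε, rfl⟩, by rw [dist_comm]; linarith⟩ ⟨_, ⟨x, hx, rfl⟩, by linarith⟩
  have h3 := dist_triangle_right (ρ t) (𝒢.pt (c.edgeBase ε)) (ρ s)
  rw [hρ t ht s hs, abs_sub_comm] at h3
  linarith [le_max_left D 0]

/-- A Morse geodesic ray cannot stay close to both sides of an edge. -/
theorem not_frequently_both (hs : 𝒢.IsMorselessStar) {M : MorseGauge} {ρ : ℝ → 𝒢.X}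
    (hρ : IsGeodesicRay ρ) (hM : IsMorseSet M (rayImage ρ)) {ε : 𝒢.TEdge} {R : ℝ}
    (h : ∃ᶠ t in atTop, ∃ p, 𝒢.Side ε p ∧ dist (ρ t) p ≤ R)
    (h' : ∃ᶠ t in atTop, ∃ p, 𝒢.CoSide ε p ∧ dist (ρ t) p ≤ R) : False := by
  obtain ⟨D, hD⟩ := exists_bound_near_fibre hs M (2 * (R + 1))
  -- After every time the ray comes near the fibre: either it is itself on the unexpected side of a
  -- nearby point, or it changes sides.
  have key : ∀ B : ℝ, 0 ≤ B → ∃ t, B ≤ t ∧ Near (2 * (R + 1)) (𝒢.fibre ε) (ρ t) := by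
    intro B hB
    obtain ⟨t, ht, p, hp, hpd⟩ := frequently_atTop.1 h B
    obtain ⟨t', ht', p', hp', hpd'⟩ := frequently_atTop.1 h' t
    have hR : 0 ≤ R := dist_nonneg.trans hpd
    have hc : ContinuousOn ρ (Icc t t') :=
      (GeodOn.continuousOn (J := Ici 0) hρ).mono fun u hu => (hB.trans ht).trans hu.1
    by_cases h1 : 𝒢.Side ε (ρ t)
    · by_cases h2 : 𝒢.CoSide ε (ρ t')
      · obtain ⟨u, hu, hn⟩ := exists_near_fibre hc ⟨le_rfl, ht'⟩ ⟨ht', le_rfl⟩ h1 h2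
        exact ⟨u, ht.trans hu.1, hn.mono (by linarith) Subset.rfl⟩
      · have h3 := (side_or_coSide ε (ρ t')).resolve_right h2
        exact ⟨t', ht.trans ht', (near_fibre_of_dist h3 hp').1.mono (by linarith) Subset.rfl⟩
    · have h3 := (side_or_coSide ε (ρ t)).resolve_left h1
      rw [dist_comm] at hpd
      exact ⟨t, ht, (near_fibre_of_dist hp h3).2.mono (by linarith) Subset.rfl⟩
  obtain ⟨t, ht, hn⟩ := key 0 le_rfl
  obtain ⟨t', ht', hn'⟩ := key (t + |D| + 1) (by positivity)
  have h1 : |t' - t| ≤ D := hD (J := Ici 0) hρ hM ε t' (by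
    have := abs_nonneg D
    simp only [mem_Ici]; linarith) t ht hn' hn
  have h2 := le_abs_self D
  have h3 := le_abs_self (t' - t)
  linarith

end GraphOfGroups

/-! ### Combinatorial rays and their realisations, piece by piece -/

theorem concatPaths_eq {X : Type*} {k : ℕ∞} {len : ℕ → ℝ} {γ : ℕ → ℝ → X} {i : ℕ} {t : ℝ}
    (hi : (i : ℕ∞) ≤ k) (hlen : ∀ m, 0 ≤ len m) (h1 : ∑ m ∈ Finset.range i, len m ≤ t)
    (h2 : (i : ℕ∞) = k ∨ t < ∑ m ∈ Finset.range (i + 1), len m) :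
    concatPaths k len γ t = γ i (t - ∑ m ∈ Finset.range i, len m) := by
  -- For an index `j < i` both clauses fail: `j` is not the last index, and the partial sum up to `j
  -- + 1` does not exceed `t`.
  have : sInf {i : ℕ | (i : ℕ∞) = k ∨ t < ∑ m ∈ Finset.range (i + 1), len m} = i := by
    refine le_antisymm (Nat.sInf_le h2) (le_csInf ⟨i, h2⟩ fun j hj => ?_)
    by_contra hlt
    push Not at hlt
    rcases hj with hj | hj
    · rw [← hj] at hi
      exact absurd (Nat.cast_le.1 hi) (not_le.2 hlt)
    · have : ∑ m ∈ Finset.range (j + 1), len m ≤ ∑ m ∈ Finset.range i, len m :=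
        Finset.sum_le_sum_of_subset_of_nonneg (Finset.range_subset_range.2 hlt)
          fun m _ _ => hlen m
      linarith
  simp only [concatPaths, this]

namespace GraphOfGroups

variable {n : ℕ} {E : Type*} [Finite E] {𝒢 : GraphOfGroups n E}

namespace CombRay

/-- `ε` is the edge number `i` of the combinatorial ray. -/
def EdgeAt : 𝒢.CombRay → ℕ → 𝒢.TEdge → Prop
  | .finite k p _ _, i, ε => ∃ h : i < k, p ⟨i, h⟩ = ε
  | .infinite p _, i, ε => p i = ε

/-- The vertices of a combinatorial ray (with the value `G_0` beyond its end). -/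
def vertAt : 𝒢.CombRay → ℕ → 𝒢.TVert
  | _, 0 => 𝒢.root
  | .finite k p _ _, i + 1 => if h : i < k then 𝒢.tTgt (p ⟨i, h⟩) else 𝒢.root
  | .infinite p _, i + 1 => 𝒢.tTgt (p i)

variable {r : 𝒢.CombRay} {i j : ℕ} {ε ε' : 𝒢.TEdge}

theorem EdgeAt.unique (h : r.EdgeAt i ε) (h' : r.EdgeAt i ε') : ε = ε' := by
  cases r with
  | finite k p hp z =>
    obtain ⟨_, rfl⟩ := h
    obtain ⟨_, rfl⟩ := h'
    rfl
  | infinite p hp => exact h.symm.trans h'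

theorem EdgeAt.lt (h : r.EdgeAt i ε) : (i : ℕ∞) < Choices.length r := by
  cases r with
  | finite k p hp z =>
    obtain ⟨h, -⟩ := h
    exact Nat.cast_lt.2 h
  | infinite p hp => exact ENat.natCast_lt_top i

theorem exists_edgeAt (h : (i : ℕ∞) < Choices.length r) : ∃ ε, r.EdgeAt i ε := by
  cases r with
  | finite k p hp z => exact ⟨_, Nat.cast_lt.1 h, rfl⟩
  | infinite p hp => exact ⟨_, rfl⟩

theorem lt_length (h : (j : ℕ∞) ≤ Choices.length r) (hij : i < j) :
    (i : ℕ∞) < Choices.length r :=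
  (Nat.cast_lt.2 hij).trans_le h

theorem EdgeAt.succ_le (h : r.EdgeAt i ε) : ((i + 1 : ℕ) : ℕ∞) ≤ Choices.length r := by
  rw [Nat.cast_add, Nat.cast_one]
  exact Order.add_one_le_of_lt h.lt

theorem vertAt_zero : r.vertAt 0 = 𝒢.root := by cases r <;> rfl

theorem EdgeAt.tTgt_eq (h : r.EdgeAt i ε) : 𝒢.tTgt ε = r.vertAt (i + 1) := by
  cases r with
  | finite k p hp z =>
    obtain ⟨h, rfl⟩ := h
    simp [vertAt, h]
  | infinite p hp =>
    obtain rfl : p i = ε := h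
    rfl

theorem pathVertex_eq {k : ℕ} {p : Fin k → 𝒢.TEdge} {hp : 𝒢.IsGeodesicPath p} {z}
    (i : Fin (k + 1)) : 𝒢.pathVertex p i = (CombRay.finite k p hp z).vertAt i := by
  refine Fin.cases ?_ (fun i => ?_) i
  · rfl
  · simp only [pathVertex, Fin.cons_succ, Fin.val_succ]
    simp [vertAt]

theorem endVertex_eq {k : ℕ} {p : Fin k → 𝒢.TEdge} {hp : 𝒢.IsGeodesicPath p} {z} :
    𝒢.endVertex p = (CombRay.finite k p hp z).vertAt k := pathVertex_eq (Fin.last k)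

theorem pathVertexInf_eq {p : ℕ → 𝒢.TEdge} {hp : 𝒢.IsGeodesicPathInf p}
    (i : ℕ) : 𝒢.pathVertexInf p i = (CombRay.infinite p hp).vertAt i := by
  cases i <;> rfl

theorem EdgeAt.tSrc_eq (h : r.EdgeAt i ε) : 𝒢.tSrc ε = r.vertAt i := by
  cases r with
  | finite k p hp z =>
    obtain ⟨h, rfl⟩ := h
    rw [hp.1 ⟨i, h⟩, pathVertex_eq (hp := hp) (z := z)]
    rfl
  | infinite p hp =>
    obtain rfl : p i = ε := h
    rw [hp.1 i, pathVertexInf_eq (hp := hp)]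

theorem dist_root_vertAt (h : (i : ℕ∞) ≤ Choices.length r) :
    𝒢.bsTree.dist 𝒢.root (r.vertAt i) = i := by
  cases r with
  | finite k p hp z =>
    have hi : i < k + 1 := Nat.lt_succ_of_le (Nat.cast_le.1 h)
    have := hp.2 0 ⟨i, hi⟩ (Fin.zero_le _)
    rw [pathVertex_eq (hp := hp) (z := z), pathVertex_eq (hp := hp) (z := z)] at this
    simpa [vertAt_zero] using this
  | infinite p hp =>
    have := hp.2 0 i (Nat.zero_le _)
    rw [pathVertexInf_eq (hp := hp), pathVertexInf_eq (hp := hp), vertAt_zero] at this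
    simpa using this

theorem EdgeAt.outgoing (h : r.EdgeAt i ε) : 𝒢.Outgoing ε := by
  unfold Outgoing
  rw [h.tSrc_eq, h.tTgt_eq, dist_root_vertAt h.lt.le, dist_root_vertAt h.succ_le]
  exact Nat.lt_succ_self i

theorem EdgeAt.beyond_mono (star : 𝒢.IsStar) (h : r.EdgeAt i ε) (h' : r.EdgeAt j ε') (hij : i ≤ j)
    {u : 𝒢.TVert} (hu : 𝒢.Beyond ε' u) : 𝒢.Beyond ε u := by
  induction j generalizing ε' with
  | zero =>
    obtain rfl : i = 0 := by omega
    rwa [h.unique h']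
  | succ j ih =>
    rcases hij.eq_or_lt with rfl | hlt
    · rwa [h.unique h']
    · obtain ⟨ε'', h''⟩ := exists_edgeAt (lt_length h'.lt.le (Nat.lt_succ_self j))
      exact ih h'' (by omega)
        (beyond_of_beyond star h''.outgoing h'.outgoing (by rw [h''.tTgt_eq, h'.tSrc_eq]) hu)

theorem EdgeAt.beyond_vertAt (star : 𝒢.IsStar) (h : r.EdgeAt i ε) (hij : i < j)
    (hj : (j : ℕ∞) ≤ Choices.length r) : 𝒢.Beyond ε (r.vertAt j) := by
  obtain ⟨j, rfl⟩ := Nat.exists_eq_add_of_lt hij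
  obtain ⟨ε', h'⟩ := exists_edgeAt (lt_length hj (Nat.lt_succ_self (i + j)))
  refine h.beyond_mono star h' (by omega) ?_
  rw [← h'.tTgt_eq]
  exact 𝒢.beyond_tgt ε'

/-- Vertices beyond an outgoing edge are at least as far from `G_0` as its target. -/
theorem EdgeAt.not_beyond_vertAt (star : 𝒢.IsStar) (h : r.EdgeAt i ε) (hij : j ≤ i) :
    ¬ 𝒢.Beyond ε (r.vertAt j) := by
  intro hb
  have h1 := (dist_lt_of_not_beyond ((outgoing_iff star).1 h.outgoing)).2 _ hb
  have hj : (j : ℕ∞) ≤ Choices.length r := (Nat.cast_le.2 hij).trans h.lt.le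
  rw [h.tTgt_eq, dist_root_vertAt hj, dist_root_vertAt h.succ_le] at h1
  omega

end CombRay

namespace Choices

open CombRay

variable {c : 𝒢.Choices} {r : 𝒢.CombRay} {i j : ℕ} {ε ε' : 𝒢.TEdge}

theorem vertBase_root : c.vertBase 𝒢.root = 𝒢.one := by
  unfold vertBase
  rw [dif_neg]
  simp

/-- Only one outgoing edge ends at a given vertex, so the choice made in `vertBase` is harmless. -/
theorem vertBase_tTgt (star : 𝒢.IsStar) (h : 𝒢.Outgoing ε) :
    c.vertBase (𝒢.tTgt ε) = c.edgeBase ε := by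
  have hne : 𝒢.tTgt ε ≠ 𝒢.root := by
    intro he
    unfold Outgoing at h
    rw [he, SimpleGraph.dist_self] at h
    exact absurd h (Nat.not_lt_zero _)
  have hex : 𝒢.tTgt ε ≠ 𝒢.root ∧ ∃ ε', 𝒢.Outgoing ε' ∧ 𝒢.tTgt ε' = 𝒢.tTgt ε := ⟨hne, ε, h, rfl⟩
  unfold vertBase
  rw [dif_pos hex, outgoing_unique star hex.2.choose_spec.1 h hex.2.choose_spec.2]

theorem corner_zero : c.corner r 0 = 𝒢.one := by cases r <;> rfl

theorem corner_succ (h : r.EdgeAt i ε) : c.corner r (i + 1) = c.edgeBase ε := by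
  cases r with
  | finite k p hp z =>
    obtain ⟨h, rfl⟩ := h
    exact dif_pos h
  | infinite p hp =>
    obtain rfl : p i = ε := h
    rfl

theorem vertBase_vertAt (star : 𝒢.IsStar) (h : (i : ℕ∞) ≤ length r) :
    c.vertBase (r.vertAt i) = c.corner r i := by
  cases i with
  | zero => rw [vertAt_zero, vertBase_root, corner_zero]
  | succ i =>
    obtain ⟨ε, hε⟩ := exists_edgeAt (lt_length h (Nat.lt_succ_self i))
    rw [← hε.tTgt_eq, vertBase_tTgt star hε.outgoing, corner_succ hε]

theorem proj_corner (h : (i : ℕ∞) ≤ length r) : 𝒢.proj (c.corner r i) = r.vertAt i := by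
  cases i with
  | zero => rw [vertAt_zero, corner_zero]; rfl
  | succ i =>
    obtain ⟨ε, hε⟩ := exists_edgeAt (lt_length h (Nat.lt_succ_self i))
    rw [← hε.tTgt_eq, corner_succ hε]
    exact 𝒢.proj_of_mem_edgeFibre (c.edgeBase_mem ε hε.outgoing)

theorem corner_mem_fibre (h : r.EdgeAt i ε) : 𝒢.pt (c.corner r (i + 1)) ∈ 𝒢.fibre ε := by
  rw [corner_succ h]
  exact ⟨_, c.edgeBase_mem ε h.outgoing, rfl⟩

theorem side_corner (star : 𝒢.IsStar) (h : r.EdgeAt i ε) (hij : i < j)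
    (hj : (j : ℕ∞) ≤ length r) : 𝒢.Side ε (𝒢.pt (c.corner r j)) :=
  side_pt (by rw [proj_corner hj]; exact h.beyond_vertAt star hij hj)

theorem coSide_corner (star : 𝒢.IsStar) (h : r.EdgeAt i ε) (hij : j ≤ i) :
    𝒢.CoSide ε (𝒢.pt (c.corner r j)) :=
  coSide_pt (by
    rw [proj_corner ((Nat.cast_le.2 hij).trans h.lt.le)]
    exact h.not_beyond_vertAt star hij)

/-- The projection to the tree does not increase distances, and the corners project to the vertices
of a geodesic. This makes the corner times increase at least linearly and later bounds numbers of
pieces. -/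
theorem sub_le_dist_corner (hij : i ≤ j) (hj : (j : ℕ∞) ≤ length r) :
    (j : ℝ) - i ≤ dist (𝒢.pt (c.corner r i)) (𝒢.pt (c.corner r j)) := by
  have hi : (i : ℕ∞) ≤ length r := (Nat.cast_le.2 hij).trans hj
  have h1 := 𝒢.bsTree_connected.dist_triangle (u := 𝒢.root) (v := r.vertAt i) (w := r.vertAt j)
  have h2 := 𝒢.bsTree_dist_le (c.corner r i) (c.corner r j)
  rw [dist_root_vertAt hi, dist_root_vertAt hj] at h1
  rw [proj_corner hi, proj_corner hj] at h2
  rw [GeomReal.dist_vertex, sub_le_iff_le_add']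
  exact_mod_cast h1.trans (Nat.add_le_add_left h2 _)

variable (c r) in
/-- The time at which the realisation of a combinatorial ray passes its corner number `i`. -/
noncomputable def time (i : ℕ) : ℝ :=
  ∑ m ∈ Finset.range i, dist (𝒢.pt (c.corner r m)) (𝒢.pt (c.corner r (m + 1)))

theorem time_succ : c.time r (i + 1) =
    c.time r i + dist (𝒢.pt (c.corner r i)) (𝒢.pt (c.corner r (i + 1))) :=
  Finset.sum_range_succ _ _

theorem time_zero : c.time r 0 = 0 := rfl

theorem time_mono : Monotone (c.time r) :=
  monotone_nat_of_le_succ fun i => by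
    rw [time_succ]
    exact le_add_of_nonneg_right dist_nonneg

theorem time_nonneg : 0 ≤ c.time r i := time_mono (Nat.zero_le i)

theorem le_time (h : (i : ℕ∞) ≤ length r) : (i : ℝ) ≤ c.time r i := by
  induction i with
  | zero => simp [time_zero]
  | succ i ih =>
    have h1 := sub_le_dist_corner (c := c) (Nat.le_succ i) h
    have h2 := ih (lt_length h (Nat.lt_succ_self i)).le
    rw [time_succ]
    push_cast at h1 ⊢
    linarith

theorem time_lt_time_succ (h : r.EdgeAt i ε) : c.time r i < c.time r (i + 1) := by
  have h1 := sub_le_dist_corner (c := c) (Nat.le_succ i) h.succ_le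
  rw [time_succ]
  push_cast at h1
  linarith

variable (c r) in
/-- The interval on which the realisation follows its piece number `i`. -/
def pieceSet (i : ℕ) : Set ℝ := {t | c.time r i ≤ t ∧ ((i : ℕ∞) < length r → t ≤ c.time r (i + 1))}

instance : (c.pieceSet r i).OrdConnected :=
  ⟨fun _ hx _ hy _ hz => ⟨hx.1.trans hz.1, fun h => hz.2.trans (hy.2 h)⟩⟩

theorem time_mem_pieceSet : c.time r i ∈ c.pieceSet r i :=
  ⟨le_rfl, fun _ => time_mono (Nat.le_succ i)⟩

theorem time_succ_mem_pieceSet : c.time r (i + 1) ∈ c.pieceSet r i :=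
  ⟨time_mono (Nat.le_succ i), fun _ => le_rfl⟩

theorem exists_mem_pieceSet {t : ℝ} (ht : 0 ≤ t) :
    ∃ i : ℕ, (i : ℕ∞) ≤ length r ∧ t ∈ c.pieceSet r i := by
  have key : ∀ N : ℕ, (N : ℕ∞) ≤ length r → t ≤ c.time r N →
      ∃ i : ℕ, (i : ℕ∞) ≤ length r ∧ t ∈ c.pieceSet r i := by
    intro N
    induction N with
    | zero =>
      intro hN htN
      exact ⟨0, hN, by rwa [time_zero], fun _ => htN.trans (time_mono (Nat.le_succ 0))⟩
    | succ N ih =>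
      intro hN htN
      have hN' := (lt_length hN (Nat.lt_succ_self N)).le
      by_cases h : t ≤ c.time r N
      · exact ih hN' h
      · exact ⟨N, hN', (not_le.1 h).le, fun _ => htN⟩
  cases r with
  | finite k p hp z =>
    by_cases h : t ≤ c.time (.finite k p hp z) k
    · exact key k le_rfl h
    · exact ⟨k, le_rfl, (not_le.1 h).le, fun h => absurd h (lt_irrefl _)⟩
  | infinite p hp =>
    obtain ⟨N, hN⟩ := exists_nat_ge t
    exact key N le_top (hN.trans (le_time le_top))

theorem realisation_eq {t : ℝ} (hi : (i : ℕ∞) ≤ length r) (h1 : c.time r i ≤ t)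
    (h2 : (i : ℕ∞) = length r ∨ t < c.time r (i + 1)) :
    c.realisation r t = c.piece r i (t - c.time r i) :=
  concatPaths_eq hi (fun _ => dist_nonneg) h1 h2

theorem piece_of_edgeAt (h : r.EdgeAt i ε) :
    c.piece r i = c.seg (c.corner r i) (c.corner r (i + 1)) := by
  cases r with
  | finite k p hp z =>
    obtain ⟨h, -⟩ := h
    exact if_pos h
  | infinite p hp => rfl

/-- The tail of a Morse combinatorial ray of finite type. -/
theorem tail_realises_of_isMorseRay {M : MorseGauge} {k : ℕ} {p : Fin k → 𝒢.TEdge}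
    {hp : 𝒢.IsGeodesicPath p} {z} (h : c.IsMorseRay M (.finite k p hp z)) :
    𝒢.RealisesTail _ z (c.tail _ z) :=
  c.tail_realises _ z ⟨h.2.choose, h.2.choose_spec.1⟩

theorem piece_zero (star : 𝒢.IsStar) {M : MorseGauge} (hr : c.IsMorseRay M r)
    (hi : (i : ℕ∞) ≤ length r) : c.piece r i 0 = 𝒢.pt (c.corner r i) := by
  rcases hi.eq_or_lt with hi' | hi'
  · cases r with
    | finite k p hp z =>
      obtain rfl : i = k := Nat.cast_inj.1 hi'
      have h1 := (tail_realises_of_isMorseRay hr).1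
      have h2 := vertBase_vertAt (c := c) star hi
      have h3 := proj_corner (c := c) hi
      rw [← endVertex_eq] at h2 h3
      simp only [piece, lt_irrefl, if_false]
      rw [h1, translate_pt, mul_one, h2]
      congr 1
      refine Prod.ext rfl ?_
      rw [← h3]
      rfl
    | infinite p hp => exact absurd hi' (ENat.natCast_ne_top i)
  · obtain ⟨ε, hε⟩ := exists_edgeAt hi'
    rw [piece_of_edgeAt hε]
    exact (c.seg_geodesic _ _).1

/-- Piece intervals are closed and share their endpoints. At the right endpoint the concatenation
already uses the next piece, which starts at the same corner; for the tail this requires that it has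
a realisation. -/
theorem realisation_of_mem_pieceSet (star : 𝒢.IsStar) {M : MorseGauge} (hr : c.IsMorseRay M r)
    (hi : (i : ℕ∞) ≤ length r) {t : ℝ} (ht : t ∈ c.pieceSet r i) :
    c.realisation r t = c.piece r i (t - c.time r i) := by
  by_cases h2 : (i : ℕ∞) = length r ∨ t < c.time r (i + 1)
  · exact realisation_eq hi ht.1 h2
  · push Not at h2
    have hlt := lt_of_le_of_ne hi h2.1
    obtain ⟨ε, hε⟩ := exists_edgeAt hlt
    obtain rfl : t = c.time r (i + 1) := le_antisymm (ht.2 hlt) h2.2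
    rw [realisation_eq hε.succ_le le_rfl, sub_self, piece_zero star hr hε.succ_le,
      piece_of_edgeAt hε, time_succ, add_sub_cancel_left, (c.seg_geodesic _ _).2.1]
    rcases hε.succ_le.eq_or_lt with h | h
    · exact Or.inl h
    · obtain ⟨ε', hε'⟩ := exists_edgeAt h
      exact Or.inr (time_lt_time_succ hε')

theorem realisation_time (star : 𝒢.IsStar) {M : MorseGauge} (hr : c.IsMorseRay M r)
    (hi : (i : ℕ∞) ≤ length r) : c.realisation r (c.time r i) = 𝒢.pt (c.corner r i) := by
  rw [realisation_of_mem_pieceSet star hr hi time_mem_pieceSet, sub_self, piece_zero star hr hi]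

theorem geodOn_realisation (star : 𝒢.IsStar) {M : MorseGauge} (hr : c.IsMorseRay M r)
    (hi : (i : ℕ∞) ≤ length r) : GeodOn (c.realisation r) (c.pieceSet r i) := by
  intro s hs t ht
  rw [realisation_of_mem_pieceSet star hr hi hs, realisation_of_mem_pieceSet star hr hi ht]
  rcases hi.eq_or_lt with hi' | hi'
  · cases r with
    | finite k p hp z =>
      obtain rfl : i = k := Nat.cast_inj.1 hi'
      simp only [piece, lt_irrefl, if_false, dist_translate]
      rw [(tail_realises_of_isMorseRay hr).2.1 _ (sub_nonneg.2 hs.1) _ (sub_nonneg.2 ht.1)]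
      congr 1
      ring
    | infinite p hp => exact absurd hi' (ENat.natCast_ne_top i)
  · obtain ⟨ε, hε⟩ := exists_edgeAt hi'
    have h1 := hs.2 hi'
    have h2 := ht.2 hi'
    rw [time_succ] at h1 h2
    rw [piece_of_edgeAt hε, (c.seg_geodesic _ _).2.2 _ ⟨sub_nonneg.2 hs.1, by linarith⟩ _
      ⟨sub_nonneg.2 ht.1, by linarith⟩]
    congr 1
    ring

theorem realisation_image_of_edgeAt (star : 𝒢.IsStar) {M : MorseGauge} (hr : c.IsMorseRay M r)
    (hε : r.EdgeAt i ε) : c.realisation r '' c.pieceSet r i =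
      segImage (c.seg (c.corner r i) (c.corner r (i + 1))) (𝒢.pt (c.corner r i))
        (𝒢.pt (c.corner r (i + 1))) := by
  ext p
  constructor
  · rintro ⟨t, ht, rfl⟩
    rw [realisation_of_mem_pieceSet star hr hε.lt.le ht, piece_of_edgeAt hε]
    have := ht.2 hε.lt
    rw [time_succ] at this
    exact ⟨_, ⟨sub_nonneg.2 ht.1, by linarith⟩, rfl⟩
  · rintro ⟨s, hs, rfl⟩
    have hmem : c.time r i + s ∈ c.pieceSet r i :=
      ⟨by linarith [hs.1], fun _ => by rw [time_succ]; linarith [hs.2]⟩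
    refine ⟨_, hmem, ?_⟩
    rw [realisation_of_mem_pieceSet star hr hε.lt.le hmem, piece_of_edgeAt hε, add_sub_cancel_left]

theorem realisation_image_tail (star : 𝒢.IsStar) {M : MorseGauge} {k : ℕ} {p : Fin k → 𝒢.TEdge}
    {hp : 𝒢.IsGeodesicPath p} {z} (hr : c.IsMorseRay M (.finite k p hp z)) :
    c.realisation (.finite k p hp z) '' c.pieceSet (.finite k p hp z) k =
      𝒢.translate (c.vertBase (𝒢.endVertex p)).1 '' rayImage (c.tail _ z) := by
  ext q
  constructor
  · rintro ⟨t, ht, rfl⟩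
    rw [realisation_of_mem_pieceSet star hr le_rfl ht]
    simp only [piece, lt_irrefl, if_false]
    exact ⟨_, ⟨_, sub_nonneg.2 ht.1, rfl⟩, rfl⟩
  · rintro ⟨_, ⟨s, hs, rfl⟩, rfl⟩
    have hmem : c.time (.finite k p hp z) k + s ∈ c.pieceSet (.finite k p hp z) k :=
      ⟨by linarith [mem_Ici.1 hs], fun h => absurd h (lt_irrefl _)⟩
    refine ⟨_, hmem, ?_⟩
    rw [realisation_of_mem_pieceSet star hr le_rfl hmem, add_sub_cancel_left]
    simp only [piece, lt_irrefl, if_false]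

/-- The realisation of a Morse combinatorial ray is `1`-Lipschitz. -/
theorem dist_realisation_le (star : 𝒢.IsStar) {M : MorseGauge} (hr : c.IsMorseRay M r) {s t : ℝ}
    (hs : 0 ≤ s) (hst : s ≤ t) : dist (c.realisation r s) (c.realisation r t) ≤ t - s := by
  obtain ⟨k, hk, ht⟩ := exists_mem_pieceSet (c := c) (r := r) (hs.trans hst)
  have key : ∀ m i : ℕ, i + m = k → ∀ s ∈ c.pieceSet r i, s ≤ t →
      dist (c.realisation r s) (c.realisation r t) ≤ t - s := by
    intro m
    induction m with
    | zero =>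
      rintro i rfl s hs hst
      rw [geodOn_realisation star hr hk s hs t ht, abs_sub_comm, abs_of_nonneg (by linarith)]
    | succ m ih =>
      rintro i hik s hs hst
      have hi : (i : ℕ∞) < length r := lt_length hk (by omega)
      have h1 : c.time r (i + 1) ≤ t := (time_mono (show i + 1 ≤ k by omega)).trans ht.1
      have h2 := ih (i + 1) (by omega) _ time_mem_pieceSet h1
      have h3 := geodOn_realisation star hr hi.le s hs _ time_succ_mem_pieceSet
      rw [abs_sub_comm, abs_of_nonneg (by linarith [hs.2 hi])] at h3
      have h4 := dist_triangle (c.realisation r s) (c.realisation r (c.time r (i + 1)))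
        (c.realisation r t)
      linarith
  obtain ⟨i, hi, hs'⟩ := exists_mem_pieceSet (c := c) (r := r) hs
  rcases le_or_gt i k with hik | hik
  · exact key (k - i) i (by omega) s hs' hst
  · have h1 := ht.2 (lt_length hi hik)
    have h2 : c.time r (k + 1) ≤ c.time r i := time_mono hik
    obtain rfl : s = t := le_antisymm hst (by linarith [hs'.1])
    simp

theorem continuousOn_realisation (star : 𝒢.IsStar) {M : MorseGauge} (hr : c.IsMorseRay M r) :
    ContinuousOn (c.realisation r) (Ici 0) := by
  refine (LipschitzOnWith.of_dist_le_mul (K := 1) fun s hs t ht => ?_).continuousOn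
  rw [NNReal.coe_one, one_mul, Real.dist_eq]
  rcases le_total s t with h | h
  · rw [abs_sub_comm, abs_of_nonneg (by linarith)]
    exact dist_realisation_le star hr hs h
  · rw [dist_comm, abs_of_nonneg (by linarith)]
    exact dist_realisation_le star hr ht h

end Choices

end GraphOfGroups

/-! ### Realisations are uniform quasi-geodesics -/

theorem FiniteHausdorff.image {X Y : Type*} [MetricSpace X] [MetricSpace Y] {A B : Set X}
    (h : FiniteHausdorff A B) {f : X → Y} (hf : ∀ x y, dist (f x) (f y) ≤ dist x y) :
    FiniteHausdorff (f '' A) (f '' B) := by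
  obtain ⟨R, h1, h2⟩ := h.exists_near
  refine finiteHausdorff_of_near (R := R) ?_ ?_
  · rintro _ ⟨a, ha, rfl⟩
    obtain ⟨b, hb, hd⟩ := h1 a ha
    exact ⟨f b, ⟨b, hb, rfl⟩, (hf a b).trans hd⟩
  · rintro _ ⟨b, hb, rfl⟩
    obtain ⟨a, ha, hd⟩ := h2 b hb
    exact ⟨f a, ⟨a, ha, rfl⟩, (hf b a).trans hd⟩

namespace GraphOfGroups

variable {n : ℕ} {E : Type*} [Finite E] {𝒢 : GraphOfGroups n E}

theorem RealisesTail.finiteHausdorff {j : Fin (n + 1)} {z : MorseBoundary (GeomReal (𝒢.cay j))}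
    {ξ ξ' : ℝ → 𝒢.X} (h : 𝒢.RealisesTail j z ξ) (h' : 𝒢.RealisesTail j z ξ') :
    FiniteHausdorff (rayImage ξ) (rayImage ξ') := by
  obtain ⟨-, -, ρ, hρ, h1⟩ := h
  obtain ⟨-, -, ρ', hρ', h2⟩ := h'
  have h3 : FiniteHausdorff (rayImage ρ.1) (rayImage ρ'.1) := Quotient.exact (hρ.trans hρ'.symm)
  exact (h1.symm.trans (h3.image (dist_inclusion_le j))).trans h2

namespace Choices

open CombRay

variable {c : 𝒢.Choices} {r : 𝒢.CombRay} {i j : ℕ} {ε ε' : 𝒢.TEdge}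

theorem isMorseEdge_of_edgeAt {M : MorseGauge} (hr : c.IsMorseRay M r) (h : r.EdgeAt i ε) :
    c.IsMorseEdge M ε := by
  cases r with
  | finite k p hp z =>
    obtain ⟨h, rfl⟩ := h
    exact hr.1 _
  | infinite p hp =>
    obtain rfl : p i = ε := h
    exact hr i

/-- An `M`-Morse combinatorial ray only has some `M`-Morse geodesics and some `M`-Morse tail with
the right ends, while the realisation uses fixed choices. These are uniformly close to the Morse
ones. -/
theorem exists_piece_gauge (star : 𝒢.IsStar) (M : MorseGauge) : ∃ M' : MorseGauge,
    ∀ {c : 𝒢.Choices} {r : 𝒢.CombRay}, c.IsMorseRay M r → ∀ {i : ℕ}, (i : ℕ∞) ≤ length r →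
      IsMorseSet M' (c.realisation r '' c.pieceSet r i) := by
  obtain ⟨K, hK⟩ := near_of_endpoints_near (X := 𝒢.X) M 0
  have hB : 0 ≤ 2 * M.bd 3 0 := by have := M.bd_pos 3 0; linarith
  refine ⟨M.shift (max K ⟨2 * M.bd 3 0, hB⟩), fun {c r} hr i hi => ?_⟩
  rcases hi.eq_or_lt with hi' | hi'
  · cases r with
    | finite k p hp z =>
      obtain rfl : i = k := Nat.cast_inj.1 hi'
      rw [realisation_image_tail star hr]
      apply isMorseSet_translate
      obtain ⟨-, ξ, hξ, hM⟩ := hr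
      have ht := c.tail_realises _ z ⟨ξ, hξ⟩
      have hd : ∀ t ∈ Ici (0 : ℝ), dist (c.tail _ z t) (ξ t) ≤
          (max K ⟨2 * M.bd 3 0, hB⟩ : ℝ≥0) := fun t h0 => by
        refine (dist_le_of_finiteHausdorff ht.2.1 hξ.2.1 (ht.1.trans hξ.1.symm) hM
          (ht.finiteHausdorff hξ) h0).trans ?_
        exact_mod_cast (le_max_right K (⟨2 * M.bd 3 0, hB⟩ : ℝ≥0))
      refine hM.transfer ?_ ?_
      · rintro _ ⟨t, ht, rfl⟩
        exact ⟨ξ t, ⟨t, ht, rfl⟩, hd t ht⟩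
      · rintro _ ⟨t, ht, rfl⟩
        exact ⟨c.tail _ z t, ⟨t, ht, rfl⟩, by rw [dist_comm]; exact hd t ht⟩
    | infinite p hp => exact absurd hi' (ENat.natCast_ne_top i)
  · obtain ⟨ε, hε⟩ := exists_edgeAt hi'
    rw [realisation_image_of_edgeAt star hr hε]
    obtain ⟨γ, hγ, hM⟩ := isMorseEdge_of_edgeAt hr hε
    rw [hε.tSrc_eq, vertBase_vertAt star hi, ← corner_succ hε] at hγ hM
    obtain ⟨h1, h2⟩ := hK hγ.geodOn hM (c.seg_geodesic (c.corner r i) (c.corner r (i + 1)))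
      ⟨le_rfl, dist_nonneg⟩ ⟨dist_nonneg, le_rfl⟩ dist_nonneg (by simp [hγ.1]) (by simp [hγ.2.1])
    exact (hM.transfer h1 h2).mono (MorseGauge.shift_mono le_rfl (le_max_left _ _))

theorem proj_vertBase_endVertex (star : 𝒢.IsStar) {k : ℕ} {p : Fin k → 𝒢.TEdge}
    (hp : 𝒢.IsGeodesicPath p) (z : MorseBoundary (GeomReal (𝒢.cay (𝒢.endVertex p).1))) :
    𝒢.proj (c.vertBase (𝒢.endVertex p)) = 𝒢.endVertex p := by
  rw [endVertex_eq (hp := hp) (z := z), vertBase_vertAt star le_rfl, proj_corner le_rfl]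

theorem proj_mul_of_proj {x : 𝒢.XVert} {u : 𝒢.TVert} (h : 𝒢.proj x = u) (s : 𝒢.G u.1) :
    𝒢.proj (x.1 * 𝒢.ι u.1 s, u.1) = u := by
  subst h
  exact (𝒢.proj_eq_iff.2 ⟨s, rfl⟩).symm

/-- The tail of the realisation of a combinatorial ray of finite type stays close to the vertices
over the end vertex. -/
theorem exists_near_endVertex (star : 𝒢.IsStar) {M : MorseGauge} (hr : c.IsMorseRay M r)
    (hi : (i : ℕ∞) = length r) : ∃ R, ∀ t ∈ c.pieceSet r i, ∃ y, 𝒢.proj y = r.vertAt i ∧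
      dist (c.realisation r t) (𝒢.pt y) ≤ R := by
  cases r with
  | finite k p hp z =>
    obtain rfl : i = k := Nat.cast_inj.1 hi
    obtain ⟨-, -, ρ, -, hρ⟩ := tail_realises_of_isMorseRay hr
    obtain ⟨R, -, hR⟩ := hρ.exists_near
    refine ⟨R + 1, fun t ht => ?_⟩
    have := mem_image_of_mem (c.realisation (.finite i p hp z)) ht
    rw [realisation_image_tail star hr] at this
    obtain ⟨a, ha, hae⟩ := this
    obtain ⟨_, ⟨b, hb, rfl⟩, hab⟩ := hR a ha
    obtain ⟨x, hx⟩ := GeomReal.exists_dist_vertex_lt b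
    refine ⟨((c.vertBase (𝒢.endVertex p)).1 * 𝒢.ι _ x, (𝒢.endVertex p).1), ?_, ?_⟩
    · rw [← endVertex_eq]
      exact proj_mul_of_proj (proj_vertBase_endVertex star hp z) x
    · have h1 := translate_pt (c.vertBase (𝒢.endVertex p)).1 (𝒢.ι (𝒢.endVertex p).1 x, (𝒢.endVertex p).1)
      simp only at h1
      rw [← hae, ← h1, dist_translate, ← inclusion_vertex]
      have h2 := dist_inclusion_le _ b (GeomReal.vertex _ x)
      have h3 := dist_triangle a (𝒢.inclusion _ b) (𝒢.inclusion _ (GeomReal.vertex _ x))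
      linarith
  | infinite p hp => exact absurd hi (ENat.natCast_ne_top i)

/-- The corner between the two pieces lies in the fibre, and on each of these Morse geodesics the
times near the fibre are close together. -/
theorem exists_bound_piece (hs : 𝒢.IsMorselessStar) (M : MorseGauge) (K : ℝ) (hK : 0 ≤ K) :
    ∃ D : ℝ, 0 ≤ D ∧ ∀ {c : 𝒢.Choices} {r : 𝒢.CombRay}, c.IsMorseRay M r → ∀ {i : ℕ} {ε : 𝒢.TEdge},
      r.EdgeAt i ε → ∀ s, s ∈ c.pieceSet r i ∨ s ∈ c.pieceSet r (i + 1) →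
      Near K (𝒢.fibre ε) (c.realisation r s) → |s - c.time r (i + 1)| ≤ D := by
  have star : 𝒢.IsStar := hs.star
  obtain ⟨M', hM'⟩ := exists_piece_gauge star M
  obtain ⟨D, hD⟩ := exists_bound_near_fibre hs M' K
  refine ⟨max D 0, le_max_right _ _, fun {c r} hr i ε hε s hs hn => ?_⟩
  have hc : Near K (𝒢.fibre ε) (c.realisation r (c.time r (i + 1))) := by
    rw [realisation_time star hr hε.succ_le]
    exact near_of_mem_fibre (corner_mem_fibre (c := c) hε) (by rw [dist_self]; exact hK)
  refine le_trans ?_ (le_max_left D 0)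
  rcases hs with hs | hs
  · exact hD (geodOn_realisation star hr hε.lt.le) (hM' hr hε.lt.le) ε s hs _
      time_succ_mem_pieceSet hn hc
  · exact hD (geodOn_realisation star hr hε.succ_le) (hM' hr hε.succ_le) ε s hs _
      time_mem_pieceSet hn hc

/-- Excursions of the pieces of a realisation beyond the edges at their ends are short. -/
theorem exists_bound_excursion (hG : 𝒢.IsMorselessStar) (M : MorseGauge) :
    ∃ D : ℝ, 0 ≤ D ∧ ∀ {c : 𝒢.Choices} {r : 𝒢.CombRay}, c.IsMorseRay M r → ∀ {i : ℕ} {ε : 𝒢.TEdge},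
      r.EdgeAt i ε →
      (∀ s ∈ c.pieceSet r i, 𝒢.Side ε (c.realisation r s) → |s - c.time r (i + 1)| ≤ D) ∧
      ∀ s ∈ c.pieceSet r (i + 1), 𝒢.CoSide ε (c.realisation r s) →
        |s - c.time r (i + 1)| ≤ D := by
  have star : 𝒢.IsStar := hG.star
  obtain ⟨M', hM'⟩ := exists_piece_gauge star M
  obtain ⟨D, hD0, hD⟩ := exists_bound_piece hG M 1 zero_le_one
  refine ⟨D, hD0, fun {c r} hr i ε hε => ⟨fun s hs hside => ?_, fun s hs hside => ?_⟩⟩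
  · have hcont := (geodOn_realisation star hr hε.lt.le).continuousOn
    have hsub : Icc (c.time r i) s ⊆ c.pieceSet r i :=
      Set.OrdConnected.out inferInstance time_mem_pieceSet hs
    -- The piece starts on the near side, so it is near the fibre at some time `u ≤ s`. As `u` is
    -- close to the end of the piece, so is `s`.
    obtain ⟨u, hu, hn⟩ := exists_near_fibre (hcont.mono hsub) ⟨hs.1, le_rfl⟩ ⟨le_rfl, hs.1⟩ hside
      (by rw [realisation_time star hr hε.lt.le]; exact coSide_corner star hε le_rfl)
    have h1 := hD hr hε u (Or.inl (hsub hu)) hn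
    have h2 := hs.2 hε.lt
    rw [abs_of_nonpos (by linarith)]
    rw [abs_of_nonpos (by linarith [hu.2])] at h1
    linarith [hu.2]
  · have hcont := (geodOn_realisation star hr hε.succ_le).continuousOn
    have key : ∀ t ∈ c.pieceSet r (i + 1), s ≤ t → 𝒢.Side ε (c.realisation r t) →
        |s - c.time r (i + 1)| ≤ D := by
      intro t ht hst hside'
      have hsub : Icc s t ⊆ c.pieceSet r (i + 1) := Set.OrdConnected.out inferInstance hs ht
      obtain ⟨u, hu, hn⟩ := exists_near_fibre (hcont.mono hsub) ⟨hst, le_rfl⟩ ⟨le_rfl, hst⟩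
        hside' hside
      have h1 := hD hr hε u (Or.inr (hsub hu)) hn
      have h2 := hs.1
      rw [abs_of_nonneg (by linarith)]
      rw [abs_of_nonneg (by linarith [hu.1])] at h1
      linarith [hu.1]
    -- A bounded piece ends beyond `ε`, so `key` applies to its last corner. A tail has no end: if
    -- it stayed on the near side after `s`, its closeness to the vertices over the end vertex,
    -- which is beyond `ε`, would keep it near the fibre forever.
    rcases hε.succ_le.eq_or_lt with hl | hl
    · by_contra hcon
      have hco : ∀ t ∈ c.pieceSet r (i + 1), s ≤ t → 𝒢.CoSide ε (c.realisation r t) :=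
        fun t ht hst => (side_or_coSide ε _).resolve_left fun h => hcon (key t ht hst h)
      obtain ⟨R, hR⟩ := exists_near_endVertex star hr hl
      have hR0 : 0 ≤ R := by
        obtain ⟨y, -, hy⟩ := hR s hs
        exact dist_nonneg.trans hy
      obtain ⟨D', hD0', hD'⟩ := exists_bound_piece hG M (R + 1) (by linarith)
      have hs1 : c.time r (i + 1) ≤ s := hs.1
      have ht : s + D' + 1 ∈ c.pieceSet r (i + 1) :=
        ⟨by linarith, fun h => absurd h (by rw [hl]; exact lt_irrefl _)⟩
      obtain ⟨y, hy, hyd⟩ := hR _ ht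
      have hn := (near_fibre_of_dist (side_pt (ε := ε) (x := y) (by
        rw [hy]; exact hε.beyond_vertAt star (Nat.lt_succ_self i) hε.succ_le))
        (hco _ ht (by linarith))).2
      rw [dist_comm] at hn
      have := hD' hr hε _ (Or.inr ht) (hn.mono (by linarith) Subset.rfl)
      rw [abs_of_nonneg (by linarith)] at this
      linarith
    · obtain ⟨ε', hε'⟩ := exists_edgeAt hl
      refine key _ time_succ_mem_pieceSet (hs.2 hl) ?_
      rw [realisation_time star hr hε'.succ_le]
      exact side_corner star hε (by omega) hε'.succ_le

/-- If a realisation comes close to itself in two different pieces, it is there close to the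
adjacent corners. -/
theorem exists_bound_close (hs : 𝒢.IsMorselessStar) (M : MorseGauge) (K : ℝ) (hK : 0 ≤ K) :
    ∃ D : ℝ, 0 ≤ D ∧ ∀ {c : 𝒢.Choices} {r : 𝒢.CombRay}, c.IsMorseRay M r → ∀ {i k : ℕ},
      i ≤ k → ((k + 1 : ℕ) : ℕ∞) ≤ length r → ∀ s ∈ c.pieceSet r i, ∀ t ∈ c.pieceSet r (k + 1),
      dist (c.realisation r s) (c.realisation r t) ≤ K →
      |s - c.time r (i + 1)| ≤ D ∧ |t - c.time r (k + 1)| ≤ D := by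
  have star : 𝒢.IsStar := hs.star
  obtain ⟨A, hA0, hA⟩ := exists_bound_excursion hs M
  obtain ⟨D, hD0, hD⟩ := exists_bound_piece hs M (K + A + 1) (by linarith)
  refine ⟨max A D, hA0.trans (le_max_left _ _), fun {c r} hr i k hik hk s hs t ht hd => ?_⟩
  -- `ε` ends piece `i` and `ε'` leads to piece `k + 1`. A point on the unexpected side of its own
  -- edge is near its corner by the excursion bound. Otherwise the other point, or the corner near
  -- it, lies across that edge, so the point is near the fibre of its edge.
  obtain ⟨ε', hε'⟩ := exists_edgeAt (lt_length hk (Nat.lt_succ_self k))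
  obtain ⟨ε, hε⟩ := exists_edgeAt (lt_length hk (Nat.lt_succ_of_le hik))
  have hmono : ∀ u, 𝒢.Beyond ε' u → 𝒢.Beyond ε u := fun u => hε.beyond_mono star hε' hik
  constructor
  · by_cases h1 : 𝒢.Side ε (c.realisation r s)
    · exact ((hA hr hε).1 s hs h1).trans (le_max_left _ _)
    have h1 := (side_or_coSide ε _).resolve_left h1
    refine (hD hr hε s (Or.inl hs) ?_).trans (le_max_right _ _)
    by_cases h2 : 𝒢.Side ε (c.realisation r t)
    · rw [dist_comm] at hd
      exact (near_fibre_of_dist h2 h1).2.mono (by linarith) Subset.rfl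
    obtain ⟨x, hx, hxd⟩ := (side_or_coSide ε _).resolve_left h2
    have h3 := (hA hr hε').2 t ht ⟨x, fun h => hx (hmono _ h), hxd⟩
    have h4 := geodOn_realisation star hr hk t ht _ time_mem_pieceSet
    rw [realisation_time star hr hk] at h4
    have h5 := near_fibre_of_dist (side_corner (c := c) star hε (Nat.lt_succ_of_le hik) hk) h1
    refine h5.2.mono ?_ Subset.rfl
    rw [dist_comm]
    have := dist_triangle (c.realisation r s) (c.realisation r t) (𝒢.pt (c.corner r (k + 1)))
    linarith
  · by_cases h1 : 𝒢.CoSide ε' (c.realisation r t)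
    · exact ((hA hr hε').2 t ht h1).trans (le_max_left _ _)
    have h1 := (side_or_coSide ε' _).resolve_right h1
    refine (hD hr hε' t (Or.inr ht) ?_).trans (le_max_right _ _)
    rw [dist_comm] at hd
    by_cases h2 : 𝒢.CoSide ε' (c.realisation r s)
    · exact (near_fibre_of_dist h1 h2).1.mono (by linarith) Subset.rfl
    obtain ⟨x, hx, hxd⟩ := (side_or_coSide ε' _).resolve_right h2
    have h3 := (hA hr hε).1 s hs ⟨x, hmono _ hx, hxd⟩
    have h4 := geodOn_realisation star hr hε.lt.le s hs _ time_succ_mem_pieceSet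
    rw [realisation_time star hr hε.succ_le] at h4
    have h6 := dist_triangle (c.realisation r t) (c.realisation r s) (𝒢.pt (c.corner r (i + 1)))
    rcases hik.eq_or_lt with rfl | hlt
    · exact near_of_mem_fibre (corner_mem_fibre hε') (by linarith)
    · have h5 := near_fibre_of_dist h1 (coSide_corner (c := c) star hε' (j := i + 1) hlt)
      exact h5.1.mono (by linarith) Subset.rfl

/-- Induction on the number of pieces: if the two points are close, the first is within `D` of the
next corner, and replacing it by this corner saves one piece. -/
theorem exists_proper_of_le (hs : 𝒢.IsMorselessStar) (M : MorseGauge) (m : ℕ) (K : ℝ)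
    (hK : 0 ≤ K) : ∃ R : ℝ, ∀ {c : 𝒢.Choices} {r : 𝒢.CombRay}, c.IsMorseRay M r → ∀ {i k : ℕ},
      i ≤ k → k ≤ i + m → (k : ℕ∞) ≤ length r → ∀ s ∈ c.pieceSet r i, ∀ t ∈ c.pieceSet r k,
      dist (c.realisation r s) (c.realisation r t) ≤ K → t - s ≤ R := by
  have star : 𝒢.IsStar := hs.star
  induction m generalizing K with
  | zero =>
    refine ⟨K, fun {c r} hr i k hik hki hk s hs t ht hd => ?_⟩
    obtain rfl : i = k := by omega
    rw [geodOn_realisation star hr hk s hs t ht, abs_sub_comm] at hd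
    exact (le_abs_self _).trans hd
  | succ m ih =>
    obtain ⟨D, hD0, hD⟩ := exists_bound_close hs M K hK
    obtain ⟨R, hR⟩ := ih (K + D) (by linarith)
    refine ⟨max K (D + R), fun {c r} hr i k hik hki hk s hs t ht hd => ?_⟩
    rcases hik.eq_or_lt with rfl | hlt
    · rw [geodOn_realisation star hr hk s hs t ht, abs_sub_comm] at hd
      exact ((le_abs_self _).trans hd).trans (le_max_left _ _)
    · obtain ⟨k, rfl⟩ : ∃ k', k = k' + 1 := ⟨k - 1, by omega⟩
      obtain ⟨h1, -⟩ := hD hr (Nat.lt_succ_iff.1 hlt) hk s hs t ht hd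
      have hi : (i : ℕ∞) < length r := lt_length hk hlt
      have h2 := geodOn_realisation star hr hi.le s hs _ time_succ_mem_pieceSet
      have h3 := hR hr (i := i + 1) (k := k + 1) hlt (by omega) hk (c.time r (i + 1))
        time_mem_pieceSet t ht (by
          have := dist_triangle_left (c.realisation r (c.time r (i + 1))) (c.realisation r t)
            (c.realisation r s)
          linarith)
      have h4 := neg_abs_le (s - c.time r (i + 1))
      exact le_trans (by linarith) (le_max_right _ _)

/-- Realisations of `M`-Morse combinatorial rays are uniformly proper. -/
theorem exists_proper (hs : 𝒢.IsMorselessStar) (M : MorseGauge) : ∃ R : ℝ → ℝ,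
    ∀ {c : 𝒢.Choices} {r : 𝒢.CombRay}, c.IsMorseRay M r → ∀ K, ∀ s ∈ Ici (0 : ℝ),
      ∀ t ∈ Ici (0 : ℝ), dist (c.realisation r s) (c.realisation r t) ≤ K → |s - t| ≤ R K := by
  have star : 𝒢.IsStar := hs.star
  have key : ∀ K : ℝ, 0 ≤ K → ∃ R : ℝ, 0 ≤ R ∧ ∀ {c : 𝒢.Choices} {r : 𝒢.CombRay}, c.IsMorseRay M r →
      ∀ s ∈ Ici (0 : ℝ), ∀ t ∈ Ici (0 : ℝ), s ≤ t →
      dist (c.realisation r s) (c.realisation r t) ≤ K → t - s ≤ R := by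
    intro K hK
    obtain ⟨D, hD0, hD⟩ := exists_bound_close hs M K hK
    -- Close points are within `D` of the corners `i + 1` and `k + 1`, whose distance is then at
    -- most `K + 2 * D` and at least `k - i`.
    obtain ⟨R, hR⟩ := exists_proper_of_le hs M (⌈K + 2 * D⌉₊ + 1) K hK
    refine ⟨max R 0, le_max_right _ _, fun {c r} hr s hs t ht hst hd => ?_⟩
    obtain ⟨i, hi, hsi⟩ := exists_mem_pieceSet (c := c) (r := r) hs
    obtain ⟨k, hk, htk⟩ := exists_mem_pieceSet (c := c) (r := r) ht
    rcases le_or_gt i k with hik | hik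
    · refine le_trans (hR hr hik ?_ hk s hsi t htk hd) (le_max_left _ _)
      rcases hik.eq_or_lt with rfl | hlt
      · omega
      obtain ⟨k, rfl⟩ : ∃ k', k = k' + 1 := ⟨k - 1, by omega⟩
      obtain ⟨h1, h2⟩ := hD hr (Nat.lt_succ_iff.1 hlt) hk s hsi t htk hd
      have hi' : (i : ℕ∞) < length r := lt_length hk hlt
      obtain ⟨ε, hε⟩ := exists_edgeAt hi'
      have h3 := geodOn_realisation star hr hi s hsi _ time_succ_mem_pieceSet
      have h4 := geodOn_realisation star hr hk t htk _ time_mem_pieceSet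
      rw [realisation_time star hr hε.succ_le, dist_comm] at h3
      rw [realisation_time star hr hk] at h4
      have h5 := dist_triangle4 (𝒢.pt (c.corner r (i + 1))) (c.realisation r s)
        (c.realisation r t) (𝒢.pt (c.corner r (k + 1)))
      have h6 := sub_le_dist_corner (c := c) (i := i + 1) (j := k + 1) hlt hk
      have h7 : ((k + 1 : ℕ) : ℝ) ≤ (i + 1 : ℕ) + (K + 2 * D) := by linarith
      have h8 : ((k + 1 : ℕ) : ℝ) ≤ ((i + 1 + ⌈K + 2 * D⌉₊ : ℕ) : ℝ) := by
        rw [Nat.cast_add (i + 1)]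
        linarith [Nat.le_ceil (K + 2 * D)]
      have := Nat.cast_le.1 h8
      omega
    · have h1 := htk.2 (lt_length hi hik)
      have h2 : c.time r (k + 1) ≤ c.time r i := time_mono hik
      refine le_trans ?_ (le_max_right _ _)
      linarith [hsi.1]
  choose! R hR0 hR using key
  refine ⟨R, fun {c r} hr K s hs t ht hd => ?_⟩
  have hK : 0 ≤ K := dist_nonneg.trans hd
  rcases le_total s t with h | h
  · rw [abs_sub_comm, abs_of_nonneg (by linarith)]
    exact hR K hK hr s hs t ht h hd
  · rw [abs_of_nonneg (by linarith)]
    rw [dist_comm] at hd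
    exact hR K hK hr t ht s hs h hd

theorem realisation_zero (star : 𝒢.IsStar) {M : MorseGauge} (hr : c.IsMorseRay M r) :
    c.realisation r 0 = 𝒢.pt 𝒢.one := by
  have := realisation_time (i := 0) star hr (by simp)
  rwa [time_zero, corner_zero] at this

/-- Realisations of `M`-Morse combinatorial rays are uniform quasi-geodesics if they are uniformly
Morse. -/
theorem exists_isQuasiGeodesicOn_realisation (hs : 𝒢.IsMorselessStar) (M M' : MorseGauge) :
    ∃ C : ℝ, 1 ≤ C ∧ ∀ {c : 𝒢.Choices} {r : 𝒢.CombRay}, c.IsMorseRay M r →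
      IsMorseSet M' (rayImage (c.realisation r)) →
      IsQuasiGeodesicOn C C (c.realisation r) (Ici 0) := by
  have star : 𝒢.IsStar := hs.star
  obtain ⟨R, hR⟩ := exists_proper hs M
  obtain ⟨C, hC, h⟩ := exists_isQuasiGeodesicOn_of_proper (X := 𝒢.X) (M'.bd 1 0)
    (M'.bd_pos 1 0).le R
  refine ⟨C, hC, fun {c r} hr hM' => h _ ?_ (fun D => hR hr D) ?_⟩
  · intro s hs t ht
    rcases le_total s t with h | h
    · rw [abs_sub_comm, abs_of_nonneg (by linarith)]
      exact dist_realisation_le star hr hs h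
    · rw [dist_comm, abs_of_nonneg (by linarith)]
      exact dist_realisation_le star hr ht h
  · rintro s hs t ht σ hσ _ ⟨u, hu, rfl⟩
    exact hM'.near le_rfl le_rfl dist_nonneg hσ.geodOn.isQuasiGeodesicOn
      (by rw [hσ.1]; exact ⟨s, hs, rfl⟩) (by rw [hσ.2.1]; exact ⟨t, ht, rfl⟩) hu

/-- The geodesic ray determined by the realisation of a Morse combinatorial ray. -/
theorem exists_geodesicRay_realisation (hs : 𝒢.IsMorselessStar) (M M' : MorseGauge) :
    ∃ K : ℝ≥0, ∀ {c : 𝒢.Choices} {r : 𝒢.CombRay}, c.IsMorseRay M r →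
      IsMorseSet M' (rayImage (c.realisation r)) → ∃ ρ : ℝ → 𝒢.X, ρ 0 = 𝒢.pt 𝒢.one ∧
      IsGeodesicRay ρ ∧ (∀ p ∈ rayImage ρ, Near K (rayImage (c.realisation r)) p) ∧
      ∀ p ∈ rayImage (c.realisation r), Near K (rayImage ρ) p := by
  obtain ⟨C, hC, h⟩ := exists_isQuasiGeodesicOn_realisation hs M M'
  obtain ⟨K, hK⟩ := exists_geodesicRay (X := 𝒢.X) M' C 0 hC
  exact ⟨K, fun {c r} hr hM' => hK (h hr hM') hM' _ (by
    rw [realisation_zero hs.star hr, dist_self])⟩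

end Choices

end GraphOfGroups

/-! ### A Morse combinatorial ray is determined by its direction -/

namespace GraphOfGroups

variable {n : ℕ} {E : Type*} [Finite E] {𝒢 : GraphOfGroups n E}

theorem finiteHausdorff_of_inclusion (hs : 𝒢.IsMorselessStar) {j : Fin (n + 1)}
    {A B : Set (GeomReal (𝒢.cay j))}
    (h : FiniteHausdorff (𝒢.inclusion j '' A) (𝒢.inclusion j '' B)) : FiniteHausdorff A B := by
  obtain ⟨C, hC1, hC⟩ := exists_dist_le_inclusion hs
  obtain ⟨R, h1, h2⟩ := h.exists_near
  refine finiteHausdorff_of_near (R := C * R + C) ?_ ?_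
  · intro a ha
    obtain ⟨_, ⟨b, hb, rfl⟩, hd⟩ := h1 _ ⟨a, ha, rfl⟩
    exact ⟨b, hb, (hC j a b).trans (by gcongr)⟩
  · intro b hb
    obtain ⟨_, ⟨a, ha, rfl⟩, hd⟩ := h2 _ ⟨b, hb, rfl⟩
    exact ⟨a, ha, (hC j b a).trans (by gcongr)⟩

theorem finiteHausdorff_of_translate {g : 𝒢.FundGroup} {A B : Set 𝒢.X}
    (h : FiniteHausdorff (𝒢.translate g '' A) (𝒢.translate g '' B)) : FiniteHausdorff A B := by
  have := h.image (f := 𝒢.translate g⁻¹) fun x y => (dist_translate g⁻¹ x y).le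
  simpa only [← image_comp, Function.comp_def, translate_translate, inv_mul_cancel, translate_one,
    image_id'] using this

namespace Choices

open CombRay

variable {c : 𝒢.Choices} {r r' : 𝒢.CombRay} {i : ℕ}

/-- The realisation of a combinatorial ray stays close to far away vertices over its vertices. -/
theorem exists_far_vertex (star : 𝒢.IsStar) {M : MorseGauge} (hr : c.IsMorseRay M r)
    (hi : (i : ℕ∞) ≤ length r) : ∃ R, ∀ B, ∃ (j : ℕ) (y : 𝒢.XVert), i ≤ j ∧ (j : ℕ∞) ≤ length r ∧
      𝒢.proj y = r.vertAt j ∧ B ≤ dist (𝒢.pt 𝒢.one) (𝒢.pt y) ∧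
      Near R (rayImage (c.realisation r)) (𝒢.pt y) := by
  by_cases hfin : ∃ k : ℕ, (k : ℕ∞) = length r
  · obtain ⟨k, hk⟩ := hfin
    obtain ⟨R, hR⟩ := exists_near_endVertex star hr hk
    refine ⟨R, fun B => ?_⟩
    set b := |B| + |R| + dist (𝒢.pt 𝒢.one) (𝒢.pt (c.corner r k)) with hb
    have hb0 : 0 ≤ b := by positivity
    have ht : c.time r k + b ∈ c.pieceSet r k :=
      ⟨by linarith, fun h => absurd h (by rw [hk]; exact lt_irrefl _)⟩
    obtain ⟨y, hy, hyd⟩ := hR _ ht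
    have h1 := geodOn_realisation star hr hk.le _ time_mem_pieceSet _ ht
    rw [realisation_time star hr hk.le, sub_add_cancel_left, abs_neg, abs_of_nonneg hb0] at h1
    have h2 := dist_triangle4 (𝒢.pt (c.corner r k)) (𝒢.pt 𝒢.one) (𝒢.pt y)
      (c.realisation r (c.time r k + b))
    rw [dist_comm _ (𝒢.pt 𝒢.one), dist_comm (𝒢.pt y), h1] at h2
    refine ⟨k, y, ?_, hk.le, hy, ?_, ⟨_, ⟨_, ?_, rfl⟩, by rw [dist_comm]; exact hyd⟩⟩
    · rw [← hk] at hi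
      exact Nat.cast_le.1 hi
    · linarith [le_abs_self B, le_abs_self R]
    · exact add_nonneg time_nonneg hb0
  · have hlen : ∀ j : ℕ, (j : ℕ∞) ≤ length r := by
      intro j
      cases hl : length r with
      | top => exact le_top
      | coe k => exact absurd ⟨k, hl.symm⟩ hfin
    refine ⟨0, fun B => ?_⟩
    obtain ⟨m, hm⟩ := exists_nat_ge B
    refine ⟨max i m, c.corner r (max i m), le_max_left _ _, hlen _, proj_corner (hlen _), ?_, ?_⟩
    · have h1 := sub_le_dist_corner (c := c) (Nat.zero_le (max i m)) (hlen _)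
      rw [corner_zero, Nat.cast_zero, sub_zero] at h1
      exact (hm.trans (Nat.cast_le.2 (le_max_right i m))).trans h1
    · rw [← realisation_time star hr (hlen _)]
      exact near_self ⟨_, time_nonneg, rfl⟩

theorem exists_frequently_near (star : 𝒢.IsStar) {M : MorseGauge} (hr : c.IsMorseRay M r)
    (hi : (i : ℕ∞) ≤ length r) {ρ : ℝ → 𝒢.X} (h0 : ρ 0 = 𝒢.pt 𝒢.one) (hρ : IsGeodesicRay ρ)
    (hH : FiniteHausdorff (rayImage (c.realisation r)) (rayImage ρ)) {Q : 𝒢.X → Prop}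
    (hQ : ∀ (j : ℕ) y, i ≤ j → (j : ℕ∞) ≤ length r → 𝒢.proj y = r.vertAt j → Q (𝒢.pt y)) :
    ∃ R, ∃ᶠ t in atTop, ∃ p, Q p ∧ dist (ρ t) p ≤ R := by
  obtain ⟨R, hR⟩ := exists_far_vertex star hr hi
  obtain ⟨K, hK, -⟩ := hH.exists_near
  refine ⟨R + K, frequently_atTop.2 fun B => ?_⟩
  obtain ⟨j, y, hij, hj, hy, hyd, hn⟩ := hR (B + (R + K))
  obtain ⟨_, ⟨t, ht, rfl⟩, hd⟩ := hn.trans hK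
  refine ⟨t, ?_, 𝒢.pt y, hQ j y hij hj hy, by rwa [dist_comm]⟩
  have h1 := hρ 0 (mem_Ici.2 le_rfl) t ht
  rw [h0, zero_sub, abs_neg, abs_of_nonneg ht] at h1
  have h2 := dist_triangle_right (𝒢.pt 𝒢.one) (𝒢.pt y) (ρ t)
  linarith

/-- From vertex `i + 1` on, `r` runs beyond `ε`. If `r'` ends at vertex `i` or leaves it by another
edge, it stays on the near side. As `ρ` follows both realisations, it would be near both sides of
`ε` at arbitrarily late times. -/
theorem edgeAt_of_vertAt_eq (hs : 𝒢.IsMorselessStar) {M M' N : MorseGauge}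
    (hr : c.IsMorseRay M r) (hr' : c.IsMorseRay M' r') {ρ : ℝ → 𝒢.X} (h0 : ρ 0 = 𝒢.pt 𝒢.one)
    (hρ : IsGeodesicRay ρ) (hN : IsMorseSet N (rayImage ρ))
    (hH : FiniteHausdorff (rayImage (c.realisation r)) (rayImage ρ))
    (hH' : FiniteHausdorff (rayImage (c.realisation r')) (rayImage ρ))
    (hv : r.vertAt i = r'.vertAt i) (hl : (i : ℕ∞) ≤ length r') {ε : 𝒢.TEdge}
    (hε : r.EdgeAt i ε) : r'.EdgeAt i ε := by
  have star : 𝒢.IsStar := hs.star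
  by_contra hcon
  obtain ⟨R, hR⟩ := exists_frequently_near star hr hε.succ_le h0 hρ hH (Q := 𝒢.Side ε)
    fun j y hij hj hy => side_pt (by rw [hy]; exact hε.beyond_vertAt star hij hj)
  have hco : ∃ R', ∃ᶠ t in atTop, ∃ p, 𝒢.CoSide ε p ∧ dist (ρ t) p ≤ R' := by
    rcases hl.eq_or_lt with hl' | hl'
    · refine exists_frequently_near star hr' hl h0 hρ hH' fun j y hij hj hy => coSide_pt ?_
      obtain rfl : j = i := by
        rw [← hl'] at hj
        exact le_antisymm (Nat.cast_le.1 hj) hij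
      rw [hy, ← hv, ← hε.tSrc_eq]
      exact not_beyond_src star ε
    · obtain ⟨ε', hε'⟩ := exists_edgeAt hl'
      refine exists_frequently_near star hr' hε'.succ_le h0 hρ hH' fun j y hij hj hy =>
        coSide_pt ?_
      rw [hy]
      refine not_beyond_of_beyond star hε'.outgoing hε.outgoing (by
        rw [hε.tSrc_eq, hε'.tSrc_eq, hv]) ?_ (hε'.beyond_vertAt star hij hj)
      rintro rfl
      exact hcon hε'
  obtain ⟨R', hR'⟩ := hco
  exact not_frequently_both hs hρ hN (R := max R R')
    (hR.mono fun t ⟨p, hp, hd⟩ => ⟨p, hp, hd.trans (le_max_left _ _)⟩)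
    (hR'.mono fun t ⟨p, hp, hd⟩ => ⟨p, hp, hd.trans (le_max_right _ _)⟩)

theorem edgeAt_of_finiteHausdorff (hs : 𝒢.IsMorselessStar) {M M' N : MorseGauge}
    (hr : c.IsMorseRay M r) (hr' : c.IsMorseRay M' r') {ρ : ℝ → 𝒢.X} (h0 : ρ 0 = 𝒢.pt 𝒢.one)
    (hρ : IsGeodesicRay ρ) (hN : IsMorseSet N (rayImage ρ))
    (hH : FiniteHausdorff (rayImage (c.realisation r)) (rayImage ρ))
    (hH' : FiniteHausdorff (rayImage (c.realisation r')) (rayImage ρ)) {ε : 𝒢.TEdge}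
    (hε : r.EdgeAt i ε) : r'.EdgeAt i ε := by
  induction i generalizing ε with
  | zero =>
    exact edgeAt_of_vertAt_eq hs hr hr' h0 hρ hN hH hH' (by rw [vertAt_zero, vertAt_zero])
      (by simp) hε
  | succ i ih =>
    obtain ⟨ε₀, hε₀⟩ := exists_edgeAt (lt_length hε.lt.le (Nat.lt_succ_self i))
    exact edgeAt_of_vertAt_eq hs hr hr' h0 hρ hN hH hH'
      (hε₀.tTgt_eq.symm.trans (ih hε₀).tTgt_eq) (ih hε₀).succ_le hε

theorem finiteHausdorff_image_pieceSet (star : 𝒢.IsStar) {M : MorseGauge}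
    (hr : c.IsMorseRay M r) (hi : (i : ℕ∞) = length r) :
    FiniteHausdorff (c.realisation r '' c.pieceSet r i) (rayImage (c.realisation r)) := by
  refine finiteHausdorff_of_near (R := c.time r i) ?_ ?_
  · rintro _ ⟨t, ht, rfl⟩
    exact (near_self (A := rayImage (c.realisation r)) ⟨t, time_nonneg.trans ht.1, rfl⟩).mono
      time_nonneg Subset.rfl
  · rintro _ ⟨t, ht, rfl⟩
    rcases le_total t (c.time r i) with h | h
    · refine ⟨_, ⟨_, time_mem_pieceSet, rfl⟩, ?_⟩
      exact (dist_realisation_le star hr ht h).trans (by linarith [mem_Ici.1 ht])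
    · have hmem : t ∈ c.pieceSet r i := ⟨h, fun h => absurd h (by rw [hi]; exact lt_irrefl _)⟩
      exact (near_self (mem_image_of_mem _ hmem)).mono time_nonneg Subset.rfl

/-- Combinatorial rays are determined by the directions of their realisations. -/
theorem eq_of_finiteHausdorff (hs : 𝒢.IsMorselessStar) {M M' N : MorseGauge}
    (hr : c.IsMorseRay M r) (hr' : c.IsMorseRay M' r') {ρ : ℝ → 𝒢.X} (h0 : ρ 0 = 𝒢.pt 𝒢.one)
    (hρ : IsGeodesicRay ρ) (hN : IsMorseSet N (rayImage ρ))
    (hH : FiniteHausdorff (rayImage (c.realisation r)) (rayImage ρ))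
    (hH' : FiniteHausdorff (rayImage (c.realisation r')) (rayImage ρ)) : r = r' := by
  have h1 : ∀ {i ε}, r.EdgeAt i ε → r'.EdgeAt i ε :=
    edgeAt_of_finiteHausdorff hs hr hr' h0 hρ hN hH hH'
  have h2 : ∀ {i ε}, r'.EdgeAt i ε → r.EdgeAt i ε :=
    edgeAt_of_finiteHausdorff hs hr' hr h0 hρ hN hH' hH
  cases r with
  | infinite p hp =>
    cases r' with
    | infinite p' hp' =>
      obtain rfl : p = p' := funext fun i => (h2 (i := i) (ε := p' i) rfl)
      rfl
    | finite k p' hp' z' =>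
      obtain ⟨h, -⟩ := h1 (i := k) (ε := p k) rfl
      exact absurd h (lt_irrefl k)
  | finite k p hp z =>
    cases r' with
    | infinite p' hp' =>
      obtain ⟨h, -⟩ := h2 (i := k) (ε := p' k) rfl
      exact absurd h (lt_irrefl k)
    | finite k' p' hp' z' =>
      obtain rfl : k = k' := by
        refine le_antisymm ?_ ?_
        · by_contra h
          obtain ⟨h, -⟩ := h1 (i := k') ⟨not_le.1 h, rfl⟩
          exact absurd h (lt_irrefl k')
        · by_contra h
          obtain ⟨h, -⟩ := h2 (i := k) ⟨not_le.1 h, rfl⟩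
          exact absurd h (lt_irrefl k)
      obtain rfl : p = p' := funext fun i => by
        obtain ⟨_, h⟩ := h2 (i := i) (ε := p' i) ⟨i.2, rfl⟩
        exact h
      congr 1
      -- The two realisations end with translates, by the same element, of realisations of `z` and
      -- `z'`. These are asymptotic, and undistortedness carries this back to the vertex group.
      have h3 := ((finiteHausdorff_image_pieceSet hs.star hr rfl).trans hH).trans
        ((finiteHausdorff_image_pieceSet hs.star hr' rfl).trans hH').symm
      rw [realisation_image_tail hs.star hr, realisation_image_tail hs.star hr'] at h3
      have h4 := finiteHausdorff_of_translate h3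
      obtain ⟨-, -, ρ₁, hρ₁, e1⟩ := tail_realises_of_isMorseRay hr
      obtain ⟨-, -, ρ₂, hρ₂, e2⟩ := tail_realises_of_isMorseRay hr'
      rw [← hρ₁, ← hρ₂]
      exact Quotient.sound (finiteHausdorff_of_inclusion hs ((e1.trans h4).trans e2.symm))

end Choices

end GraphOfGroups

/-! ### The combinatorial ray of a Morse geodesic ray -/

/-- Geodesics with endpoints close to a Morse geodesic ray are close to it and uniformly Morse. -/
theorem exists_near_segment {X : Type*} [MetricSpace X] [GeodesicSpace X] (M : MorseGauge) (D : ℝ) :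
    ∃ K : ℝ≥0, ∀ {ρ : ℝ → X}, IsGeodesicRay ρ → IsMorseSet M (rayImage ρ) → ∀ {x y : X} {σ : ℝ → X},
      IsGeodesicSegment σ x y → (∃ s ∈ Ici (0 : ℝ), dist (ρ s) x ≤ D) →
      (∃ t ∈ Ici (0 : ℝ), dist (ρ t) y ≤ D) →
      (∀ p ∈ segImage σ x y, Near K (rayImage ρ) p) ∧
      ∀ M₀, IsMorseSet M₀ (rayImage ρ) → IsMorseSet (M₀.half.half.shift K) (segImage σ x y) := by
  obtain ⟨K, hK⟩ := near_of_endpoints_near (X := X) M D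
  refine ⟨K, fun {ρ} hρ hM => ?_⟩
  have key : ∀ {x y : X} {σ : ℝ → X}, IsGeodesicSegment σ x y → ∀ s ∈ Ici (0 : ℝ),
      ∀ t ∈ Ici (0 : ℝ), s ≤ t → dist (ρ s) x ≤ D → dist (ρ t) y ≤ D →
      (∀ p ∈ segImage σ x y, Near K (rayImage ρ) p) ∧
      ∀ M₀, IsMorseSet M₀ (rayImage ρ) → IsMorseSet (M₀.half.half.shift K) (segImage σ x y) := by
    intro x y σ hσ s hs t ht hst hx hy
    obtain ⟨h1, h2⟩ := hK (J := Ici 0) hρ hM hσ hs ht hst (by rwa [dist_comm]) (by rwa [dist_comm])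
    exact ⟨fun p hp => (h1 p hp).mono le_rfl (image_mono fun u hu => le_trans hs hu.1),
      fun M₀ hM₀ => (IsMorseSet.of_Icc (J := Ici 0) hρ hM₀ hs ht hst).transfer h1 h2⟩
  rintro x y σ hσ ⟨s, hs, hx⟩ ⟨t, ht, hy⟩
  rcases le_total s t with hst | hst
  · exact key hσ s hs t ht hst hx hy
  · have := key hσ.reverse t ht s hs hst hy hx
    rwa [IsGeodesicSegment.segImage_reverse] at this

namespace GraphOfGroups

variable {n : ℕ} {E : Type*} [Finite E] {𝒢 : GraphOfGroups n E}

/-- Each outgoing edge increases the distance from `G_0` by exactly one; the triangle inequality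
does the rest. -/
theorem dist_eq_sub_of_chain (star : 𝒢.IsStar) {v : ℕ → 𝒢.TVert} (h0 : v 0 = 𝒢.root) {k : ℕ}
    (h : ∀ i < k, ∃ ε, 𝒢.Outgoing ε ∧ 𝒢.tSrc ε = v i ∧ 𝒢.tTgt ε = v (i + 1)) {i j : ℕ}
    (hij : i ≤ j) (hj : j ≤ k) : 𝒢.bsTree.dist (v i) (v j) = j - i := by
  have hroot : ∀ i, i ≤ k → 𝒢.bsTree.dist 𝒢.root (v i) = i := by
    intro i
    induction i with
    | zero => intro _; rw [h0, SimpleGraph.dist_self]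
    | succ i ih =>
      intro hi
      obtain ⟨ε, hε, h1, h2⟩ := h i (by omega)
      rw [← h2, dist_root_tTgt star hε, h1, ih (by omega)]
  have hle : ∀ j, i ≤ j → j ≤ k → 𝒢.bsTree.dist (v i) (v j) ≤ j - i := by
    intro j hij
    induction j, hij using Nat.le_induction with
    | base => intro _; simp
    | succ j hij ih =>
      intro hj
      obtain ⟨ε, hε, h1, h2⟩ := h j (by omega)
      have h3 := 𝒢.bsTree_connected.dist_triangle (u := v i) (v := v j) (w := v (j + 1))
      have h4 := SimpleGraph.dist_eq_one_iff_adj.2 (𝒢.bsTree_adj_of_edge (tSrc_ne_tTgt star ε))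
      rw [h1, h2] at h4
      have := ih (by omega)
      omega
  have h1 := 𝒢.bsTree_connected.dist_triangle (u := 𝒢.root) (v := v i) (w := v j)
  rw [hroot i (by omega), hroot j hj] at h1
  have := hle j hij hj
  omega

variable (𝒢) in
/-- The ray passes beyond `ε` again and again. -/
def Passes (ρ : ℝ → 𝒢.X) (ε : 𝒢.TEdge) : Prop := ∃ᶠ t in atTop, 𝒢.Side ε (ρ t)

/-- The vertices of the tree which a ray passes form a finite or infinite path. -/
theorem exists_path_of_ray (star : 𝒢.IsStar) (ρ : ℝ → 𝒢.X) :
    (∃ p : ℕ → 𝒢.TEdge, 𝒢.IsGeodesicPathInf p ∧ ∀ i, 𝒢.Outgoing (p i) ∧ 𝒢.Passes ρ (p i)) ∨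
    ∃ (k : ℕ) (p : Fin k → 𝒢.TEdge), 𝒢.IsGeodesicPath p ∧
      (∀ i, 𝒢.Outgoing (p i) ∧ 𝒢.Passes ρ (p i)) ∧
      ∀ ε, 𝒢.Outgoing ε → 𝒢.tSrc ε = 𝒢.endVertex p → ¬ 𝒢.Passes ρ ε := by
  classical
  -- From `G_0`, an outgoing edge which the ray passes is followed as long as there is one; the path
  -- is finite exactly if some vertex has none.
  let N : 𝒢.TVert → Prop := fun u => ∃ ε, 𝒢.Outgoing ε ∧ 𝒢.tSrc ε = u ∧ 𝒢.Passes ρ ε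
  let next : 𝒢.TVert → 𝒢.TVert := fun u => if h : N u then 𝒢.tTgt h.choose else u
  let v : ℕ → 𝒢.TVert := fun i => next^[i] 𝒢.root
  have hv0 : v 0 = 𝒢.root := rfl
  have hv : ∀ i, N (v i) →
      ∃ ε, 𝒢.Outgoing ε ∧ 𝒢.tSrc ε = v i ∧ 𝒢.tTgt ε = v (i + 1) ∧ 𝒢.Passes ρ ε := by
    intro i hi
    refine ⟨hi.choose, hi.choose_spec.1, hi.choose_spec.2.1, ?_, hi.choose_spec.2.2⟩
    simp only [v, Function.iterate_succ_apply']
    change _ = next (v i)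
    simp only [next]
    rw [dif_pos hi]
  by_cases hall : ∀ i, N (v i)
  · left
    choose p hp1 hp2 hp3 hp4 using fun i => hv i (hall i)
    have hpv : ∀ i, 𝒢.pathVertexInf p i = v i := by
      intro i
      cases i with
      | zero => rfl
      | succ i => exact hp3 i
    refine ⟨p, ⟨fun i => by rw [hpv, hp2], fun i j hij => ?_⟩, fun i => ⟨hp1 i, hp4 i⟩⟩
    rw [hpv, hpv]
    exact dist_eq_sub_of_chain star hv0 (k := j) (fun i _ => ⟨p i, hp1 i, hp2 i, hp3 i⟩) hij le_rfl
  · right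
    push Not at hall
    set k := Nat.find hall with hk
    have hlt : ∀ i < k, N (v i) := fun i hi => not_not.1 (Nat.find_min hall hi)
    choose p hp1 hp2 hp3 hp4 using fun i : Fin k => hv i (hlt i i.2)
    have hpv : ∀ i : Fin (k + 1), 𝒢.pathVertex p i = v i := by
      intro i
      refine Fin.cases rfl (fun i => ?_) i
      simp only [pathVertex, Fin.cons_succ, Fin.val_succ]
      exact hp3 i
    refine ⟨k, p, ⟨fun i => by rw [hpv, hp2]; rfl, fun i j hij => ?_⟩, fun i => ⟨hp1 i, hp4 i⟩, ?_⟩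
    · rw [hpv, hpv]
      exact dist_eq_sub_of_chain star hv0 (k := k)
        (fun i hi => ⟨p ⟨i, hi⟩, hp1 _, hp2 _, hp3 _⟩) hij (Nat.lt_succ_iff.1 j.2)
    · intro ε hε hsrc hpass
      refine Nat.find_spec hall ⟨ε, hε, ?_, hpass⟩
      rw [hsrc, endVertex, hpv]
      rfl

variable (𝒢) in
/-- `u` is the vertex `G_0`, or the target of an outgoing edge which the ray passes. -/
def Visits (ρ : ℝ → 𝒢.X) (u : 𝒢.TVert) : Prop :=
  u = 𝒢.root ∨ ∃ α, 𝒢.Outgoing α ∧ 𝒢.tTgt α = u ∧ 𝒢.Passes ρ α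

namespace Choices

open CombRay

/-- A ray from the base point which gets beyond `α` crosses near the fibre of `α`, where it is close
to `α^*`. -/
theorem exists_bound_vertBase (hs : 𝒢.IsMorselessStar) (M : MorseGauge) : ∃ D : ℝ, 0 ≤ D ∧
    ∀ {c : 𝒢.Choices} {ρ : ℝ → 𝒢.X}, ρ 0 = 𝒢.pt 𝒢.one → IsGeodesicRay ρ →
      IsMorseSet M (rayImage ρ) → ∀ {u : 𝒢.TVert}, 𝒢.Visits ρ u →
      𝒢.proj (c.vertBase u) = u ∧ ∃ t ∈ Ici (0 : ℝ), dist (ρ t) (𝒢.pt (c.vertBase u)) ≤ D := by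
  have star : 𝒢.IsStar := hs.star
  obtain ⟨D, hD0, hD⟩ := exists_bound_edgeBase hs M 1 zero_le_one
  refine ⟨D, hD0, fun {c ρ} h0 hρ hM u hu => ?_⟩
  rcases hu with rfl | ⟨α, hα, rfl, hpass⟩
  · rw [vertBase_root]
    exact ⟨rfl, 0, mem_Ici.2 le_rfl, by rw [h0, dist_self]; exact hD0⟩
  · rw [vertBase_tTgt star hα]
    refine ⟨𝒢.proj_of_mem_edgeFibre (c.edgeBase_mem α hα), ?_⟩
    obtain ⟨t, ht, hside⟩ := frequently_atTop.1 hpass 0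
    have hcont : ContinuousOn ρ (Icc 0 t) :=
      (GeodOn.continuousOn (J := Ici 0) hρ).mono Icc_subset_Ici_self
    obtain ⟨s, hs, hn⟩ := exists_near_fibre hcont ⟨ht, le_rfl⟩ ⟨le_rfl, ht⟩ hside
      (by rw [h0]; exact coSide_pt ((outgoing_iff star).1 hα))
    exact ⟨s, hs.1, hD h0 hρ hM α hα s hs.1 hn⟩

/-- A Morse ray which visits `u` but passes no outgoing edge at `u` stays close to the vertices
over `u`. -/
theorem exists_bound_stays (hs : 𝒢.IsMorselessStar) (M : MorseGauge) : ∃ D : ℝ, 0 ≤ D ∧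
    ∀ {c : 𝒢.Choices} {ρ : ℝ → 𝒢.X}, ρ 0 = 𝒢.pt 𝒢.one → IsGeodesicRay ρ →
      IsMorseSet M (rayImage ρ) → ∀ {u : 𝒢.TVert}, 𝒢.Visits ρ u →
      (∀ ε, 𝒢.Outgoing ε → 𝒢.tSrc ε = u → ¬ 𝒢.Passes ρ ε) →
      𝒢.proj (c.vertBase u) = u ∧ ∃ τ ∈ Ici (0 : ℝ), dist (ρ τ) (𝒢.pt (c.vertBase u)) ≤ D ∧
        ∀ t, τ ≤ t → ∃ y, 𝒢.proj y = u ∧ dist (ρ t) (𝒢.pt y) ≤ D := by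
  have star : 𝒢.IsStar := hs.star
  obtain ⟨D, hD0, hD⟩ := exists_bound_vertBase hs M
  obtain ⟨D₁, hD₁⟩ := exists_bound_near_fibre hs M (D + 1)
  refine ⟨|D₁| + D + 2, by positivity, fun {c ρ} h0 hρ hM u hu hno => ?_⟩
  have hD₁' := le_abs_self D₁
  have hD₁0 := abs_nonneg D₁
  obtain ⟨hproj, τ, hτ, hτd⟩ := hD (c := c) h0 hρ hM hu
  refine ⟨hproj, τ, hτ, by linarith, fun t ht => ?_⟩
  have hτ0 : 0 ≤ τ := hτ
  have hcont : ∀ a b, 0 ≤ a → ContinuousOn ρ (Icc a b) := fun a b ha =>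
    (GeodOn.continuousOn (J := Ici 0) hρ).mono fun u hu => ha.trans hu.1
  obtain ⟨x, hx⟩ := GeomReal.exists_dist_vertex_lt (ρ t)
  -- If `ρ t` is beyond an outgoing edge `β` at `u`, the ray is near the fibre of `β` before `t`
  -- and, since it does not pass `β`, again after `t`. These times differ by a bounded amount, so `ρ
  -- t` is near the fibre, hence near vertices over `u`.
  have hβ : ∀ β, 𝒢.Outgoing β → 𝒢.tSrc β = u → 𝒢.Beyond β (𝒢.proj x) →
      ∃ y, 𝒢.proj y = u ∧ dist (ρ t) (𝒢.pt y) ≤ |D₁| + D + 2 := by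
    intro β hβ hsrc hb
    have hside : 𝒢.Side β (ρ t) := ⟨x, hb, hx⟩
    have hw : 𝒢.CoSide β (𝒢.pt (c.vertBase u)) := coSide_pt (by
      rw [hproj, ← hsrc]; exact not_beyond_src star β)
    obtain ⟨t₁, ht₁, hn₁⟩ : ∃ t₁ ∈ Icc τ t, Near (D + 1) (𝒢.fibre β) (ρ t₁) := by
      by_cases h1 : 𝒢.CoSide β (ρ τ)
      · obtain ⟨t₁, ht₁, hn⟩ := exists_near_fibre (hcont τ t hτ0) ⟨ht, le_rfl⟩ ⟨le_rfl, ht⟩ hside h1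
        exact ⟨t₁, ht₁, hn.mono (by linarith) Subset.rfl⟩
      · exact ⟨τ, ⟨le_rfl, ht⟩, (near_fibre_of_dist ((side_or_coSide β _).resolve_right h1)
          hw).1.mono (by linarith) Subset.rfl⟩
    have hev : ∃ t' ≥ t, 𝒢.CoSide β (ρ t') := by
      have := hno β hβ hsrc
      rw [Passes, not_frequently, eventually_atTop] at this
      obtain ⟨a, ha⟩ := this
      exact ⟨max a t, le_max_right _ _, (side_or_coSide β _).resolve_left (ha _ (le_max_left _ _))⟩
    obtain ⟨t', ht', hco⟩ := hev
    obtain ⟨t₂, ht₂, hn₂⟩ := exists_near_fibre (hcont t t' (hτ0.trans ht)) ⟨le_rfl, ht'⟩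
      ⟨ht', le_rfl⟩ hside hco
    have h2 : |t₂ - t₁| ≤ D₁ := hD₁ (J := Ici 0) hρ hM β t₂ (hτ0.trans (ht.trans ht₂.1)) t₁
      (hτ0.trans ht₁.1) (hn₂.mono (by linarith) Subset.rfl) hn₁
    have h3 := le_abs_self (t₂ - t₁)
    have h4 := hρ t (hτ0.trans ht) t₁ (hτ0.trans ht₁.1)
    rw [abs_of_nonneg (by linarith [ht₁.2])] at h4
    obtain ⟨_, ⟨y, hy, rfl⟩, hyd⟩ := hn₁
    obtain ⟨y', hy', hadj⟩ := 𝒢.exists_adj_of_mem_edgeFibre hy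
    refine ⟨y', ?_, ?_⟩
    · rw [𝒢.proj_of_mem_edgeFibre hy', tTgt_trev, hsrc]
    · have h5 : dist (𝒢.pt y) (𝒢.pt y') ≤ 1 := by
        rcases hadj with rfl | hadj
        · simp
        · rw [GeomReal.dist_vertex, SimpleGraph.dist_eq_one_iff_adj.2 hadj, Nat.cast_one]
      have h6 := dist_triangle4 (ρ t) (ρ t₁) (𝒢.pt y) (𝒢.pt y')
      linarith [ht₂.1]
  rcases hu with hu | ⟨α, hα, hαu, hpass⟩
  · rcases eq_root_or_beyond star (𝒢.proj x) with h | ⟨β, h1, h2, h3⟩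
    · exact ⟨x, h.trans hu.symm, by linarith⟩
    · exact hβ β h1 (h2.trans hu.symm) h3
  · by_cases hb : 𝒢.Beyond α (𝒢.proj x)
    · rcases eq_or_beyond star hα hb with h | ⟨β, h1, h2, h3⟩
      · exact ⟨x, h.trans hαu, by linarith⟩
      · exact hβ β h1 (h2.trans hαu) h3
    -- If `ρ t` is not beyond `α`, the ray crosses near the fibre of `α` after `t`. At time `τ` it
    -- is near the point `u^*` of the same fibre, so `t - τ` is bounded.
    · obtain ⟨t', ht', hside⟩ := frequently_atTop.1 hpass t
      obtain ⟨t₂, ht₂, hn₂⟩ := exists_near_fibre (hcont t t' (hτ0.trans ht)) ⟨ht', le_rfl⟩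
        ⟨le_rfl, ht'⟩ hside ⟨x, hb, hx⟩
      have hmem : 𝒢.pt (c.vertBase u) ∈ 𝒢.fibre α := by
        rw [← hαu, vertBase_tTgt star hα]
        exact ⟨_, c.edgeBase_mem α hα, rfl⟩
      have h2 : |t₂ - τ| ≤ D₁ := hD₁ (J := Ici 0) hρ hM α t₂ (hτ0.trans (ht.trans ht₂.1)) τ
        hτ (hn₂.mono (by linarith) Subset.rfl) (near_of_mem_fibre hmem (by linarith))
      have h3 := le_abs_self (t₂ - τ)
      have h4 := hρ t (hτ0.trans ht) τ hτ
      rw [abs_of_nonneg (by linarith)] at h4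
      refine ⟨c.vertBase u, hproj, ?_⟩
      have h6 := dist_triangle (ρ t) (ρ τ) (𝒢.pt (c.vertBase u))
      linarith [ht₂.1]

end Choices

/-- Sets in a vertex group which are Morse in the Bass–Serre space are Morse. -/
theorem isMorseSet_of_inclusion {C : ℝ≥0} (hC1 : 1 ≤ C) {j : Fin (n + 1)}
    (hC : ∀ x y : GeomReal (𝒢.cay j),
      dist x y ≤ C * dist (𝒢.inclusion j x) (𝒢.inclusion j y) + C)
    {M : MorseGauge} {A : Set (GeomReal (𝒢.cay j))} (h : IsMorseSet M (𝒢.inclusion j '' A)) :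
    IsMorseSet (M.comp C) A := by
  refine isMorseSet_of_near fun l e T η hT hη h0 h1 t ht => ?_
  have hl : (1 : ℝ) ≤ l := l.2
  have hC1' : (1 : ℝ) ≤ C := by exact_mod_cast hC1
  have hCl : (1 : ℝ) ≤ C * l := by nlinarith
  have hlC : (l : ℝ) ≤ C * l := by nlinarith
  -- The inclusion expands no distance and contracts at most by the factor `C` up to an additive
  -- constant, so the image is a `(C * l, e + 1)`-quasi-geodesic.
  have hq : IsQuasiGeodesicOn (max 1 (C * l)) ((e + 1 : ℝ≥0) : ℝ) (fun t => 𝒢.inclusion j (η t))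
      (Icc 0 T) := by
    rw [max_eq_right hCl]
    refine ⟨(LipschitzWith.of_dist_le_mul (K := 1) (f := 𝒢.inclusion j)
      fun x y => by rw [NNReal.coe_one, one_mul]; exact dist_inclusion_le j x y).continuous.comp_continuousOn hη.1, fun s hs t ht => ?_⟩
    have e1 := hC (η s) (η t)
    have e2 := dist_inclusion_le j (η s) (η t)
    obtain ⟨e3, e4⟩ := hη.2 s hs t ht
    have e5 := abs_nonneg (s - t)
    have he : (0 : ℝ) ≤ e := e.2
    push_cast
    constructor
    · have e6 : (C : ℝ)⁻¹ * (↑l)⁻¹ * |s - t| - e - 1 ≤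
          dist (𝒢.inclusion j (η s)) (𝒢.inclusion j (η t)) := by
        have e7 : (C : ℝ)⁻¹ * ((↑l)⁻¹ * |s - t|) ≤
            (C : ℝ)⁻¹ * (C * dist (𝒢.inclusion j (η s)) (𝒢.inclusion j (η t)) + C + e) :=
          mul_le_mul_of_nonneg_left (by linarith) (by positivity)
        have e8 : (C : ℝ)⁻¹ * (C * dist (𝒢.inclusion j (η s)) (𝒢.inclusion j (η t)) + C + e) =
            dist (𝒢.inclusion j (η s)) (𝒢.inclusion j (η t)) + 1 + (C : ℝ)⁻¹ * e := by
          field_simp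
        have e9 : (C : ℝ)⁻¹ * e ≤ e := mul_le_of_le_one_left he (inv_le_one_of_one_le₀ hC1')
        rw [mul_assoc]
        linarith
      rw [mul_inv]
      linarith
    · have : (l : ℝ) * |s - t| ≤ C * l * |s - t| := mul_le_mul_of_nonneg_right hlC e5
      linarith
  obtain ⟨_, ⟨a, ha, rfl⟩, hd⟩ := h.near_val (l := ⟨max 1 (C * l), mem_Ici.2 (le_max_left _ _)⟩)
    hT hq ⟨_, h0, rfl⟩ ⟨_, h1, rfl⟩ ht
  refine ⟨a, ha, (hC _ _).trans ?_⟩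
  have : (C : ℝ) * dist (𝒢.inclusion j (η t)) (𝒢.inclusion j a) ≤
      C * (M.toFun ⟨max 1 (C * l), mem_Ici.2 (le_max_left _ _)⟩ (e + 1) + 1) :=
    mul_le_mul_of_nonneg_left hd C.2
  change _ ≤ ((C * M.toFun ⟨max 1 (C * l), mem_Ici.2 (le_max_left _ _)⟩ (e + 1) + C * 2 : ℝ≥0) : ℝ)
  push_cast
  linarith

end GraphOfGroups

namespace GraphOfGroups

variable {n : ℕ} {E : Type*} [Finite E] {𝒢 : GraphOfGroups n E}

/-- A quasi-geodesic ray in a vertex group which follows a geodesic ray staying close to the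
corresponding coset. -/
theorem exists_ray_in_vertexGroup (hs : 𝒢.IsMorselessStar) {D : ℝ} (hD : 0 ≤ D) {ρ : ℝ → 𝒢.X}
    (hρ : IsGeodesicRay ρ) {g : 𝒢.FundGroup} {j : Fin (n + 1)}
    (hy : ∀ t, 0 ≤ t → ∃ y, 𝒢.proj y = 𝒢.proj (g, j) ∧ dist (ρ t) (𝒢.pt y) ≤ D) :
    ∃ (C : ℝ) (q : ℝ → GeomReal (𝒢.cay j)) (K : ℝ≥0), 1 ≤ C ∧ IsQuasiGeodesicOn C C q (Ici 0) ∧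
      (∀ p ∈ 𝒢.translate g '' (𝒢.inclusion j '' rayImage q), Near K (rayImage ρ) p) ∧
      ∀ p ∈ rayImage ρ, Near K (𝒢.translate g '' (𝒢.inclusion j '' rayImage q)) p := by
  obtain ⟨C, hC1, hC⟩ := exists_dist_le_inclusion hs
  -- The ray is sampled at integer times, nearby vertices of the coset are chosen, and these are
  -- joined by geodesics in the vertex group.
  have hseq : ∀ i : ℕ, ∃ s : 𝒢.G j, dist (ρ i) (𝒢.pt (g * 𝒢.ι j s, j)) ≤ D := by
    intro i
    obtain ⟨y, hy, hyd⟩ := hy i (Nat.cast_nonneg i)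
    obtain ⟨s, rfl⟩ : ∃ s : 𝒢.G j, y = (g * 𝒢.ι j s, j) := by
      obtain ⟨y1, y2⟩ := y
      have h1 : y2 = j := congrArg Sigma.fst hy
      subst h1
      obtain ⟨s, rfl⟩ := 𝒢.proj_eq_iff.1 hy.symm
      exact ⟨s, rfl⟩
    exact ⟨s, hyd⟩
  choose s hsd using hseq
  let f : ℕ → GeomReal (𝒢.cay j) := fun i => GeomReal.vertex _ (s i)
  have hf : ∀ i, 𝒢.translate g (𝒢.inclusion j (f i)) = 𝒢.pt (g * 𝒢.ι j (s i), j) := by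
    intro i
    rw [inclusion_vertex, translate_pt]
  have hρd : ∀ i k : ℕ, dist (ρ i) (ρ k) = |(i : ℝ) - k| := fun i k =>
    hρ i (mem_Ici.2 (Nat.cast_nonneg i)) k (mem_Ici.2 (Nat.cast_nonneg k))
  have hfd : ∀ i k : ℕ, |(i : ℝ) - k| - 2 * D ≤ dist (𝒢.inclusion j (f i)) (𝒢.inclusion j (f k)) ∧
      dist (𝒢.inclusion j (f i)) (𝒢.inclusion j (f k)) ≤ |(i : ℝ) - k| + 2 * D := by
    intro i k
    rw [← dist_translate g, hf, hf, ← hρd]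
    have h1 := hsd i
    have h2 := hsd k
    have h3 := dist_triangle4 (ρ i) (𝒢.pt (g * 𝒢.ι j (s i), j)) (𝒢.pt (g * 𝒢.ι j (s k), j)) (ρ k)
    have h4 := dist_triangle4 (𝒢.pt (g * 𝒢.ι j (s i), j)) (ρ i) (ρ k) (𝒢.pt (g * 𝒢.ι j (s k), j))
    rw [dist_comm (𝒢.pt _) (ρ k)] at h3
    rw [dist_comm (𝒢.pt _) (ρ i)] at h4
    constructor <;> linarith
  set δ : ℝ := C * (1 + 2 * D) + C with hδ
  have hδ1 : 1 ≤ δ := by nlinarith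
  obtain ⟨q, hqf, hq⟩ := exists_path_of_seq f (δ := δ) (by
    intro i
    refine (hC j _ _).trans ?_
    have h1 := (hfd i (i + 1)).2
    push_cast at h1
    rw [show (i : ℝ) - (i + 1) = -1 by ring, abs_neg, abs_one] at h1
    rw [hδ]
    gcongr)
  have hqg : IsQuasiGeodesicOn δ (2 * D + 2 * δ + 1) q (Ici 0) := by
    refine isQuasiGeodesicOn_of_seq hδ1 le_rfl (by linarith) hq
      (fun t ht => ⟨ht, mem_Ici.2 (Nat.cast_nonneg _)⟩) fun i k _ _ => ?_
    rw [hqf, hqf]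
    have h1 := (hfd i k).1
    have h2 := dist_inclusion_le j (f i) (f k)
    have h3 : δ⁻¹ * |(i : ℝ) - k| ≤ |(i : ℝ) - k| :=
      mul_le_of_le_one_left (abs_nonneg _) (inv_le_one_of_one_le₀ hδ1)
    linarith
  have hfloor : ∀ t : ℝ, 0 ≤ t → |t - ⌊t⌋₊| ≤ 1 := by
    intro t ht
    rw [abs_of_nonneg (by linarith [Nat.floor_le ht])]
    linarith [Nat.lt_floor_add_one t]
  refine ⟨2 * D + 2 * δ + 1, q, ⟨δ + D + 1, by linarith⟩, by linarith,
    hqg.weaken hδ1 (by linarith) le_rfl, ?_, ?_⟩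
  · rintro _ ⟨_, ⟨_, ⟨t, ht, rfl⟩, rfl⟩, rfl⟩
    refine ⟨ρ ⌊t⌋₊, ⟨_, mem_Ici.2 (Nat.cast_nonneg _), rfl⟩, ?_⟩
    have h1 := hq t ht ⌊t⌋₊ (mem_Ici.2 (Nat.cast_nonneg _))
    have h2 := dist_inclusion_le j (q t) (q ⌊t⌋₊)
    rw [← dist_translate g, hqf ⌊t⌋₊, hf] at h2
    rw [hqf ⌊t⌋₊] at h1
    have h3 := dist_triangle_right (𝒢.translate g (𝒢.inclusion j (q t))) (ρ ⌊t⌋₊)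
      (𝒢.pt (g * 𝒢.ι j (s ⌊t⌋₊), j))
    have h4 := hsd ⌊t⌋₊
    have h5 : δ * |t - ⌊t⌋₊| ≤ δ := mul_le_of_le_one_right (by linarith) (hfloor t ht)
    change _ ≤ δ + D + 1
    linarith
  · rintro _ ⟨t, ht, rfl⟩
    refine ⟨_, ⟨_, ⟨_, ⟨⌊t⌋₊, mem_Ici.2 (Nat.cast_nonneg _), rfl⟩, rfl⟩, rfl⟩, ?_⟩
    rw [hqf, hf]
    have h1 := hρ t ht ⌊t⌋₊ (mem_Ici.2 (Nat.cast_nonneg _))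
    have h3 := dist_triangle (ρ t) (ρ ⌊t⌋₊) (𝒢.pt (g * 𝒢.ι j (s ⌊t⌋₊), j))
    have h4 := hsd ⌊t⌋₊
    have h5 := hfloor t ht
    change _ ≤ δ + D + 1
    linarith

/-- A Morse geodesic ray which stays close to a coset of a vertex group follows the translate of
a realisation of a Morse direction of that vertex group. -/
theorem exists_realisesTail (hs : 𝒢.IsMorselessStar) (M : MorseGauge) {D : ℝ} (hD : 0 ≤ D) :
    ∃ K : ℝ≥0, ∀ {ρ : ℝ → 𝒢.X}, IsGeodesicRay ρ → IsMorseSet M (rayImage ρ) →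
      ∀ {x : 𝒢.XVert} {u : 𝒢.TVert}, 𝒢.proj x = u → dist (ρ 0) (𝒢.pt x) ≤ D →
      (∀ t, 0 ≤ t → ∃ y, 𝒢.proj y = u ∧ dist (ρ t) (𝒢.pt y) ≤ D) →
      ∃ z ξ, 𝒢.RealisesTail u.1 z ξ ∧
        (∀ p ∈ 𝒢.translate x.1 '' rayImage ξ, Near K (rayImage ρ) p) ∧
        ∀ p ∈ rayImage ρ, Near K (𝒢.translate x.1 '' rayImage ξ) p := by
  obtain ⟨K, hK⟩ := exists_geodesicRay (X := 𝒢.X) M 1 D le_rfl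
  obtain ⟨C, hC1, hC⟩ := exists_dist_le_inclusion hs
  refine ⟨K, fun {ρ} hρ hM x u hu hx hy => ?_⟩
  subst hu
  obtain ⟨g, j⟩ := x
  -- A geodesic ray along `ρ` which starts exactly at `(g, j)`; its translate by `g⁻¹` is the
  -- realisation. Only the constant of this step has to be uniform.
  obtain ⟨σ, hσ0, hσ, hσ1, hσ2⟩ := hK (q := ρ)
    ((GeodOn.isQuasiGeodesicOn (J := Ici 0) hρ).weaken le_rfl le_rfl zero_le_one) hM _
    (by rwa [dist_comm])
  have himg : 𝒢.translate g '' rayImage (fun t => 𝒢.translate g⁻¹ (σ t)) = rayImage σ := by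
    rw [rayImage, image_image]
    simp only [translate_translate, mul_inv_cancel, translate_one]
    rfl
  obtain ⟨C', q, K', hC'1, hq, hq1, hq2⟩ := exists_ray_in_vertexGroup hs hD hρ hy
  have hqM : IsMorseSet ((M.shift K').comp ⟨C, by linarith⟩) (rayImage q) := by
    refine isMorseSet_of_inclusion (C := ⟨C, by linarith⟩) hC1 (hC j) ?_
    have := isMorseSet_translate (hM.transfer hq1 hq2) g⁻¹
    rw [image_image] at this
    simpa only [translate_translate, inv_mul_cancel, translate_one, image_id'] using this
  -- The path `q` in the vertex group is Morse there, so a geodesic ray follows it and defines `z`.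
  -- The constants `K'` and `K''` may depend on `ρ`, since only finiteness of a Hausdorff distance
  -- is needed.
  obtain ⟨K'', hK''⟩ := exists_geodesicRay (X := GeomReal (𝒢.cay j))
    ((M.shift K').comp ⟨C, by linarith⟩) C' 0 hC'1
  obtain ⟨τ, -, hτ, hτ1, hτ2⟩ := hK'' hq hqM (q 0) (by simp)
  let τ' : MorseRay (GeomReal (𝒢.cay j)) := ⟨τ, hτ, _, hqM.transfer hτ1 hτ2⟩
  refine ⟨Quotient.mk _ τ', fun t => 𝒢.translate g⁻¹ (σ t), ⟨?_, ?_, τ', rfl, ?_⟩, ?_, ?_⟩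
  · change 𝒢.translate g⁻¹ (σ 0) = _
    rw [hσ0, translate_pt, inv_mul_cancel]
    rfl
  · intro s hs t ht
    rw [dist_translate]
    exact hσ s hs t ht
  · apply finiteHausdorff_of_translate (g := g)
    rw [himg]
    refine FiniteHausdorff.trans (B := 𝒢.translate g '' (𝒢.inclusion j '' rayImage q)) ?_
      ((finiteHausdorff_of_near hq1 hq2).trans (finiteHausdorff_of_near hσ2 hσ1))
    exact ((finiteHausdorff_of_near hτ1 hτ2).image (dist_inclusion_le j)).image
      fun x y => (dist_translate g x y).le
  · rw [himg]; exact hσ1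
  · rw [himg]; exact hσ2

namespace Choices

open CombRay

variable {c : 𝒢.Choices} {r : 𝒢.CombRay}

/-- Closeness in one direction is enough: the realisation is an unbounded path along `ρ` from its
start, so it passes near every point of `ρ`. -/
theorem finiteHausdorff_of_pieces (star : 𝒢.IsStar) {M : MorseGauge} (hr : c.IsMorseRay M r)
    {ρ : ℝ → 𝒢.X} (h0 : ρ 0 = 𝒢.pt 𝒢.one) (hρ : IsGeodesicRay ρ) {K : ℝ}
    (h : ∀ i : ℕ, (i : ℕ∞) ≤ length r →
      ∀ p ∈ c.realisation r '' c.pieceSet r i, Near K (rayImage ρ) p) :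
    FiniteHausdorff (rayImage (c.realisation r)) (rayImage ρ) := by
  have hz := realisation_zero star hr
  have h1 : ∀ t ∈ Ici (0 : ℝ), Near (max K 0) (ρ '' Ici 0) (c.realisation r t) := by
    intro t ht
    obtain ⟨i, hi, hti⟩ := exists_mem_pieceSet (c := c) (r := r) ht
    exact (h i hi _ ⟨t, hti, rfl⟩).mono (le_max_left _ _) Subset.rfl
  have hK0 := le_max_right K 0
  have h2 := near_of_unbounded (η := c.realisation r) (ρ := ρ) (K := max K 0) hρ
    (continuousOn_realisation star hr) (by rw [hz, h0, dist_self]; exact hK0) (by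
      intro B
      obtain ⟨R, hR⟩ := exists_far_vertex star hr (i := 0) (by simp)
      obtain ⟨j, y, -, -, -, hy, _, ⟨t, ht, rfl⟩, hd⟩ := hR (B + R)
      refine ⟨t, ht, ?_⟩
      rw [h0, dist_comm]
      have := dist_triangle_right (𝒢.pt 𝒢.one) (𝒢.pt y) (c.realisation r t)
      linarith) h1
  refine finiteHausdorff_of_near (R := 3 * max K 0 + 3) ?_ ?_
  · rintro _ ⟨t, ht, rfl⟩
    exact (h1 t ht).mono (by linarith) Subset.rfl
  · rintro _ ⟨t, ht, rfl⟩
    exact h2 t ht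

theorem visits_vertAt {ρ : ℝ → 𝒢.X} (hpass : ∀ i ε, r.EdgeAt i ε → 𝒢.Passes ρ ε) {i : ℕ}
    (hi : (i : ℕ∞) ≤ length r) : 𝒢.Visits ρ (r.vertAt i) := by
  cases i with
  | zero => exact Or.inl vertAt_zero
  | succ i =>
    obtain ⟨ε, hε⟩ := exists_edgeAt (lt_length hi (Nat.lt_succ_self i))
    exact Or.inr ⟨ε, hε.outgoing, hε.tTgt_eq, hpass i ε hε⟩

/-- The ray passes near both ends of every piece between corners. The constant `K` is determined by
`M`, but the resulting gauge is expressed by any gauge `M₀` of `ρ`; this makes it possible to choose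
`K` monotonically in `M`. -/
theorem exists_bound_edges (hs : 𝒢.IsMorselessStar) (M : MorseGauge) : ∃ K : ℝ≥0,
    ∀ {c : 𝒢.Choices} {ρ : ℝ → 𝒢.X}, ρ 0 = 𝒢.pt 𝒢.one → IsGeodesicRay ρ →
      IsMorseSet M (rayImage ρ) → ∀ {r : 𝒢.CombRay}, (∀ i ε, r.EdgeAt i ε → 𝒢.Passes ρ ε) →
      ∀ {i : ℕ} {ε : 𝒢.TEdge}, r.EdgeAt i ε →
      (∀ M₀, IsMorseSet M₀ (rayImage ρ) → c.IsMorseEdge (M₀.half.half.shift K) ε) ∧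
      ∀ p ∈ segImage (c.seg (c.corner r i) (c.corner r (i + 1))) (𝒢.pt (c.corner r i))
        (𝒢.pt (c.corner r (i + 1))), Near K (rayImage ρ) p := by
  have star : 𝒢.IsStar := hs.star
  obtain ⟨D, hD0, hD⟩ := exists_bound_vertBase hs M
  obtain ⟨K, hK⟩ := exists_near_segment (X := 𝒢.X) M D
  refine ⟨K, fun {c ρ} h0 hρ hM r hpass i ε hε => ?_⟩
  have h1 := (hD (c := c) h0 hρ hM (visits_vertAt hpass hε.lt.le)).2
  have h2 := (hD (c := c) h0 hρ hM (visits_vertAt hpass hε.succ_le)).2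
  rw [vertBase_vertAt star hε.lt.le] at h1
  rw [vertBase_vertAt star hε.succ_le] at h2
  obtain ⟨h3, h4⟩ := hK hρ hM (c.seg_geodesic (c.corner r i) (c.corner r (i + 1))) h1 h2
  refine ⟨fun M₀ hM₀ => ⟨c.seg (c.corner r i) (c.corner r (i + 1)), ?_, ?_⟩, h3⟩
  · rw [hε.tSrc_eq, vertBase_vertAt star hε.lt.le, ← corner_succ hε]
    exact c.seg_geodesic _ _
  · rw [hε.tSrc_eq, vertBase_vertAt star hε.lt.le, ← corner_succ hε]
    exact h4 M₀ hM₀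

/-- Morse geodesic rays are at finite distance from realisations of Morse combinatorial rays. -/
theorem exists_combRay (hs : 𝒢.IsMorselessStar) (M : MorseGauge) : ∃ K : ℝ≥0,
    ∀ {c : 𝒢.Choices} {ρ : ℝ → 𝒢.X}, ρ 0 = 𝒢.pt 𝒢.one → IsGeodesicRay ρ →
      IsMorseSet M (rayImage ρ) → ∃ r : 𝒢.CombRay,
      (∀ M₀, IsMorseSet M₀ (rayImage ρ) → c.IsMorseRay (M₀.half.half.shift K) r) ∧
      FiniteHausdorff (rayImage (c.realisation r)) (rayImage ρ) := by
  have star : 𝒢.IsStar := hs.star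
  obtain ⟨D, hD0, hD⟩ := exists_bound_stays hs M
  obtain ⟨K₁, hK₁⟩ := exists_bound_edges hs M
  obtain ⟨K₂, hK₂⟩ := exists_realisesTail hs M.half hD0
  refine ⟨max K₁ K₂, fun {c ρ} h0 hρ hM => ?_⟩
  have hmono : ∀ {N N' : MorseGauge} {ε : 𝒢.TEdge}, N ≤ N' → c.IsMorseEdge N ε →
      c.IsMorseEdge N' ε := fun h ⟨γ, h1, h2⟩ => ⟨γ, h1, h2.mono h⟩
  rcases exists_path_of_ray star ρ with ⟨p, hp, hpass⟩ | ⟨k, p, hp, hpass, hend⟩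
  · have hpass' : ∀ i ε, (CombRay.infinite p hp).EdgeAt i ε → 𝒢.Passes ρ ε := by
      rintro i _ rfl
      exact (hpass i).2
    have hr : ∀ M₀, IsMorseSet M₀ (rayImage ρ) →
        c.IsMorseRay (M₀.half.half.shift (max K₁ K₂)) (.infinite p hp) := fun M₀ hM₀ i =>
      hmono (MorseGauge.shift_mono le_rfl (le_max_left _ _))
        ((hK₁ h0 hρ hM hpass' (i := i) (ε := p i) rfl).1 M₀ hM₀)
    refine ⟨.infinite p hp, hr, finiteHausdorff_of_pieces star (hr M hM) h0 hρ (K := K₁) ?_⟩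
    intro i _
    rw [realisation_image_of_edgeAt star (hr M hM) (i := i) (ε := p i) rfl]
    exact (hK₁ h0 hρ hM hpass' rfl).2
  · have hpass' : ∀ z i ε, (CombRay.finite k p hp z).EdgeAt i ε → 𝒢.Passes ρ ε := by
      rintro z i _ ⟨hi, rfl⟩
      exact (hpass _).2
    have hvis : 𝒢.Visits ρ (𝒢.endVertex p) := by
      rcases Nat.eq_zero_or_pos k with rfl | hk
      · exact Or.inl rfl
      · obtain ⟨k, rfl⟩ := Nat.exists_eq_succ_of_ne_zero hk.ne'
        exact Or.inr ⟨p (Fin.last k), (hpass _).1, rfl, (hpass _).2⟩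
    obtain ⟨hproj, τ, hτ, hτd, hstay⟩ := hD (c := c) h0 hρ hM hvis hend
    have hτ0 : 0 ≤ τ := hτ
    have himg : rayImage (fun t => ρ (τ + t)) = ρ '' (Ici 0 ∩ Ici τ) := by
      ext x
      constructor
      · rintro ⟨t, ht, rfl⟩
        have ht0 : 0 ≤ t := ht
        exact ⟨τ + t, ⟨mem_Ici.2 (by linarith), mem_Ici.2 (by linarith)⟩, rfl⟩
      · rintro ⟨t, ⟨-, ht⟩, rfl⟩
        exact ⟨t - τ, mem_Ici.2 (sub_nonneg.2 ht), by simp⟩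
    -- The tail is read off from the ray after time `τ`, when it is near the base point of the end
    -- vertex; cutting it there costs one `half`.
    have hMτ : ∀ M₀, IsMorseSet M₀ (rayImage ρ) →
        IsMorseSet M₀.half (rayImage fun t => ρ (τ + t)) := by
      intro M₀ hM₀
      rw [himg]
      exact IsMorseSet.of_ge (J := Ici 0) hρ hM₀ hτ
    obtain ⟨z, ξ, hξ, hξ1, hξ2⟩ := hK₂ (ρ := fun t => ρ (τ + t)) (fun s hs t ht => by
        rw [hρ _ (add_nonneg hτ0 hs) _ (add_nonneg hτ0 ht)]
        congr 1
        ring) (hMτ M hM) hproj (by simpa using hτd)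
      (fun t ht => hstay (τ + t) (by linarith))
    have hξM : ∀ M₀, IsMorseSet M₀ (rayImage ρ) →
        IsMorseSet (M₀.half.half.shift (max K₁ K₂)) (rayImage ξ) := by
      intro M₀ hM₀
      have := isMorseSet_translate ((hMτ M₀ hM₀).transfer hξ1 hξ2)
        (c.vertBase (𝒢.endVertex p)).1⁻¹
      rw [image_image] at this
      simp only [translate_translate, inv_mul_cancel, translate_one, image_id'] at this
      exact this.mono (MorseGauge.shift_mono (MorseGauge.le_half _) (le_max_right _ _))
    have hr : ∀ M₀, IsMorseSet M₀ (rayImage ρ) →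
        c.IsMorseRay (M₀.half.half.shift (max K₁ K₂)) (.finite k p hp z) := fun M₀ hM₀ =>
      ⟨fun i => hmono (MorseGauge.shift_mono le_rfl (le_max_left _ _))
        ((hK₁ h0 hρ hM (hpass' z) (i := i) (ε := p i) ⟨i.2, rfl⟩).1 M₀ hM₀),
        ξ, hξ, hξM M₀ hM₀⟩
    obtain ⟨R, hR, -⟩ := ((tail_realises_of_isMorseRay (hr M hM)).finiteHausdorff hξ).exists_near
    refine ⟨.finite k p hp z, hr,
      finiteHausdorff_of_pieces star (hr M hM) h0 hρ (K := max K₁ (R + K₂)) ?_⟩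
    intro i hi
    rcases hi.lt_or_eq with hi | hi
    · obtain ⟨ε, hε⟩ := exists_edgeAt hi
      rw [realisation_image_of_edgeAt star (hr M hM) hε]
      exact fun q hq => ((hK₁ h0 hρ hM (hpass' z) hε).2 q hq).mono (le_max_left _ _) Subset.rfl
    · change (i : ℕ∞) = (k : ℕ∞) at hi
      obtain rfl : i = k := by exact_mod_cast hi
      rw [realisation_image_tail star (hr M hM)]
      rintro _ ⟨x, hx, rfl⟩
      obtain ⟨y, hy, hd⟩ := hR x hx
      refine ((hξ1 _ ⟨y, hy, rfl⟩).trans_dist (D := R) ?_).mono (le_max_right _ _) ?_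
      · rwa [dist_translate]
      · rw [himg]
        exact image_mono inter_subset_left

end Choices

end GraphOfGroups

/-! ### Monotone choice of constants and the theorem -/

theorem exists_monotone_bound {P : MorseGauge → ℝ≥0 → Prop} (hP : ∀ M, ∃ K, P M K)
    (hM : ∀ {M M' K}, M ≤ M' → P M' K → P M K) (hK : ∀ {M K K'}, K ≤ K' → P M K → P M K') :
    ∃ F : MorseGauge → ℝ≥0, Monotone F ∧ ∀ M, P M (F M) := by
  have hne : ∀ M, {k : ℕ | P M k}.Nonempty := by
    intro M
    obtain ⟨K, h⟩ := hP M
    obtain ⟨k, hk⟩ := exists_nat_ge K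
    exact ⟨k, hK hk h⟩
  -- The least natural number that works grows with `M` and, unlike an infimum of reals, works
  -- itself.
  refine ⟨fun M => (sInf {k : ℕ | P M k} : ℕ), fun M M' h => ?_, fun M => Nat.sInf_mem (hne M)⟩
  exact Nat.cast_le.2 (Nat.sInf_le (hM h (Nat.sInf_mem (hne M'))))

theorem IsClassOf.unique {X : Type*} [MetricSpace X] {γ : ℝ → X} {z z' : MorseBoundary X}
    (h : IsClassOf γ z) (h' : IsClassOf γ z') : z = z' := by
  obtain ⟨-, -, ρ, rfl, hρ⟩ := h
  obtain ⟨-, -, ρ', rfl, hρ'⟩ := h'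
  exact Quotient.sound (hρ.symm.trans hρ')

theorem IsClassOf.finiteHausdorff {X : Type*} [MetricSpace X] {γ : ℝ → X} {ρ : MorseRay X}
    (h : IsClassOf γ (Quotient.mk _ ρ : MorseBoundary X)) :
    FiniteHausdorff (rayImage γ) (rayImage ρ.1) := by
  obtain ⟨-, -, ρ', h1, h2⟩ := h
  exact h2.trans (Quotient.exact h1)

namespace GraphOfGroups

namespace Choices

variable {n : ℕ} {E : Type*} [Finite E] {𝒢 : GraphOfGroups n E} {c : 𝒢.Choices}

theorem IsMorseRay.mono {M M' : MorseGauge} {r : 𝒢.CombRay} (h : c.IsMorseRay M r) (hM : M ≤ M') :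
    c.IsMorseRay M' r := by
  have hedge : ∀ {ε}, c.IsMorseEdge M ε → c.IsMorseEdge M' ε := fun ⟨γ, h1, h2⟩ =>
    ⟨γ, h1, h2.mono hM⟩
  cases r with
  | finite k p hp z =>
    obtain ⟨h1, ξ, h2, h3⟩ := h
    exact ⟨fun i => hedge (h1 i), ξ, h2, h3.mono hM⟩
  | infinite p hp => exact fun i => hedge (h i)

theorem isClassOf_realisation (hs : 𝒢.IsMorselessStar) {M M' : MorseGauge}
    {r : 𝒢.CombRay} (hr : c.IsMorseRay M r) (hM : IsMorseSet M' (rayImage (c.realisation r)))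
    {ρ : MorseRay 𝒢.X} (h : FiniteHausdorff (rayImage (c.realisation r)) (rayImage ρ.1)) :
    IsClassOf (c.realisation r) (Quotient.mk _ ρ : MorseBoundary 𝒢.X) := by
  obtain ⟨C, hC1, hC⟩ := exists_isQuasiGeodesicOn_realisation hs M M'
  exact ⟨⟨C, hC1, hC hr hM⟩, ⟨M', hM⟩, ρ, rfl, h⟩

end Choices

end GraphOfGroups

open GraphOfGroups.Choices in
theorem mainTheorem5 {n : ℕ} {E : Type*} [Finite E] (𝒢 : GraphOfGroups n E)
    (hstar : 𝒢.IsMorselessStar) (c : 𝒢.Choices) (hpres : c.MorsePreserving) :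
    ∃ Φ : c.CombBoundary → MorseBoundary 𝒢.X,
      (∀ (r : c.CombBoundary) (z : MorseBoundary 𝒢.X),
        Φ r = z ↔ IsClassOf (c.realisation r.1) z) ∧
      Function.Bijective Φ ∧
      ∃ f₅ : MorseGauge → MorseGauge, IsIncreasing f₅ ∧
        (∀ (M : MorseGauge) (r : c.CombBoundary),
          c.IsMorseRay M r.1 → (Φ r).IsMorse (𝒢.pt 𝒢.one) (f₅ M)) ∧
        (∀ (M : MorseGauge) (r : c.CombBoundary),
          (Φ r).IsMorse (𝒢.pt 𝒢.one) M → c.IsMorseRay (f₅ M) r.1) := by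
  obtain ⟨f₄, ⟨hf₄, -⟩, hf⟩ := hpres
  obtain ⟨F, hF, hF'⟩ := exists_monotone_bound (P := fun M K => ∀ r, c.IsMorseRay M r →
      ∃ ρ : ℝ → 𝒢.X, ρ 0 = 𝒢.pt 𝒢.one ∧ IsGeodesicRay ρ ∧
        (∀ p ∈ rayImage ρ, Near K (rayImage (c.realisation r)) p) ∧
        ∀ p ∈ rayImage (c.realisation r), Near K (rayImage ρ) p)
    (fun M => by
      obtain ⟨K, hK⟩ := exists_geodesicRay_realisation hstar M (f₄ M)
      exact ⟨K, fun r hr => hK hr (hf M r hr)⟩)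
    (fun h hP r hr => hP r (hr.mono h))
    (fun h hP r hr => by
      obtain ⟨ρ, h0, hρ, h1, h2⟩ := hP r hr
      exact ⟨ρ, h0, hρ, fun p hp => (h1 p hp).mono h Subset.rfl,
        fun p hp => (h2 p hp).mono h Subset.rfl⟩)
  -- The quantifier over `M₀` makes the property inherited by smaller `M`: the ray found for a
  -- larger gauge still has a gauge computed from the smaller one.
  obtain ⟨F', hFm, hFr⟩ := exists_monotone_bound (P := fun M K => ∀ ρ : ℝ → 𝒢.X,
      ρ 0 = 𝒢.pt 𝒢.one → IsGeodesicRay ρ → IsMorseSet M (rayImage ρ) → ∃ r : 𝒢.CombRay,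
      (∀ M₀, IsMorseSet M₀ (rayImage ρ) → c.IsMorseRay (M₀.half.half.shift K) r) ∧
      FiniteHausdorff (rayImage (c.realisation r)) (rayImage ρ))
    (fun M => by
      obtain ⟨K, hK⟩ := exists_combRay hstar M
      exact ⟨K, fun ρ h0 hρ hM => hK h0 hρ hM⟩)
    (fun h hP ρ h0 hρ hM => hP ρ h0 hρ (hM.mono h))
    (fun h hP ρ h0 hρ hM => by
      obtain ⟨r, h1, h2⟩ := hP ρ h0 hρ hM
      exact ⟨r, fun M₀ hM₀ => (h1 M₀ hM₀).mono (MorseGauge.shift_mono le_rfl h), h2⟩)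
  have hrep : ∀ M r, c.IsMorseRay M r → ∃ ρ : MorseRay 𝒢.X, ρ.1 0 = 𝒢.pt 𝒢.one ∧
      IsMorseSet ((f₄ M).shift (F M)) (rayImage ρ.1) ∧
      FiniteHausdorff (rayImage (c.realisation r)) (rayImage ρ.1) := by
    intro M r hr
    obtain ⟨ρ, h0, hρ, h1, h2⟩ := hF' M r hr
    have hM := (hf M r hr).transfer h1 h2
    exact ⟨⟨ρ, hρ, _, hM⟩, h0, hM, finiteHausdorff_of_near h2 h1⟩
  have hclass : ∀ r : c.CombBoundary, ∃ z, IsClassOf (c.realisation r.1) z := by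
    rintro ⟨r, M, hr⟩
    obtain ⟨ρ, -, -, h⟩ := hrep M r hr
    exact ⟨_, isClassOf_realisation hstar hr (hf M r hr) h⟩
  choose Φ hΦ using hclass
  have hΦeq : ∀ (r : c.CombBoundary) (ρ : MorseRay 𝒢.X),
      FiniteHausdorff (rayImage (c.realisation r.1)) (rayImage ρ.1) →
      (Quotient.mk _ ρ : MorseBoundary 𝒢.X) = Φ r := by
    rintro ⟨r, M, hr⟩ ρ h
    exact (isClassOf_realisation hstar hr (hf M r hr) h).unique (hΦ ⟨r, M, hr⟩)
  -- The three summands of `f₅` provide `M ≤ f₅ M`, the gauge of the geodesic ray near a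
  -- realisation, and the gauge of the combinatorial ray of a geodesic ray.
  refine ⟨Φ, fun r z => ⟨?_, (hΦ r).unique⟩, ⟨?_, ?_⟩,
    fun M => (M.add ((f₄ M).shift (F M))).add (M.half.half.shift (F' M)), ⟨?_, ?_⟩, ?_, ?_⟩
  · rintro rfl
    exact hΦ r
  · rintro r r' h
    obtain ⟨M, hr⟩ := r.2
    obtain ⟨M', hr'⟩ := r'.2
    obtain ⟨ρ, h0, hM, hρ⟩ := hrep M r.1 hr
    refine Subtype.ext (eq_of_finiteHausdorff hstar hr hr' h0 ρ.2.1 hM hρ ?_)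
    have := hΦ r'
    rw [← h, ← hΦeq r ρ hρ] at this
    exact this.finiteHausdorff
  · intro z
    obtain ⟨γ, rfl⟩ := Quotient.exists_rep z
    obtain ⟨hγ, M, hM⟩ := γ.2
    -- A representative may start anywhere; it is replaced by an asymptotic ray from the base point.
    obtain ⟨K, hK⟩ := exists_geodesicRay (X := 𝒢.X) M 1 (dist (𝒢.pt 𝒢.one) (γ.1 0)) le_rfl
    obtain ⟨ρ, h0, hρ, h1, h2⟩ := hK
      ((GeodOn.isQuasiGeodesicOn (J := Ici 0) hγ).weaken le_rfl le_rfl zero_le_one) hM _ le_rfl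
    have hρM := hM.transfer h1 h2
    obtain ⟨r, hr, hH⟩ := hFr _ ρ h0 hρ hρM
    exact ⟨⟨r, _, hr _ hρM⟩, (hΦeq _ γ (hH.trans (finiteHausdorff_of_near h1 h2))).symm⟩
  · intro M M' h
    exact MorseGauge.add_mono (MorseGauge.add_mono h (MorseGauge.shift_mono (hf₄ h) (hF h)))
      (MorseGauge.shift_mono (MorseGauge.half_mono (MorseGauge.half_mono h)) (hFm h))
  · exact fun M => (MorseGauge.le_add_left _ _).trans (MorseGauge.le_add_left _ _)
  · intro M r hr
    obtain ⟨ρ, h0, hM, hρ⟩ := hrep M r.1 hr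
    exact ⟨ρ, h0, hΦeq r ρ hρ,
      hM.mono ((MorseGauge.le_add_right _ _).trans (MorseGauge.le_add_left _ _))⟩
  · rintro M r ⟨ρ, h0, hz, hM⟩
    obtain ⟨r', hr', hH⟩ := hFr M ρ.1 h0 ρ.2.1 hM
    obtain ⟨N, hr⟩ := r.2
    have hH' := hΦ r
    rw [← hz] at hH'
    -- By injectivity, the controlled combinatorial ray constructed from `ρ` is `r` itself.
    rw [eq_of_finiteHausdorff hstar hr (hr' M hM) h0 ρ.2.1 hM hH'.finiteHausdorff hH]
    exact (hr' M hM).mono (MorseGauge.le_add_right _ _)
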